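/- Let $\kappa>0$ and let $c\in C^1(\mathbb R)$ satisfy $\kappa^{-1}\le c\le\kappa$, with $c'$ locally Lipschitz. Vectors in $\mathbb R^5$ are written $Z=(t,x,U,J,K)=(Z_1,\dots,Z_5)$. Consider for $Z\colon\mathbb R^2\to\mathbb R^5$, $(X,Y)\mapsto Z(X,Y)$, the system $Z_{XY}=F(Z)(Z_X,Z_Y)$, that is, $$t_{XY}=-\tfrac{c'}{2c}(U_Xt_Y+U_Yt_X),\quad x_{XY}=\tfrac{c'}{2c}(U_Yx_X+U_Xx_Y),\quad U_{XY}=\tfrac{c'}{2c^3}(x_YJ_X+J_Yx_X)-\tfrac{c'}{2c}U_YU_X,$$ $$J_{XY}=\tfrac{c'}{2c}(J_XU_Y+J_YU_X),\quad K_{XY}=-\tfrac{c'}{2c}(K_XU_Y+K_YU_X),\qquad c=c(U),\ c'=c'(U).$$ **Curves.** $\mathcal C$ is the set of curves $(\mathcal X,\mathcal Y)\colon\mathbb R\to\mathbb R^2$ with $\mathcal X-\mathrm{id},\mathcal Y-\mathrm{id}\in W^{1,\infty}(\mathbb R)$, $\dot{\mathcal X},\dot{\mathcal Y}\ge0$ and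 $\frac12(\mathcal X(s)+\mathcal Y(s))=s$ for all $s$. **The sets $\mathcal G$, $\mathcal G_0$.** $\mathcal G$ is the set of $\Theta=(\mathcal X,\mathcal Y,\mathcal Z,\mathcal V,\mathcal W)$ with $(\mathcal X,\mathcal Y)\in\mathcal C$, $\mathcal Z(s)\in\mathbb R^5$ Lipschitz, and $\mathcal V(X),\mathcal W(Y)\in\mathbb R^5$ measurable and defined almost everywhere, such that, with $e_2=(0,1,0,0,0)$: $\mathcal Z-s\,e_2$, $\mathcal V-\frac12e_2$, $\mathcal W-\frac12e_2$, $\frac1{\mathcal V_2+\mathcal V_4}$, $\frac1{\mathcal W_2+\mathcal W_4}$ are (essentially) bounded; $\mathcal Z_3$ and the components $2,\dots,5$ of $\mathcal V-\frac12e_2$, $\mathcal W-\frac12e_2$ are in $L^2(\mathbb R)$; $\mathcal V_2,\mathcal V_4,\mathcal W_2,\mathcal W_4\ge0$ a.e.; $\dot{\mathcal Z}=\mathcal V(\mathcal X)\dot{\mathcal X}+\mathcal W(\mathcal Y)\dot{\mathcal Y}$ a.e.; for a.e. $X=\mathcal X(s)$, respectively a.e. $Y=\mathcal Y(s)$, with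 $c=c(\mathcal Z_3(s))$, $2\mathcal V_4\mathcal V_2=(c\mathcal V_3)^2$, $\mathcal V_2=c\mathcal V_1$, $\mathcal V_4=c\mathcal V_5$, respectively $2\mathcal W_4\mathcal W_2=(c\mathcal W_3)^2$, $\mathcal W_2=-c\mathcal W_1$, $\mathcal W_4=-c\mathcal W_5$; and $\lim_{s\to-\infty}\mathcal Z_4(s)=0$. $\mathcal G_0=\{\Theta\in\mathcal G:\mathcal Z_1=0\}$. For $(\mathcal X,\mathcal Y)\in\mathcal C$, $Z\bullet(\mathcal X,\mathcal Y)$ denotes $(\mathcal X,\mathcal Y,\mathcal Z,\mathcal V,\mathcal W)$ with $\mathcal Z(s)=Z(\mathcal X(s),\mathcal Y(s))$, $\mathcal V(X)=Z_X(X,\mathcal Y(s))$ for a.e. $X=\mathcal X(s)$, $\mathcal W(Y)=Z_Y(\mathcal X(s),Y)$ for a.e. $Y=\mathcal Y(s)$. **The set $\mathcal H$.** $\mathcal H$ is the set of $Z\colon\mathbb R^2\to\mathbb R^5$ such that on every rectangle $[X_l,X_r]\times[Y_l,Y_r]$: $Z\in W^{1,\infty}$, $Z_X\in L^\infty_X(W^{1,\infty}_Y)$,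 $Z_Y\in L^\infty_Y(W^{1,\infty}_X)$; the system holds a.e. both as $(Z_X)_Y=F(Z)(Z_X,Z_Y)$ and as $(Z_Y)_X=F(Z)(Z_X,Z_Y)$; and $x_X=c(U)t_X$, $x_Y=-c(U)t_Y$, $J_X=c(U)K_X$, $J_Y=-c(U)K_Y$, $2J_Xx_X=(c(U)U_X)^2$, $2J_Yx_Y=(c(U)U_Y)^2$, $x_X,J_X,x_Y,J_Y\ge0$, $x_X+J_X>0$, $x_Y+J_Y>0$ (for a.e. $X$ and all $Y$ for the relations in $Z_X$, for a.e. $Y$ and all $X$ for those in $Z_Y$); and such that $Z\bullet(\mathcal X,\mathcal Y)\in\mathcal G$ for some $(\mathcal X,\mathcal Y)\in\mathcal C$. **The set $\mathcal F$.** $\mathcal F$ is the set of $\psi=(\psi_1,\psi_2)$, $\psi_i=(x_i,U_i,V_i,J_i,K_i)$ functions on $\mathbb R$ ($V_i$ up to null sets), with $x_i-\mathrm{id},J_i,K_i\in W^{1,\infty}$; $x_i'-1,J_i',K_i'\in L^2\cap L^\infty$; $U_i\in H^1$; $V_i\in L^2\cap L^\infty$; $x_i',J_i'\ge0$; $J_1'=c(U_1)K_1'$,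 $J_2'=-c(U_2)K_2'$; $x_i'J_i'=(c(U_i)V_i)^2$; $x_i+J_i$ invertible, $f=x_i+J_i$ satisfying $f-\mathrm{id},f^{-1}-\mathrm{id}\in W^{1,\infty}$ and $(f-\mathrm{id})'\in L^2$; $\lim_{-\infty}J_i=0$; and for every $(\mathcal X,\mathcal Y)\in\mathcal C$ with $x_1(\mathcal X)=x_2(\mathcal Y)$ one has $U_1(\mathcal X)=U_2(\mathcal Y)$ everywhere and $U_1'(\mathcal X)\dot{\mathcal X}=U_2'(\mathcal Y)\dot{\mathcal Y}=V_1(\mathcal X)\dot{\mathcal X}+V_2(\mathcal Y)\dot{\mathcal Y}$ a.e. **Theorem.** The following five maps are well defined. - $\mathbf C\colon\mathcal F\to\mathcal G_0$: $\mathcal X(s)=\sup\{X: x_1(X')<x_2(2s-X')\ \forall X'<X\}$, $\mathcal Y(s)=2s-\mathcal X(s)$, $\mathcal Z=(0,\,x_1(\mathcal X)=x_2(\mathcal Y),\,U_1(\mathcal X)=U_2(\mathcal Y),\,J_1(\mathcal X)+J_2(\mathcal Y),\,K_1(\mathcal X)+K_2(\mathcal Y))$, $\mathcal V=(\frac{x_1'}{2c(U_1)},\frac{x_1'}2,V_1,J_1',K_1')$,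 $\mathcal W=(-\frac{x_2'}{2c(U_2)},\frac{x_2'}2,V_2,J_2',K_2')$. - $\mathbf S\colon\mathcal G\to\mathcal H$: $\mathbf S(\Theta)$ is the unique $Z\in\mathcal H$ with $Z\bullet(\mathcal X,\mathcal Y)=\Theta$. - $\mathbf t_T\colon\mathcal H\to\mathcal H$ ($T\in\mathbb R$): $\mathbf t_T(t,x,U,J,K)=(t-T,x,U,J,K)$. - $\mathbf E\colon\mathcal H\to\mathcal G_0$: $\mathbf E(Z)=Z\bullet(\mathcal X,\mathcal Y)$ with $\mathcal X(s)=\sup\{X: t(X',2s-X')<0\ \forall X'<X\}$, $\mathcal Y(s)=2s-\mathcal X(s)$. - $\mathbf D\colon\mathcal G_0\to\mathcal F$: the unique $\psi\in\mathcal F$ with $x_1(\mathcal X)=x_2(\mathcal Y)=\mathcal Z_2$, $U_1(\mathcal X)=U_2(\mathcal Y)=\mathcal Z_3$, $J_1(\mathcal X(s))=\int_{-\infty}^s\mathcal V_4(\mathcal X)\dot{\mathcal X}\,dr$, $J_2(\mathcal Y(s))=\int_{-\infty}^s\mathcal W_4(\mathcal Y)\dot{\mathcal Y}\,dr$, $K_1(\mathcal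 X(s))=\int_{-\infty}^s\mathcal V_5(\mathcal X)\dot{\mathcal X}\,dr$, $K_2(\mathcal Y(s))=\int_{-\infty}^s\mathcal W_5(\mathcal Y)\dot{\mathcal Y}\,dr$, $V_1=\mathcal V_3$, $V_2=\mathcal W_3$. The maps $S_T=\mathbf D\circ\mathbf E\circ\mathbf t_T\circ\mathbf S\circ\mathbf C\colon\mathcal F\to\mathcal F$ form a semigroup: $S_T\circ S_{T'}=S_{T+T'}$ for all $T,T'\ge0$, and $S_0\psi=\psi$ for every $\psi\in\mathcal F$ whose potentials are normalized by $\lim_{-\infty}K_1=\lim_{-\infty}K_2=0$. -/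

import Mathlib

open MeasureTheory Filter Topology Set
open scoped NNReal ENNReal

noncomputable section

namespace NVW

/-! Vectors in `Fin 5 → ℝ` hold the five unknowns in the order
`0 ↦ t`, `1 ↦ x`, `2 ↦ U`, `3 ↦ J`, `4 ↦ K`.
Functions that are only defined almost everywhere are classes `ℝ →ₘ[volume] _`, so that
equality of data means equality almost everywhere for them. -/

/-- The space `W^{1,∞}(ℝ)` (continuous representatives): bounded Lipschitz functions. -/
def MemW1Inf (f : ℝ → ℝ) : Prop :=
  (∃ L : ℝ≥0, LipschitzWith L f) ∧ ∃ M : ℝ, ∀ s, |f s| ≤ M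

/-- The space `H¹(ℝ)` (continuous representatives): locally absolutely continuous functions in
`L²` whose derivative is in `L²`. -/
def MemH1 (f : ℝ → ℝ) : Prop :=
  (∀ a b : ℝ, AbsolutelyContinuousOnInterval f a b) ∧
    MemLp f 2 volume ∧ MemLp (deriv f) 2 volume

/-! ### The governing system -/

/-- The bilinear symmetric operator `F(Z)`, which depends on `Z` through its component `u = U`;
the system is `Z_XY = F(Z)(Z_X, Z_Y)`. -/
def bilin (c : ℝ → ℝ) (u : ℝ) (v w : Fin 5 → ℝ) : Fin 5 → ℝ :=
  ![-(deriv c u / (2 * c u)) * (v 2 * w 0 + w 2 * v 0),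
    (deriv c u / (2 * c u)) * (w 2 * v 1 + v 2 * w 1),
    (deriv c u / (2 * c u ^ 3)) * (w 1 * v 3 + w 3 * v 1)
      - (deriv c u / (2 * c u)) * (w 2 * v 2),
    (deriv c u / (2 * c u)) * (v 3 * w 2 + w 3 * v 2),
    -(deriv c u / (2 * c u)) * (v 4 * w 2 + w 4 * v 2)]

/-- The partial derivative `Z_X`. -/
def dX (Z : ℝ → ℝ → Fin 5 → ℝ) (X Y : ℝ) : Fin 5 → ℝ := deriv (fun ξ => Z ξ Y) X

/-- The partial derivative `Z_Y`. -/
def dY (Z : ℝ → ℝ → Fin 5 → ℝ) (X Y : ℝ) : Fin 5 → ℝ := deriv (fun η => Z X η) Y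

/-- `Z` is a solution of `Z_XY = F(Z)(Z_X, Z_Y)` in the rectangle `[Xl,Xr] × [Yl,Yr]`:
`Z ∈ W^{1,∞}`, `Z_X ∈ L^∞_X(W^{1,∞}_Y)`, `Z_Y ∈ L^∞_Y(W^{1,∞}_X)` and the equation holds for both
orders of differentiation. A function of class `W^{1,∞}` on a rectangle is a Lipschitz function.
When in addition the weak derivative `Z_X` lies in `L^∞_X(W^{1,∞}_Y)`, then for almost every `X`
the function `Z` is classically differentiable in `X` at `(X,Y)` for *all* `Y`, and `Z_X(X,·)` is
Lipschitz with a constant independent of `X`; this is how the condition is written. -/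
structure IsSolutionOn (c : ℝ → ℝ) (Z : ℝ → ℝ → Fin 5 → ℝ) (Xl Xr Yl Yr : ℝ) : Prop where
  lipschitz : ∃ L : ℝ≥0, LipschitzOnWith L (fun p : ℝ × ℝ => Z p.1 p.2)
    (Icc Xl Xr ×ˢ Icc Yl Yr)
  dX_reg : ∃ L : ℝ≥0, ∀ᵐ X, X ∈ Icc Xl Xr →
    (∀ Y ∈ Icc Yl Yr, DifferentiableAt ℝ (fun ξ => Z ξ Y) X) ∧
      LipschitzOnWith L (fun Y => dX Z X Y) (Icc Yl Yr)
  dY_reg : ∃ L : ℝ≥0, ∀ᵐ Y, Y ∈ Icc Yl Yr →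
    (∀ X ∈ Icc Xl Xr, DifferentiableAt ℝ (fun η => Z X η) Y) ∧
      LipschitzOnWith L (fun X => dY Z X Y) (Icc Xl Xr)
  eq_YX : ∀ᵐ X, X ∈ Icc Xl Xr → ∀ᵐ Y, Y ∈ Icc Yl Yr →
    HasDerivAt (fun η => dX Z X η) (bilin c (Z X Y 2) (dX Z X Y) (dY Z X Y)) Y
  eq_XY : ∀ᵐ Y, Y ∈ Icc Yl Yr → ∀ᵐ X, X ∈ Icc Xl Xr →
    HasDerivAt (fun ξ => dY Z ξ Y) (bilin c (Z X Y 2) (dX Z X Y) (dY Z X Y)) X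

/-- The set `ℋ(Ω)` for `Ω = [Xl,Xr] × [Yl,Yr]`. -/
structure MemHOn (c : ℝ → ℝ) (Z : ℝ → ℝ → Fin 5 → ℝ) (Xl Xr Yl Yr : ℝ) : Prop where
  sol : IsSolutionOn c Z Xl Xr Yl Yr
  rel_X : ∀ᵐ X, X ∈ Icc Xl Xr → ∀ Y ∈ Icc Yl Yr,
    dX Z X Y 1 = c (Z X Y 2) * dX Z X Y 0 ∧
    dX Z X Y 3 = c (Z X Y 2) * dX Z X Y 4 ∧
    2 * dX Z X Y 3 * dX Z X Y 1 = (c (Z X Y 2) * dX Z X Y 2) ^ 2 ∧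
    0 ≤ dX Z X Y 1 ∧ 0 ≤ dX Z X Y 3 ∧ 0 < dX Z X Y 1 + dX Z X Y 3
  rel_Y : ∀ᵐ Y, Y ∈ Icc Yl Yr → ∀ X ∈ Icc Xl Xr,
    dY Z X Y 1 = -c (Z X Y 2) * dY Z X Y 0 ∧
    dY Z X Y 3 = -c (Z X Y 2) * dY Z X Y 4 ∧
    2 * dY Z X Y 3 * dY Z X Y 1 = (c (Z X Y 2) * dY Z X Y 2) ^ 2 ∧
    0 ≤ dY Z X Y 1 ∧ 0 ≤ dY Z X Y 3 ∧ 0 < dY Z X Y 1 + dY Z X Y 3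

/-! ### Curves and data on curves -/

/-- The set `𝒞` of monotone curves `(𝒳(s), 𝒴(s))`. -/
structure IsCurve (X Y : ℝ → ℝ) : Prop where
  reg_X : MemW1Inf (fun s => X s - s)
  reg_Y : MemW1Inf (fun s => Y s - s)
  deriv_X : ∀ᵐ s, 0 ≤ deriv X s
  deriv_Y : ∀ᵐ s, 0 ≤ deriv Y s
  normalized : ∀ s, (X s + Y s) / 2 = s

/-- The quintuples `Θ = (𝒳, 𝒴, 𝒵, 𝒱, 𝒲)`. -/
@[ext]
structure CurveData where
  /-- the `X`-coordinate `𝒳(s)` of the curve -/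
  X : ℝ → ℝ
  /-- the `Y`-coordinate `𝒴(s)` of the curve -/
  Y : ℝ → ℝ
  /-- the value `𝒵(s)` of `Z` on the curve -/
  Z : ℝ → Fin 5 → ℝ
  /-- the value `𝒱(X)` of `Z_X` on the curve -/
  V : ℝ →ₘ[volume] (Fin 5 → ℝ)
  /-- the value `𝒲(Y)` of `Z_Y` on the curve -/
  W : ℝ →ₘ[volume] (Fin 5 → ℝ)

/-- The vector `(0, 1/2, 0, 0, 0)`. -/
def halfX : Fin 5 → ℝ := ![0, 1 / 2, 0, 0, 0]

/-- Membership in `𝒢`. The vectors `(0, s, 0, 0, 0)` and `(0, 1/2, 0, 0, 0)` are subtracted from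
`𝒵` and from `𝒱`, `𝒲`, respectively, to get `𝒵ᵃ`, `𝒱ᵃ`, `𝒲ᵃ`. The time component is left out of the
`L²` conditions: `𝒱₁ = 𝒱₂ / c(U)` with `𝒱₂ - 1/2` in `L²` is never in `L²`. A relation at a point `X = 𝒳(s)` of the
curve is required for almost every `X` and every `s` with `𝒳(s) = X` (for almost every `X` there is
exactly one such `s`). -/
structure MemG (c : ℝ → ℝ) (Θ : CurveData) : Prop where
  curve : IsCurve Θ.X Θ.Y
  Z_lipschitz : ∃ L : ℝ≥0, LipschitzWith L Θ.Z
  Z_bdd : ∃ M : ℝ, ∀ s i, |(Θ.Z s - ![0, s, 0, 0, 0]) i| ≤ M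
  V_bdd : ∀ i, MemLp (fun X => (Θ.V X - halfX) i) ∞ volume
  W_bdd : ∀ i, MemLp (fun Y => (Θ.W Y - halfX) i) ∞ volume
  V_inv : ∃ δ > 0, ∀ᵐ X, δ ≤ Θ.V X 1 + Θ.V X 3
  W_inv : ∃ δ > 0, ∀ᵐ Y, δ ≤ Θ.W Y 1 + Θ.W Y 3
  U_sq : MemLp (fun s => Θ.Z s 2) 2 volume
  V_sq : ∀ i, i ≠ 0 → MemLp (fun X => (Θ.V X - halfX) i) 2 volume
  W_sq : ∀ i, i ≠ 0 → MemLp (fun Y => (Θ.W Y - halfX) i) 2 volume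
  V_nonneg : ∀ᵐ X, 0 ≤ Θ.V X 1 ∧ 0 ≤ Θ.V X 3
  W_nonneg : ∀ᵐ Y, 0 ≤ Θ.W Y 1 ∧ 0 ≤ Θ.W Y 3
  compat : ∀ᵐ s, deriv Θ.Z s = deriv Θ.X s • Θ.V (Θ.X s) + deriv Θ.Y s • Θ.W (Θ.Y s)
  rel_V : ∀ᵐ X, ∀ s, Θ.X s = X →
    2 * Θ.V X 3 * Θ.V X 1 = (c (Θ.Z s 2) * Θ.V X 2) ^ 2 ∧
    Θ.V X 1 = c (Θ.Z s 2) * Θ.V X 0 ∧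
    Θ.V X 3 = c (Θ.Z s 2) * Θ.V X 4
  rel_W : ∀ᵐ Y, ∀ s, Θ.Y s = Y →
    2 * Θ.W Y 3 * Θ.W Y 1 = (c (Θ.Z s 2) * Θ.W Y 2) ^ 2 ∧
    Θ.W Y 1 = -c (Θ.Z s 2) * Θ.W Y 0 ∧
    Θ.W Y 3 = -c (Θ.Z s 2) * Θ.W Y 4
  J_lim : Tendsto (fun s => Θ.Z s 3) atBot (𝓝 0)

/-- The set `𝒢`. -/
def setG (c : ℝ → ℝ) : Set CurveData := {Θ | MemG c Θ}

/-- The set `𝒢₀` of data at time zero. -/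
def setG0 (c : ℝ → ℝ) : Set CurveData := {Θ | MemG c Θ ∧ ∀ s, Θ.Z s 0 = 0}

theorem setG0_subset_setG (c : ℝ → ℝ) : setG0 c ⊆ setG c := fun _ h => h.1

/-- The relation `Θ = Z • (𝒳, 𝒴)`, where `(𝒳, 𝒴)` is the curve of `Θ`: the data `𝒵`, `𝒱`, `𝒲` of
`Θ` are the values of `Z`, `Z_X`, `Z_Y` on the curve. -/
structure IsBullet (Z : ℝ → ℝ → Fin 5 → ℝ) (Θ : CurveData) : Prop where
  eq_Z : ∀ s, Θ.Z s = Z (Θ.X s) (Θ.Y s)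
  eq_V : ∀ᵐ X, ∀ s, Θ.X s = X → Θ.V X = dX Z X (Θ.Y s)
  eq_W : ∀ᵐ Y, ∀ s, Θ.Y s = Y → Θ.W Y = dY Z (Θ.X s) Y

/-- The set `ℋ` of global solutions. -/
def setH (c : ℝ → ℝ) : Set (ℝ → ℝ → Fin 5 → ℝ) :=
  {Z | (∀ Xl Xr Yl Yr : ℝ, Xl < Xr → Yl < Yr → MemHOn c Z Xl Xr Yl Yr) ∧
    ∃ Θ : CurveData, IsBullet Z Θ ∧ MemG c Θ}

/-! ### Lagrangian initial data -/

/-- One half `ψᵢ = (xᵢ, Uᵢ, Vᵢ, Jᵢ, Kᵢ)` of Lagrangian data. -/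
@[ext]
structure LagHalf where
  x : ℝ → ℝ
  U : ℝ → ℝ
  V : ℝ →ₘ[volume] ℝ
  J : ℝ → ℝ
  K : ℝ → ℝ

/-- The pairs `ψ = (ψ₁, ψ₂)`. -/
@[ext]
structure LagData where
  fst : LagHalf
  snd : LagHalf

/-- The group `G` of bi-Lipschitz homeomorphisms of the line. -/
def MemGroup (f : ℝ → ℝ) : Prop :=
  (∃ g : ℝ → ℝ, Function.LeftInverse g f ∧ Function.RightInverse g f ∧
    MemW1Inf (fun X => f X - X) ∧ MemW1Inf (fun X => g X - X)) ∧
  MemLp (deriv fun X => f X - X) 2 volume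

/-- The conditions in the definition of `ℱ` that involve `ψ₁` only (`σ = 1`) or `ψ₂` only
(`σ = -1`). -/
structure LagHalf.Admissible (c : ℝ → ℝ) (σ : ℝ) (ψ : LagHalf) : Prop where
  x_reg : MemW1Inf (fun X => ψ.x X - X)
  J_reg : MemW1Inf ψ.J
  K_reg : MemW1Inf ψ.K
  dx_sq : MemLp (fun X => deriv ψ.x X - 1) 2 volume
  dx_bdd : MemLp (fun X => deriv ψ.x X - 1) ∞ volume
  dJ_sq : MemLp (deriv ψ.J) 2 volume
  dJ_bdd : MemLp (deriv ψ.J) ∞ volume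
  dK_sq : MemLp (deriv ψ.K) 2 volume
  dK_bdd : MemLp (deriv ψ.K) ∞ volume
  U_reg : MemH1 ψ.U
  V_sq : MemLp ψ.V 2 volume
  V_bdd : MemLp ψ.V ∞ volume
  nonneg : ∀ᵐ X, 0 ≤ deriv ψ.x X ∧ 0 ≤ deriv ψ.J X
  rel_JK : ∀ᵐ X, deriv ψ.J X = σ * c (ψ.U X) * deriv ψ.K X
  rel_xJV : ∀ᵐ X, deriv ψ.x X * deriv ψ.J X = (c (ψ.U X) * ψ.V X) ^ 2
  group : MemGroup (fun X => ψ.x X + ψ.J X)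
  J_lim : Tendsto ψ.J atBot (𝓝 0)

/-- The set `ℱ` of Lagrangian initial data. -/
def setF (c : ℝ → ℝ) : Set LagData :=
  {ψ | ψ.fst.Admissible c 1 ∧ ψ.snd.Admissible c (-1) ∧
    ∀ X Y : ℝ → ℝ, IsCurve X Y → (∀ s, ψ.fst.x (X s) = ψ.snd.x (Y s)) →
      (∀ s, ψ.fst.U (X s) = ψ.snd.U (Y s)) ∧
      ∀ᵐ s, deriv ψ.fst.U (X s) * deriv X s = deriv ψ.snd.U (Y s) * deriv Y s ∧
        deriv ψ.snd.U (Y s) * deriv Y s = ψ.fst.V (X s) * deriv X s + ψ.snd.V (Y s) * deriv Y s}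

/-! ### The mappings -/

/-- `Θ = 𝐂(ψ)`. -/
structure IsC (c : ℝ → ℝ) (ψ : LagData) (Θ : CurveData) : Prop where
  eq_X : ∀ s, Θ.X s = sSup {X | ∀ X' < X, ψ.fst.x X' < ψ.snd.x (2 * s - X')}
  eq_Y : ∀ s, Θ.Y s = 2 * s - Θ.X s
  eq_t : ∀ s, Θ.Z s 0 = 0
  eq_x : ∀ s, Θ.Z s 1 = ψ.fst.x (Θ.X s) ∧ Θ.Z s 1 = ψ.snd.x (Θ.Y s)
  eq_U : ∀ s, Θ.Z s 2 = ψ.fst.U (Θ.X s) ∧ Θ.Z s 2 = ψ.snd.U (Θ.Y s)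
  eq_J : ∀ s, Θ.Z s 3 = ψ.fst.J (Θ.X s) + ψ.snd.J (Θ.Y s)
  eq_K : ∀ s, Θ.Z s 4 = ψ.fst.K (Θ.X s) + ψ.snd.K (Θ.Y s)
  eq_V : ∀ᵐ X, Θ.V X = ![1 / (2 * c (ψ.fst.U X)) * deriv ψ.fst.x X, 1 / 2 * deriv ψ.fst.x X,
    ψ.fst.V X, deriv ψ.fst.J X, deriv ψ.fst.K X]
  eq_W : ∀ᵐ Y, Θ.W Y = ![-(1 / (2 * c (ψ.snd.U Y))) * deriv ψ.snd.x Y, 1 / 2 * deriv ψ.snd.x Y,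
    ψ.snd.V Y, deriv ψ.snd.J Y, deriv ψ.snd.K Y]

/-- `Θ = 𝐄(Z)`. -/
structure IsE (Z : ℝ → ℝ → Fin 5 → ℝ) (Θ : CurveData) : Prop where
  eq_X : ∀ s, Θ.X s = sSup {X | ∀ X' < X, Z X' (2 * s - X') 0 < 0}
  eq_Y : ∀ s, Θ.Y s = 2 * s - Θ.X s
  bullet : IsBullet Z Θ

/-- The function `Z` with the time `t` replaced by `t - T`. -/
def timeShift (T : ℝ) (Z : ℝ → ℝ → Fin 5 → ℝ) : ℝ → ℝ → Fin 5 → ℝ :=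
  fun X Y => Z X Y - ![T, 0, 0, 0, 0]

/-- `a = ∫_{-∞}^s f(r) dr`, the integral being absolutely convergent. -/
def IsIntegralTo (f : ℝ → ℝ) (s a : ℝ) : Prop :=
  IntegrableOn f (Iic s) volume ∧ a = ∫ r in Iic s, f r

/-- `ψ = 𝐃(Θ)`. -/
structure IsD (Θ : CurveData) (ψ : LagData) : Prop where
  eq_x : ∀ s, ψ.fst.x (Θ.X s) = Θ.Z s 1 ∧ ψ.snd.x (Θ.Y s) = Θ.Z s 1
  eq_U : ∀ s, ψ.fst.U (Θ.X s) = Θ.Z s 2 ∧ ψ.snd.U (Θ.Y s) = Θ.Z s 2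
  eq_J₁ : ∀ s, IsIntegralTo (fun r => Θ.V (Θ.X r) 3 * deriv Θ.X r) s (ψ.fst.J (Θ.X s))
  eq_J₂ : ∀ s, IsIntegralTo (fun r => Θ.W (Θ.Y r) 3 * deriv Θ.Y r) s (ψ.snd.J (Θ.Y s))
  eq_K₁ : ∀ s, IsIntegralTo (fun r => Θ.V (Θ.X r) 4 * deriv Θ.X r) s (ψ.fst.K (Θ.X s))
  eq_K₂ : ∀ s, IsIntegralTo (fun r => Θ.W (Θ.Y r) 4 * deriv Θ.Y r) s (ψ.snd.K (Θ.Y s))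
  eq_V : ∀ᵐ X, ψ.fst.V X = Θ.V X 2 ∧ ψ.snd.V X = Θ.W X 2

end NVW

end

/-!
The idea is to treat the hyperbolic system as a Goursat problem with data on a monotone curve, and
to use that the increments of `x` and `J` along characteristics are nonnegative.

**The map `𝐒`.** The algebraic relations (`Rel`) bound all components of `Z_X` by a multiple of
`x_X + J_X`, and they make `x` and `J` nondecreasing in `X` and in `Y`. The right-hand side of the
system is bilinear in `(Z_X, Z_Y)`, so a Gronwall argument along a characteristic bounds `x_X +
J_X` by its value on the curve times the exponential of a multiple of the increment of `x + J`
along the characteristic (`IsChar.pos_part_le`). This increment is at most that of `x + J` between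
the two points of the curve which see the end of the characteristic, a known quantity: this is the
a priori bound `IsData.exists_bound`, on every strip around the diagonal. Existence follows by
truncation: for a bounded Lipschitz nonlinearity the problem is solved by iteration in a norm with
an exponential weight (`exists_wave`), the relations propagate from the curve wherever the
truncation is not active (`rel_propagates`), and there the a priori bound keeps it inactive
(`IsData.exists_solution_strip`). Uniqueness is `goursat_zero`, and the solutions on strips fit
together to a global one (`IsData.exists_global`, `MemG.existsUnique_solution`). The region above
the curve and the one below it are treated at once, by a sign `σ`, and `Z_X` and `Z_Y` are
exchanged by the reflection `(X, Y) ↦ (Y, X)`, which reverses the sign `τ` of `c` in the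
relations.

**The map `𝐄`.** A solution with data in `𝒢` on one curve has data in `𝒢` on every curve
(`IsBullet.memG`). For this, `Z_X` at the two ends of a characteristic is compared
(`IsChar.exists_comparable`): both `J_X` and the square of the variation of `x_X` are controlled
by `J_X` at one end plus the increment of `J`. As `J` is bounded and monotone, its increments over
a bounded distance are integrable (`integrable_increment`), and the `L²` conditions carry over.
The time is nondecreasing in `X`, nonincreasing in `Y` and has both signs far from the diagonal
(`IsGlobal.exists_isLevel`), so that its leftmost zero curve exists and is a curve in `𝒞`
(`IsLevel.isCurve`, `existsUnique_isE`).

**The map `𝐂`.** The function `x₁(X) - x₂(Y)` has the same monotonicity (`setF_isLevel`). On its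
zero curve `U` is Lipschitz, because its derivative is given by `V₁` and `V₂` (`setF_deriv_U`),
and the remaining conditions of `𝒢` are those of `ℱ`, transported by changes of variables along
monotone Lipschitz maps (`IsC.memG`).

**The map `𝐃`.** Where the time vanishes along a curve, the relations `x_X = c t_X` and `x_Y = -c
t_Y` force the two terms of the derivative of `x` to agree. Hence each of them is half of that
derivative, `x` and `U` are constant on the fibres of `𝒳` and `𝒴`, and they define functions `x₁,
U₁` of `X` and `x₂, U₂` of `Y` (`IsTimeZero`, `MemG.isTimeZero`). The compatibility condition on
an arbitrary curve with `x₁ = x₂` reduces to the given one, since such a curve can differ from it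
only where `x` is constant (`MemG.lagData_compat`); this gives `isD_lagData`.

**The semigroup.** The composition `𝐂 ∘ 𝐃` changes data on the leftmost curve of time zero only by
a constant added to the potential `K` (`IsE.isC_lagData`). Shifts of `t` and
`K` preserve the system, the maps `𝐒`, `𝐭_T` and `𝐄` commute with those of `K`, and `𝐃` does not
see them; this gives the composition law (`flow_add`). Conversely the curve of `𝐂 ψ` is the leftmost curve of time zero of the solution
(`IsC.isE`), and `𝐃` recovers `ψ` when its potentials are normalized (`IsC.isD`), which gives
`flow_zero`.
-/

noncomputable section

namespace NVW

/-! ### Locally Lipschitz functions of one variable -/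

/-- The state space `ℝ⁵`. -/
abbrev Vec5 := Fin 5 → ℝ

theorem _root_.LocallyLipschitz.lipschitzOn_Icc {E : Type*} [PseudoMetricSpace E] {f : ℝ → E}
    (hf : LocallyLipschitz f) (a b : ℝ) : ∃ K, LipschitzOnWith K f (Icc a b) :=
  (hf.locallyLipschitzOn (s := Icc a b)).exists_lipschitzOnWith_of_compact isCompact_Icc

theorem _root_.LocallyLipschitz.absolutelyContinuousOnInterval {E : Type*} [PseudoMetricSpace E]
    {f : ℝ → E} (hf : LocallyLipschitz f) (a b : ℝ) : AbsolutelyContinuousOnInterval f a b := by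
  obtain ⟨K, hK⟩ := hf.lipschitzOn_Icc (min a b) (max a b)
  exact LipschitzOnWith.absolutelyContinuousOnInterval hK

theorem locallyLipschitz_of_Icc {E : Type*} [PseudoMetricSpace E] {f : ℝ → E}
    (h : ∀ R : ℝ, ∃ K, LipschitzOnWith K f (Icc (-R) R)) : LocallyLipschitz f := by
  intro x
  obtain ⟨K, hK⟩ := h (|x| + 1)
  refine ⟨K, _, Icc_mem_nhds ?_ ?_, hK⟩ <;> linarith [neg_abs_le x, le_abs_self x]

theorem _root_.LocallyLipschitz.mul_real {f g : ℝ → ℝ} (hf : LocallyLipschitz f)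
    (hg : LocallyLipschitz g) : LocallyLipschitz fun x => f x * g x := by
  have h : LocallyLipschitz fun p : ℝ × ℝ => p.1 * p.2 :=
    ContDiff.locallyLipschitz (𝕂 := ℝ) (contDiff_fst.mul contDiff_snd)
  exact h.comp (hf.prodMk hg)

theorem _root_.LocallyLipschitz.add_real {f g : ℝ → ℝ} (hf : LocallyLipschitz f)
    (hg : LocallyLipschitz g) : LocallyLipschitz fun x => f x + g x := LocallyLipschitz.add hf hg

theorem _root_.LocallyLipschitz.sub_real {f g : ℝ → ℝ} (hf : LocallyLipschitz f)
    (hg : LocallyLipschitz g) : LocallyLipschitz fun x => f x - g x := LocallyLipschitz.sub hf hg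

theorem _root_.LocallyLipschitz.contDiff_comp {f g : ℝ → ℝ} (hg : LocallyLipschitz g)
    (hf : ContDiff ℝ 1 f) : LocallyLipschitz fun x => f (g x) := hf.locallyLipschitz.comp hg

theorem _root_.LocallyLipschitz.const_mul {f : ℝ → ℝ} (hf : LocallyLipschitz f) (a : ℝ) :
    LocallyLipschitz fun x => a * f x := (LocallyLipschitz.const a).mul_real hf

theorem _root_.LocallyLipschitz.coord {f : ℝ → Vec5} (hf : LocallyLipschitz f) (i : Fin 5) :
    LocallyLipschitz fun x => f x i := (LipschitzWith.eval i).locallyLipschitz.comp hf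

theorem _root_.LocallyLipschitz.comp_neg {E : Type*} [PseudoMetricSpace E] {f : ℝ → E}
    (hf : LocallyLipschitz f) : LocallyLipschitz fun x => f (-x) :=
  hf.comp (LocallyLipschitz.neg LocallyLipschitz.id)

theorem _root_.LocallyLipschitz.ae_differentiableAt {f : ℝ → ℝ} (hf : LocallyLipschitz f) :
    ∀ᵐ x, DifferentiableAt ℝ f x := by
  have h : ∀ n : ℕ, ∀ᵐ x, x ∈ uIcc (-n : ℝ) n → DifferentiableAt ℝ f x := fun n =>
    (hf.absolutelyContinuousOnInterval _ _).ae_differentiableAt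
  filter_upwards [ae_all_iff.2 h] with x hx
  obtain ⟨n, hn⟩ := exists_nat_ge |x|
  refine hx n ?_
  rw [uIcc_of_le (by linarith [abs_nonneg x])]
  exact abs_le.1 hn

/-- A monotonicity criterion: only almost every derivative is looked at. -/
theorem le_of_ae_deriv_nonneg {f : ℝ → ℝ} (hf : LocallyLipschitz f) {a b : ℝ} (hab : a ≤ b)
    (h : ∀ᵐ x, x ∈ Ioo a b → 0 ≤ deriv f x) : f a ≤ f b := by
  have h1 := (hf.absolutelyContinuousOnInterval a b).integral_deriv_eq_sub
  have h2 : 0 ≤ ∫ x in a..b, deriv f x := by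
    rw [intervalIntegral.integral_of_le hab, integral_Ioc_eq_integral_Ioo]
    refine setIntegral_nonneg_of_ae_restrict ?_
    exact (ae_restrict_iff' measurableSet_Ioo).2 h
  linarith

theorem abs_sub_le_of_ae_deriv {f h : ℝ → ℝ} (hf : LocallyLipschitz f) (hh : LocallyLipschitz h)
    {a b : ℝ} (hd : ∀ᵐ x, x ∈ uIoo a b → |deriv f x| ≤ deriv h x) : |f b - f a| ≤ |h b - h a| := by
  wlog hab : a ≤ b generalizing a b
  · rw [abs_sub_comm, abs_sub_comm (h b)]
    exact this (by rwa [uIoo_comm]) (le_of_not_ge hab)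
  rw [uIoo_of_le hab] at hd
  have h1 : (fun x => h x - f x) a ≤ (fun x => h x - f x) b := by
    refine le_of_ae_deriv_nonneg (hh.sub_real hf) hab ?_
    filter_upwards [hd, hf.ae_differentiableAt, hh.ae_differentiableAt] with x hx h1 h2 hx'
    rw [deriv_fun_sub h2 h1]
    linarith [le_abs_self (deriv f x), hx hx']
  have h2 : (fun x => h x + f x) a ≤ (fun x => h x + f x) b := by
    refine le_of_ae_deriv_nonneg (hh.add_real hf) hab ?_
    filter_upwards [hd, hf.ae_differentiableAt, hh.ae_differentiableAt] with x hx h1 h2 hx'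
    rw [deriv_fun_add h2 h1]
    linarith [neg_abs_le (deriv f x), hx hx']
  simp only at h1 h2
  refine le_trans (abs_le.2 ⟨?_, ?_⟩) (le_abs_self _) <;> linarith

theorem norm_sub_le_of_ae_deriv {E : Type*} [NormedAddCommGroup E] [NormedSpace ℝ E] {f : ℝ → E}
    {h : ℝ → ℝ} (hf : LocallyLipschitz f) (hh : LocallyLipschitz h) {a b : ℝ}
    (hd : ∀ᵐ x, x ∈ uIoo a b → ∃ d, HasDerivAt f d x ∧ ‖d‖ ≤ deriv h x) :
    ‖f b - f a‖ ≤ |h b - h a| := by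
  obtain ⟨φ, hφ, hφ'⟩ := exists_dual_vector'' ℝ (f b - f a)
  have h1 : LocallyLipschitz fun x => φ (f x) := φ.lipschitz.locallyLipschitz.comp hf
  have h2 := abs_sub_le_of_ae_deriv (a := a) (b := b) h1 hh (by
    filter_upwards [hd] with x hx hx'
    obtain ⟨d, hd, hd'⟩ := hx hx'
    have hφd : HasDerivAt (fun x => φ (f x)) (φ d) x := φ.hasFDerivAt.comp_hasDerivAt x hd
    rw [hφd.deriv]
    calc |φ d| ≤ ‖φ‖ * ‖d‖ := φ.le_opNorm d
      _ ≤ 1 * ‖d‖ := by gcongr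
      _ ≤ _ := by linarith)
  rw [← map_sub, hφ'] at h2
  exact (le_abs_self _).trans h2

theorem norm_sub_le_of_ae_deriv_const {E : Type*} [NormedAddCommGroup E] [NormedSpace ℝ E]
    {f : ℝ → E} {K : ℝ} (hK : 0 ≤ K) (hf : LocallyLipschitz f) {a b : ℝ}
    (hd : ∀ᵐ x, x ∈ uIoo a b → ∃ d, HasDerivAt f d x ∧ ‖d‖ ≤ K) :
    ‖f b - f a‖ ≤ K * |b - a| := by
  have h := norm_sub_le_of_ae_deriv (h := fun x => K * x) (a := a) (b := b) hf
    (LocallyLipschitz.id.const_mul K) (by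
      filter_upwards [hd] with x hx hx'
      obtain ⟨d, h1, h2⟩ := hx hx'
      refine ⟨d, h1, h2.trans (le_of_eq ?_)⟩
      simp)
  rwa [← mul_sub, abs_mul, abs_of_nonneg hK] at h

/-- Grönwall's inequality in a form that is insensitive to orientation: the coefficient and the
source are given as derivatives of nondecreasing functions `m` and `h`. -/
theorem gronwall_ae {g m h : ℝ → ℝ} (hg : LocallyLipschitz g) (hm : LocallyLipschitz m)
    (hh : LocallyLipschitz h) {a b : ℝ}
    (hd : ∀ᵐ x, x ∈ uIoo a b →
      |deriv g x| ≤ g x * deriv m x + deriv h x ∧ 0 ≤ deriv m x ∧ 0 ≤ deriv h x) :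
    g b ≤ (g a + |h b - h a|) * Real.exp |m b - m a| := by
  -- reflecting the line exchanges the end points
  wlog hab : a ≤ b generalizing a b g m h
  · have hr : ∀ᵐ x : ℝ, -x ∈ uIoo a b →
      |deriv g (-x)| ≤ g (-x) * deriv m (-x) + deriv h (-x) ∧
        0 ≤ deriv m (-x) ∧ 0 ≤ deriv h (-x) :=
      (Measure.measurePreserving_neg (volume : Measure ℝ)).quasiMeasurePreserving.ae hd
    have h1 := @this (fun x => g (-x)) (fun x => -m (-x)) (fun x => -h (-x)) hg.comp_neg
      (LocallyLipschitz.neg hm.comp_neg) (LocallyLipschitz.neg hh.comp_neg)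
      (-a) (-b) (by
        filter_upwards [hr] with x hx hx'
        have hmem : -x ∈ uIoo a b := by
          rw [uIoo_of_ge (le_of_not_ge hab)]
          rw [uIoo_of_le (by linarith)] at hx'
          constructor <;> linarith [hx'.1, hx'.2]
        have := hx hmem
        simpa [deriv.fun_neg, deriv_comp_neg] using this) (by linarith)
    simp only [neg_neg] at h1
    rwa [show -h b - -h a = -(h b - h a) by ring, show -m b - -m a = -(m b - m a) by ring,
      abs_neg, abs_neg] at h1
  rw [uIoo_of_le hab] at hd
  have hma : ∀ x ∈ Icc a b, m a ≤ m x := fun x hx => by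
    refine le_of_ae_deriv_nonneg hm hx.1 ?_
    filter_upwards [hd] with y hy hy'
    exact (hy ⟨hy'.1, hy'.2.trans_le hx.2⟩).2.1
  have hha : h a ≤ h b := by
    refine le_of_ae_deriv_nonneg hh hab ?_
    filter_upwards [hd] with y hy hy'
    exact (hy hy').2.2
  have he : LocallyLipschitz fun x => Real.exp (-m x) :=
    (LocallyLipschitz.neg hm).contDiff_comp Real.contDiff_exp
  -- `exp (-m) g` grows at most like `exp (-m a) h`
  have key := le_of_ae_deriv_nonneg (f := fun x => Real.exp (-m a) * h x - g x * Real.exp (-m x))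
    ((hh.const_mul _).sub_real (hg.mul_real he)) hab (by
    filter_upwards [hd, hg.ae_differentiableAt, hm.ae_differentiableAt, hh.ae_differentiableAt]
      with x hx h1 h2 h3 hx'
    obtain ⟨i1, i2, i3⟩ := hx hx'
    have hD := ((h3.hasDerivAt.const_mul (Real.exp (-m a))).sub
      (h1.hasDerivAt.mul h2.hasDerivAt.neg.exp)).deriv
    have hD' : deriv (fun x => Real.exp (-m a) * h x - g x * Real.exp (-m x)) x = _ := hD
    rw [hD', Pi.neg_apply]
    have e1 : Real.exp (-m x) ≤ Real.exp (-m a) :=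
      Real.exp_le_exp.2 (by linarith [hma x ⟨hx'.1.le, hx'.2.le⟩])
    have e2 := Real.exp_pos (-m x)
    have e3 := mul_le_mul_of_nonneg_right e1 i3
    have e4 : (deriv g x - g x * deriv m x) * Real.exp (-m x)
        ≤ deriv h x * Real.exp (-m x) :=
      mul_le_mul_of_nonneg_right (by linarith [le_abs_self (deriv g x)]) e2.le
    nlinarith)
  rw [abs_of_nonneg (sub_nonneg.2 hha), abs_of_nonneg (sub_nonneg.2 (hma b ⟨hab, le_rfl⟩))]
  have e5 : g b * Real.exp (-m b) ≤ (g a + (h b - h a)) * Real.exp (-m a) := by linarith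
  calc g b = g b * Real.exp (-m b) * Real.exp (m b) := by
        rw [mul_assoc, ← Real.exp_add]; simp
    _ ≤ (g a + (h b - h a)) * Real.exp (-m a) * Real.exp (m b) := by gcongr
    _ = _ := by rw [mul_assoc, ← Real.exp_add]; ring_nf

/-- A Cauchy–Schwarz inequality for increments. -/
theorem abs_sub_le_sqrt_of_ae_deriv {y j m : ℝ → ℝ} (hy : LocallyLipschitz y)
    (hj : LocallyLipschitz j) (hm : LocallyLipschitz m) {a b C D : ℝ} (hC : 0 ≤ C)
    (hd : ∀ᵐ x, x ∈ uIoo a b → |deriv y x| ≤ C * √(deriv j x * deriv m x) + D * deriv m x ∧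
      0 ≤ deriv j x ∧ 0 ≤ deriv m x) :
    |y b - y a| ≤ C * √(|j b - j a| * |m b - m a|) + |D| * |m b - m a| := by
  -- weighted arithmetic-geometric mean inequality, with a weight `ε` to be optimized
  have h1 : ∀ ε : ℝ, 0 < ε →
      |y b - y a| ≤ C / 2 * (|j b - j a| / ε + ε * |m b - m a|) + |D| * |m b - m a| := by
    intro ε hε
    have h := abs_sub_le_of_ae_deriv (a := a) (b := b) hy
      (h := fun x => C / 2 / ε * j x + (C / 2 * ε + |D|) * m x)
      ((hj.const_mul _).add_real (hm.const_mul _)) (by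
      filter_upwards [hd, hj.ae_differentiableAt, hm.ae_differentiableAt] with x hx h1 h2 hx'
      obtain ⟨i1, i2, i3⟩ := hx hx'
      rw [deriv_fun_add (h1.const_mul _) (h2.const_mul _), deriv_const_mul_field,
        deriv_const_mul_field]
      have h4 : √(deriv j x * deriv m x) ≤ (deriv j x / ε + ε * deriv m x) / 2 := by
        refine Real.sqrt_le_iff.2 ⟨by positivity, ?_⟩
        have : deriv j x * deriv m x = (deriv j x / ε) * (ε * deriv m x) := by field_simp
        rw [this]
        nlinarith [sq_nonneg (deriv j x / ε - ε * deriv m x)]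
      have h5 := mul_le_mul_of_nonneg_left h4 hC
      have h6 : D * deriv m x ≤ |D| * deriv m x := mul_le_mul_of_nonneg_right (le_abs_self D) i3
      calc |deriv y x| ≤ _ := i1
        _ ≤ C * ((deriv j x / ε + ε * deriv m x) / 2) + |D| * deriv m x := by linarith
        _ = _ := by ring)
    refine h.trans ?_
    calc _ = |C / 2 / ε * (j b - j a) + (C / 2 * ε + |D|) * (m b - m a)| := by congr 1; ring
      _ ≤ |C / 2 / ε * (j b - j a)| + |(C / 2 * ε + |D|) * (m b - m a)| := abs_add_le _ _
      _ = C / 2 / ε * |j b - j a| + (C / 2 * ε + |D|) * |m b - m a| := by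
        rw [abs_mul, abs_mul, abs_of_nonneg (by positivity : 0 ≤ C / 2 / ε),
          abs_of_nonneg (by positivity : 0 ≤ C / 2 * ε + |D|)]
      _ = _ := by ring
  generalize |j b - j a| = u at *
  generalize hv : |m b - m a| = v at *
  have hv0 : 0 ≤ v := hv ▸ abs_nonneg _
  -- if an increment vanishes, the optimal weight is degenerate: take the limits `ε → 0`, `ε → ∞`
  rcases le_or_gt u 0 with hu | hu
  · have hlim : Tendsto (fun ε : ℝ => C / 2 * (ε * v) + |D| * v) (𝓝[>] 0)
        (𝓝 (C / 2 * (0 * v) + |D| * v)) :=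
      (Continuous.tendsto (by fun_prop) 0).mono_left nhdsWithin_le_nhds
    have h2 : |y b - y a| ≤ C / 2 * (0 * v) + |D| * v := by
      refine ge_of_tendsto hlim ?_
      filter_upwards [self_mem_nhdsWithin] with ε hε
      have h3 := h1 ε hε
      have h4 : u / ε ≤ 0 := div_nonpos_of_nonpos_of_nonneg hu (le_of_lt hε)
      nlinarith
    have := Real.sqrt_nonneg (u * v)
    nlinarith [mul_nonneg hC this]
  · rcases hv0.eq_or_lt with hv1 | hv1
    · have hlim : Tendsto (fun ε : ℝ => C / 2 * (u / ε)) atTop (𝓝 (C / 2 * 0)) :=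
        (tendsto_const_nhds.div_atTop tendsto_id).const_mul _
      have h2 : |y b - y a| ≤ C / 2 * 0 := by
        refine ge_of_tendsto hlim ?_
        filter_upwards [eventually_gt_atTop 0] with ε hε
        simpa [← hv1] using h1 ε hε
      simpa [← hv1] using h2
    · -- the optimal parameter
      have h2 := h1 (√u / √v) (by positivity)
      have e1 : u / (√u / √v) = √u * √v := by
        rw [div_div_eq_mul_div, div_eq_iff (by positivity)]
        rw [mul_right_comm, Real.mul_self_sqrt hu.le]
      have e2 : √u / √v * v = √u * √v := by
        rw [div_mul_eq_mul_div, div_eq_iff (by positivity)]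
        rw [mul_assoc, Real.mul_self_sqrt hv0]
      rw [e1, e2] at h2
      rw [Real.sqrt_mul hu.le]
      linarith

/-! ### Monotone Lipschitz parametrisations and monotone curves -/

/-- A coordinate of a curve in `𝒞`: a nondecreasing Lipschitz function at bounded distance from the
identity. -/
structure IsParam (X : ℝ → ℝ) : Prop where
  mono : Monotone X
  lip : LipschitzWith 2 X
  near : ∃ M, ∀ s, |X s - s| ≤ M

theorem isCurve_add {X Y : ℝ → ℝ} (h : IsCurve X Y) (s : ℝ) : X s + Y s = 2 * s := by
  linarith [h.normalized s]

theorem isCurve_comm {X Y : ℝ → ℝ} (h : IsCurve X Y) : IsCurve Y X :=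
  ⟨h.reg_Y, h.reg_X, h.deriv_Y, h.deriv_X, fun s => by rw [add_comm]; exact h.normalized s⟩

theorem monotone_of_memW1Inf {X : ℝ → ℝ} (h : MemW1Inf fun s => X s - s)
    (hd : ∀ᵐ s, 0 ≤ deriv X s) : Monotone X := by
  have h1 : LocallyLipschitz X := by
    obtain ⟨L, hL⟩ := h.1
    have := hL.locallyLipschitz.add_real LocallyLipschitz.id
    simpa using this
  intro a b hab
  exact le_of_ae_deriv_nonneg h1 hab (hd.mono fun x hx _ => hx)

/-- A pair of functions with `X + Y = 2 id` is a curve as soon as both are nondecreasing and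
`X - id` is bounded. -/
theorem isParam_of_monotone {X Y : ℝ → ℝ} (hX : Monotone X) (hY : Monotone Y)
    (hXY : ∀ s, X s + Y s = 2 * s) (hb : ∃ M, ∀ s, |X s - s| ≤ M) : IsParam X := by
  refine ⟨hX, ?_, hb⟩
  refine LipschitzWith.of_le_add_mul 2 fun a b => ?_
  rw [Real.dist_eq]
  simp only [NNReal.coe_ofNat]
  rcases le_total a b with h | h
  · linarith [hX h, abs_nonneg (a - b)]
  · linarith [hY h, hXY a, hXY b, le_abs_self (a - b)]

theorem IsCurve.isParam {X Y : ℝ → ℝ} (h : IsCurve X Y) : IsParam X :=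
  isParam_of_monotone (monotone_of_memW1Inf h.reg_X h.deriv_X)
    (monotone_of_memW1Inf h.reg_Y h.deriv_Y) (isCurve_add h) h.reg_X.2

theorem isCurve_of_monotone {X Y : ℝ → ℝ} (hX : Monotone X) (hY : Monotone Y)
    (hXY : ∀ s, X s + Y s = 2 * s) (hb : ∃ M, ∀ s, |X s - s| ≤ M) : IsCurve X Y := by
  have hb' : ∃ M, ∀ s, |Y s - s| ≤ M := by
    obtain ⟨M, hM⟩ := hb
    refine ⟨M, fun s => ?_⟩
    rw [show Y s - s = -(X s - s) by linarith [hXY s], abs_neg]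
    exact hM s
  have h1 := isParam_of_monotone hX hY hXY hb
  have h2 := isParam_of_monotone hY hX (fun s => by rw [add_comm]; exact hXY s) hb'
  exact ⟨⟨⟨2 + 1, h1.lip.sub LipschitzWith.id⟩, hb⟩, ⟨⟨2 + 1, h2.lip.sub LipschitzWith.id⟩, hb'⟩,
    .of_forall fun s => hX.deriv_nonneg, .of_forall fun s => hY.deriv_nonneg,
    fun s => by linarith [hXY s]⟩

namespace IsParam

variable {X : ℝ → ℝ}

theorem continuous (h : IsParam X) : Continuous X := h.lip.continuous

theorem deriv_nonneg (h : IsParam X) (s : ℝ) : 0 ≤ deriv X s := h.mono.deriv_nonneg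

theorem deriv_le (h : IsParam X) (s : ℝ) : deriv X s ≤ 2 :=
  (le_abs_self _).trans (norm_deriv_le_of_lipschitz h.lip)

theorem tendsto_atTop (h : IsParam X) : Tendsto X atTop atTop := by
  obtain ⟨M, hM⟩ := h.near
  refine tendsto_atTop_mono (f := fun s => s - M) (fun s => ?_)
    (tendsto_atTop_add_const_right _ (-M) tendsto_id)
  linarith [(abs_le.1 (hM s)).1]

theorem tendsto_atBot (h : IsParam X) : Tendsto X atBot atBot := by
  obtain ⟨M, hM⟩ := h.near
  refine tendsto_atBot_mono (f := fun s => s + M) (fun s => ?_)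
    (tendsto_atBot_add_const_right _ M tendsto_id)
  linarith [(abs_le.1 (hM s)).2]

theorem surjective (h : IsParam X) : Function.Surjective X :=
  h.continuous.surjective h.tendsto_atTop h.tendsto_atBot

theorem image_Icc (h : IsParam X) {a b : ℝ} (hab : a ≤ b) : X '' Icc a b = Icc (X a) (X b) :=
  h.continuous.continuousOn.image_Icc_of_monotoneOn hab (h.mono.monotoneOn _)

theorem image_Iic (h : IsParam X) (s : ℝ) : X '' Iic s = Iic (X s) := by
  refine Subset.antisymm (image_subset_iff.2 fun r hr => h.mono hr) fun x hx => ?_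
  obtain ⟨r, rfl⟩ := h.surjective x
  rcases le_total r s with hrs | hrs
  · exact ⟨r, hrs, rfl⟩
  · exact ⟨s, mem_Iic.2 le_rfl, le_antisymm (h.mono hrs) hx⟩

theorem ae_differentiableAt (h : IsParam X) : ∀ᵐ s, DifferentiableAt ℝ X s :=
  h.lip.ae_differentiableAt_real

theorem volume_image_eq_zero (h : IsParam X) {N : Set ℝ} (hN : volume N = 0) :
    volume (X '' N) = 0 := by
  have h1 := h.lip.hausdorffMeasure_image_le (d := 1) zero_le_one N
  rw [hausdorffMeasure_real, hN, mul_zero] at h1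
  exact le_antisymm h1 zero_le

/-- An exceptional null set of values is only visited where the derivative vanishes. -/
theorem ae_comp (h : IsParam X) {p : ℝ → Prop} (hp : ∀ᵐ x, p x) :
    ∀ᵐ s, deriv X s ≠ 0 → p (X s) := by
  obtain ⟨N, hN, hNm, hN0⟩ := exists_measurable_superset_of_null (ae_iff.1 hp)
  have hDm : MeasurableSet {s | DifferentiableAt ℝ X s} := measurableSet_of_differentiableAt ℝ X
  have hsm : MeasurableSet (X ⁻¹' N ∩ {s | DifferentiableAt ℝ X s}) :=
    (h.continuous.measurable hNm).inter hDm
  have h1 := lintegral_deriv_eq_volume_image_of_monotoneOn hsm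
    (fun s hs => hs.2.hasDerivAt.hasDerivWithinAt) (h.mono.monotoneOn _)
  have h2 : volume (X '' (X ⁻¹' N ∩ {s | DifferentiableAt ℝ X s})) = 0 :=
    measure_mono_null (by rintro _ ⟨s, hs, rfl⟩; exact hs.1) hN0
  rw [h2, lintegral_eq_zero_iff (measurable_deriv X).ennreal_ofReal] at h1
  have h3 := (ae_restrict_iff' hsm).1 h1
  filter_upwards [h3, h.ae_differentiableAt] with s hs hd hne
  by_contra hcon
  have h4 := hs ⟨hN hcon, hd⟩
  rw [Pi.zero_apply, ENNReal.ofReal_eq_zero] at h4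
  exact hne (le_antisymm h4 (h.deriv_nonneg s))

/-- Almost every value is attained only at parameters at which the derivative is positive and at
which a given property that holds almost everywhere (with respect to the measure `X' ds`) is
valid. -/
theorem ae_of_ae (h : IsParam X) {p : ℝ → Prop} (hp : ∀ᵐ s, deriv X s ≠ 0 → p s) :
    ∀ᵐ x, ∀ s, X s = x → p s ∧ HasDerivAt X (deriv X s) s ∧ 0 < deriv X s := by
  have h1 : volume (X '' {s | ¬ (DifferentiableAt ℝ X s ∧ (deriv X s ≠ 0 → p s))}) = 0 :=
    h.volume_image_eq_zero (ae_iff.1 (h.ae_differentiableAt.and hp))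
  have h2 : volume (X '' {s | DifferentiableAt ℝ X s ∧ deriv X s = 0}) = 0 := by
    have hsm : MeasurableSet {s | DifferentiableAt ℝ X s ∧ deriv X s = 0} :=
      (measurableSet_of_differentiableAt ℝ X).inter (measurable_deriv X (measurableSet_singleton 0))
    rw [← lintegral_deriv_eq_volume_image_of_monotoneOn hsm
      (fun s hs => hs.1.hasDerivAt.hasDerivWithinAt) (h.mono.monotoneOn _)]
    rw [setLIntegral_congr_fun hsm (g := fun _ => 0) fun s hs => by simp [hs.2]]
    simp
  have h3 := measure_union_null h1 h2
  filter_upwards [(measure_eq_zero_iff_ae_notMem).1 h3] with x hx s hs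
  have h4 : DifferentiableAt ℝ X s ∧ (deriv X s ≠ 0 → p s) := by
    by_contra hcon
    exact hx (Or.inl ⟨s, hcon, hs⟩)
  have h5 : deriv X s ≠ 0 := fun h0 => hx (Or.inr ⟨s, ⟨h4.1, h0⟩, hs⟩)
  exact ⟨h4.2 h5, h4.1.hasDerivAt, lt_of_le_of_ne (h.deriv_nonneg s) (Ne.symm h5)⟩

theorem _root_.Monotone.eq_of_hasDerivAt_pos {f : ℝ → ℝ} (hf : Monotone f) {s r d : ℝ}
    (hs : HasDerivAt f d s) (hpos : 0 < d) (hr : f r = f s) : r = s := by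
  by_contra hne
  have hcst : ∀ t ∈ uIcc r s, f t = f s := by
    intro t ht
    rcases le_total r s with hle | hle
    · rw [uIcc_of_le hle] at ht
      exact le_antisymm (hf ht.2) (hr ▸ hf ht.1)
    · rw [uIcc_of_ge hle] at ht
      exact le_antisymm (hr ▸ hf ht.2) (hf ht.1)
  have hu : UniqueDiffWithinAt ℝ (uIcc r s) s :=
    uniqueDiffOn_Icc (by simpa using Ne.symm hne) s right_mem_uIcc
  have h1 : HasDerivWithinAt f 0 (uIcc r s) s :=
    (hasDerivWithinAt_const s (uIcc r s) (f s)).congr hcst (hcst s right_mem_uIcc)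
  have := hu.eq_deriv _ h1 hs.hasDerivWithinAt
  linarith

theorem eq_of_deriv_pos (h : IsParam X) {s r : ℝ} (hs : HasDerivAt X (deriv X s) s)
    (hpos : 0 < deriv X s) (hr : X r = X s) : r = s :=
  h.mono.eq_of_hasDerivAt_pos hs hpos hr

theorem ae_unique (h : IsParam X) : ∀ᵐ x, ∀ s r, X s = x → X r = x → r = s := by
  filter_upwards [h.ae_of_ae (p := fun _ => True) (.of_forall fun _ _ => trivial)]
    with x hx s r hs hr
  exact h.eq_of_deriv_pos (hx s hs).2.1 (hx s hs).2.2 (hr.trans hs.symm)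

theorem image_inter_ae_eq (h : IsParam X) (A : Set ℝ) :
    (X '' (A ∩ {s | DifferentiableAt ℝ X s}) : Set ℝ) =ᵐ[volume] X '' A := by
  refine Filter.EventuallyEq.symm ?_
  rw [ae_eq_set]
  refine ⟨measure_mono_null ?_ (h.volume_image_eq_zero (ae_iff.1 h.ae_differentiableAt)), ?_⟩
  · rintro _ ⟨⟨s, hs, rfl⟩, hx⟩
    exact ⟨s, fun hd => hx ⟨s, ⟨hs, hd⟩, rfl⟩, rfl⟩
  · rw [sdiff_eq_empty.2 (image_mono inter_subset_left), measure_empty]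

theorem inter_ae_eq (h : IsParam X) (A : Set ℝ) :
    (A ∩ {s | DifferentiableAt ℝ X s} : Set ℝ) =ᵐ[volume] A := by
  filter_upwards [h.ae_differentiableAt] with s hs
  exact propext ⟨fun h => h.1, fun h => ⟨h, hs⟩⟩

theorem integral_image (h : IsParam X) {A : Set ℝ} (hA : MeasurableSet A) {E : Type*}
    [NormedAddCommGroup E] [NormedSpace ℝ E] (g : ℝ → E) :
    ∫ x in X '' A, g x = ∫ s in A, deriv X s • g (X s) := by
  rw [← setIntegral_congr_set (h.image_inter_ae_eq A), ← setIntegral_congr_set (h.inter_ae_eq A)]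
  exact integral_image_eq_integral_deriv_smul_of_monotoneOn
    (hA.inter (measurableSet_of_differentiableAt ℝ X))
    (fun s hs => hs.2.hasDerivAt.hasDerivWithinAt) (h.mono.monotoneOn _) g

theorem integrableOn_image_iff (h : IsParam X) {A : Set ℝ} (hA : MeasurableSet A) {E : Type*}
    [NormedAddCommGroup E] [NormedSpace ℝ E] (g : ℝ → E) :
    IntegrableOn g (X '' A) ↔ IntegrableOn (fun s => deriv X s • g (X s)) A := by
  rw [← integrableOn_congr_set_ae (h.image_inter_ae_eq A),
    ← integrableOn_congr_set_ae (h.inter_ae_eq A)]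
  exact integrableOn_image_iff_integrableOn_deriv_smul_of_monotoneOn
    (hA.inter (measurableSet_of_differentiableAt ℝ X))
    (fun s hs => hs.2.hasDerivAt.hasDerivWithinAt) (h.mono.monotoneOn _) g

theorem integrable_comp_iff (h : IsParam X) {E : Type*}
    [NormedAddCommGroup E] [NormedSpace ℝ E] (g : ℝ → E) :
    Integrable g ↔ Integrable (fun s => deriv X s • g (X s)) := by
  have := h.integrableOn_image_iff MeasurableSet.univ g
  rwa [image_univ, h.surjective.range_eq, integrableOn_univ, integrableOn_univ] at this

theorem intervalIntegral_comp (h : IsParam X) {E : Type*}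
    [NormedAddCommGroup E] [NormedSpace ℝ E] (g : ℝ → E) (a b : ℝ) :
    ∫ x in X a..X b, g x = ∫ s in a..b, deriv X s • g (X s) := by
  wlog hab : a ≤ b generalizing a b
  · rw [intervalIntegral.integral_symm, intervalIntegral.integral_symm b a,
      this b a (le_of_not_ge hab)]
  rw [intervalIntegral.integral_of_le hab, intervalIntegral.integral_of_le (h.mono hab),
    ← integral_Icc_eq_integral_Ioc, ← integral_Icc_eq_integral_Ioc, ← h.image_Icc hab,
    h.integral_image measurableSet_Icc]

theorem intervalIntegrable_comp (h : IsParam X) {E : Type*}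
    [NormedAddCommGroup E] [NormedSpace ℝ E] {g : ℝ → E} (hg : LocallyIntegrable g) (a b : ℝ) :
    IntervalIntegrable (fun s => deriv X s • g (X s)) volume a b := by
  wlog hab : a ≤ b generalizing a b
  · exact (this b a (le_of_not_ge hab)).symm
  rw [intervalIntegrable_iff_integrableOn_Icc_of_le hab,
    ← h.integrableOn_image_iff measurableSet_Icc g, h.image_Icc hab]
  exact hg.integrableOn_isCompact isCompact_Icc

end IsParam

/-- The smallest parameter at which the value `x` is attained. -/
def leftInv (X : ℝ → ℝ) (x : ℝ) : ℝ := sInf {s | x ≤ X s}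

/-- The largest parameter at which the value `x` is attained. -/
def rightInv (X : ℝ → ℝ) (x : ℝ) : ℝ := sSup {s | X s ≤ x}

namespace IsParam

variable {X : ℝ → ℝ}

theorem le_iff_leftInv_le (h : IsParam X) {x s : ℝ} : x ≤ X s ↔ leftInv X x ≤ s := by
  have hb : BddBelow {s | x ≤ X s} := by
    obtain ⟨M, hM⟩ := h.near
    exact ⟨x - M, fun r hr => by have := abs_le.1 (hM r); have : x ≤ X r := hr; linarith⟩
  have hne : {s | x ≤ X s}.Nonempty := by
    obtain ⟨r, hr⟩ := h.surjective x
    exact ⟨r, hr.ge⟩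
  have hcl : IsClosed {s | x ≤ X s} := isClosed_le continuous_const h.continuous
  refine ⟨fun hs => csInf_le hb hs, fun hs => ?_⟩
  have : x ≤ X (leftInv X x) := hcl.csInf_mem hne hb
  exact this.trans (h.mono hs)

theorem le_iff_le_rightInv (h : IsParam X) {x s : ℝ} : X s ≤ x ↔ s ≤ rightInv X x := by
  have hb : BddAbove {s | X s ≤ x} := by
    obtain ⟨M, hM⟩ := h.near
    exact ⟨x + M, fun r hr => by have := abs_le.1 (hM r); have : X r ≤ x := hr; linarith⟩
  have hne : {s | X s ≤ x}.Nonempty := by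
    obtain ⟨r, hr⟩ := h.surjective x
    exact ⟨r, hr.le⟩
  have hcl : IsClosed {s | X s ≤ x} := isClosed_le h.continuous continuous_const
  refine ⟨fun hs => le_csSup hb hs, fun hs => ?_⟩
  have : X (rightInv X x) ≤ x := hcl.csSup_mem hne hb
  exact (h.mono hs).trans this

theorem apply_leftInv (h : IsParam X) (x : ℝ) : X (leftInv X x) = x := by
  refine le_antisymm ?_ (h.le_iff_leftInv_le.2 le_rfl)
  obtain ⟨r, rfl⟩ := h.surjective x
  exact h.mono (h.le_iff_leftInv_le.1 le_rfl)

theorem apply_rightInv (h : IsParam X) (x : ℝ) : X (rightInv X x) = x := by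
  refine le_antisymm (h.le_iff_le_rightInv.2 le_rfl) ?_
  obtain ⟨r, rfl⟩ := h.surjective x
  exact h.mono (h.le_iff_le_rightInv.1 le_rfl)

theorem leftInv_mono (h : IsParam X) : Monotone (leftInv X) := fun _ y hxy =>
  h.le_iff_leftInv_le.1 (hxy.trans (h.apply_leftInv y).ge)

theorem rightInv_mono (h : IsParam X) : Monotone (rightInv X) := fun x _ hxy =>
  h.le_iff_le_rightInv.1 ((h.apply_rightInv x).le.trans hxy)

end IsParam

/-- The height at which the vertical line through `x` meets the curve. -/
def curveBeta (X Y : ℝ → ℝ) (x : ℝ) : ℝ := Y (leftInv X x)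

/-- The abscissa at which the horizontal line through `y` meets the curve. -/
def curveAlpha (X Y : ℝ → ℝ) (y : ℝ) : ℝ := X (rightInv Y y)

/-- Lying above the curve can be tested in both directions. -/
theorem curve_galois {X Y : ℝ → ℝ} (hX : IsParam X) (hY : IsParam Y) (x y : ℝ) :
    curveBeta X Y x ≤ y ↔ x ≤ curveAlpha X Y y := by
  rw [curveBeta, curveAlpha, hY.le_iff_le_rightInv, hX.le_iff_leftInv_le]

/-- A Lipschitz function whose derivative along the curve is given by densities in `X` and `Y`. -/
theorem curve_integral {X Y : ℝ → ℝ} (hX : IsParam X) (hY : IsParam Y) {Z : ℝ → ℝ}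
    (hZ : LocallyLipschitz Z) {v w : ℝ → ℝ} (hv : LocallyIntegrable v) (hw : LocallyIntegrable w)
    (hd : ∀ᵐ s, deriv Z s = deriv X s * v (X s) + deriv Y s * w (Y s)) (a b : ℝ) :
    Z b - Z a = (∫ r in X a..X b, v r) + ∫ r in Y a..Y b, w r := by
  rw [← (hZ.absolutelyContinuousOnInterval a b).integral_deriv_eq_sub, hX.intervalIntegral_comp,
    hY.intervalIntegral_comp, ← intervalIntegral.integral_add (hX.intervalIntegrable_comp hv _ _)
      (hY.intervalIntegrable_comp hw _ _)]
  refine intervalIntegral.integral_congr_ae ?_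
  filter_upwards [hd] with s hs _
  simpa using hs

/-! ### Fields with a prescribed mixed derivative -/

/-- A locally Lipschitz field `Z` with `Z_XY = F(Z, Z_X, Z_Y)`, in both orders of differentiation;
for almost every `X` the derivative `Z_X(X, ·)` exists everywhere and is locally Lipschitz, with
locally uniform constants, and similarly for `Z_Y`. -/
structure IsWave (F : Vec5 → Vec5 → Vec5 → Vec5) (Z : ℝ → ℝ → Vec5) : Prop where
  lip : ∀ R : ℝ, ∃ L : ℝ≥0,
    LipschitzOnWith L (fun p : ℝ × ℝ => Z p.1 p.2) (Icc (-R) R ×ˢ Icc (-R) R)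
  diff_X : ∀ᵐ X, ∀ Y, DifferentiableAt ℝ (fun ξ => Z ξ Y) X
  diff_Y : ∀ᵐ Y, ∀ X, DifferentiableAt ℝ (fun η => Z X η) Y
  dX_lip : ∀ R : ℝ, ∃ L : ℝ≥0, ∀ᵐ X, X ∈ Icc (-R) R → LipschitzOnWith L (dX Z X) (Icc (-R) R)
  dY_lip : ∀ R : ℝ, ∃ L : ℝ≥0, ∀ᵐ Y, Y ∈ Icc (-R) R →
    LipschitzOnWith L (fun X => dY Z X Y) (Icc (-R) R)
  eq_YX : ∀ᵐ X, ∀ᵐ Y, HasDerivAt (dX Z X) (F (Z X Y) (dX Z X Y) (dY Z X Y)) Y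
  eq_XY : ∀ᵐ Y, ∀ᵐ X, HasDerivAt (fun ξ => dY Z ξ Y) (F (Z X Y) (dX Z X Y) (dY Z X Y)) X

/-- The nonlinearity of the governing system as a function of `Z`, `Z_X`, `Z_Y`. -/
def waveF (c : ℝ → ℝ) : Vec5 → Vec5 → Vec5 → Vec5 := fun z v w => bilin c (z 2) v w

theorem bilin_comm (c : ℝ → ℝ) (u : ℝ) (v w : Vec5) : bilin c u v w = bilin c u w v := by
  ext i; fin_cases i <;> simp only [bilin, Fin.zero_eta, Fin.mk_one, Fin.reduceFinMk,
    Matrix.cons_val] <;> ring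

namespace IsWave

variable {F : Vec5 → Vec5 → Vec5 → Vec5} {Z : ℝ → ℝ → Vec5}

/-- Exchanging the two characteristic variables. -/
theorem swap (h : IsWave F Z) : IsWave (fun z v w => F z w v) fun X Y => Z Y X where
  lip R := by
    obtain ⟨L, hL⟩ := h.lip R
    refine ⟨L * 1, hL.comp (f := Prod.swap) (s := Icc (-R) R ×ˢ Icc (-R) R) ?_
      fun p hp => ⟨hp.2, hp.1⟩⟩
    exact (LipschitzWith.of_edist_le fun p q => by
      simp [Prod.edist_eq, max_comm]).lipschitzOnWith
  diff_X := h.diff_Y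
  diff_Y := h.diff_X
  dX_lip := h.dY_lip
  dY_lip := h.dX_lip
  eq_YX := h.eq_XY
  eq_XY := h.eq_YX

theorem lip_Y (h : IsWave F Z) (X : ℝ) : LocallyLipschitz (Z X) := by
  refine locallyLipschitz_of_Icc fun R => ?_
  obtain ⟨L, hL⟩ := h.lip (max R |X|)
  refine ⟨L * 1, hL.comp (f := fun Y => (X, Y)) (LipschitzWith.prodMk_left X).lipschitzOnWith
    fun Y hY => ⟨?_, ?_⟩⟩
  · exact abs_le.1 (le_max_right _ _)
  · exact ⟨(neg_le_neg (le_max_left _ _)).trans hY.1, hY.2.trans (le_max_left _ _)⟩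

theorem lip_X (h : IsWave F Z) (Y : ℝ) : LocallyLipschitz fun X => Z X Y := h.swap.lip_Y Y

theorem hasDerivAt_X (h : IsWave F Z) : ∀ᵐ X, ∀ Y, HasDerivAt (fun ξ => Z ξ Y) (dX Z X Y) X :=
  h.diff_X.mono fun _ hX Y => (hX Y).hasDerivAt

theorem hasDerivAt_Y (h : IsWave F Z) : ∀ᵐ Y, ∀ X, HasDerivAt (Z X) (dY Z X Y) Y :=
  h.diff_Y.mono fun _ hY X => (hY X).hasDerivAt

theorem dX_locLip (h : IsWave F Z) : ∀ᵐ X, LocallyLipschitz (dX Z X) := by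
  choose L hL using h.dX_lip
  filter_upwards [ae_all_iff.2 fun n : ℕ => hL n] with X hX
  refine locallyLipschitz_of_Icc fun R => ?_
  obtain ⟨n, hn⟩ := exists_nat_ge (max R |X|)
  refine ⟨L n, (hX n (abs_le.1 ((le_max_right _ _).trans hn))).mono ?_⟩
  have := (le_max_left R |X|).trans hn
  exact Icc_subset_Icc (neg_le_neg this) this

theorem dY_locLip (h : IsWave F Z) : ∀ᵐ Y, LocallyLipschitz fun X => dY Z X Y := h.swap.dX_locLip

end IsWave

/-! ### Domains of dependence and uniqueness -/

/-- A set `Ω` on one side (`σ = 1`: above, `σ = -1`: below) of a curve, which contains with each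
point the vertical and the horizontal segment that join it to the curve. The curve is given by
`X ↦ (X, β X)` and by `Y ↦ (α Y, Y)`. -/
structure IsDom (β α : ℝ → ℝ) (σ : ℝ) (Ω : Set (ℝ × ℝ)) : Prop where
  vert : ∀ X Y, (X, Y) ∈ Ω → 0 ≤ σ * (Y - β X) ∧ ∀ η ∈ uIoo (β X) Y, (X, η) ∈ Ω
  horiz : ∀ X Y, (X, Y) ∈ Ω → 0 ≤ σ * (α Y - X) ∧ ∀ ξ ∈ uIoo (α Y) X, (ξ, Y) ∈ Ω

theorem IsDom.swap {β α : ℝ → ℝ} {σ : ℝ} {Ω : Set (ℝ × ℝ)} (h : IsDom β α σ Ω) :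
    IsDom α β (-σ) (Prod.swap ⁻¹' Ω) where
  vert X Y hXY := ⟨by have := (h.horiz Y X hXY).1; linarith, (h.horiz Y X hXY).2⟩
  horiz X Y hXY := ⟨by have := (h.vert Y X hXY).1; linarith, (h.vert Y X hXY).2⟩

/-- Integration of an exponential weight along a segment that leaves the curve. -/
theorem norm_le_of_deriv_le_exp {E : Type*} [NormedAddCommGroup E] [NormedSpace ℝ E] {g : ℝ → E}
    (hg : LocallyLipschitz g) {σ b y x A l : ℝ} (hσ : σ ^ 2 = 1) (hA : 0 ≤ A) (hl : 0 < l)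
    (hy : 0 ≤ σ * (y - b)) (hb : g b = 0)
    (hd : ∀ᵐ η, η ∈ uIoo b y → ∃ d, HasDerivAt g d η ∧ ‖d‖ ≤ A * Real.exp (l * (σ * (η - x)))) :
    ‖g y‖ ≤ A / l * Real.exp (l * (σ * (y - x))) := by
  have hexp : ∀ η, HasDerivAt (fun η => σ * (A / l * Real.exp (l * (σ * (η - x)))))
      (A * Real.exp (l * (σ * (η - x)))) η := by
    intro η
    have h1 : HasDerivAt (fun η => l * (σ * (η - x))) (l * (σ * 1)) η :=
      (((hasDerivAt_id η).sub_const x).const_mul σ).const_mul l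
    convert! (h1.exp.const_mul (A / l)).const_mul σ using 1
    field_simp
    linear_combination (-A) * hσ
  have h1 := norm_sub_le_of_ae_deriv
    (h := fun η => σ * (A / l * Real.exp (l * (σ * (η - x))))) (a := b) (b := y) hg
    (ContDiff.locallyLipschitz (𝕂 := ℝ) (by fun_prop)) (by
      filter_upwards [hd] with η hη hη'
      rw [(hexp η).deriv]
      exact hη hη')
  rw [hb, sub_zero, ← mul_sub, ← mul_sub, abs_mul, abs_mul] at h1
  have hs : |σ| = 1 := by rw [← sq_abs] at hσ; nlinarith [abs_nonneg σ]
  have hle : Real.exp (l * (σ * (b - x))) ≤ Real.exp (l * (σ * (y - x))) :=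
    Real.exp_le_exp.2 (mul_le_mul_of_nonneg_left (by linarith) hl.le)
  rw [hs, one_mul, abs_of_nonneg (by positivity : 0 ≤ A / l), abs_of_nonneg (by linarith)] at h1
  refine h1.trans (mul_le_mul_of_nonneg_left ?_ (by positivity))
  linarith [Real.exp_pos (l * (σ * (b - x)))]

/-- Uniqueness for the linear Goursat problem: if `|p_Y|, |q_X| ≤ K (|z| + |p| + |q|)`,
`|z_Y| ≤ |q|`, and `z`, `p`, `q` vanish on the curve, then they vanish. With the weight
`exp (l σ (Y - X))`, which decreases towards the curve in both directions, each integration gains a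
factor `1/2`. -/
theorem goursat_zero {E : Type*} [NormedAddCommGroup E] [NormedSpace ℝ E] {β α : ℝ → ℝ} {σ : ℝ}
    {Ω : Set (ℝ × ℝ)} (hσ : σ ^ 2 = 1) (hΩ : IsDom β α σ Ω) {K C B : ℝ} (hK : 0 ≤ K) (hB : 0 ≤ B)
    (hnear : ∀ X Y, (X, Y) ∈ Ω → -C ≤ σ * (Y - X)) {z p q : ℝ → ℝ → E}
    (pb : ∀ᵐ X, ∀ Y, (X, Y) ∈ Ω → ‖p X Y‖ ≤ B) (qb : ∀ᵐ Y, ∀ X, (X, Y) ∈ Ω → ‖q X Y‖ ≤ B)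
    (zb : ∀ X Y, (X, Y) ∈ Ω → ‖z X Y‖ ≤ B)
    (pl : ∀ᵐ X, LocallyLipschitz (p X)) (ql : ∀ᵐ Y, LocallyLipschitz fun X => q X Y)
    (zl : ∀ X, LocallyLipschitz (z X))
    (p0 : ∀ᵐ X, (∃ Y, (X, Y) ∈ Ω) → p X (β X) = 0)
    (q0 : ∀ᵐ Y, (∃ X, (X, Y) ∈ Ω) → q (α Y) Y = 0)
    (z0 : ∀ X, (∃ Y, (X, Y) ∈ Ω) → z X (β X) = 0)
    (pd : ∀ᵐ X, ∀ᵐ Y, (X, Y) ∈ Ω →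
      ∃ d, HasDerivAt (p X) d Y ∧ ‖d‖ ≤ K * (‖z X Y‖ + ‖p X Y‖ + ‖q X Y‖))
    (qd : ∀ᵐ Y, ∀ᵐ X, (X, Y) ∈ Ω →
      ∃ d, HasDerivAt (fun ξ => q ξ Y) d X ∧ ‖d‖ ≤ K * (‖z X Y‖ + ‖p X Y‖ + ‖q X Y‖))
    (zd : ∀ X, ∀ᵐ Y, (X, Y) ∈ Ω → ∃ d, HasDerivAt (z X) d Y ∧ ‖d‖ ≤ ‖q X Y‖) :
    (∀ᵐ X, ∀ Y, (X, Y) ∈ Ω → p X Y = 0) ∧ (∀ᵐ Y, ∀ X, (X, Y) ∈ Ω → q X Y = 0) ∧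
      ∀ X Y, (X, Y) ∈ Ω → z X Y = 0 := by
  -- the rate `l` makes `3 K / l` and `1 / l` at most `1 / 2`
  set l : ℝ := 6 * K + 2 with hl
  have hl0 : 0 < l := by linarith
  -- on `Ω` the weight is at least `exp (-l C)`, so that `A` times the weight dominates `B`
  set A : ℝ := B * Real.exp (l * C) with hA
  have hA0 : 0 ≤ A := by positivity
  have hw : ∀ X Y, (X, Y) ∈ Ω → B ≤ A * Real.exp (l * (σ * (Y - X))) := by
    intro X Y h
    rw [hA, mul_assoc, ← Real.exp_add]
    refine le_mul_of_one_le_right hB (Real.one_le_exp ?_)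
    nlinarith [hnear X Y h]
  have key : ∀ n : ℕ,
      (∀ᵐ X, ∀ Y, (X, Y) ∈ Ω → ‖p X Y‖ ≤ A * (1 / 2) ^ n * Real.exp (l * (σ * (Y - X)))) ∧
      (∀ᵐ Y, ∀ X, (X, Y) ∈ Ω → ‖q X Y‖ ≤ A * (1 / 2) ^ n * Real.exp (l * (σ * (Y - X)))) ∧
      ∀ X Y, (X, Y) ∈ Ω → ‖z X Y‖ ≤ A * (1 / 2) ^ n * Real.exp (l * (σ * (Y - X))) := by
    intro n
    induction n with
    | zero =>
      simp only [pow_zero, mul_one]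
      exact ⟨pb.mono fun X hX Y h => (hX Y h).trans (hw X Y h),
        qb.mono fun Y hY X h => (hY X h).trans (hw X Y h),
        fun X Y h => (zb X Y h).trans (hw X Y h)⟩
    | succ n ih =>
      obtain ⟨ihp, ihq, ihz⟩ := ih
      set a : ℝ := A * (1 / 2) ^ n with ha
      have ha0 : 0 ≤ a := by positivity
      have h3 : ∀ e : ℝ, 0 ≤ e → K * (3 * a) / l * e ≤ A * (1 / 2) ^ (n + 1) * e := by
        intro e he
        refine mul_le_mul_of_nonneg_right ?_ he
        rw [pow_succ, ← mul_assoc A, ← ha, div_le_iff₀ hl0]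
        nlinarith
      have h4 : ∀ e : ℝ, 0 ≤ e → a / l * e ≤ A * (1 / 2) ^ (n + 1) * e := by
        intro e he
        refine mul_le_mul_of_nonneg_right ?_ he
        rw [pow_succ, ← mul_assoc A, ← ha, div_le_iff₀ hl0]
        nlinarith [mul_nonneg ha0 hK]
      refine ⟨?_, ?_, ?_⟩
      · filter_upwards [pl, p0, pd, ihp] with X h1 h2 h5 h6 Y hXY
        refine (norm_le_of_deriv_le_exp (b := β X) (A := K * (3 * a)) h1 hσ (by positivity) hl0
          (hΩ.vert X Y hXY).1 (h2 ⟨Y, hXY⟩) ?_).trans (h3 _ (Real.exp_pos _).le)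
        filter_upwards [h5, ihq] with η h7 h8 hη
        have hm := (hΩ.vert X Y hXY).2 η hη
        obtain ⟨d, hd, hd'⟩ := h7 hm
        refine ⟨d, hd, hd'.trans ?_⟩
        rw [mul_assoc K]
        refine mul_le_mul_of_nonneg_left ?_ hK
        linarith [h6 η hm, h8 X hm, ihz X η hm]
      · filter_upwards [ql, q0, qd, ihq] with Y h1 h2 h5 h6 X hXY
        have h9 : ∀ ξ : ℝ, -σ * (ξ - Y) = σ * (Y - ξ) := fun ξ => by ring
        have := norm_le_of_deriv_le_exp (b := α Y) (y := X) (x := Y) (σ := -σ)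
          (A := K * (3 * a)) h1 (by linarith) (by positivity) hl0
          (by linarith [(hΩ.horiz X Y hXY).1]) (h2 ⟨X, hXY⟩) (by
          filter_upwards [h5, ihp] with ξ h7 h8 hξ
          have hm := (hΩ.horiz X Y hXY).2 ξ hξ
          obtain ⟨d, hd, hd'⟩ := h7 hm
          refine ⟨d, hd, hd'.trans ?_⟩
          rw [mul_assoc K, h9]
          refine mul_le_mul_of_nonneg_left ?_ hK
          linarith [h6 ξ hm, h8 Y hm, ihz ξ Y hm])
        rw [h9] at this
        exact this.trans (h3 _ (Real.exp_pos _).le)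
      · intro X Y hXY
        refine (norm_le_of_deriv_le_exp (b := β X) (A := a) (zl X) hσ ha0 hl0
          (hΩ.vert X Y hXY).1 (z0 X ⟨Y, hXY⟩) ?_).trans (h4 _ (Real.exp_pos _).le)
        filter_upwards [zd X, ihq] with η h7 h8 hη
        have hm := (hΩ.vert X Y hXY).2 η hη
        obtain ⟨d, hd, hd'⟩ := h7 hm
        exact ⟨d, hd, hd'.trans (h8 X hm)⟩
  have hlim : ∀ e x : ℝ, (∀ n : ℕ, x ≤ A * (1 / 2) ^ n * e) → x ≤ 0 := by
    intro e x hx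
    have h1 : Tendsto (fun n : ℕ => A * (1 / 2 : ℝ) ^ n * e) atTop (𝓝 (A * 0 * e)) :=
      ((tendsto_pow_atTop_nhds_zero_of_lt_one (by norm_num) (by norm_num)).const_mul A).mul_const e
    simpa using ge_of_tendsto' h1 hx
  refine ⟨?_, ?_, ?_⟩
  · filter_upwards [ae_all_iff.2 fun n => (key n).1] with X hX Y h
    exact norm_le_zero_iff.1 (hlim _ _ fun n => hX n Y h)
  · filter_upwards [ae_all_iff.2 fun n => (key n).2.1] with Y hY X h
    exact norm_le_zero_iff.1 (hlim _ _ fun n => hY n X h)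
  · intro X Y h
    exact norm_le_zero_iff.1 (hlim _ _ fun n => (key n).2.2 X Y h)

/-! ### Propagation of the algebraic relations -/

/-- The hypotheses on the wave speed `c`. -/
structure IsSpeed (c : ℝ → ℝ) (κ : ℝ) : Prop where
  pos_bound : 0 < κ
  contDiff : ContDiff ℝ 1 c
  lip : LocallyLipschitz (deriv c)
  bounds : ∀ u, κ⁻¹ ≤ c u ∧ c u ≤ κ

namespace IsSpeed

variable {c : ℝ → ℝ} {κ : ℝ}

theorem pos (h : IsSpeed c κ) (u : ℝ) : 0 < c u := (inv_pos.2 h.pos_bound).trans_le (h.bounds u).1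

theorem inv_le (h : IsSpeed c κ) (u : ℝ) : (c u)⁻¹ ≤ κ :=
  inv_le_of_inv_le₀ h.pos_bound (h.bounds u).1

theorem one_le (h : IsSpeed c κ) : 1 ≤ κ := by
  have h1 := (h.bounds 0).1.trans (h.bounds 0).2
  rw [inv_le_iff_one_le_mul₀ h.pos_bound] at h1
  nlinarith [h.pos_bound]

theorem hasDerivAt (h : IsSpeed c κ) (u : ℝ) : HasDerivAt c (deriv c u) u :=
  (h.contDiff.differentiable one_ne_zero u).hasDerivAt

theorem deriv_bdd (h : IsSpeed c κ) (M : ℝ) : ∃ k, 0 ≤ k ∧ ∀ u, |u| ≤ M → |deriv c u| ≤ k := by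
  obtain ⟨k, hk⟩ := isCompact_Icc.exists_bound_of_continuousOn (s := Icc (-M) M)
    h.lip.continuous.continuousOn
  refine ⟨max k 0, le_max_right _ _, fun u hu => (hk u (abs_le.1 hu)).trans (le_max_left _ _)⟩

end IsSpeed

/-- The relations between the components of `Z_X` (`τ = 1`) and of `Z_Y` (`τ = -1`). -/
structure Rel (c : ℝ → ℝ) (τ u : ℝ) (v : Vec5) : Prop where
  tx : v 1 = τ * c u * v 0
  KJ : v 3 = τ * c u * v 4
  energy : 2 * v 3 * v 1 = (c u * v 2) ^ 2
  x_nonneg : 0 ≤ v 1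
  J_nonneg : 0 ≤ v 3
  pos : 0 < v 1 + v 3

theorem abs_le_of_speed_mul {c : ℝ → ℝ} {κ τ u a b : ℝ} (hs : IsSpeed c κ) (hτ : τ ^ 2 = 1)
    (hb : 0 ≤ b) (h : b = τ * c u * a) : |a| ≤ κ * b := by
  have hc := hs.pos u
  have h1 : a = τ * (c u)⁻¹ * b := by
    rw [h]; field_simp; linear_combination (-a) * hτ
  have hτ' : |τ| = 1 := by rw [← sq_abs] at hτ; nlinarith [abs_nonneg τ]
  rw [h1, abs_mul, abs_mul, hτ', one_mul, abs_of_nonneg hb, abs_of_nonneg (by positivity)]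
  exact mul_le_mul_of_nonneg_right (hs.inv_le u) hb

theorem abs_le_of_energy {c : ℝ → ℝ} {κ u a x J : ℝ} (hs : IsSpeed c κ)
    (h : 2 * J * x = (c u * a) ^ 2) : |a| ≤ κ * |x + J| := by
  have hc := hs.pos u
  have h1 : |c u * a| ≤ |x + J| := sq_le_sq.1 (by nlinarith [sq_nonneg x, sq_nonneg J])
  have h2 : a = (c u)⁻¹ * (c u * a) := by field_simp
  rw [h2, abs_mul, abs_of_nonneg (by positivity : 0 ≤ (c u)⁻¹)]
  exact mul_le_mul (hs.inv_le u) h1 (abs_nonneg _) hs.pos_bound.le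

namespace Rel

variable {c : ℝ → ℝ} {κ τ u : ℝ} {v : Vec5}

theorem abs_U_le (h : Rel c τ u v) (hs : IsSpeed c κ) : |v 2| ≤ κ * (v 1 + v 3) := by
  have := abs_le_of_energy hs h.energy
  rwa [abs_of_pos h.pos] at this

theorem norm_le (h : Rel c τ u v) (hs : IsSpeed c κ) (hτ : τ ^ 2 = 1) :
    ‖v‖ ≤ κ * (v 1 + v 3) := by
  have h1 := hs.one_le
  have hx := h.x_nonneg
  have hJ := h.J_nonneg
  refine (pi_norm_le_iff_of_nonneg (by positivity)).2 fun i => ?_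
  rw [Real.norm_eq_abs]
  fin_cases i
  · exact (abs_le_of_speed_mul hs hτ hx h.tx).trans (by nlinarith)
  · change |v 1| ≤ _
    rw [abs_of_nonneg hx]; nlinarith
  · exact h.abs_U_le hs
  · change |v 3| ≤ _
    rw [abs_of_nonneg hJ]; nlinarith
  · exact (abs_le_of_speed_mul hs hτ hJ h.KJ).trans (by nlinarith)

theorem U_sq_le (h : Rel c τ u v) (hs : IsSpeed c κ) : (v 2) ^ 2 ≤ 2 * κ ^ 2 * (v 3 * v 1) := by
  have hc := hs.pos u
  have h1 : (v 2) ^ 2 = ((c u)⁻¹) ^ 2 * (2 * v 3 * v 1) := by rw [h.energy]; field_simp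
  rw [h1, show 2 * κ ^ 2 * (v 3 * v 1) = κ ^ 2 * (2 * v 3 * v 1) by ring]
  have := mul_nonneg h.J_nonneg h.x_nonneg
  exact mul_le_mul_of_nonneg_right
    (pow_le_pow_left₀ (by positivity) (hs.inv_le u) 2) (by linarith)

end Rel

/-- The common coefficient `c' / (2 c)` of the system. -/
def coef (c : ℝ → ℝ) (u : ℝ) : ℝ := deriv c u / (2 * c u)

theorem abs_coef_le {c : ℝ → ℝ} {κ u k : ℝ} (hs : IsSpeed c κ) (h : |deriv c u| ≤ k) :
    |coef c u| ≤ κ * k := by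
  have hc := hs.pos u
  have : coef c u = deriv c u * (c u)⁻¹ * (1 / 2) := by rw [coef]; field_simp
  rw [this, abs_mul, abs_mul, abs_of_pos (inv_pos.2 hc)]
  have h1 := mul_le_mul h (hs.inv_le u) (inv_pos.2 hc).le ((abs_nonneg _).trans h)
  rw [abs_of_pos (by norm_num : (0 : ℝ) < 1 / 2)]
  nlinarith [mul_nonneg (abs_nonneg (deriv c u)) (inv_pos.2 hc).le]

section bilin

variable (c : ℝ → ℝ) (u : ℝ) (v w : Vec5)

theorem bilin_t : bilin c u v w 0 = -coef c u * (v 2 * w 0 + w 2 * v 0) := by simp [bilin, coef]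

theorem bilin_x : bilin c u v w 1 = coef c u * (w 2 * v 1 + v 2 * w 1) := by simp [bilin, coef]

theorem bilin_U : bilin c u v w 2 =
    deriv c u / (2 * c u ^ 3) * (w 1 * v 3 + w 3 * v 1) - coef c u * (w 2 * v 2) := by
  simp [bilin, coef]

theorem bilin_J : bilin c u v w 3 = coef c u * (w 2 * v 3 + v 2 * w 3) := by
  simp only [bilin, coef, Matrix.cons_val]; ring

theorem bilin_K : bilin c u v w 4 = -coef c u * (v 2 * w 4 + w 2 * v 4) := by
  simp only [bilin, coef, Matrix.cons_val]; ring

end bilin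

section oneDim

variable {c : ℝ → ℝ} {κ : ℝ} {P Q : ℝ → Vec5} {u : ℝ → ℝ} {b y K : ℝ}

/-- The quantity `R = 2 J_X x_X - (c U_X)²` satisfies `R_Y = (c'/c) U_Y R`, so that it vanishes
along a characteristic if it vanishes at one point. -/
theorem energy_propagates (hs : IsSpeed c κ) (hP : LocallyLipschitz P) (hu : LocallyLipschitz u)
    (hd : ∀ᵐ η, η ∈ uIoo b y → HasDerivAt P (bilin c (u η) (P η) (Q η)) η ∧
      HasDerivAt u (Q η 2) η ∧ |deriv c (u η)| * ‖Q η‖ ≤ K)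
    (h0 : 2 * P b 3 * P b 1 = (c (u b) * P b 2) ^ 2) :
    2 * P y 3 * P y 1 = (c (u y) * P y 2) ^ 2 := by
  set R : ℝ → ℝ := fun η => 2 * (P η 3 * P η 1) - c (u η) * P η 2 * (c (u η) * P η 2) with hR
  have hcu : LocallyLipschitz fun η => c (u η) * P η 2 :=
    (hu.contDiff_comp hs.contDiff).mul_real (hP.coord 2)
  have hRl : LocallyLipschitz R :=
    (((hP.coord 3).mul_real (hP.coord 1)).const_mul 2).sub_real (hcu.mul_real hcu)
  -- Grönwall for `R²`, which is nonnegative, differentiable where `R` is, and vanishes at `b`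
  have h1 := gronwall_ae (g := fun η => R η * R η) (m := fun η => 2 * κ * K * η) (h := fun _ => 0)
    (a := b) (b := y) (hRl.mul_real hRl) (LocallyLipschitz.id.const_mul _)
    (LocallyLipschitz.const 0) (by
      filter_upwards [hd] with η hη hη'
      obtain ⟨d1, d2, d3⟩ := hη hη'
      have hi := hasDerivAt_pi.1 d1
      have hc := hs.pos (u η)
      have dc : HasDerivAt (fun η => c (u η)) (deriv c (u η) * Q η 2) η :=
        (hs.hasDerivAt (u η)).comp η d2
      have dcu := dc.mul (hi 2)
      have dR : HasDerivAt R (deriv c (u η) * (c (u η))⁻¹ * Q η 2 * R η) η := by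
        convert! (((hi 3).mul (hi 1)).const_mul 2).sub (dcu.mul dcu) using 1
        simp only [bilin_x, bilin_J, bilin_U, coef, hR, Pi.mul_apply]
        field_simp
        ring
      have h4 : |deriv c (u η) * (c (u η))⁻¹ * Q η 2| ≤ κ * K := by
        rw [abs_mul, abs_mul, abs_of_pos (inv_pos.2 hc)]
        have h5 : |deriv c (u η)| * |Q η 2| ≤ K :=
          le_trans (mul_le_mul_of_nonneg_left (norm_le_pi_norm (Q η) 2) (abs_nonneg _)) d3
        calc _ = (c (u η))⁻¹ * (|deriv c (u η)| * |Q η 2|) := by ring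
          _ ≤ _ := mul_le_mul (hs.inv_le _) h5 (by positivity) hs.pos_bound.le
      have hK : 0 ≤ K := le_trans (by positivity) d3
      have hm : deriv (fun η => 2 * κ * K * η) η = 2 * κ * K := by simp
      rw [(dR.fun_mul dR).deriv, hm, deriv_const]
      refine ⟨?_, by have := hs.pos_bound; positivity, le_rfl⟩
      calc _ = 2 * |deriv c (u η) * (c (u η))⁻¹ * Q η 2| * (R η * R η) := by
            rw [← abs_mul_abs_self (R η),
              show ∀ a r : ℝ, a * r * r + r * (a * r) = 2 * a * (r * r) by intros; ring,
              abs_mul, abs_mul, abs_mul]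
            simp
        _ ≤ 2 * (κ * K) * (R η * R η) := by gcongr; exact mul_self_nonneg _
        _ = _ := by ring)
  have h2 : R b = 0 := by simp only [hR]; linarith
  rw [h2] at h1
  have h3 : R y = 0 := by
    have : R y * R y ≤ 0 := by simpa using h1
    nlinarith [mul_self_nonneg (R y)]
  simp only [hR] at h3
  linarith

theorem uIoo_subset_of_mem_uIcc {b y t : ℝ} (ht : t ∈ uIcc b y) : uIoo b t ⊆ uIoo b y := by
  rcases le_total b y with h | h
  · rw [uIcc_of_le h] at ht
    rw [uIoo_of_le h, uIoo_of_le ht.1]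
    exact Ioo_subset_Ioo_right ht.2
  · rw [uIcc_of_ge h] at ht
    rw [uIoo_of_ge h, uIoo_of_ge ht.2]
    exact Ioo_subset_Ioo_left ht.1

/-- Given `2 J_X x_X = (c U_X)²`, the sum `p = x_X + J_X` satisfies `|p_Y| ≤ C |p|`; hence it keeps
its sign, and `x_X` and `J_X`, whose product is nonnegative, remain nonnegative. -/
theorem positivity_propagates (hs : IsSpeed c κ) (hP : LocallyLipschitz P)
    (hu : LocallyLipschitz u)
    (hd : ∀ᵐ η, η ∈ uIoo b y → HasDerivAt P (bilin c (u η) (P η) (Q η)) η ∧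
      HasDerivAt u (Q η 2) η ∧ |deriv c (u η)| * ‖Q η‖ ≤ K)
    (h0 : 2 * P b 3 * P b 1 = (c (u b) * P b 2) ^ 2) (hp : 0 < P b 1 + P b 3) :
    0 ≤ P y 1 ∧ 0 ≤ P y 3 ∧ 0 < P y 1 + P y 3 := by
  have hen : ∀ t ∈ uIcc b y, 2 * P t 3 * P t 1 = (c (u t) * P t 2) ^ 2 := fun t ht =>
    energy_propagates hs hP hu (hd.mono fun η hη h => hη (uIoo_subset_of_mem_uIcc ht h)) h0
  set p : ℝ → ℝ := fun η => P η 1 + P η 3 with hpdef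
  have hpl : LocallyLipschitz p := (hP.coord 1).add_real (hP.coord 3)
  -- backwards from `t` to `b`: a zero of `p` at `t` would force `p b = 0`
  have hne : ∀ t ∈ uIcc b y, p t ≠ 0 := by
    intro t ht h
    have h1 := gronwall_ae (g := fun η => p η * p η) (m := fun η => 2 * (κ * K * (1 + 2 * κ)) * η)
      (h := fun _ => 0) (a := t) (b := b) (hpl.mul_real hpl) (LocallyLipschitz.id.const_mul _)
      (LocallyLipschitz.const 0) (by
        filter_upwards [hd] with η hη hη'
        rw [uIoo_comm] at hη'
        have hη'' := uIoo_subset_of_mem_uIcc ht hη'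
        obtain ⟨d1, d2, d3⟩ := hη hη''
        have hi := hasDerivAt_pi.1 d1
        have hK : 0 ≤ K := le_trans (by positivity) d3
        have hκ := hs.pos_bound
        have dp : HasDerivAt p (coef c (u η) * (Q η 2 * p η + P η 2 * (Q η 1 + Q η 3))) η := by
          convert! (hi 1).add (hi 3) using 1
          simp only [bilin_x, bilin_J, hpdef]
          ring
        have hU := abs_le_of_energy hs (hen η (uIoo_subset_uIcc_self hη''))
        have hk := abs_coef_le hs (le_refl |deriv c (u η)|)
        have hQ : ∀ i, |Q η i| ≤ ‖Q η‖ := fun i => norm_le_pi_norm (Q η) i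
        have hb : |coef c (u η) * (Q η 2 * p η + P η 2 * (Q η 1 + Q η 3))|
            ≤ κ * K * (1 + 2 * κ) * |p η| := by
          rw [abs_mul]
          have h5 : |Q η 2 * p η + P η 2 * (Q η 1 + Q η 3)| ≤ ‖Q η‖ * ((1 + 2 * κ) * |p η|) := by
            refine (abs_add_le _ _).trans ?_
            rw [abs_mul, abs_mul]
            have h6 : |P η 2| * |Q η 1 + Q η 3| ≤ κ * |p η| * (2 * ‖Q η‖) :=
              mul_le_mul hU ((abs_add_le _ _).trans (by linarith [hQ 1, hQ 3])) (abs_nonneg _)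
                (by positivity)
            have h7 := mul_le_mul_of_nonneg_right (hQ 2) (abs_nonneg (p η))
            linarith
          calc _ ≤ κ * |deriv c (u η)| * (‖Q η‖ * ((1 + 2 * κ) * |p η|)) :=
                mul_le_mul hk h5 (abs_nonneg _) (by positivity)
            _ = κ * (|deriv c (u η)| * ‖Q η‖) * ((1 + 2 * κ) * |p η|) := by ring
            _ ≤ κ * K * ((1 + 2 * κ) * |p η|) := by gcongr
            _ = _ := by ring
        have hm : deriv (fun η => 2 * (κ * K * (1 + 2 * κ)) * η) η
            = 2 * (κ * K * (1 + 2 * κ)) := by simp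
        rw [(dp.fun_mul dp).deriv, hm, deriv_const]
        refine ⟨?_, by positivity, le_rfl⟩
        rw [show ∀ a r : ℝ, a * r + r * a = 2 * (a * r) by intros; ring, abs_mul, abs_mul, abs_two]
        have := mul_le_mul_of_nonneg_right hb (abs_nonneg (p η))
        rw [mul_assoc _ |p η| |p η|, abs_mul_abs_self] at this
        linarith)
    rw [h] at h1
    have h2 : p b * p b ≤ 0 := by simpa using h1
    have h3 : 0 < p b := hp
    nlinarith
  have hpos : 0 < p y := by
    by_contra hcon
    have h1 := intermediate_value_uIcc (a := b) (b := y) hpl.continuous.continuousOn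
    have h2 : (0 : ℝ) ∈ uIcc (p b) (p y) := by
      rw [uIcc_of_ge ((not_lt.1 hcon).trans hp.le)]
      exact ⟨not_lt.1 hcon, hp.le⟩
    obtain ⟨t, ht, ht0⟩ := h1 h2
    exact hne t ht ht0
  have h4 := hen y right_mem_uIcc
  have h5 : 0 ≤ P y 3 * P y 1 := by nlinarith [sq_nonneg (c (u y) * P y 2)]
  have h6 : 0 < P y 1 + P y 3 := hpos
  refine ⟨?_, ?_, h6⟩
  · by_contra hcon
    nlinarith
  · by_contra hcon
    nlinarith

end oneDim

/-- `Z` solves the governing system in `Ω`; outside `Ω` only `Z_XY = F(Z, Z_X, Z_Y)` is known. -/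
structure SolvesOn (c : ℝ → ℝ) (F : Vec5 → Vec5 → Vec5 → Vec5) (Z : ℝ → ℝ → Vec5)
    (Ω : Set (ℝ × ℝ)) : Prop where
  wave : IsWave F Z
  eq_F : ∀ᵐ X, ∀ᵐ Y, (X, Y) ∈ Ω →
    F (Z X Y) (dX Z X Y) (dY Z X Y) = bilin c (Z X Y 2) (dX Z X Y) (dY Z X Y)
  eq_F' : ∀ᵐ Y, ∀ᵐ X, (X, Y) ∈ Ω →
    F (Z X Y) (dX Z X Y) (dY Z X Y) = bilin c (Z X Y 2) (dX Z X Y) (dY Z X Y)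

theorem SolvesOn.swap {c : ℝ → ℝ} {F : Vec5 → Vec5 → Vec5 → Vec5} {Z : ℝ → ℝ → Vec5}
    {Ω : Set (ℝ × ℝ)} (h : SolvesOn c F Z Ω) :
    SolvesOn c (fun z v w => F z w v) (fun X Y => Z Y X) (Prod.swap ⁻¹' Ω) where
  wave := h.wave.swap
  eq_F := by
    filter_upwards [h.eq_F'] with X hX
    filter_upwards [hX] with Y hY hΩ
    rw [bilin_comm]
    exact hY hΩ
  eq_F' := by
    filter_upwards [h.eq_F] with X hX
    filter_upwards [hX] with Y hY hΩ
    rw [bilin_comm]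
    exact hY hΩ

/-- Bounds on the quantities that enter the nonlinearity. -/
structure BddOn (Z : ℝ → ℝ → Vec5) (Ω : Set (ℝ × ℝ)) (M : ℝ) : Prop where
  U : ∀ X Y, (X, Y) ∈ Ω → |Z X Y 2| ≤ M
  dX : ∀ᵐ X, ∀ Y, (X, Y) ∈ Ω → ‖dX Z X Y‖ ≤ M
  dY : ∀ᵐ Y, ∀ X, (X, Y) ∈ Ω → ‖dY Z X Y‖ ≤ M

theorem BddOn.swap {Z : ℝ → ℝ → Vec5} {Ω : Set (ℝ × ℝ)} {M : ℝ} (h : BddOn Z Ω M) :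
    BddOn (fun X Y => Z Y X) (Prod.swap ⁻¹' Ω) M where
  U X Y hXY := h.U Y X hXY
  dX := h.dY
  dY := h.dX

section propagation

variable {c : ℝ → ℝ} {κ : ℝ} {F : Vec5 → Vec5 → Vec5 → Vec5} {Z : ℝ → ℝ → Vec5}
  {Ω : Set (ℝ × ℝ)} {β α : ℝ → ℝ} {σ M C τ : ℝ}

/-- The pairs of indices `(x, t)` and `(J, K)`. -/
def IsPair (i j : Fin 5) : Prop := (i = 1 ∧ j = 0) ∨ (i = 3 ∧ j = 4)

theorem IsPair.bilin {i j : Fin 5} (h : IsPair i j) (c : ℝ → ℝ) (u : ℝ) (v w : Vec5) :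
    bilin c u v w i = coef c u * (w 2 * v i + v 2 * w i) ∧
      NVW.bilin c u v w j = -coef c u * (w 2 * v j + v 2 * w j) := by
  rcases h with ⟨rfl, rfl⟩ | ⟨rfl, rfl⟩
  · exact ⟨bilin_x .., by rw [bilin_t]; ring⟩
  · exact ⟨bilin_J .., by rw [bilin_K]; ring⟩

/-- The derivative along a characteristic of `e = x_X - τ c t_X` is
`(c'/2c) (U_Y e + U_X (x_Y + τ c t_Y))`. -/
theorem hasDerivAt_pair_defect (hs : IsSpeed c κ) {i j : Fin 5} (hij : IsPair i j)
    {P : ℝ → Vec5} {u : ℝ → ℝ} {q : Vec5} {η : ℝ} (hP : HasDerivAt P (bilin c (u η) (P η) q) η)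
    (hu : HasDerivAt u (q 2) η) :
    HasDerivAt (fun η => P η i - τ * c (u η) * P η j)
      (coef c (u η) * (q 2 * (P η i - τ * c (u η) * P η j)
        + P η 2 * (q i + τ * c (u η) * q j))) η := by
  have hi := hasDerivAt_pi.1 hP
  have hc := hs.pos (u η)
  have dc : HasDerivAt (fun η => c (u η)) (deriv c (u η) * q 2) η :=
    (hs.hasDerivAt (u η)).comp η hu
  convert! (hi i).sub ((dc.const_mul τ).mul (hi j)) using 1
  rw [(hij.bilin c (u η) (P η) q).1, (hij.bilin c (u η) (P η) q).2, coef]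
  field_simp
  ring

theorem abs_pair_defect_le (hs : IsSpeed c κ) (hτ : τ ^ 2 = 1) {i j : Fin 5} {u : ℝ} {v : Vec5}
    (hv : ‖v‖ ≤ M) : |v i - τ * c u * v j| ≤ (1 + κ) * M ∧
      |v i + τ * c u * v j| ≤ (1 + κ) * M := by
  have h1 : |τ * c u * v j| ≤ κ * M := by
    have hτ' : |τ| = 1 := by rw [← sq_abs] at hτ; nlinarith [abs_nonneg τ]
    rw [abs_mul, abs_mul, hτ', one_mul, abs_of_pos (hs.pos u)]
    exact mul_le_mul (hs.bounds u).2 ((norm_le_pi_norm v j).trans hv) (abs_nonneg _)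
      hs.pos_bound.le
  have h2 : |v i| ≤ M := (norm_le_pi_norm v i).trans hv
  exact ⟨(abs_sub _ _).trans (by linarith), (abs_add_le _ _).trans (by linarith)⟩

theorem abs_pair_defect_deriv_le (hs : IsSpeed c κ) {k u a b e e' : ℝ}
    (hk : |deriv c u| ≤ k) (ha : |a| ≤ M) (hb : |b| ≤ M) :
    ‖coef c u * (a * e + b * e')‖ ≤ κ * k * M * (‖(0 : ℝ)‖ + ‖e‖ + ‖e'‖) := by
  have h1 := abs_coef_le hs hk
  have hM := (abs_nonneg _).trans ha
  have h2 : |a * e + b * e'| ≤ M * (|e| + |e'|) := by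
    refine (abs_add_le _ _).trans ?_
    rw [abs_mul, abs_mul, mul_add]
    exact add_le_add (mul_le_mul_of_nonneg_right ha (abs_nonneg _))
      (mul_le_mul_of_nonneg_right hb (abs_nonneg _))
  rw [norm_zero, zero_add, Real.norm_eq_abs, Real.norm_eq_abs, Real.norm_eq_abs, abs_mul,
    mul_assoc (κ * k)]
  exact mul_le_mul h1 h2 (abs_nonneg _) ((abs_nonneg _).trans h1)

/-- The linear relations between `x` and `t`, and between `J` and `K`, propagate from the curve:
their defects solve a linear Goursat problem with zero data. -/
theorem pair_relation (hs : IsSpeed c κ) (hσ : σ ^ 2 = 1) (hτ : τ ^ 2 = 1)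
    (hΩ : IsDom β α σ Ω) (hnear : ∀ X Y, (X, Y) ∈ Ω → -C ≤ σ * (Y - X)) (hZ : SolvesOn c F Z Ω)
    (hM : 0 ≤ M) (hb : BddOn Z Ω M) {i j : Fin 5} (hij : IsPair i j)
    (hX : ∀ᵐ X, dX Z X (β X) i = τ * c (Z X (β X) 2) * dX Z X (β X) j)
    (hY : ∀ᵐ Y, dY Z (α Y) Y i = -τ * c (Z (α Y) Y 2) * dY Z (α Y) Y j) :
    (∀ᵐ X, ∀ Y, (X, Y) ∈ Ω → dX Z X Y i = τ * c (Z X Y 2) * dX Z X Y j) ∧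
      ∀ᵐ Y, ∀ X, (X, Y) ∈ Ω → dY Z X Y i = -τ * c (Z X Y 2) * dY Z X Y j := by
  obtain ⟨k, hk0, hk⟩ := hs.deriv_bdd M
  have hκ := hs.pos_bound
  have cl : ∀ {g : ℝ → Vec5} {u : ℝ → ℝ} {τ : ℝ}, LocallyLipschitz g → LocallyLipschitz u →
      LocallyLipschitz fun x => g x i - τ * c (u x) * g x j := by
    intro g u τ hg hu
    simp only [mul_assoc]
    exact (hg.coord i).sub_real (((hu.contDiff_comp hs.contDiff).mul_real (hg.coord j)).const_mul _)
  have key := goursat_zero (E := ℝ) (z := fun _ _ => 0)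
    (p := fun X Y => dX Z X Y i - τ * c (Z X Y 2) * dX Z X Y j)
    (q := fun X Y => dY Z X Y i - -τ * c (Z X Y 2) * dY Z X Y j) hσ hΩ
    (K := κ * k * M) (B := (1 + κ) * M) (by positivity) (by positivity) hnear
    (hb.dX.mono fun X h Y hm => (abs_pair_defect_le hs hτ (h Y hm)).1)
    (hb.dY.mono fun Y h X hm => (abs_pair_defect_le hs (by linarith) (h X hm)).1)
    (fun X Y _ => by simpa using (by positivity : 0 ≤ (1 + κ) * M))
    (hZ.wave.dX_locLip.mono fun X h => cl h ((hZ.wave.lip_Y X).coord 2))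
    (hZ.wave.dY_locLip.mono fun Y h => cl h ((hZ.wave.lip_X Y).coord 2))
    (fun X => LocallyLipschitz.const 0)
    (hX.mono fun X h _ => sub_eq_zero.2 h) (hY.mono fun Y h _ => sub_eq_zero.2 h)
    (fun _ _ => rfl)
    (by
      filter_upwards [hZ.wave.eq_YX, hZ.eq_F, hb.dX] with X h1 h2 h3
      filter_upwards [h1, h2, hZ.wave.hasDerivAt_Y, hb.dY] with Y h4 h5 h6 h7 hm
      rw [h5 hm] at h4
      refine ⟨_, hasDerivAt_pair_defect hs hij (u := fun Y => Z X Y 2) h4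
        (hasDerivAt_pi.1 (h6 X) 2), ?_⟩
      simp only [neg_mul, sub_neg_eq_add]
      exact abs_pair_defect_deriv_le hs (hk _ (hb.U X Y hm))
        ((norm_le_pi_norm _ 2).trans (h7 X hm)) ((norm_le_pi_norm _ 2).trans (h3 Y hm)))
    (by
      filter_upwards [hZ.wave.eq_XY, hZ.eq_F', hb.dY] with Y h1 h2 h3
      filter_upwards [h1, h2, hZ.wave.hasDerivAt_X, hb.dX] with X h4 h5 h6 h7 hm
      rw [h5 hm, bilin_comm] at h4
      refine ⟨_, hasDerivAt_pair_defect (τ := -τ) hs hij (u := fun X => Z X Y 2)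
        (P := fun X => dY Z X Y) h4 (hasDerivAt_pi.1 (h6 Y) 2), ?_⟩
      simp only [neg_mul, sub_neg_eq_add, ← sub_eq_add_neg]
      rw [add_right_comm]
      exact abs_pair_defect_deriv_le hs (hk _ (hb.U X Y hm))
        ((norm_le_pi_norm _ 2).trans (h7 Y hm)) ((norm_le_pi_norm _ 2).trans (h3 X hm)))
    (fun X => .of_forall fun Y _ => ⟨0, hasDerivAt_const _ _, by simp⟩)
  exact ⟨key.1.mono fun X h Y hm => sub_eq_zero.1 (h Y hm),
    key.2.1.mono fun Y h X hm => sub_eq_zero.1 (h X hm)⟩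

/-- Given the linear relations in a domain of dependence, the energy relation and the signs of `Z_X`
propagate along the vertical characteristics. -/
theorem rel_of_pair_relation (hs : IsSpeed c κ) (hΩ : IsDom β α σ Ω) (hZ : SolvesOn c F Z Ω)
    (hb : BddOn Z Ω M)
    (h10 : ∀ᵐ X, ∀ Y, (X, Y) ∈ Ω → dX Z X Y 1 = τ * c (Z X Y 2) * dX Z X Y 0)
    (h34 : ∀ᵐ X, ∀ Y, (X, Y) ∈ Ω → dX Z X Y 3 = τ * c (Z X Y 2) * dX Z X Y 4)
    (hX : ∀ᵐ X, Rel c τ (Z X (β X) 2) (dX Z X (β X))) :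
    ∀ᵐ X, ∀ Y, (X, Y) ∈ Ω → Rel c τ (Z X Y 2) (dX Z X Y) := by
  obtain ⟨k, hk0, hk⟩ := hs.deriv_bdd M
  filter_upwards [h10, h34, hX, hZ.wave.dX_locLip, hZ.wave.eq_YX, hZ.eq_F] with
    X h1 h2 h3 h4 h5 h6 Y hm
  have hd : ∀ᵐ η, η ∈ uIoo (β X) Y →
      HasDerivAt (dX Z X) (bilin c (Z X η 2) (dX Z X η) (dY Z X η)) η ∧
        HasDerivAt (fun η => Z X η 2) (dY Z X η 2) η ∧
          |deriv c (Z X η 2)| * ‖dY Z X η‖ ≤ k * M := by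
    filter_upwards [h5, h6, hZ.wave.hasDerivAt_Y, hb.dY] with η h7 h8 h9 h10 hη
    have hm' := (hΩ.vert X Y hm).2 η hη
    rw [h8 hm'] at h7
    exact ⟨h7, hasDerivAt_pi.1 (h9 X) 2,
      mul_le_mul (hk _ (hb.U X η hm')) (h10 X hm') (norm_nonneg _) hk0⟩
  have hu := (hZ.wave.lip_Y X).coord 2
  obtain ⟨h7, h8, h9⟩ := positivity_propagates hs h4 hu hd h3.energy h3.pos
  exact ⟨h1 Y hm, h2 Y hm, energy_propagates hs h4 hu hd h3.energy, h7, h8, h9⟩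

/-- All relations, for `Z_X` and for `Z_Y`, propagate from the curve into a domain of dependence. -/
theorem rel_propagates (hs : IsSpeed c κ) (hσ : σ ^ 2 = 1) (hτ : τ ^ 2 = 1)
    (hΩ : IsDom β α σ Ω) (hnear : ∀ X Y, (X, Y) ∈ Ω → -C ≤ σ * (Y - X)) (hZ : SolvesOn c F Z Ω)
    (hM : 0 ≤ M) (hb : BddOn Z Ω M)
    (hX : ∀ᵐ X, Rel c τ (Z X (β X) 2) (dX Z X (β X)))
    (hY : ∀ᵐ Y, Rel c (-τ) (Z (α Y) Y 2) (dY Z (α Y) Y)) :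
    (∀ᵐ X, ∀ Y, (X, Y) ∈ Ω → Rel c τ (Z X Y 2) (dX Z X Y)) ∧
      ∀ᵐ Y, ∀ X, (X, Y) ∈ Ω → Rel c (-τ) (Z X Y 2) (dY Z X Y) := by
  have h1 := pair_relation hs hσ hτ hΩ hnear hZ hM hb (.inl ⟨rfl, rfl⟩)
    (hX.mono fun _ h => h.tx) (hY.mono fun _ h => h.tx)
  have h2 := pair_relation hs hσ hτ hΩ hnear hZ hM hb (.inr ⟨rfl, rfl⟩)
    (hX.mono fun _ h => h.KJ) (hY.mono fun _ h => h.KJ)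
  exact ⟨rel_of_pair_relation hs hΩ hZ hb h1.1 h2.1 hX,
    rel_of_pair_relation (Z := fun X Y => Z Y X) (β := α) hs hΩ.swap hZ.swap hb.swap h1.2 h2.2 hY⟩

end propagation

/-! ### A priori bounds -/

section apriori

variable {c : ℝ → ℝ} {κ : ℝ} {F : Vec5 → Vec5 → Vec5 → Vec5} {Z : ℝ → ℝ → Vec5}
  {Ω : Set (ℝ × ℝ)} {β α : ℝ → ℝ} {σ τ : ℝ}

/-- Along a vertical segment that leaves the curve, `x` and `J` are monotone. -/
theorem increment_nonneg (hσ : σ ^ 2 = 1) {z : ℝ → ℝ} (hz : LocallyLipschitz z) {b y : ℝ}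
    (hy : 0 ≤ σ * (y - b)) (hd : ∀ᵐ η, η ∈ uIoo b y → 0 ≤ deriv z η) : 0 ≤ σ * (z y - z b) := by
  have hσ' : σ = 1 ∨ σ = -1 := mul_self_eq_one_iff.1 (by rwa [← sq])
  rcases hσ' with rfl | rfl
  · have hby : b ≤ y := by linarith
    rw [uIoo_of_le hby] at hd
    linarith [le_of_ae_deriv_nonneg hz hby hd]
  · have hby : y ≤ b := by linarith
    rw [uIoo_of_ge hby] at hd
    linarith [le_of_ae_deriv_nonneg hz hby hd]

/-- The relations hold in `Ω`. -/
structure RelOn (c : ℝ → ℝ) (τ : ℝ) (Z : ℝ → ℝ → Vec5) (Ω : Set (ℝ × ℝ)) : Prop where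
  dX : ∀ᵐ X, ∀ Y, (X, Y) ∈ Ω → Rel c τ (Z X Y 2) (dX Z X Y)
  dY : ∀ᵐ Y, ∀ X, (X, Y) ∈ Ω → Rel c (-τ) (Z X Y 2) (dY Z X Y)

theorem RelOn.swap (h : RelOn c τ Z Ω) :
    RelOn c (-τ) (fun X Y => Z Y X) (Prod.swap ⁻¹' Ω) where
  dX := h.dY
  dY := by rw [neg_neg]; exact h.dX

theorem increment_Y_nonneg (hσ : σ ^ 2 = 1) (hZ : IsWave F Z) (hΩ : IsDom β α σ Ω)
    (hr : RelOn c τ Z Ω) {X Y : ℝ} (hm : (X, Y) ∈ Ω) {i : Fin 5} (hi : i = 1 ∨ i = 3) :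
    0 ≤ σ * (Z X Y i - Z X (β X) i) := by
  refine increment_nonneg (z := fun Y => Z X Y i) hσ ((hZ.lip_Y X).coord i)
    (hΩ.vert X Y hm).1 ?_
  filter_upwards [hr.dY, hZ.hasDerivAt_Y] with η h1 h2 hη
  have h3 := h1 X ((hΩ.vert X Y hm).2 η hη)
  rw [(hasDerivAt_pi.1 (h2 X) i).deriv]
  rcases hi with rfl | rfl
  exacts [h3.x_nonneg, h3.J_nonneg]

/-- On each side of the curve the increments of `x` and `J` are controlled by their values on the
curve. -/
theorem increment_Y_le (hσ : σ ^ 2 = 1) (hZ : IsWave F Z) (hΩ : IsDom β α σ Ω)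
    (hr : RelOn c τ Z Ω) {X Y : ℝ} (hm : (X, Y) ∈ Ω) {i : Fin 5} (hi : i = 1 ∨ i = 3) :
    |Z X Y i - Z X (β X) i| ≤ |Z (α Y) Y i - Z X (β X) i| := by
  have h1 := increment_Y_nonneg hσ hZ hΩ hr hm hi
  have h2 := increment_Y_nonneg (Z := fun X Y => Z Y X) (σ := -σ) (by linarith) hZ.swap hΩ.swap
    hr.swap (X := Y) (Y := X) hm hi
  have hσ' : σ = 1 ∨ σ = -1 := mul_self_eq_one_iff.1 (by rwa [← sq])
  rw [abs_le]
  rcases hσ' with rfl | rfl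
  · have := le_abs_self (Z (α Y) Y i - Z X (β X) i)
    constructor <;> linarith
  · have := neg_abs_le (Z (α Y) Y i - Z X (β X) i)
    constructor <;> linarith

end apriori

/-! ### Estimates along one characteristic -/

/-- A segment of a characteristic on which the system, the relations for `P = Z_X` and `Q = Z_Y`
and the bound `|c'(U)| ≤ k` are available; `z` is `Z` itself. -/
structure IsChar (c : ℝ → ℝ) (τ k : ℝ) (P Q z : ℝ → Vec5) (a b : ℝ) : Prop where
  P_lip : LocallyLipschitz P
  z_lip : LocallyLipschitz z
  ae : ∀ᵐ η, η ∈ uIoo a b → HasDerivAt P (bilin c (z η 2) (P η) (Q η)) η ∧ HasDerivAt z (Q η) η ∧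
    Rel c τ (z η 2) (P η) ∧ Rel c (-τ) (z η 2) (Q η) ∧ |deriv c (z η 2)| ≤ k

namespace IsChar

variable {c : ℝ → ℝ} {κ τ k : ℝ} {P Q z : ℝ → Vec5} {a b : ℝ}

theorem symm (h : IsChar c τ k P Q z a b) : IsChar c τ k P Q z b a :=
  ⟨h.P_lip, h.z_lip, by rw [uIoo_comm]; exact h.ae⟩

theorem mono (h : IsChar c τ k P Q z a b) {t : ℝ} (ht : t ∈ uIcc a b) :
    IsChar c τ k P Q z a t :=
  ⟨h.P_lip, h.z_lip, h.ae.mono fun _ hη h' => hη (uIoo_subset_of_mem_uIcc ht h')⟩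

/-- The function `x + J`. -/
abbrev mass (z : ℝ → Vec5) (η : ℝ) : ℝ := z η 1 + z η 3

theorem mass_lip (h : IsChar c τ k P Q z a b) : LocallyLipschitz (mass z) :=
  (h.z_lip.coord 1).add_real (h.z_lip.coord 3)

theorem hasDerivAt_mass {η : ℝ} (h : HasDerivAt z (Q η) η) :
    HasDerivAt (mass z) (Q η 1 + Q η 3) η :=
  (hasDerivAt_pi.1 h 1).add (hasDerivAt_pi.1 h 3)

/-- The sum `p = x_X + J_X` can grow and decay at most exponentially in the increment of `x + J`. -/
theorem pos_part_le (h : IsChar c τ k P Q z a b) (hs : IsSpeed c κ) :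
    P b 1 + P b 3 ≤
      (P a 1 + P a 3) * Real.exp (2 * κ ^ 2 * k * |mass z b - mass z a|) := by
  have hκ := hs.pos_bound
  rcases eq_or_ne a b with rfl | hab
  · simp
  -- the constant `k` is nonnegative because the segment is not trivial
  have hk : 0 ≤ k := by
    by_contra hcon
    have h0 : ∀ᵐ η, η ∉ uIoo a b := h.ae.mono fun η hη hη' =>
      hcon ((abs_nonneg _).trans (hη hη').2.2.2.2)
    have h1 := measure_eq_zero_iff_ae_notMem.2 h0
    rw [Real.volume_uIoo, ENNReal.ofReal_eq_zero] at h1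
    exact hab (by linarith [abs_nonpos_iff.1 h1])
  have h1 := gronwall_ae (g := fun η => P η 1 + P η 3) (m := fun η => 2 * κ ^ 2 * k * mass z η)
    (h := fun _ => 0) (a := a) (b := b) ((h.P_lip.coord 1).add_real (h.P_lip.coord 3))
    (h.mass_lip.const_mul _) (LocallyLipschitz.const 0) (by
      filter_upwards [h.ae] with η hη hη'
      obtain ⟨d1, d2, r1, r2, hkη⟩ := hη hη'
      have hi := hasDerivAt_pi.1 d1
      have dp : HasDerivAt (fun η => P η 1 + P η 3)
          (coef c (z η 2) * (Q η 2 * (P η 1 + P η 3) + P η 2 * (Q η 1 + Q η 3))) η := by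
        convert! (hi 1).add (hi 3) using 1
        simp only [bilin_x, bilin_J]
        ring
      rw [dp.deriv, deriv_const_mul_field, (hasDerivAt_mass d2).deriv, deriv_const]
      have p1 := r1.pos
      have p2 := r2.pos
      refine ⟨?_, by positivity, le_rfl⟩
      have h2 : |Q η 2 * (P η 1 + P η 3) + P η 2 * (Q η 1 + Q η 3)|
          ≤ 2 * κ * ((P η 1 + P η 3) * (Q η 1 + Q η 3)) := by
        refine (abs_add_le _ _).trans ?_
        rw [abs_mul, abs_mul, abs_of_pos p1, abs_of_pos p2]
        have e1 := mul_le_mul_of_nonneg_right (r2.abs_U_le hs) p1.le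
        have e2 := mul_le_mul_of_nonneg_right (r1.abs_U_le hs) p2.le
        linarith
      rw [abs_mul]
      calc _ ≤ κ * k * (2 * κ * ((P η 1 + P η 3) * (Q η 1 + Q η 3))) :=
            mul_le_mul (abs_coef_le hs hkη) h2 (abs_nonneg _) (by positivity)
        _ = _ := by ring)
  rw [← mul_sub, abs_mul, abs_of_nonneg (by positivity : 0 ≤ 2 * κ ^ 2 * k)] at h1
  simpa using h1

/-- The growth of `J_X` along a characteristic, in terms of the increment of `J`. -/
theorem J_part_le (h : IsChar c τ k P Q z a b) (hs : IsSpeed c κ) (hk : 0 ≤ k) {B : ℝ}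
    (hB : ∀ η ∈ uIcc a b, P η 1 + P η 3 ≤ B) :
    P b 3 ≤ (P a 3 + κ ^ 2 * k * |B| * |z b 3 - z a 3|) *
      Real.exp (κ ^ 2 * k * |mass z b - mass z a|) := by
  have hκ := hs.pos_bound
  have h1 := gronwall_ae (g := fun η => P η 3) (m := fun η => κ ^ 2 * k * mass z η)
    (h := fun η => κ ^ 2 * k * |B| * z η 3) (a := a) (b := b) (h.P_lip.coord 3)
    (h.mass_lip.const_mul _) ((h.z_lip.coord 3).const_mul _) (by
      filter_upwards [h.ae] with η hη hη'
      obtain ⟨d1, d2, r1, r2, hkη⟩ := hη hη'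
      have p1 := r1.pos
      have p2 := r2.pos
      have j1 := r1.J_nonneg
      have j2 := r2.J_nonneg
      rw [(hasDerivAt_pi.1 d1 3).deriv, bilin_J, deriv_const_mul_field, deriv_const_mul_field,
        (hasDerivAt_mass d2).deriv, (hasDerivAt_pi.1 d2 3).deriv]
      refine ⟨?_, by positivity, by positivity⟩
      have h2 : |Q η 2 * P η 3 + P η 2 * Q η 3| ≤
          κ * (P η 3 * (Q η 1 + Q η 3)) + κ * (|B| * Q η 3) := by
        refine (abs_add_le _ _).trans ?_
        rw [abs_mul, abs_mul, abs_of_nonneg j1, abs_of_nonneg j2]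
        have e1 := mul_le_mul_of_nonneg_right (r2.abs_U_le hs) j1
        have e2 : |P η 2| ≤ κ * |B| := (r1.abs_U_le hs).trans
          (mul_le_mul_of_nonneg_left ((hB η (uIoo_subset_uIcc_self hη')).trans (le_abs_self B))
            hκ.le)
        have e3 := mul_le_mul_of_nonneg_right e2 j2
        linarith
      rw [abs_mul]
      calc _ ≤ κ * k * (κ * (P η 3 * (Q η 1 + Q η 3)) + κ * (|B| * Q η 3)) :=
            mul_le_mul (abs_coef_le hs hkη) h2 (abs_nonneg _) (by positivity)
        _ = _ := by ring)
  have e1 : |κ ^ 2 * k * |B| * (z b 3 - z a 3)| = κ ^ 2 * k * |B| * |z b 3 - z a 3| := by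
    rw [abs_mul, abs_of_nonneg (by positivity)]
  have e2 : |κ ^ 2 * k * (mass z b - mass z a)| = κ ^ 2 * k * |mass z b - mass z a| := by
    rw [abs_mul, abs_of_nonneg (by positivity)]
  rw [← mul_sub, ← mul_sub, e1, e2] at h1
  exact h1

/-- The variation of `x_X` along a characteristic, in terms of `J`. -/
theorem x_part_sub_le (h : IsChar c τ k P Q z a b) (hs : IsSpeed c κ) (hk : 0 ≤ k) {B j : ℝ}
    (hB : ∀ η ∈ uIcc a b, P η 1 + P η 3 ≤ B) (hj : ∀ η ∈ uIcc a b, P η 3 ≤ j) :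
    |P b 1 - P a 1| ≤ 2 * κ ^ 2 * k * |B| * √(|z b 3 - z a 3| * |mass z b - mass z a|) +
      2 * κ ^ 2 * k * √(|j| * |B|) * |mass z b - mass z a| := by
  have hκ := hs.pos_bound
  have h1 := abs_sub_le_sqrt_of_ae_deriv (a := a) (b := b) (C := 2 * κ ^ 2 * k * |B|)
    (D := 2 * κ ^ 2 * k * √(|j| * |B|))
    (h.P_lip.coord 1) (h.z_lip.coord 3) h.mass_lip (by positivity) (by
    filter_upwards [h.ae] with η hη hη'
    obtain ⟨d1, d2, r1, r2, hkη⟩ := hη hη'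
    have p1 := r1.pos
    have p2 := r2.pos
    have j1 := r1.J_nonneg
    have j2 := r2.J_nonneg
    have x1 := r1.x_nonneg
    have x2 := r2.x_nonneg
    have hη'' := uIoo_subset_uIcc_self hη'
    rw [(hasDerivAt_pi.1 d1 1).deriv, bilin_x, (hasDerivAt_mass d2).deriv,
      (hasDerivAt_pi.1 d2 3).deriv]
    refine ⟨?_, j2, p2.le⟩
    have e0 : ∀ v : ℝ, ∀ s : ℝ, 0 ≤ s → v ^ 2 ≤ 2 * κ ^ 2 * s → |v| ≤ 2 * κ * √s := by
      intro v s hs0 hv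
      refine abs_le_of_sq_le_sq ?_ (by positivity)
      rw [mul_pow, Real.sq_sqrt hs0]
      nlinarith [mul_nonneg (sq_nonneg κ) hs0]
    have e1 : |Q η 2| ≤ 2 * κ * √(Q η 3 * (Q η 1 + Q η 3)) := by
      refine (e0 _ _ (by positivity) (r2.U_sq_le hs)).trans ?_
      gcongr
      linarith
    have e2 : |P η 2| ≤ 2 * κ * √(|j| * |B|) := by
      refine (e0 _ _ (by positivity) (r1.U_sq_le hs)).trans ?_
      have := (hj η hη'').trans (le_abs_self j)
      have h3 : P η 1 ≤ |B| := by linarith [(hB η hη'').trans (le_abs_self B)]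
      gcongr
    have e3 : P η 1 ≤ |B| := by linarith [(hB η hη'').trans (le_abs_self B)]
    have e4 : Q η 1 ≤ Q η 1 + Q η 3 := by linarith
    have h2 : |Q η 2 * P η 1 + P η 2 * Q η 1| ≤
        2 * κ * √(Q η 3 * (Q η 1 + Q η 3)) * |B| + 2 * κ * √(|j| * |B|) * (Q η 1 + Q η 3) := by
      refine (abs_add_le _ _).trans ?_
      rw [abs_mul, abs_mul, abs_of_nonneg x1, abs_of_nonneg x2]
      gcongr
    rw [abs_mul]
    calc _ ≤ κ * k * (2 * κ * √(Q η 3 * (Q η 1 + Q η 3)) * |B|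
            + 2 * κ * √(|j| * |B|) * (Q η 1 + Q η 3)) :=
          mul_le_mul (abs_coef_le hs hkη) h2 (abs_nonneg _) (by positivity)
      _ = _ := by ring)
  rwa [abs_of_nonneg (by positivity : 0 ≤ 2 * κ ^ 2 * k * √(|j| * |B|))] at h1

end IsChar

section strip

variable {c : ℝ → ℝ} {κ : ℝ} {F : Vec5 → Vec5 → Vec5 → Vec5} {Z : ℝ → ℝ → Vec5}
  {Ω : Set (ℝ × ℝ)} {β α : ℝ → ℝ} {σ τ H U₀ k : ℝ}

/-- Bounds for `Z` on the curve: `U` is bounded, and the increments of `x` and `J` between the two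
points of the curve that see a point of `Ω` are bounded. -/
structure CurveBdd (β α : ℝ → ℝ) (Z : ℝ → ℝ → Vec5) (Ω : Set (ℝ × ℝ)) (U₀ H : ℝ) : Prop where
  U_X : ∀ X, |Z X (β X) 2| ≤ U₀
  U_Y : ∀ Y, |Z (α Y) Y 2| ≤ U₀
  inc : ∀ X Y, (X, Y) ∈ Ω → ∀ i : Fin 5, i = 1 ∨ i = 3 → |Z (α Y) Y i - Z X (β X) i| ≤ H

theorem CurveBdd.swap (h : CurveBdd β α Z Ω U₀ H) :
    CurveBdd α β (fun X Y => Z Y X) (Prod.swap ⁻¹' Ω) U₀ H where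
  U_X := h.U_Y
  U_Y := h.U_X
  inc X Y hm i hi := by rw [abs_sub_comm]; exact h.inc Y X hm i hi

theorem mass_inc_le (hσ : σ ^ 2 = 1) (hΩ : IsDom β α σ Ω) (hZ : IsWave F Z)
    (hr : RelOn c τ Z Ω) (hc : CurveBdd β α Z Ω U₀ H) {X Y : ℝ} (hm : (X, Y) ∈ Ω) :
    |IsChar.mass (Z X) Y - IsChar.mass (Z X) (β X)| ≤ 2 * H := by
  have h1 := (increment_Y_le hσ hZ hΩ hr hm (.inl rfl)).trans (hc.inc X Y hm 1 (.inl rfl))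
  have h2 := (increment_Y_le hσ hZ hΩ hr hm (.inr rfl)).trans (hc.inc X Y hm 3 (.inr rfl))
  rw [IsChar.mass, IsChar.mass, add_sub_add_comm]
  exact (abs_add_le _ _).trans (by linarith)

theorem U_le_on_strip (hs : IsSpeed c κ) (hσ : σ ^ 2 = 1) (hΩ : IsDom β α σ Ω) (hZ : IsWave F Z)
    (hr : RelOn c τ Z Ω) (hc : CurveBdd β α Z Ω U₀ H) {X Y : ℝ} (hm : (X, Y) ∈ Ω) :
    |Z X Y 2| ≤ U₀ + κ * (2 * H) := by
  have h1 := abs_sub_le_of_ae_deriv (a := β X) (b := Y) ((hZ.lip_Y X).coord 2)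
    ((((hZ.lip_Y X).coord 1).add_real ((hZ.lip_Y X).coord 3)).const_mul κ) (by
    filter_upwards [hr.dY, hZ.hasDerivAt_Y] with η h1 h2 hη
    have d2 := h2 X
    rw [(hasDerivAt_pi.1 d2 2).deriv, deriv_const_mul_field,
      ((hasDerivAt_pi.1 d2 1).fun_add (hasDerivAt_pi.1 d2 3)).deriv]
    exact (h1 X ((hΩ.vert X Y hm).2 η hη)).abs_U_le hs)
  rw [← mul_sub, abs_mul, abs_of_pos hs.pos_bound] at h1
  have h2 := mul_le_mul_of_nonneg_left (mass_inc_le hσ hΩ hZ hr hc hm) hs.pos_bound.le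
  have h3 := hc.U_X X
  calc |Z X Y 2| = |Z X (β X) 2 + (Z X Y 2 - Z X (β X) 2)| := by congr 1; ring
    _ ≤ |Z X (β X) 2| + |Z X Y 2 - Z X (β X) 2| := abs_add_le _ _
    _ ≤ _ := add_le_add h3 (h1.trans h2)

/-- Almost every vertical segment from the curve to a point of `Ω` is a characteristic on which
the estimates apply. -/
theorem ae_isChar (hs : IsSpeed c κ) (hσ : σ ^ 2 = 1) (hΩ : IsDom β α σ Ω)
    (hZ : SolvesOn c F Z Ω) (hr : RelOn c τ Z Ω) (hc : CurveBdd β α Z Ω U₀ H)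
    (hk : ∀ u, |u| ≤ U₀ + κ * (2 * H) → |deriv c u| ≤ k) :
    ∀ᵐ X, ∀ Y, (X, Y) ∈ Ω → IsChar c τ k (dX Z X) (dY Z X) (Z X) (β X) Y := by
  filter_upwards [hr.dX, hZ.wave.dX_locLip, hZ.wave.eq_YX, hZ.eq_F] with X h1 h4 h5 h6 Y hm
  refine ⟨h4, hZ.wave.lip_Y X, ?_⟩
  filter_upwards [h5, h6, hZ.wave.hasDerivAt_Y, hr.dY] with η h7 h8 h9 h10 hη
  have hm' := (hΩ.vert X Y hm).2 η hη
  rw [h8 hm'] at h7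
  exact ⟨h7, h9 X, h1 η hm', h10 X hm', hk _ (U_le_on_strip hs hσ hΩ hZ.wave hr hc hm')⟩

theorem pos_part_on_strip (hs : IsSpeed c κ) (hσ : σ ^ 2 = 1) (hΩ : IsDom β α σ Ω)
    (hZ : SolvesOn c F Z Ω) (hr : RelOn c τ Z Ω) (hc : CurveBdd β α Z Ω U₀ H) (hk0 : 0 ≤ k)
    (hk : ∀ u, |u| ≤ U₀ + κ * (2 * H) → |deriv c u| ≤ k)
    (hX : ∀ᵐ X, Rel c τ (Z X (β X) 2) (dX Z X (β X))) :
    ∀ᵐ X, ∀ Y, (X, Y) ∈ Ω →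
      dX Z X Y 1 + dX Z X Y 3 ≤
        (dX Z X (β X) 1 + dX Z X (β X) 3) * Real.exp (2 * κ ^ 2 * k * (2 * H)) ∧
      dX Z X (β X) 1 + dX Z X (β X) 3 ≤
        (dX Z X Y 1 + dX Z X Y 3) * Real.exp (2 * κ ^ 2 * k * (2 * H)) := by
  filter_upwards [ae_isChar hs hσ hΩ hZ hr hc hk, hr.dX, hX] with X h1 h2 h3 Y hm
  have h4 := mass_inc_le hσ hΩ hZ.wave hr hc hm
  have h5 : Real.exp (2 * κ ^ 2 * k * |IsChar.mass (Z X) Y - IsChar.mass (Z X) (β X)|) ≤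
      Real.exp (2 * κ ^ 2 * k * (2 * H)) := Real.exp_le_exp.2 (by gcongr)
  refine ⟨((h1 Y hm).pos_part_le hs).trans (mul_le_mul_of_nonneg_left h5 h3.pos.le), ?_⟩
  refine ((h1 Y hm).symm.pos_part_le hs).trans ?_
  rw [abs_sub_comm]
  exact mul_le_mul_of_nonneg_left h5 (h2 Y hm).pos.le

end strip

/-! ### The Goursat problem for a bounded nonlinearity -/

/-- Boundedness on bounded sets. -/
def LocBdd (g : ℝ → Vec5) : Prop := ∀ R : ℝ, ∃ B : ℝ, ∀ x, |x| ≤ R → ‖g x‖ ≤ B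

theorem LocBdd.locallyIntegrable {g : ℝ → Vec5} (h : LocBdd g) (hg : Measurable g) :
    LocallyIntegrable g := by
  rw [locallyIntegrable_iff]
  intro k hk
  obtain ⟨R, hR⟩ := hk.isBounded.subset_closedBall 0
  obtain ⟨B, hB⟩ := h R
  refine Measure.integrableOn_of_bounded (M := B) hk.measure_lt_top.ne hg.aestronglyMeasurable ?_
  refine (ae_restrict_iff' hk.measurableSet).2 (.of_forall fun x hx => hB x ?_)
  simpa using hR hx

theorem LocBdd.intervalIntegrable {g : ℝ → Vec5} (h : LocBdd g) (hg : Measurable g) (a b : ℝ) :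
    IntervalIntegrable g volume a b :=
  ((h.locallyIntegrable hg).integrableOn_isCompact isCompact_uIcc).intervalIntegrable

theorem LocBdd.locallyLipschitz_integral {g : ℝ → Vec5} (h : LocBdd g) (hg : Measurable g)
    (a : ℝ) : LocallyLipschitz fun y => ∫ x in a..y, g x := by
  refine locallyLipschitz_of_Icc fun R => ?_
  obtain ⟨B, hB⟩ := h R
  refine ⟨B.toNNReal, LipschitzOnWith.of_dist_le_mul fun x hx y hy => ?_⟩
  have hi := h.intervalIntegrable hg
  rw [dist_eq_norm, intervalIntegral.integral_interval_sub_left (hi _ _) (hi _ _), Real.dist_eq]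
  refine intervalIntegral.norm_integral_le_of_norm_le_const fun t ht => ?_
  refine (hB t ?_).trans (Real.le_coe_toNNReal B)
  have h1 := uIoc_subset_uIcc ht
  have h2 := uIcc_subset_Icc hy hx h1
  exact abs_le.2 h2

theorem LocBdd.ae_hasDerivAt_integral {g : ℝ → Vec5} (h : LocBdd g) (hg : Measurable g) :
    ∀ᵐ y, ∀ a, HasDerivAt (fun y => ∫ x in a..y, g x) (g y) y :=
  LocallyIntegrable.ae_hasDerivAt_integral (h.locallyIntegrable hg)

/-- The kernel of the oriented integral from `a` to `b`. -/
def orient (a b t : ℝ) : ℝ := (if a < t ∧ t ≤ b then 1 else 0) - if b < t ∧ t ≤ a then 1 else 0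

theorem intervalIntegral_eq_orient {E : Type*} [NormedAddCommGroup E] [NormedSpace ℝ E]
    (g : ℝ → E) (a b : ℝ) : ∫ t in a..b, g t = ∫ t, orient a b t • g t := by
  rcases le_total a b with h | h
  · rw [intervalIntegral.integral_of_le h, ← integral_indicator measurableSet_Ioc]
    congr 1
    ext t
    by_cases h1 : a < t ∧ t ≤ b
    · rw [indicator_of_mem (by exact h1), orient, if_pos h1, if_neg (by grind)]; simp
    · rw [indicator_of_notMem (by exact h1), orient, if_neg h1, if_neg (by grind)]; simp
  · rw [intervalIntegral.integral_of_ge h, ← integral_indicator measurableSet_Ioc, ← integral_neg]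
    congr 1
    ext t
    by_cases h1 : b < t ∧ t ≤ a
    · rw [indicator_of_mem (by exact h1), orient, if_pos h1, if_neg (by grind)]; simp
    · rw [indicator_of_notMem (by exact h1), orient, if_neg h1, if_neg (by grind)]; simp

theorem abs_orient_le (a b t : ℝ) : |orient a b t| ≤ 1 := by
  rw [orient]; split_ifs <;> norm_num

theorem orient_eq_zero {a b t R : ℝ} (ha : |a| ≤ R) (hb : |b| ≤ R) (ht : ¬ |t| ≤ R) :
    orient a b t = 0 := by
  rw [abs_le] at *
  rw [orient, if_neg (fun h => ht ⟨by linarith [h.1], by linarith [h.2]⟩),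
    if_neg (fun h => ht ⟨by linarith [h.1], by linarith [h.2]⟩), sub_zero]

theorem measurable_orient {α : Type*} [MeasurableSpace α] {a b t : α → ℝ} (ha : Measurable a)
    (hb : Measurable b) (ht : Measurable t) : Measurable fun x => orient (a x) (b x) (t x) := by
  unfold NVW.orient
  refine Measurable.sub (Measurable.ite ?_ measurable_const measurable_const)
    (Measurable.ite ?_ measurable_const measurable_const)
  · exact (measurableSet_lt ha ht).inter (measurableSet_le ht hb)
  · exact (measurableSet_lt hb ht).inter (measurableSet_le ht ha)

theorem measurable_intervalIntegral {α : Type*} [MeasurableSpace α] {a b : α → ℝ}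
    (ha : Measurable a) (hb : Measurable b) {g : α × ℝ → Vec5} (hg : Measurable g) :
    Measurable fun x => ∫ t in a x..b x, g (x, t) := by
  simp only [intervalIntegral_eq_orient]
  have h1 : StronglyMeasurable fun p : α × ℝ => orient (a p.1) (b p.1) p.2 • g p :=
    ((measurable_orient (ha.comp measurable_fst) (hb.comp measurable_fst) measurable_snd).smul
      hg).stronglyMeasurable
  exact (h1.integral_prod_right' (ν := volume)).measurable

/-- If `z(X, Y)` is an integral of `p(·, Y)`, and `p` is Lipschitz in `Y`, then for almost every
`X` one has `z_X(X, Y) = p(X, Y)` for all `Y` at once. -/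
theorem ae_forall_hasDerivAt_integral {z p : ℝ → ℝ → Vec5} {ω : ℝ → Vec5} {a : ℝ → ℝ} {B : ℝ≥0}
    (hm : ∀ Y, Measurable fun X => p X Y) (hb : ∀ Y, LocBdd fun X => p X Y)
    (hl : ∀ X, LipschitzWith B (p X))
    (hz : ∀ X Y, z X Y = ω Y + ∫ ξ in a Y..X, p ξ Y) :
    ∀ᵐ X, ∀ Y, HasDerivAt (fun ξ => z ξ Y) (p X Y) X := by
  have h1 : ∀ q : ℚ, ∀ᵐ X, HasDerivAt (fun ξ => z ξ q) (p X q) X := by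
    intro q
    filter_upwards [(hb q).ae_hasDerivAt_integral (hm q)] with X hX
    simp only [hz]
    exact (hX (a q)).const_add _
  have hi : ∀ Y u v, IntervalIntegrable (fun X => p X Y) volume u v := fun Y u v =>
    (hb Y).intervalIntegrable (hm Y) u v
  have hinc : ∀ X X' Y, z X' Y - z X Y = ∫ ξ in X..X', p ξ Y := by
    intro X X' Y
    rw [hz, hz, add_sub_add_left_eq_sub,
      intervalIntegral.integral_interval_sub_left (hi _ _ _) (hi _ _ _)]
  filter_upwards [ae_all_iff.2 h1] with X hX Y
  rw [hasDerivAt_iff_isLittleO, Asymptotics.isLittleO_iff]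
  intro ε hε
  obtain ⟨q, hq⟩ : ∃ q : ℚ, |Y - q| < ε / (4 * (B + 1)) := by
    obtain ⟨q, hq1, hq2⟩ := exists_rat_btwn (lt_add_of_pos_right Y
      (by positivity : 0 < ε / (4 * (B + 1))))
    exact ⟨q, abs_lt.2 ⟨by linarith, by linarith⟩⟩
  have hq' : B * |Y - q| ≤ ε / 4 := by
    rw [lt_div_iff₀ (by positivity)] at hq
    nlinarith [abs_nonneg (Y - q), B.coe_nonneg]
  have h2 := hX q
  rw [hasDerivAt_iff_isLittleO, Asymptotics.isLittleO_iff] at h2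
  filter_upwards [h2 (half_pos hε)] with X' hX'
  have hd : ∀ ξ, ‖p ξ Y - p ξ q‖ ≤ ε / 4 := fun ξ => by
    rw [← dist_eq_norm]
    exact ((hl ξ).dist_le_mul Y q).trans (by rwa [Real.dist_eq])
  have h3 : ‖(∫ ξ in X..X', p ξ Y) - ∫ ξ in X..X', p ξ q‖ ≤ ε / 4 * |X' - X| := by
    rw [← intervalIntegral.integral_sub (hi _ _ _) (hi _ _ _)]
    exact intervalIntegral.norm_integral_le_of_norm_le_const fun ξ _ => hd ξ
  have h4 : ‖(X' - X) • (p X Y - p X q)‖ ≤ ε / 4 * |X' - X| := by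
    rw [norm_smul, mul_comm, Real.norm_eq_abs]
    exact mul_le_mul_of_nonneg_right (hd X) (abs_nonneg _)
  rw [hinc] at hX' ⊢
  rw [Real.norm_eq_abs] at hX' ⊢
  calc _ = ‖((∫ ξ in X..X', p ξ q) - (X' - X) • p X q) +
        (((∫ ξ in X..X', p ξ Y) - ∫ ξ in X..X', p ξ q) - (X' - X) • (p X Y - p X q))‖ := by
        congr 1; rw [smul_sub]; abel
    _ ≤ ε / 2 * |X' - X| + (ε / 4 * |X' - X| + ε / 4 * |X' - X|) :=
        (norm_add_le _ _).trans (add_le_add hX' ((norm_sub_le _ _).trans (add_le_add h3 h4)))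
    _ = _ := by ring

/-- Data on a curve: `V` and `W` are the prescribed values of `Z_X` and `Z_Y`, and `ζ X` and `ω Y`
those of `Z` at `(X, β X)` and at `(α Y, Y)`. That the two descriptions of the curve belong together
is expressed by the Galois connection `gc`. -/
structure IsData (β α : ℝ → ℝ) (V W ζ ω : ℝ → Vec5) (C : ℝ) : Prop where
  gc : ∀ X Y, β X ≤ Y ↔ X ≤ α Y
  near_β : ∀ X, |β X - X| ≤ C
  near_α : ∀ Y, |α Y - Y| ≤ C
  V_meas : Measurable V
  W_meas : Measurable W
  ζ_meas : Measurable ζ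
  V_bdd : ∀ X, ‖V X‖ ≤ C
  W_bdd : ∀ Y, ‖W Y‖ ≤ C
  compat : ∀ X Y, ω Y - ζ X = (∫ x in X..α Y, V x) + ∫ y in β X..Y, W y
  ζ_U : ∀ X, |ζ X 2| ≤ C
  ω_U : ∀ Y, |ω Y 2| ≤ C
  growth : ∀ X Y, ‖ω Y - ζ X‖ ≤ C * (1 + |Y - X|)

namespace IsData

variable {β α : ℝ → ℝ} {V W ζ ω : ℝ → Vec5} {C : ℝ}

theorem nonneg (h : IsData β α V W ζ ω C) : 0 ≤ C := (abs_nonneg _).trans (h.near_β 0)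

theorem gc' (h : IsData β α V W ζ ω C) {X Y : ℝ} : Y < β X ↔ α Y < X := by
  rw [← not_le, ← not_le, h.gc]

theorem mono_β (h : IsData β α V W ζ ω C) : Monotone β := fun _ X' hX =>
  (h.gc _ _).2 (hX.trans ((h.gc X' _).1 le_rfl))

theorem mono_α (h : IsData β α V W ζ ω C) : Monotone α := fun Y _ hY =>
  (h.gc _ _).1 (((h.gc _ Y).2 le_rfl).trans hY)

end IsData

/-- The points on the side `σ` of the curve. -/
def side (β : ℝ → ℝ) (σ : ℝ) : Set (ℝ × ℝ) :=
  {p | (σ = 1 ∧ β p.1 ≤ p.2) ∨ (σ = -1 ∧ p.2 < β p.1)}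

theorem exists_side (β : ℝ → ℝ) (X Y : ℝ) : ∃ σ : ℝ, σ ^ 2 = 1 ∧ (X, Y) ∈ side β σ := by
  rcases le_or_gt (β X) Y with h | h
  · exact ⟨1, by norm_num, .inl ⟨rfl, h⟩⟩
  · exact ⟨-1, by norm_num, .inr ⟨rfl, h⟩⟩

theorem IsData.isDom {β α : ℝ → ℝ} {V W ζ ω : ℝ → Vec5} {C : ℝ} (h : IsData β α V W ζ ω C)
    (σ : ℝ) : IsDom β α σ (side β σ) where
  vert X Y hm := by
    rcases hm with ⟨rfl, hm⟩ | ⟨rfl, hm⟩ <;> simp only at hm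
    · refine ⟨by linarith, fun η hη => .inl ⟨rfl, ?_⟩⟩
      rw [uIoo_of_le hm] at hη
      exact hη.1.le
    · refine ⟨by linarith, fun η hη => .inr ⟨rfl, ?_⟩⟩
      rw [uIoo_of_ge hm.le] at hη
      exact hη.2
  horiz X Y hm := by
    rcases hm with ⟨rfl, hm⟩ | ⟨rfl, hm⟩ <;> simp only at hm
    · rw [h.gc] at hm
      refine ⟨by linarith, fun ξ hξ => .inl ⟨rfl, ?_⟩⟩
      rw [uIoo_of_ge hm] at hξ
      exact (h.gc _ _).2 hξ.2.le
    · rw [h.gc'] at hm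
      refine ⟨by linarith, fun ξ hξ => .inr ⟨rfl, ?_⟩⟩
      rw [uIoo_of_le hm.le] at hξ
      exact h.gc'.2 hξ.1

theorem IsData.near_side {β α : ℝ → ℝ} {V W ζ ω : ℝ → Vec5} {C : ℝ} (h : IsData β α V W ζ ω C)
    {σ X Y : ℝ} (hm : (X, Y) ∈ side β σ) : -C ≤ σ * (Y - X) := by
  have h1 := abs_le.1 (h.near_β X)
  rcases hm with ⟨rfl, hm⟩ | ⟨rfl, hm⟩ <;> simp only at hm <;> linarith

section picard

variable {β α : ℝ → ℝ} {V W ζ ω : ℝ → Vec5} {C : ℝ} {f g : ℝ × ℝ → Vec5} {B : ℝ}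

/-- The candidate for `Z_X`, given the candidate `f` for the mixed derivative. -/
def fieldP (β : ℝ → ℝ) (V : ℝ → Vec5) (f : ℝ × ℝ → Vec5) (X Y : ℝ) : Vec5 :=
  V X + ∫ η in β X..Y, f (X, η)

/-- The candidate for `Z_Y`, given the candidate `f` for the mixed derivative. -/
def fieldQ (α : ℝ → ℝ) (W : ℝ → Vec5) (f : ℝ × ℝ → Vec5) (X Y : ℝ) : Vec5 :=
  W Y + ∫ ξ in α Y..X, f (ξ, Y)

/-- The candidate for `Z`, given the candidate `f` for the mixed derivative. -/
def fieldZ (β α : ℝ → ℝ) (W ζ : ℝ → Vec5) (f : ℝ × ℝ → Vec5) (X Y : ℝ) : Vec5 :=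
  ζ X + ∫ η in β X..Y, fieldQ α W f X η

theorem locBdd_of_le {g : ℝ → Vec5} (h : ∀ x, ‖g x‖ ≤ B) : LocBdd g := fun _ => ⟨B, fun x _ => h x⟩

theorem measurable_fieldP (hβ : Measurable β) (hV : Measurable V) (hf : Measurable f) :
    Measurable fun p : ℝ × ℝ => fieldP β V f p.1 p.2 := by
  refine (hV.comp measurable_fst).add (measurable_intervalIntegral (α := ℝ × ℝ)
    (g := fun q => f (q.1.1, q.2)) (hβ.comp measurable_fst) measurable_snd ?_)
  exact hf.comp (by fun_prop)

theorem measurable_fieldQ (hα : Measurable α) (hW : Measurable W) (hf : Measurable f) :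
    Measurable fun p : ℝ × ℝ => fieldQ α W f p.1 p.2 := by
  refine (hW.comp measurable_snd).add (measurable_intervalIntegral (α := ℝ × ℝ)
    (g := fun q => f (q.2, q.1.2)) (hα.comp measurable_snd) measurable_fst ?_)
  exact hf.comp (by fun_prop)

theorem measurable_fieldZ (hβ : Measurable β) (hα : Measurable α) (hW : Measurable W)
    (hζ : Measurable ζ) (hf : Measurable f) :
    Measurable fun p : ℝ × ℝ => fieldZ β α W ζ f p.1 p.2 := by
  refine (hζ.comp measurable_fst).add (measurable_intervalIntegral (α := ℝ × ℝ)
    (g := fun q => fieldQ α W f q.1.1 q.2) (hβ.comp measurable_fst) measurable_snd ?_)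
  exact (measurable_fieldQ hα hW hf).comp (f := fun q : (ℝ × ℝ) × ℝ => (q.1.1, q.2)) (by fun_prop)

theorem norm_integral_sub_le {g : ℝ → Vec5} (h : ∀ x, ‖g x‖ ≤ B) (a b : ℝ) :
    ‖∫ x in a..b, g x‖ ≤ B * |b - a| :=
  intervalIntegral.norm_integral_le_of_norm_le_const fun x _ => h x

/-- An integral along a segment that leaves the curve, in the weighted norm. -/
theorem norm_integral_le_exp {g : ℝ → Vec5} (hg : Measurable g) (hb : LocBdd g)
    {σ b y x A l : ℝ} (hσ : σ ^ 2 = 1) (hA : 0 ≤ A) (hl : 0 < l) (hy : 0 ≤ σ * (y - b))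
    (h : ∀ η ∈ uIoo b y, ‖g η‖ ≤ A * Real.exp (l * (σ * (η - x)))) :
    ‖∫ η in b..y, g η‖ ≤ A / l * Real.exp (l * (σ * (y - x))) := by
  refine norm_le_of_deriv_le_exp (g := fun y => ∫ η in b..y, g η)
    (hb.locallyLipschitz_integral hg b) hσ hA hl hy intervalIntegral.integral_same ?_
  filter_upwards [hb.ae_hasDerivAt_integral hg] with η h1 h2
  exact ⟨g η, h1 b, h η h2⟩

theorem norm_fieldP_le (hd : IsData β α V W ζ ω C)
    (hB : 0 ≤ B) (hb : ∀ p, ‖f p‖ ≤ B) (X Y : ℝ) :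
    ‖fieldP β V f X Y‖ ≤ C + B * (|Y - X| + C) := by
  refine (norm_add_le _ _).trans (add_le_add (hd.V_bdd X) ?_)
  refine (norm_integral_sub_le (fun x => hb (X, x)) _ _).trans (mul_le_mul_of_nonneg_left ?_ hB)
  calc |Y - β X| = |(Y - X) - (β X - X)| := by congr 1; ring
    _ ≤ |Y - X| + |β X - X| := abs_sub _ _
    _ ≤ _ := by gcongr; exact hd.near_β X

theorem norm_fieldQ_le (hd : IsData β α V W ζ ω C)
    (hB : 0 ≤ B) (hb : ∀ p, ‖f p‖ ≤ B) (X Y : ℝ) :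
    ‖fieldQ α W f X Y‖ ≤ C + B * (|Y - X| + C) := by
  refine (norm_add_le _ _).trans (add_le_add (hd.W_bdd Y) ?_)
  refine (norm_integral_sub_le (fun x => hb (x, Y)) _ _).trans (mul_le_mul_of_nonneg_left ?_ hB)
  calc |X - α Y| = |(X - Y) - (α Y - Y)| := by congr 1; ring
    _ ≤ |X - Y| + |α Y - Y| := abs_sub _ _
    _ ≤ _ := by rw [abs_sub_comm X Y]; gcongr; exact hd.near_α Y

theorem locBdd_fieldP (hd : IsData β α V W ζ ω C)
    (hB : 0 ≤ B) (hb : ∀ p, ‖f p‖ ≤ B) (Y : ℝ) :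
    LocBdd fun X => fieldP β V f X Y := fun R => ⟨C + B * (|Y| + R + C), fun x hx =>
  (norm_fieldP_le hd hB hb x Y).trans (by gcongr; exact (abs_sub _ _).trans (by gcongr))⟩

theorem locBdd_fieldQ (hd : IsData β α V W ζ ω C)
    (hB : 0 ≤ B) (hb : ∀ p, ‖f p‖ ≤ B) (X : ℝ) :
    LocBdd fun Y => fieldQ α W f X Y := fun R => ⟨C + B * (R + |X| + C), fun x hx =>
  (norm_fieldQ_le hd hB hb X x).trans (by gcongr; exact (abs_sub _ _).trans (by gcongr))⟩

theorem measurable_fieldP_left (hd : IsData β α V W ζ ω C)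
    (hf : Measurable f) (Y : ℝ) :
    Measurable fun X => fieldP β V f X Y :=
  (measurable_fieldP hd.mono_β.measurable hd.V_meas hf).comp (f := fun X => (X, Y)) (by fun_prop)

theorem measurable_fieldQ_right (hd : IsData β α V W ζ ω C)
    (hf : Measurable f) (X : ℝ) :
    Measurable fun Y => fieldQ α W f X Y :=
  (measurable_fieldQ hd.mono_α.measurable hd.W_meas hf).comp (f := fun Y => (X, Y)) (by fun_prop)

theorem intervalIntegrable_right (hf : Measurable f) (hb : ∀ p, ‖f p‖ ≤ B) (X a b : ℝ) :
    IntervalIntegrable (fun η => f (X, η)) volume a b :=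
  (locBdd_of_le fun η => hb (X, η)).intervalIntegrable (hf.comp (by fun_prop)) a b

theorem intervalIntegrable_left (hf : Measurable f) (hb : ∀ p, ‖f p‖ ≤ B) (Y a b : ℝ) :
    IntervalIntegrable (fun ξ => f (ξ, Y)) volume a b :=
  (locBdd_of_le fun ξ => hb (ξ, Y)).intervalIntegrable (hf.comp (by fun_prop)) a b

/-- The orientation kernels of the two iterated integrals agree off a null set. -/
theorem IsData.orient_mul_orient (hd : IsData β α V W ζ ω C)
    {X Y ξ η : ℝ} (h1 : η ≠ β ξ) (h2 : η ≠ β X) :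
    orient (β X) Y η * orient (α η) X ξ = orient (α Y) X ξ * orient (β ξ) Y η := by
  have m1 := fun h => hd.mono_β (a := ξ) (b := X) h
  have m2 := fun h => hd.mono_β (a := X) (b := ξ) h
  simp only [orient, ← hd.gc, ← hd.gc']
  generalize β X = b at *
  generalize β ξ = b' at *
  rcases le_or_gt ξ X with h | h
  · have m := m1 h
    rw [if_neg (c := X < ξ ∧ b' ≤ η) (fun hh => absurd hh.1 (not_lt.2 h)),
      if_neg (c := X < ξ ∧ b' ≤ Y) (fun hh => absurd hh.1 (not_lt.2 h))]
    simp only [h, and_true, sub_zero]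
    clear m1 m2
    split_ifs <;> first | (exfalso; grind) | norm_num
  · have m := m2 h.le
    rw [if_neg (c := η < b' ∧ ξ ≤ X) (fun hh => absurd hh.2 (not_le.2 h)),
      if_neg (c := Y < b' ∧ ξ ≤ X) (fun hh => absurd hh.2 (not_le.2 h))]
    simp only [h, true_and, zero_sub]
    clear m1 m2
    split_ifs <;> first | (exfalso; grind) | norm_num

/-- Fubini's theorem for the region between the curve and the point `(X, Y)`, with the signs that
belong to its position relative to the curve. -/
theorem integral_swap_orient (hd : IsData β α V W ζ ω C)
    (hf : Measurable f) (hb : ∀ p, ‖f p‖ ≤ B) (X Y : ℝ) :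
    ∫ η in β X..Y, ∫ ξ in α η..X, f (ξ, η) = ∫ ξ in α Y..X, ∫ η in β ξ..Y, f (ξ, η) := by
  have hC := hd.nonneg
  simp only [intervalIntegral_eq_orient, ← integral_smul]
  rw [integral_integral_swap]
  · refine integral_congr_ae (.of_forall fun ξ => integral_congr_ae ?_)
    have e1 : ∀ x : ℝ, ∀ᵐ η : ℝ, η ≠ x := fun x => by
      simp [ae_iff]
    filter_upwards [e1 (β ξ), e1 (β X)] with η h1 h2
    simp only [smul_smul]
    rw [hd.orient_mul_orient h1 h2]
  -- integrability: the integrand is bounded and supported in a square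
  · set R : ℝ := |X| + |Y| + 2 * C with hR
    have hm : Measurable (Function.uncurry fun η ξ =>
        orient (β X) Y η • orient (α η) X ξ • f (ξ, η)) := by
      have m1 := measurable_orient (a := fun _ : ℝ × ℝ => β X) (b := fun _ => Y) (t := fun p => p.1)
        measurable_const measurable_const measurable_fst
      have m2 := measurable_orient (a := fun p : ℝ × ℝ => α p.1) (b := fun _ => X)
        (t := fun p => p.2) (hd.mono_α.measurable.comp measurable_fst) measurable_const
          measurable_snd
      exact m1.smul (m2.smul (hf.comp measurable_swap))
    have hs : ∀ p : ℝ × ℝ, p ∉ Icc (-(R + C)) (R + C) ×ˢ Icc (-(R + C)) (R + C) →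
        (Function.uncurry fun η ξ => orient (β X) Y η • orient (α η) X ξ • f (ξ, η)) p = 0 := by
      rintro ⟨η, ξ⟩ hp
      simp only [Function.uncurry]
      have b1 : |β X| ≤ R := by
        have := abs_sub_abs_le_abs_sub (β X) X
        have := hd.near_β X
        linarith [abs_nonneg Y]
      have b2 : |Y| ≤ R := by linarith [abs_nonneg X]
      by_cases h1 : |η| ≤ R
      · have b3 : |α η| ≤ R + C := by
          have := abs_sub_abs_le_abs_sub (α η) η
          have := hd.near_α η
          linarith
        have b4 : |X| ≤ R + C := by linarith [abs_nonneg Y]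
        have h2 : ¬ |ξ| ≤ R + C := fun h2 => hp ⟨abs_le.1 (h1.trans (by linarith)), abs_le.1 h2⟩
        rw [orient_eq_zero b3 b4 h2, zero_smul, smul_zero]
      · rw [orient_eq_zero b1 b2 h1, zero_smul]
    rw [← integrableOn_iff_integrable_of_support_subset (s := Icc (-(R + C)) (R + C) ×ˢ
      Icc (-(R + C)) (R + C)) (fun p hp => by_contra fun h => hp (hs p h))]
    refine Measure.integrableOn_of_bounded (M := B) ?_ hm.aestronglyMeasurable
      (.of_forall fun p => ?_)
    · exact (isCompact_Icc.prod isCompact_Icc).measure_lt_top.ne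
    · simp only [Function.uncurry, norm_smul, Real.norm_eq_abs]
      calc _ ≤ 1 * (1 * B) := by
            gcongr
            · exact abs_orient_le _ _ _
            · exact abs_orient_le _ _ _
            · exact hb _
        _ = B := by ring

/-- Integrating first in `X` or first in `Y` gives the same field. -/
theorem fieldZ_eq (hd : IsData β α V W ζ ω C)
    (hf : Measurable f) (hB : 0 ≤ B) (hb : ∀ p, ‖f p‖ ≤ B) (X Y : ℝ) :
    fieldZ β α W ζ f X Y = ω Y + ∫ ξ in α Y..X, fieldP β V f ξ Y := by
  have iW : ∀ a b, IntervalIntegrable W volume a b :=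
    (locBdd_of_le hd.W_bdd).intervalIntegrable hd.W_meas
  have iV : ∀ a b, IntervalIntegrable V volume a b :=
    (locBdd_of_le hd.V_bdd).intervalIntegrable hd.V_meas
  have iQ := ((locBdd_fieldQ hd hB hb X).intervalIntegrable (measurable_fieldQ_right hd hf X)
    (β X) Y).sub (iW _ _)
  have iP := ((locBdd_fieldP hd hB hb Y).intervalIntegrable (measurable_fieldP_left hd hf Y)
    (α Y) X).sub (iV _ _)
  have e1 : (fun η => fieldQ α W f X η - W η) = fun η => ∫ ξ in α η..X, f (ξ, η) := by
    ext1 η; simp [fieldQ]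
  have e2 : (fun ξ => fieldP β V f ξ Y - V ξ) = fun ξ => ∫ η in β ξ..Y, f (ξ, η) := by
    ext1 η; simp [fieldP]
  rw [e1] at iQ
  rw [e2] at iP
  unfold fieldZ
  simp only [fieldQ, fieldP]
  rw [intervalIntegral.integral_add (iW _ _) iQ, intervalIntegral.integral_add (iV _ _) iP,
    integral_swap_orient hd hf hb, ← add_assoc, ← add_assoc]
  congr 1
  have h1 := hd.compat X Y
  rw [intervalIntegral.integral_symm] at h1
  rw [sub_eq_iff_eq_add] at h1
  rw [h1]; abel

end picard

section fixedPoint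

variable {β α : ℝ → ℝ} {V W ζ ω : ℝ → Vec5} {C B K : ℝ} {F : Vec5 → Vec5 → Vec5 → Vec5}

/-- A bounded nonlinearity that is globally Lipschitz. -/
structure IsTame (F : Vec5 → Vec5 → Vec5 → Vec5) (B K : ℝ) : Prop where
  bdd : ∀ z v w, ‖F z v w‖ ≤ B
  lip : ∀ z v w z' v' w', ‖F z v w - F z' v' w'‖ ≤ K * (‖z - z'‖ + ‖v - v'‖ + ‖w - w'‖)

theorem IsTame.bound_nonneg (hF : IsTame F B K) : 0 ≤ B := (norm_nonneg _).trans (hF.bdd 0 0 0)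

theorem IsTame.lip_nonneg (hF : IsTame F B K) : 0 ≤ K := by
  have h := hF.lip (fun _ => 1) 0 0 0 0 0
  have h1 : (0 : ℝ) < ‖(fun _ => 1 : Vec5) - 0‖ := by
    rw [sub_zero, norm_pos_iff]
    exact fun h => one_ne_zero (congrFun h 0)
  rw [sub_self, norm_zero, add_zero, add_zero] at h
  exact nonneg_of_mul_nonneg_left ((norm_nonneg _).trans h) h1

theorem IsTame.continuous (hF : IsTame F B K) :
    Continuous fun p : Vec5 × Vec5 × Vec5 => F p.1 p.2.1 p.2.2 := by
  refine (LipschitzWith.of_dist_le_mul (K := (3 * K).toNNReal) fun p q => ?_).continuous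
  rw [dist_eq_norm, dist_eq_norm, Real.coe_toNNReal _ (by have := hF.lip_nonneg; positivity)]
  refine (hF.lip _ _ _ _ _ _).trans ?_
  have h1 := norm_fst_le (p - q)
  have h2 := (norm_fst_le (p - q).2).trans (norm_snd_le (p - q))
  have h3 := (norm_snd_le (p - q).2).trans (norm_snd_le (p - q))
  simp only [Prod.fst_sub, Prod.snd_sub] at h1 h2 h3
  nlinarith [hF.lip_nonneg]

/-- One step of the Picard iteration. -/
def picard (β α : ℝ → ℝ) (V W ζ : ℝ → Vec5) (F : Vec5 → Vec5 → Vec5 → Vec5) (f : ℝ × ℝ → Vec5)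
    (p : ℝ × ℝ) : Vec5 :=
  F (fieldZ β α W ζ f p.1 p.2) (fieldP β V f p.1 p.2) (fieldQ α W f p.1 p.2)

theorem measurable_picard (hd : IsData β α V W ζ ω C) (hF : IsTame F B K) {f : ℝ × ℝ → Vec5}
    (hf : Measurable f) : Measurable (picard β α V W ζ F f) :=
  hF.continuous.measurable.comp <|
    (measurable_fieldZ hd.mono_β.measurable hd.mono_α.measurable hd.W_meas hd.ζ_meas hf).prodMk <|
      (measurable_fieldP hd.mono_β.measurable hd.V_meas hf).prodMk
        (measurable_fieldQ hd.mono_α.measurable hd.W_meas hf)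

/-- The Picard step halves the weighted distance. -/
theorem picard_contracts (hd : IsData β α V W ζ ω C) (hF : IsTame F B K) {f g : ℝ × ℝ → Vec5}
    (hf : Measurable f) (hg : Measurable g) (hfb : ∀ p, ‖f p‖ ≤ B) (hgb : ∀ p, ‖g p‖ ≤ B)
    {σ A : ℝ} (hσ : σ ^ 2 = 1) (hA : 0 ≤ A)
    (h : ∀ X Y, (X, Y) ∈ side β σ →
      ‖f (X, Y) - g (X, Y)‖ ≤ A * Real.exp ((6 * K + 2) * (σ * (Y - X)))) {X Y : ℝ}
    (hm : (X, Y) ∈ side β σ) :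
    ‖picard β α V W ζ F f (X, Y) - picard β α V W ζ F g (X, Y)‖ ≤
      A / 2 * Real.exp ((6 * K + 2) * (σ * (Y - X))) := by
  have hK := hF.lip_nonneg
  have hB := hF.bound_nonneg
  have hΩ := hd.isDom σ
  set l : ℝ := 6 * K + 2 with hl
  have hl0 : 0 < l := by linarith
  have hdm : Measurable fun p => f p - g p := hf.sub hg
  have hdb : ∀ p, ‖f p - g p‖ ≤ B + B := fun p =>
    (norm_sub_le _ _).trans (add_le_add (hfb p) (hgb p))
  have hP : ∀ X Y, (X, Y) ∈ side β σ → ‖fieldP β V f X Y - fieldP β V g X Y‖ ≤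
      A / l * Real.exp (l * (σ * (Y - X))) := by
    intro X Y hm
    rw [fieldP, fieldP, add_sub_add_left_eq_sub, ← intervalIntegral.integral_sub
      (intervalIntegrable_right hf hfb _ _ _) (intervalIntegrable_right hg hgb _ _ _)]
    refine norm_integral_le_exp (g := fun η => f (X, η) - g (X, η)) (hdm.comp (by fun_prop))
      (locBdd_of_le fun η => hdb _) hσ hA hl0 (hΩ.vert X Y hm).1 fun η hη => ?_
    exact h X η ((hΩ.vert X Y hm).2 η hη)
  have hQ : ∀ X Y, (X, Y) ∈ side β σ → ‖fieldQ α W f X Y - fieldQ α W g X Y‖ ≤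
      A / l * Real.exp (l * (σ * (Y - X))) := by
    intro X Y hm
    rw [fieldQ, fieldQ, add_sub_add_left_eq_sub, ← intervalIntegral.integral_sub
      (intervalIntegrable_left hf hfb _ _ _) (intervalIntegrable_left hg hgb _ _ _)]
    have := norm_integral_le_exp (g := fun ξ => f (ξ, Y) - g (ξ, Y)) (b := α Y) (y := X) (x := Y)
      (σ := -σ) (A := A) (l := l) (hdm.comp (by fun_prop))
      (locBdd_of_le fun η => hdb _) (by linarith) hA hl0 (by linarith [(hΩ.horiz X Y hm).1])
      fun ξ hξ => by
        refine (h ξ Y ((hΩ.horiz X Y hm).2 ξ hξ)).trans_eq ?_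
        ring_nf
    refine this.trans_eq ?_
    ring_nf
  have hZ : ‖fieldZ β α W ζ f X Y - fieldZ β α W ζ g X Y‖ ≤
      A / l / l * Real.exp (l * (σ * (Y - X))) := by
    have m1 := measurable_fieldQ_right hd hf X
    have m2 := measurable_fieldQ_right hd hg X
    have b1 := locBdd_fieldQ hd hB hfb X
    have b2 := locBdd_fieldQ hd hB hgb X
    rw [fieldZ, fieldZ, add_sub_add_left_eq_sub, ← intervalIntegral.integral_sub
      (b1.intervalIntegrable m1 _ _) (b2.intervalIntegrable m2 _ _)]
    refine norm_integral_le_exp (m1.sub m2) (fun R => ?_) hσ (by positivity) hl0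
      (hΩ.vert X Y hm).1 fun η hη => hQ X η ((hΩ.vert X Y hm).2 η hη)
    obtain ⟨B1, h1⟩ := b1 R
    obtain ⟨B2, h2⟩ := b2 R
    exact ⟨B1 + B2, fun x hx => (norm_sub_le _ _).trans (add_le_add (h1 x hx) (h2 x hx))⟩
  have hle : A / l / l ≤ A / l := div_le_self (by positivity) (by linarith)
  have hle2 : K * (A / l + A / l + A / l) ≤ A / 2 := by
    have : K * (A / l + A / l + A / l) = 3 * K * A / l := by ring
    rw [this, div_le_div_iff₀ hl0 two_pos]
    nlinarith
  refine (hF.lip _ _ _ _ _ _).trans ?_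
  calc _ ≤ K * (A / l * Real.exp (l * (σ * (Y - X))) + A / l * Real.exp (l * (σ * (Y - X))) +
        A / l * Real.exp (l * (σ * (Y - X)))) := by
        gcongr
        · exact hZ.trans (mul_le_mul_of_nonneg_right hle (Real.exp_pos _).le)
        · exact hP X Y hm
        · exact hQ X Y hm
    _ = K * (A / l + A / l + A / l) * Real.exp (l * (σ * (Y - X))) := by ring
    _ ≤ _ := mul_le_mul_of_nonneg_right hle2 (Real.exp_pos _).le

/-- The Picard iterates converge at every point, geometrically with respect to the weight
`exp (l σ (Y - X))` on either side of the curve; the limit is a fixed point. -/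
theorem exists_picard_fixed (hd : IsData β α V W ζ ω C) (hF : IsTame F B K) :
    ∃ f : ℝ × ℝ → Vec5, Measurable f ∧ (∀ p, ‖f p‖ ≤ B) ∧ picard β α V W ζ F f = f := by
  have hK := hF.lip_nonneg
  have hB := hF.bound_nonneg
  have hC := hd.nonneg
  let Φ := picard β α V W ζ F
  let u : ℕ → ℝ × ℝ → Vec5 := fun n => Φ^[n] 0
  have hu : ∀ n, u (n + 1) = Φ (u n) := fun n => Function.iterate_succ_apply' Φ n 0
  have hm : ∀ n, Measurable (u n) := by
    intro n
    induction n with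
    | zero => exact measurable_const
    | succ n ih => rw [hu]; exact measurable_picard hd hF ih
  have hb : ∀ n p, ‖u n p‖ ≤ B := by
    intro n p
    cases n with
    | zero => exact norm_zero.le.trans hB
    | succ n => rw [hu]; exact hF.bdd _ _ _
  set l : ℝ := 6 * K + 2 with hl
  set A : ℝ := B * Real.exp (l * C) with hA
  -- on a side of the curve the weight is at least `exp (-l C)`, which starts the induction
  have hstep : ∀ (σ : ℝ), σ ^ 2 = 1 → ∀ n X Y, (X, Y) ∈ side β σ →
      ‖u n (X, Y) - u (n + 1) (X, Y)‖ ≤ A / 2 ^ n * Real.exp (l * (σ * (Y - X))) := by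
    intro σ hσ n
    induction n with
    | zero =>
      intro X Y hXY
      have h1 : u 0 (X, Y) = 0 := rfl
      rw [h1, zero_sub, norm_neg, pow_zero, div_one, hA, mul_assoc, ← Real.exp_add]
      refine (hb 1 _).trans (le_mul_of_one_le_right hB (Real.one_le_exp ?_))
      nlinarith [hd.near_side hXY]
    | succ n ih =>
      intro X Y hXY
      rw [hu (n + 1), hu n, pow_succ, ← div_div]
      exact picard_contracts hd hF (hm n) (by rw [← hu]; exact hm (n + 1)) (hb n)
        (by rw [← hu]; exact hb (n + 1)) hσ (by positivity)
        (by rw [← hu]; exact ih) hXY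
  have hex : ∀ p : ℝ × ℝ, ∃ y, Tendsto (fun n => u n p) atTop (𝓝 y) := by
    rintro ⟨X, Y⟩
    obtain ⟨σ, hσ, hXY⟩ := exists_side β X Y
    refine cauchySeq_tendsto_of_complete (cauchySeq_of_le_geometric_two
      (C := 2 * (A * Real.exp (l * (σ * (Y - X))))) fun n => ?_)
    rw [dist_eq_norm]
    refine (hstep σ hσ n X Y hXY).trans_eq ?_
    ring
  choose f hf using hex
  have hfm : Measurable f := measurable_of_tendsto_metrizable hm (tendsto_pi_nhds.2 hf)
  have hfb : ∀ p, ‖f p‖ ≤ B := fun p => le_of_tendsto (hf p).norm (.of_forall fun n => hb n p)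
  have herr : ∀ (σ : ℝ), σ ^ 2 = 1 → ∀ n X Y, (X, Y) ∈ side β σ →
      ‖u n (X, Y) - f (X, Y)‖ ≤ 2 * A / 2 ^ n * Real.exp (l * (σ * (Y - X))) := by
    intro σ hσ n X Y hXY
    have := dist_le_of_le_geometric_two_of_tendsto
      (C := 2 * (A * Real.exp (l * (σ * (Y - X))))) (f := fun n => u n (X, Y))
      (fun n => by
        rw [dist_eq_norm]
        refine (hstep σ hσ n X Y hXY).trans_eq ?_
        ring) (hf (X, Y)) n
    rw [dist_eq_norm] at this
    refine this.trans_eq ?_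
    ring
  refine ⟨f, hfm, hfb, funext fun p => ?_⟩
  obtain ⟨X, Y⟩ := p
  obtain ⟨σ, hσ, hXY⟩ := exists_side β X Y
  refine (tendsto_nhds_unique ((tendsto_add_atTop_iff_nat 1).2 (hf (X, Y))) ?_).symm
  rw [tendsto_iff_norm_sub_tendsto_zero]
  have hlim : Tendsto (fun n : ℕ => A * Real.exp (l * (σ * (Y - X))) * (1 / 2 : ℝ) ^ n) atTop
      (𝓝 (A * Real.exp (l * (σ * (Y - X))) * 0)) :=
    (tendsto_pow_atTop_nhds_zero_of_lt_one (by norm_num) (by norm_num)).const_mul _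
  rw [mul_zero] at hlim
  refine squeeze_zero (fun n => norm_nonneg _) (fun n => ?_) hlim
  rw [hu]
  refine (picard_contracts hd hF (hm n) hfm (hb n) hfb hσ (by positivity) (herr σ hσ n)
    hXY).trans_eq ?_
  rw [one_div, inv_pow]
  ring

/-- The Goursat problem for a tame nonlinearity. -/
theorem exists_wave (hd : IsData β α V W ζ ω C) (hF : IsTame F B K) :
    ∃ Z : ℝ → ℝ → Vec5, IsWave F Z ∧ (∀ X, Z X (β X) = ζ X) ∧ (∀ Y, Z (α Y) Y = ω Y) ∧
      (∀ᵐ X, dX Z X (β X) = V X) ∧ (∀ᵐ Y, dY Z (α Y) Y = W Y) ∧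
      (∀ᵐ X, LipschitzWith B.toNNReal (dX Z X)) ∧
      ∀ᵐ Y, LipschitzWith B.toNNReal fun X => dY Z X Y := by
  obtain ⟨f, hf, hb, hfix⟩ := exists_picard_fixed hd hF
  have hB := hF.bound_nonneg
  have hC := hd.nonneg
  set P := fieldP β V f with hP
  set Q := fieldQ α W f with hQ
  set Z := fieldZ β α W ζ f with hZ
  have hZ' : ∀ X Y, Z X Y = ω Y + ∫ ξ in α Y..X, P ξ Y := fieldZ_eq hd hf hB hb
  have Pl : ∀ X, LipschitzWith B.toNNReal (P X) := fun X =>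
    LipschitzWith.of_dist_le_mul fun y y' => by
      rw [dist_eq_norm, hP, fieldP, fieldP, add_sub_add_left_eq_sub,
        intervalIntegral.integral_interval_sub_left (intervalIntegrable_right hf hb _ _ _)
        (intervalIntegrable_right hf hb _ _ _), Real.coe_toNNReal _ hB, Real.dist_eq]
      exact norm_integral_sub_le (fun η => hb (X, η)) _ _
  have Ql : ∀ Y, LipschitzWith B.toNNReal fun X => Q X Y := fun Y =>
    LipschitzWith.of_dist_le_mul fun y y' => by
      rw [dist_eq_norm, hQ, fieldQ, fieldQ, add_sub_add_left_eq_sub,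
        intervalIntegral.integral_interval_sub_left (intervalIntegrable_left hf hb _ _ _)
        (intervalIntegrable_left hf hb _ _ _), Real.coe_toNNReal _ hB, Real.dist_eq]
      exact norm_integral_sub_le (fun η => hb (η, Y)) _ _
  have dP : ∀ᵐ X, ∀ Y, HasDerivAt (fun ξ => Z ξ Y) (P X Y) X :=
    ae_forall_hasDerivAt_integral (measurable_fieldP_left hd hf) (locBdd_fieldP hd hB hb) Pl hZ'
  have dQ : ∀ᵐ Y, ∀ X, HasDerivAt (Z X) (Q X Y) Y :=
    ae_forall_hasDerivAt_integral (z := fun Y X => Z X Y) (p := fun Y X => Q X Y) (ω := ζ)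
      (a := β) (measurable_fieldQ_right hd hf) (locBdd_fieldQ hd hB hb) Ql fun _ _ => rfl
  have eP : ∀ᵐ X, dX Z X = P X := dP.mono fun X hX => funext fun Y => (hX Y).deriv
  have eQ : ∀ᵐ Y, ∀ X, dY Z X Y = Q X Y := dQ.mono fun Y hY X => (hY X).deriv
  have eF : ∀ X Y, f (X, Y) = F (Z X Y) (P X Y) (Q X Y) := fun X Y => (congrFun hfix (X, Y)).symm
  refine ⟨Z, ⟨?_, ?_, ?_, ?_, ?_, ?_, ?_⟩, ?_, ?_, ?_, ?_, ?_, ?_⟩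
  · intro R
    set D := C + B * ((R + R) + C)
    have hPD : ∀ X Y, |X| ≤ R → |Y| ≤ R → ‖P X Y‖ ≤ D := fun X Y h1 h2 =>
      (norm_fieldP_le hd hB hb X Y).trans
        (add_le_add le_rfl (mul_le_mul_of_nonneg_left (add_le_add
          ((abs_sub _ _).trans (add_le_add h2 h1)) le_rfl) hB))
    have hQD : ∀ X Y, |X| ≤ R → |Y| ≤ R → ‖Q X Y‖ ≤ D := fun X Y h1 h2 =>
      (norm_fieldQ_le hd hB hb X Y).trans
        (add_le_add le_rfl (mul_le_mul_of_nonneg_left (add_le_add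
          ((abs_sub _ _).trans (add_le_add h2 h1)) le_rfl) hB))
    refine ⟨(2 * D).toNNReal, LipschitzOnWith.of_dist_le_mul ?_⟩
    rintro ⟨x, y⟩ ⟨hx, hy⟩ ⟨x', y'⟩ ⟨hx', hy'⟩
    simp only at hx hy hx' hy'
    have hR : 0 ≤ R := by linarith [hx.1, hx.2]
    have hD : 0 ≤ D := by positivity
    have h1 : dist (Z x y) (Z x' y) ≤ D * dist x x' := by
      rw [dist_eq_norm, hZ', hZ', add_sub_add_left_eq_sub,
        intervalIntegral.integral_interval_sub_left
        ((locBdd_fieldP hd hB hb y).intervalIntegrable (measurable_fieldP_left hd hf y) _ _)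
        ((locBdd_fieldP hd hB hb y).intervalIntegrable (measurable_fieldP_left hd hf y) _ _),
        Real.dist_eq]
      refine intervalIntegral.norm_integral_le_of_norm_le_const fun t ht => hPD t y ?_ (abs_le.2 hy)
      exact abs_le.2 (uIcc_subset_Icc hx' hx (uIoc_subset_uIcc ht))
    have h2 : dist (Z x' y) (Z x' y') ≤ D * dist y y' := by
      rw [dist_eq_norm, hZ, fieldZ, fieldZ, add_sub_add_left_eq_sub,
        intervalIntegral.integral_interval_sub_left
        ((locBdd_fieldQ hd hB hb x').intervalIntegrable (measurable_fieldQ_right hd hf x') _ _)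
        ((locBdd_fieldQ hd hB hb x').intervalIntegrable (measurable_fieldQ_right hd hf x') _ _),
        Real.dist_eq]
      refine intervalIntegral.norm_integral_le_of_norm_le_const fun t ht => hQD x' t (abs_le.2 hx')
        ?_
      exact abs_le.2 (uIcc_subset_Icc hy' hy (uIoc_subset_uIcc ht))
    have h3 : dist x x' ≤ dist (x, y) (x', y') := le_max_left _ _
    have h4 : dist y y' ≤ dist (x, y) (x', y') := le_max_right _ _
    rw [Real.coe_toNNReal _ (by positivity)]
    refine (dist_triangle _ (Z x' y) _).trans ?_
    nlinarith
  · exact dP.mono fun X hX Y => (hX Y).differentiableAt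
  · exact dQ.mono fun Y hY X => (hY X).differentiableAt
  · exact fun R => ⟨B.toNNReal, eP.mono fun X hX _ => by rw [hX]; exact (Pl X).lipschitzOnWith⟩
  · exact fun R => ⟨B.toNNReal, eQ.mono fun Y hY _ => by
      simp only [hY]; exact (Ql Y).lipschitzOnWith⟩
  · filter_upwards [eP] with X hX
    filter_upwards [eQ, (locBdd_of_le fun η => hb (X, η)).ae_hasDerivAt_integral
      (hf.comp (by fun_prop))] with Y hY hd
    rw [hX, hY, ← eF]
    exact (hd (β X)).const_add _
  · filter_upwards [eQ] with Y hY
    filter_upwards [eP, (locBdd_of_le fun ξ => hb (ξ, Y)).ae_hasDerivAt_integral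
      (hf.comp (by fun_prop))] with X hX hd
    simp only [hX, hY, ← eF]
    exact (hd (α Y)).const_add _
  · intro X; simp [hZ, fieldZ]
  · intro Y; simp [hZ']
  · exact eP.mono fun X hX => by simp [hX, hP, fieldP]
  · exact eQ.mono fun Y hY => by simp [hY, hQ, fieldQ]
  · exact eP.mono fun X hX => by rw [hX]; exact Pl X
  · exact eQ.mono fun Y hY => by simp only [hY]; exact Ql Y

end fixedPoint

/-! ### Solutions on strips -/

section lipschitz

variable {c : ℝ → ℝ} {κ : ℝ}

theorem exists_bound_lip (M : ℝ) {a : ℝ → ℝ} (ha : LocallyLipschitz a) :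
    ∃ A, 0 ≤ A ∧ ∀ u u', |u| ≤ M → |u'| ≤ M → |a u| ≤ A ∧ |a u - a u'| ≤ A * |u - u'| := by
  obtain ⟨L, hL⟩ := ha.lipschitzOn_Icc (-M) M
  obtain ⟨B, hB⟩ := isCompact_Icc.exists_bound_of_continuousOn (s := Icc (-M) M)
    ha.continuous.continuousOn
  refine ⟨max L B, L.coe_nonneg.trans (le_max_left _ _), fun u u' h h' => ⟨?_, ?_⟩⟩
  · exact (hB u (abs_le.1 h)).trans (le_max_right _ _)
  · have := hL.dist_le_mul u (abs_le.1 h) u' (abs_le.1 h')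
    rw [Real.dist_eq, Real.dist_eq] at this
    exact this.trans (by gcongr; exact le_max_left _ _)

theorem IsSpeed.inv_lip (hs : IsSpeed c κ) : LocallyLipschitz fun u => (c u)⁻¹ :=
  (hs.contDiff.inv fun u => (hs.pos u).ne').locallyLipschitz

theorem abs_triple_sub_le {a a' v v' w w' A M D : ℝ} (hA : 0 ≤ A) (hM : 0 ≤ M)
    (h1' : |a'| ≤ A) (h2 : |v'| ≤ M) (h3 : |w| ≤ M) (h2' : |v| ≤ M) (d1 : |a - a'| ≤ A * D)
    (d2 : |v - v'| ≤ D) (d3 : |w - w'| ≤ D) :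
    |a * (v * w) - a' * (v' * w')| ≤ 3 * A * (M + 1) ^ 2 * D := by
  have hD : 0 ≤ D := (abs_nonneg _).trans d2
  calc |a * (v * w) - a' * (v' * w')|
      = |(a - a') * (v * w) + (a' * ((v - v') * w) + a' * (v' * (w - w')))| := by congr 1; ring
    _ ≤ |a - a'| * (|v| * |w|) + (|a'| * (|v - v'| * |w|) + |a'| * (|v'| * |w - w'|)) := by
        refine (abs_add_le _ _).trans (add_le_add ?_ ((abs_add_le _ _).trans ?_)) <;>
          simp only [abs_mul, le_refl]
    _ ≤ A * D * (M * M) + (A * (D * M) + A * (M * D)) := by gcongr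
    _ ≤ _ := by nlinarith [mul_nonneg hA hD, mul_nonneg (mul_nonneg hA hD) hM,
        mul_nonneg (mul_nonneg hA hD) (mul_nonneg hM hM)]

/-- The nonlinearity is Lipschitz on bounded sets, because `c'` is locally Lipschitz and `c` is
bounded from below. -/
theorem bilin_lip (hs : IsSpeed c κ) {M : ℝ} (hM : 0 ≤ M) : ∃ K, 0 ≤ K ∧
    ∀ u u' v v' w w', |u| ≤ M → |u'| ≤ M → ‖v‖ ≤ M → ‖v'‖ ≤ M → ‖w‖ ≤ M → ‖w'‖ ≤ M →
      ‖bilin c u v w - bilin c u' v' w'‖ ≤ K * (|u - u'| + ‖v - v'‖ + ‖w - w'‖) := by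
  have hi := hs.inv_lip
  obtain ⟨A, hA, hA'⟩ := exists_bound_lip M ((hs.lip.mul_real hi).const_mul (1 / 2))
  obtain ⟨A2, hA2, hA2'⟩ := exists_bound_lip M
    ((hs.lip.mul_real (hi.mul_real (hi.mul_real hi))).const_mul (1 / 2))
  refine ⟨9 * (A + A2) * (M + 1) ^ 2, by positivity, ?_⟩
  intro u u' v v' w w' hu hu' hv hv' hw hw'
  set D := |u - u'| + ‖v - v'‖ + ‖w - w'‖ with hD
  have hD0 : 0 ≤ D := by positivity
  set a : ℝ → ℝ := coef c with ha
  have ea : ∀ u, 1 / 2 * (deriv c u * (c u)⁻¹) = coef c u := fun u => by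
    rw [coef]; have := (hs.pos u).ne'; field_simp
  set b : ℝ → ℝ := fun u => deriv c u / (2 * c u ^ 3) with hb
  have eb : ∀ u, 1 / 2 * (deriv c u * ((c u)⁻¹ * ((c u)⁻¹ * (c u)⁻¹))) = b u := fun u => by
    rw [hb]; have := (hs.pos u).ne'; field_simp
  simp only [ea] at hA'
  simp only [eb] at hA2'
  have T : ∀ {e : ℝ → ℝ} {A}, 0 ≤ A → (∀ u u', |u| ≤ M → |u'| ≤ M → |e u| ≤ A ∧
      |e u - e u'| ≤ A * |u - u'|) → ∀ i j, |e u * (v i * w j) - e u' * (v' i * w' j)| ≤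
        3 * A * (M + 1) ^ 2 * D := by
    intro e A hA he i j
    refine abs_triple_sub_le hA hM (he u' u hu' hu).1
      ((norm_le_pi_norm v' i).trans hv') ((norm_le_pi_norm w j).trans hw)
      ((norm_le_pi_norm v i).trans hv) ((he u u' hu hu').2.trans ?_) ?_ ?_
    · gcongr; rw [hD]; linarith [norm_nonneg (v - v'), norm_nonneg (w - w')]
    · have := norm_le_pi_norm (v - v') i
      rw [Pi.sub_apply, Real.norm_eq_abs] at this
      rw [hD]; linarith [abs_nonneg (u - u'), norm_nonneg (w - w')]
    · have := norm_le_pi_norm (w - w') j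
      rw [Pi.sub_apply, Real.norm_eq_abs] at this
      rw [hD]; linarith [abs_nonneg (u - u'), norm_nonneg (v - v')]
  have Ta := T hA hA'
  have Tb := T hA2 hA2'
  have e1 : 0 ≤ A * (M + 1) ^ 2 * D := by positivity
  have e2 : 0 ≤ A2 * (M + 1) ^ 2 * D := by positivity
  rw [pi_norm_le_iff_of_nonneg (by positivity)]
  have key : ∀ {x : ℝ}, |x| ≤ 6 * (A * (M + 1) ^ 2 * D) + 9 * (A2 * (M + 1) ^ 2 * D) ∨
      |x| ≤ 3 * (A * (M + 1) ^ 2 * D) + 9 * (A2 * (M + 1) ^ 2 * D) →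
      ‖x‖ ≤ 9 * (A + A2) * (M + 1) ^ 2 * D := fun {x} h => by
    rw [Real.norm_eq_abs]
    rcases h with h | h <;> linarith
  intro i
  rw [Pi.sub_apply]
  refine key (.inl ?_)
  fin_cases i <;> simp only [Fin.zero_eta, Fin.mk_one, Fin.reduceFinMk, bilin_t, bilin_x, bilin_U,
    bilin_J, bilin_K]
  · have h1 := abs_le.1 (Ta 2 0)
    have h2 := abs_le.1 (Ta 0 2)
    exact abs_le.2 ⟨by linarith, by linarith⟩
  · have h1 := abs_le.1 (Ta 2 1)
    have h2 := abs_le.1 (Ta 1 2)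
    exact abs_le.2 ⟨by linarith, by linarith⟩
  · have h1 := abs_le.1 (Ta 2 2)
    have h2 := abs_le.1 (Tb 3 1)
    have h3 := abs_le.1 (Tb 1 3)
    exact abs_le.2 ⟨by simp only [hb] at h2 h3; linarith, by simp only [hb] at h2 h3; linarith⟩
  · have h1 := abs_le.1 (Ta 3 2)
    have h2 := abs_le.1 (Ta 2 3)
    exact abs_le.2 ⟨by linarith, by linarith⟩
  · have h1 := abs_le.1 (Ta 4 2)
    have h2 := abs_le.1 (Ta 2 4)
    exact abs_le.2 ⟨by linarith, by linarith⟩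

/-- Truncation of a real number at the levels `-M` and `M`. -/
def clamp (M x : ℝ) : ℝ := max (-M) (min M x)

theorem abs_clamp_le {M : ℝ} (hM : 0 ≤ M) (x : ℝ) : |clamp M x| ≤ M :=
  abs_le.2 ⟨le_max_left _ _, max_le (by linarith) (min_le_left _ _)⟩

theorem clamp_eq {M x : ℝ} (h : |x| ≤ M) : clamp M x = x := by
  rw [clamp, min_eq_right (abs_le.1 h).2, max_eq_right (abs_le.1 h).1]

theorem clamp_lip (M : ℝ) : LipschitzWith 1 (clamp M) :=
  (LipschitzWith.id.const_min M).const_max (-M)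

theorem abs_clamp_sub_le (M x y : ℝ) : |clamp M x - clamp M y| ≤ |x - y| := by
  simpa [Real.dist_eq] using (clamp_lip M).dist_le_mul x y

/-- Componentwise truncation. -/
def clampVec (M : ℝ) (v : Vec5) : Vec5 := fun i => clamp M (v i)

theorem norm_clampVec_le {M : ℝ} (hM : 0 ≤ M) (v : Vec5) : ‖clampVec M v‖ ≤ M :=
  (pi_norm_le_iff_of_nonneg hM).2 fun i => abs_clamp_le hM (v i)

theorem clampVec_eq {M : ℝ} {v : Vec5} (h : ‖v‖ ≤ M) : clampVec M v = v :=
  funext fun i => clamp_eq ((norm_le_pi_norm v i).trans h)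

theorem norm_clampVec_sub_le (M : ℝ) (v w : Vec5) : ‖clampVec M v - clampVec M w‖ ≤ ‖v - w‖ :=
  (pi_norm_le_iff_of_nonneg (norm_nonneg _)).2 fun i =>
    (abs_clamp_sub_le M _ _).trans (norm_le_pi_norm (v - w) i)

/-- The nonlinearity of the system with all arguments truncated at the level `M`. -/
def truncF (c : ℝ → ℝ) (M : ℝ) : Vec5 → Vec5 → Vec5 → Vec5 := fun z v w =>
  bilin c (clamp M (z 2)) (clampVec M v) (clampVec M w)

theorem truncF_eq {M : ℝ} {z v w : Vec5} (hz : |z 2| ≤ M) (hv : ‖v‖ ≤ M) (hw : ‖w‖ ≤ M) :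
    truncF c M z v w = bilin c (z 2) v w := by
  rw [truncF, clamp_eq hz, clampVec_eq hv, clampVec_eq hw]

theorem truncF_tame (hs : IsSpeed c κ) {M : ℝ} (hM : 0 ≤ M) : ∃ B K, IsTame (truncF c M) B K := by
  obtain ⟨K, hK, h⟩ := bilin_lip hs hM
  have h0 : ∀ u, bilin c u 0 0 = 0 := fun u => by
    ext i; fin_cases i <;> simp [bilin]
  refine ⟨K * (M + M), K, fun z v w => ?_, fun z v w z' v' w' => ?_⟩
  · have := h (clamp M (z 2)) (clamp M (z 2)) (clampVec M v) 0 (clampVec M w) 0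
      (abs_clamp_le hM _) (abs_clamp_le hM _) (norm_clampVec_le hM _) (by simpa)
      (norm_clampVec_le hM _) (by simpa)
    rw [h0, sub_zero, sub_zero, sub_zero, sub_self, abs_zero, zero_add] at this
    exact this.trans (by gcongr <;> exact norm_clampVec_le hM _)
  · refine (h _ _ _ _ _ _ (abs_clamp_le hM _) (abs_clamp_le hM _) (norm_clampVec_le hM _)
      (norm_clampVec_le hM _) (norm_clampVec_le hM _) (norm_clampVec_le hM _)).trans ?_
    gcongr
    · exact (abs_clamp_sub_le M _ _).trans (norm_le_pi_norm (z - z') 2)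
    · exact norm_clampVec_sub_le _ _ _
    · exact norm_clampVec_sub_le _ _ _

end lipschitz

section bootstrap

variable {c : ℝ → ℝ} {κ : ℝ} {β α : ℝ → ℝ} {V W ζ ω : ℝ → Vec5} {C σ L : ℝ}
  {F : Vec5 → Vec5 → Vec5 → Vec5} {Z : ℝ → ℝ → Vec5}

/-- The part of a side of the curve with `σ (Y - X) ≤ r`. -/
def strip (β : ℝ → ℝ) (σ r : ℝ) : Set (ℝ × ℝ) := {p | p ∈ side β σ ∧ σ * (p.2 - p.1) ≤ r}

theorem mul_nonneg_of_mem_uIoo {σ b y η : ℝ} (hy : 0 ≤ σ * (y - b)) (hη : η ∈ uIoo b y) :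
    0 ≤ σ * (y - η) ∧ 0 ≤ σ * (η - b) := by
  rcases le_total b y with h | h
  · rw [uIoo_of_le h] at hη
    have h1 : 0 < y - b := by linarith [hη.1, hη.2]
    have h2 : 0 ≤ σ := nonneg_of_mul_nonneg_left hy h1
    exact ⟨mul_nonneg h2 (by linarith [hη.2]), mul_nonneg h2 (by linarith [hη.1])⟩
  · rw [uIoo_of_ge h] at hη
    have h1 : y - b < 0 := by linarith [hη.1, hη.2]
    have h2 : σ ≤ 0 := by by_contra h3; nlinarith
    exact ⟨mul_nonneg_of_nonpos_of_nonpos h2 (by linarith [hη.1]),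
      mul_nonneg_of_nonpos_of_nonpos h2 (by linarith [hη.2])⟩

theorem IsData.isDom_strip (hd : IsData β α V W ζ ω C) (σ r : ℝ) :
    IsDom β α σ (strip β σ r) where
  vert X Y hm := by
    obtain ⟨h1, h2⟩ := (hd.isDom σ).vert X Y hm.1
    refine ⟨h1, fun η hη => ⟨h2 η hη, ?_⟩⟩
    have := (mul_nonneg_of_mem_uIoo h1 hη).1
    have h3 := hm.2
    simp only at h3 ⊢
    linarith
  horiz X Y hm := by
    obtain ⟨h1, h2⟩ := (hd.isDom σ).horiz X Y hm.1
    refine ⟨h1, fun ξ hξ => ⟨h2 ξ hξ, ?_⟩⟩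
    rw [uIoo_comm] at hξ
    have := (mul_nonneg_of_mem_uIoo h1 hξ).2
    have h3 := hm.2
    simp only at h3 ⊢
    linarith

theorem IsData.abs_sub_le_of_strip (hd : IsData β α V W ζ ω C) (hσ : σ ^ 2 = 1) (hL : 0 ≤ L)
    {X Y : ℝ} (hm : (X, Y) ∈ strip β σ L) : |Y - X| ≤ L + C := by
  have h1 := hd.near_side hm.1
  have h2 := hm.2
  have hC := hd.nonneg
  simp only at h2
  rcases (mul_self_eq_one_iff.1 ((sq σ).symm.trans hσ)) with rfl | rfl <;>
    exact abs_le.2 ⟨by linarith, by linarith⟩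

/-- The values of `Z`, `Z_X`, `Z_Y` on the curve are those of the data, and the data satisfy the
algebraic relations. -/
structure Attains (c : ℝ → ℝ) (β α : ℝ → ℝ) (V W ζ ω : ℝ → Vec5) (Z : ℝ → ℝ → Vec5) : Prop where
  eq_ζ : ∀ X, Z X (β X) = ζ X
  eq_ω : ∀ Y, Z (α Y) Y = ω Y
  eq_V : ∀ᵐ X, dX Z X (β X) = V X
  eq_W : ∀ᵐ Y, dY Z (α Y) Y = W Y
  rel_V : ∀ᵐ X, Rel c 1 (ζ X 2) (V X)
  rel_W : ∀ᵐ Y, Rel c (-1) (ω Y 2) (W Y)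

theorem Attains.relX (h : Attains c β α V W ζ ω Z) :
    ∀ᵐ X, Rel c 1 (Z X (β X) 2) (dX Z X (β X)) := by
  filter_upwards [h.eq_V, h.rel_V] with X h1 h2
  rwa [h1, h.eq_ζ]

theorem Attains.relY (h : Attains c β α V W ζ ω Z) :
    ∀ᵐ Y, Rel c (-1) (Z (α Y) Y 2) (dY Z (α Y) Y) := by
  filter_upwards [h.eq_W, h.rel_W] with Y h1 h2
  rwa [h1, h.eq_ω]

theorem IsData.curveBdd (hd : IsData β α V W ζ ω C) (ha : Attains c β α V W ζ ω Z)
    (hσ : σ ^ 2 = 1) (hL : 0 ≤ L) {Ω : Set (ℝ × ℝ)} (hΩ : Ω ⊆ strip β σ L) :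
    CurveBdd β α Z Ω C (C * (1 + (L + C))) where
  U_X X := by rw [ha.eq_ζ]; exact hd.ζ_U X
  U_Y Y := by rw [ha.eq_ω]; exact hd.ω_U Y
  inc X Y hm i _ := by
    rw [ha.eq_ζ, ha.eq_ω]
    refine (norm_le_pi_norm (ω Y - ζ X) i).trans ((hd.growth X Y).trans ?_)
    have := hd.nonneg
    gcongr
    exact hd.abs_sub_le_of_strip hσ hL (hΩ hm)

/-- A priori bounds: a solution that satisfies the algebraic relations is bounded on strips, with
bounds that only depend on the data. -/
theorem IsData.exists_bound (hd : IsData β α V W ζ ω C) (hs : IsSpeed c κ) (hL : 0 ≤ L) :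
    ∃ M, C ≤ M ∧ ∀ (σ r : ℝ) F Z, σ ^ 2 = 1 → r ≤ L → Attains c β α V W ζ ω Z →
      SolvesOn c F Z (strip β σ r) → RelOn c 1 Z (strip β σ r) → BddOn Z (strip β σ r) M := by
  have hC := hd.nonneg
  have hκ := hs.pos_bound
  -- `H` bounds the increments of `x` and `J` on the curve, hence those along characteristics
  set H := C * (1 + (L + C)) with hH
  have hH0 : 0 ≤ H := by positivity
  -- bound for `U`, as `|U_Y| ≤ κ (x_Y + J_Y)`; it controls `c'(U)` by `k`
  set U₁ := C + κ * (2 * H) with hU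
  obtain ⟨k, hk0, hk⟩ := hs.deriv_bdd U₁
  -- growth factor of `x_X + J_X` along a characteristic
  set E := Real.exp (2 * κ ^ 2 * k * (2 * H)) with hE
  refine ⟨max U₁ (κ * ((C + C) * E)), le_max_of_le_left (le_add_of_nonneg_right (by positivity)),
    ?_⟩
  intro σ r F Z hσ hr ha hZ hrel
  have hΩ := hd.isDom_strip σ r
  have hc : CurveBdd β α Z (strip β σ r) C H :=
    hd.curveBdd ha hσ hL fun p hp => ⟨hp.1, hp.2.trans hr⟩
  have hsum : ∀ {v : Vec5}, ‖v‖ ≤ C → v 1 + v 3 ≤ C + C := fun {v} hv =>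
    add_le_add ((le_abs_self _).trans ((norm_le_pi_norm v 1).trans hv))
      ((le_abs_self _).trans ((norm_le_pi_norm v 3).trans hv))
  refine ⟨fun X Y hm => (U_le_on_strip hs hσ hΩ hZ.wave hrel hc hm).trans (le_max_left _ _), ?_, ?_⟩
  · filter_upwards [pos_part_on_strip hs hσ hΩ hZ hrel hc hk0 hk ha.relX, hrel.dX, ha.eq_V]
      with X h1 h2 h3 Y hm
    refine ((h2 Y hm).norm_le hs (by norm_num)).trans (le_max_of_le_right ?_)
    gcongr
    refine (h1 Y hm).1.trans ?_
    rw [h3]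
    exact mul_le_mul_of_nonneg_right (hsum (hd.V_bdd X)) (Real.exp_pos _).le
  · filter_upwards [pos_part_on_strip hs (by simpa using hσ) hΩ.swap hZ.swap hrel.swap hc.swap hk0
      hk ha.relY, hrel.dY, ha.eq_W] with Y h1 h2 h3 X hm
    refine ((h2 X hm).norm_le hs (by norm_num)).trans (le_max_of_le_right ?_)
    gcongr
    refine (h1 X hm).1.trans ?_
    rw [show dX (fun X Y => Z Y X) Y (α Y) = W Y from h3]
    exact mul_le_mul_of_nonneg_right (hsum (hd.W_bdd Y)) (Real.exp_pos _).le

end bootstrap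

section existence

variable {c : ℝ → ℝ} {κ : ℝ} {β α : ℝ → ℝ} {V W ζ ω : ℝ → Vec5} {C σ L B M δ r : ℝ}
  {F : Vec5 → Vec5 → Vec5 → Vec5} {Z : ℝ → ℝ → Vec5}

/-- A point of a strip is connected to the curve or to a slightly smaller strip by a short vertical
segment. -/
theorem IsData.exists_near (hd : IsData β α V W ζ ω C) (hσ : σ ^ 2 = 1) (hδ : 0 ≤ δ) {X Y : ℝ}
    (hm : (X, Y) ∈ strip β σ (r + δ)) :
    ∃ η, |Y - η| ≤ δ ∧ ((X, η) ∈ strip β σ r ∨ η = β X) ∧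
      ∀ y ∈ uIoo η Y, (X, y) ∈ strip β σ (r + δ) := by
  obtain ⟨h1, h2⟩ := (hd.isDom_strip σ (r + δ)).vert X Y hm
  have hm2 := hm.2
  simp only at hm2
  rcases le_or_gt (σ * (Y - β X)) δ with h | h
  · refine ⟨β X, ?_, .inr rfl, h2⟩
    rcases mul_self_eq_one_iff.1 ((sq σ).symm.trans hσ) with rfl | rfl <;>
      exact abs_le.2 ⟨by linarith, by linarith⟩
  · have hη : 0 < σ * ((Y - σ * δ) - β X) := by nlinarith
    have hin : Y - σ * δ ∈ uIcc (β X) Y ∧ (σ * δ ≠ 0 → Y - σ * δ ∈ uIoo (β X) Y) := by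
      rcases mul_self_eq_one_iff.1 ((sq σ).symm.trans hσ) with rfl | rfl
      · rw [uIcc_of_le (by linarith), uIoo_of_le (by linarith)]
        refine ⟨⟨by linarith, by linarith⟩, fun h0 => ⟨by linarith, ?_⟩⟩
        have := lt_of_le_of_ne hδ (by rintro rfl; simp at h0)
        linarith
      · rw [uIcc_of_ge (by linarith), uIoo_of_ge (by linarith)]
        refine ⟨⟨by linarith, by linarith⟩, fun h0 => ⟨?_, by linarith⟩⟩
        have := lt_of_le_of_ne hδ (by rintro rfl; simp at h0)
        linarith
    refine ⟨Y - σ * δ, ?_, .inl ⟨?_, ?_⟩, fun y hy => h2 y ?_⟩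
    · rw [sub_sub_cancel, abs_mul, abs_of_nonneg hδ]
      rcases mul_self_eq_one_iff.1 ((sq σ).symm.trans hσ) with rfl | rfl <;> simp
    · by_cases h0 : σ * δ = 0
      · rw [h0, sub_zero]; exact hm.1
      · exact (h2 _ (hin.2 h0)).1
    · simp only; nlinarith
    · have h3 := hin.1
      rw [uIcc_comm] at h3
      rw [uIoo_comm] at hy ⊢
      exact uIoo_subset_of_mem_uIcc h3 hy

/-- The horizontal counterpart of `IsData.exists_near`. -/
theorem IsData.exists_near' (hd : IsData β α V W ζ ω C) (hσ : σ ^ 2 = 1) (hδ : 0 ≤ δ) {X Y : ℝ}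
    (hm : (X, Y) ∈ strip β σ (r + δ)) :
    ∃ ξ, |X - ξ| ≤ δ ∧ ((ξ, Y) ∈ strip β σ r ∨ ξ = α Y) := by
  obtain ⟨h1, h2⟩ := (hd.isDom_strip σ (r + δ)).horiz X Y hm
  have hm2 := hm.2
  simp only at hm2
  rcases le_or_gt (σ * (α Y - X)) δ with h | h
  · refine ⟨α Y, ?_, .inr rfl⟩
    rcases mul_self_eq_one_iff.1 ((sq σ).symm.trans hσ) with rfl | rfl <;>
      exact abs_le.2 ⟨by linarith, by linarith⟩
  · refine ⟨X + σ * δ, ?_, .inl ⟨?_, ?_⟩⟩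
    · rw [sub_add_cancel_left, abs_neg, abs_mul, abs_of_nonneg hδ]
      rcases mul_self_eq_one_iff.1 ((sq σ).symm.trans hσ) with rfl | rfl <;> simp
    · by_cases h0 : σ * δ = 0
      · rw [h0, add_zero]; exact hm.1
      · refine (h2 _ ?_).1
        have hδ' := lt_of_le_of_ne hδ (by rintro rfl; simp at h0)
        rcases mul_self_eq_one_iff.1 ((sq σ).symm.trans hσ) with rfl | rfl
        · rw [uIoo_of_ge (by linarith)]
          exact ⟨by linarith, by linarith⟩
        · rw [uIoo_of_le (by linarith)]
          exact ⟨by linarith, by linarith⟩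
    · simp only; nlinarith

/-- Continuation of the bounds to a slightly larger strip. -/
theorem IsData.bddOn_succ (hd : IsData β α V W ζ ω C) (hσ : σ ^ 2 = 1) (hZ : IsWave F Z)
    (ha : Attains c β α V W ζ ω Z) (hB : 0 ≤ B)
    (lX : ∀ᵐ X, LipschitzWith B.toNNReal (dX Z X))
    (lY : ∀ᵐ Y, LipschitzWith B.toNNReal fun X => dY Z X Y)
    (hM : C ≤ M) (hδ : 0 ≤ δ) (hδB : B * δ ≤ 1) (hδM : (M + 1) * δ ≤ 1)
    (hb : BddOn Z (strip β σ r) M) : BddOn Z (strip β σ (r + δ)) (M + 1) := by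
  have hstep : ∀ {g : ℝ → Vec5} {x y : ℝ}, LipschitzWith B.toNNReal g → |y - x| ≤ δ → ‖g x‖ ≤ M →
      ‖g y‖ ≤ M + 1 := by
    intro g x y hg hxy hx
    have h1 := hg.dist_le_mul y x
    rw [Real.coe_toNNReal _ hB, dist_eq_norm, Real.dist_eq] at h1
    have h2 := norm_sub_norm_le (g y) (g x)
    have h3 : B * |y - x| ≤ B * δ := mul_le_mul_of_nonneg_left hxy hB
    linarith
  have hY : ∀ᵐ Y, ∀ X, (X, Y) ∈ strip β σ (r + δ) → ‖NVW.dY Z X Y‖ ≤ M + 1 := by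
    filter_upwards [lY, hb.dY, ha.eq_W] with Y h1 h2 h3 X hm
    obtain ⟨ξ, h4, h5⟩ := hd.exists_near' hσ hδ hm
    refine hstep (g := fun X => NVW.dY Z X Y) h1 h4 ?_
    rcases h5 with h5 | rfl
    · exact h2 ξ h5
    · simp only [h3]; exact (hd.W_bdd Y).trans hM
  refine ⟨fun X Y hm => ?_, ?_, hY⟩
  · obtain ⟨η, h4, h5, h6⟩ := hd.exists_near hσ hδ hm
    have hM0 : 0 ≤ M := hd.nonneg.trans hM
    have h7 := norm_sub_le_of_ae_deriv_const (f := fun y => Z X y) (K := M + 1) (a := η) (b := Y)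
      (by linarith) (hZ.lip_Y X) (by
        filter_upwards [hY, hZ.hasDerivAt_Y] with y hy1 hy2 hy
        exact ⟨_, hy2 X, hy1 X (h6 y hy)⟩)
    have h8 := norm_le_pi_norm (Z X Y - Z X η) 2
    rw [Pi.sub_apply, Real.norm_eq_abs] at h8
    have h9 : |Z X η 2| ≤ M := by
      rcases h5 with h5 | rfl
      · exact hb.U X η h5
      · rw [ha.eq_ζ]; exact (hd.ζ_U X).trans hM
    have h10 : (M + 1) * |Y - η| ≤ (M + 1) * δ := mul_le_mul_of_nonneg_left h4 (by linarith)
    have h11 := abs_sub_abs_le_abs_sub (Z X Y 2) (Z X η 2)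
    linarith
  · filter_upwards [lX, hb.dX, ha.eq_V] with X h1 h2 h3 Y hm
    obtain ⟨η, h4, h5, -⟩ := hd.exists_near hσ hδ hm
    refine hstep h1 h4 ?_
    rcases h5 with h5 | rfl
    · exact h2 η h5
    · rw [h3]; exact (hd.V_bdd X).trans hM

/-- Where the bound holds, the truncation is not active. -/
theorem solvesOn_of_bddOn {Ω : Set (ℝ × ℝ)} (hZ : IsWave (truncF c M) Z) (hb : BddOn Z Ω M) :
    SolvesOn c (truncF c M) Z Ω where
  wave := hZ
  eq_F := by
    filter_upwards [hb.dX] with X h1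
    filter_upwards [hb.dY] with Y h2 hm
    exact truncF_eq (hb.U X Y hm) (h1 Y hm) (h2 X hm)
  eq_F' := by
    filter_upwards [hb.dY] with Y h2
    filter_upwards [hb.dX] with X h1 hm
    exact truncF_eq (hb.U X Y hm) (h1 Y hm) (h2 X hm)

/-- Existence on a strip. The nonlinearity is truncated at `M + 1`, where `M` is the a priori
bound. A bound by `M` on a strip gives a bound by `M + 1` on a slightly larger strip, where the
truncation is therefore not active, the relations propagate, and the a priori bound restores `M`.
The width of the step does not depend on the strip, so that finitely many steps suffice. -/
theorem IsData.exists_solution_strip (hd : IsData β α V W ζ ω C) (hs : IsSpeed c κ)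
    (hV : ∀ᵐ X, Rel c 1 (ζ X 2) (V X)) (hW : ∀ᵐ Y, Rel c (-1) (ω Y 2) (W Y)) (hL : 0 ≤ L) :
    ∃ F Z, Attains c β α V W ζ ω Z ∧ ∀ σ : ℝ, σ ^ 2 = 1 →
      SolvesOn c F Z (strip β σ L) ∧ RelOn c 1 Z (strip β σ L) := by
  obtain ⟨M, hCM, hM⟩ := hd.exists_bound hs hL
  have hM0 : 0 ≤ M := hd.nonneg.trans hCM
  obtain ⟨B, K, hF⟩ := truncF_tame hs (M := M + 1) (by linarith)
  have hB := hF.bound_nonneg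
  obtain ⟨Z, hZ, z1, z2, z3, z4, lX, lY⟩ := exists_wave hd hF
  have ha : Attains c β α V W ζ ω Z := ⟨z1, z2, z3, z4, hV, hW⟩
  refine ⟨truncF c (M + 1), Z, ha, fun σ hσ => ?_⟩
  have hsol : ∀ r, BddOn Z (strip β σ r) (M + 1) →
      SolvesOn c (truncF c (M + 1)) Z (strip β σ r) ∧ RelOn c 1 Z (strip β σ r) := by
    intro r hb
    have h1 := solvesOn_of_bddOn hZ hb
    obtain ⟨h2, h3⟩ := rel_propagates hs hσ (τ := 1) (by norm_num) (hd.isDom_strip σ r)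
      (C := C) (fun X Y hm => hd.near_side hm.1) h1 (by linarith) hb ha.relX ha.relY
    exact ⟨h1, h2, h3⟩
  have hmono : ∀ {r r' m : ℝ}, r ≤ r' → BddOn Z (strip β σ r') m → BddOn Z (strip β σ r) m :=
    fun {r r' m} hr hb => ⟨fun X Y hm => hb.U X Y ⟨hm.1, hm.2.trans hr⟩,
      hb.dX.mono fun X h Y hm => h Y ⟨hm.1, hm.2.trans hr⟩,
      hb.dY.mono fun Y h X hm => h X ⟨hm.1, hm.2.trans hr⟩⟩
  set δ : ℝ := 1 / (B + (M + 1)) with hδ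
  have hδ0 : 0 < δ := by positivity
  have hδB : B * δ ≤ 1 := by
    rw [hδ, mul_one_div, div_le_one (by positivity)]; linarith
  have hδM : (M + 1) * δ ≤ 1 := by
    rw [hδ, mul_one_div, div_le_one (by positivity)]; linarith
  have key : ∀ n : ℕ, BddOn Z (strip β σ (min L (-C - 1 + n * δ))) M := by
    intro n
    induction n with
    -- the first strip is empty because the curve is close to the diagonal
    | zero =>
      have hemp : ∀ X Y, (X, Y) ∉ strip β σ (min L (-C - 1 + (0 : ℕ) * δ)) := fun X Y hm => by
        have h1 := hd.near_side hm.1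
        have h2 := hm.2.trans (min_le_right _ _)
        simp only [Nat.cast_zero, zero_mul, add_zero] at h2
        linarith
      exact ⟨fun X Y hm => absurd hm (hemp X Y), .of_forall fun X Y hm => absurd hm (hemp X Y),
        .of_forall fun Y X hm => absurd hm (hemp X Y)⟩
    | succ n ih =>
      have h1 := hd.bddOn_succ hσ hZ ha hB lX lY hCM hδ0.le hδB hδM ih
      have h2 : min L (-C - 1 + (n + 1 : ℕ) * δ) ≤ min L (-C - 1 + n * δ) + δ := by
        push_cast
        rw [min_add]
        exact le_min ((min_le_left _ _).trans (by linarith))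
          ((min_le_right _ _).trans (by linarith))
      obtain ⟨h3, h4⟩ := hsol _ (hmono h2 h1)
      exact hM σ _ _ Z hσ (min_le_left _ _) ha h3 h4
  obtain ⟨n, hn⟩ := exists_nat_ge ((L + C + 1) / δ)
  rw [div_le_iff₀ hδ0] at hn
  have h1 := key n
  rw [min_eq_left (by linarith)] at h1
  refine hsol L ⟨fun X Y hm => (h1.U X Y hm).trans (by linarith),
    h1.dX.mono fun X h Y hm => (h Y hm).trans (by linarith),
    h1.dY.mono fun Y h X hm => (h X hm).trans (by linarith)⟩

/-- Two solutions with the same data agree on strips. -/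
theorem IsData.eq_on_strip (hd : IsData β α V W ζ ω C) (hs : IsSpeed c κ) (hL : 0 ≤ L)
    {F' : Vec5 → Vec5 → Vec5 → Vec5} {Z' : ℝ → ℝ → Vec5}
    (ha : Attains c β α V W ζ ω Z) (ha' : Attains c β α V W ζ ω Z') (hσ : σ ^ 2 = 1)
    (hZ : SolvesOn c F Z (strip β σ L)) (hZ' : SolvesOn c F' Z' (strip β σ L))
    (hr : RelOn c 1 Z (strip β σ L)) (hr' : RelOn c 1 Z' (strip β σ L)) {X Y : ℝ}
    (hm : (X, Y) ∈ strip β σ L) : Z X Y = Z' X Y := by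
  obtain ⟨M, hCM, hM⟩ := hd.exists_bound hs hL
  have hb := hM σ L F Z hσ le_rfl ha hZ hr
  have hb' := hM σ L F' Z' hσ le_rfl ha' hZ' hr'
  have hC := hd.nonneg
  have hM0 : 0 ≤ M := hC.trans hCM
  obtain ⟨K, hK, hlip⟩ := bilin_lip hs hM0
  have hΩ := hd.isDom_strip σ L
  -- the differences of `Z_X`, `Z_Y` are at most `2 M`, that of `Z` at most `2 M` times the distance
  -- to the curve
  have hmn : M + M ≤ (M + M) * (1 + (L + C + C)) :=
    le_mul_of_one_le_right (by positivity) (by linarith)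
  refine sub_eq_zero.1 ((goursat_zero hσ hΩ (K := K) (C := C) (B := (M + M) * (1 + (L + C + C)))
    (z := fun X Y => Z X Y - Z' X Y) (p := fun X Y => dX Z X Y - dX Z' X Y)
    (q := fun X Y => dY Z X Y - dY Z' X Y) hK (by positivity) (fun X Y hm => hd.near_side hm.1)
    ?_ ?_ ?_ ?_ ?_ ?_ ?_ ?_ ?_ ?_ ?_ ?_).2.2 X Y hm)
  · filter_upwards [hb.dX, hb'.dX] with X h1 h2 Y hm
    exact ((norm_sub_le _ _).trans (add_le_add (h1 Y hm) (h2 Y hm))).trans hmn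
  · filter_upwards [hb.dY, hb'.dY] with X h1 h2 Y hm
    exact ((norm_sub_le _ _).trans (add_le_add (h1 Y hm) (h2 Y hm))).trans hmn
  · intro X Y hm
    have h1 := norm_sub_le_of_ae_deriv_const (f := fun y => Z X y - Z' X y) (K := M + M)
      (a := β X) (b := Y) (by positivity) ((hZ.wave.lip_Y X).sub (hZ'.wave.lip_Y X)) (by
        filter_upwards [hb.dY, hb'.dY, hZ.wave.hasDerivAt_Y, hZ'.wave.hasDerivAt_Y]
          with y h1 h2 h3 h4 hy
        have hm' := (hΩ.vert X Y hm).2 y hy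
        exact ⟨_, (h3 X).sub (h4 X), (norm_sub_le _ _).trans (add_le_add (h1 X hm') (h2 X hm'))⟩)
    rw [ha.eq_ζ, ha'.eq_ζ, sub_self, sub_zero] at h1
    refine h1.trans (mul_le_mul_of_nonneg_left ?_ (by positivity))
    have h2 := hd.abs_sub_le_of_strip hσ hL hm
    have h3 := hd.near_β X
    have h4 : |Y - β X| ≤ |Y - X| + |β X - X| := by
      rw [show Y - β X = (Y - X) - (β X - X) by ring]; exact abs_sub _ _
    linarith
  · filter_upwards [hZ.wave.dX_locLip, hZ'.wave.dX_locLip] with X h1 h2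
    exact h1.sub h2
  · filter_upwards [hZ.wave.dY_locLip, hZ'.wave.dY_locLip] with Y h1 h2
    exact h1.sub h2
  · exact fun X => (hZ.wave.lip_Y X).sub (hZ'.wave.lip_Y X)
  · filter_upwards [ha.eq_V, ha'.eq_V] with X h1 h2 _
    rw [h1, h2, sub_self]
  · filter_upwards [ha.eq_W, ha'.eq_W] with Y h1 h2 _
    rw [h1, h2, sub_self]
  · exact fun X _ => by rw [ha.eq_ζ, ha'.eq_ζ, sub_self]
  · filter_upwards [hb.dX, hb'.dX, hZ.eq_F, hZ'.eq_F, hZ.wave.eq_YX, hZ'.wave.eq_YX]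
      with X b1 b2 e1 e2 d1 d2
    filter_upwards [hb.dY, hb'.dY, e1, e2, d1, d2] with Y b3 b4 e1 e2 d1 d2 hm
    refine ⟨_, d1.sub d2, ?_⟩
    rw [e1 hm, e2 hm]
    refine (hlip _ _ _ _ _ _ (hb.U X Y hm) (hb'.U X Y hm) (b1 Y hm) (b2 Y hm) (b3 X hm)
      (b4 X hm)).trans ?_
    gcongr
    exact norm_le_pi_norm (Z X Y - Z' X Y) 2
  · filter_upwards [hb.dY, hb'.dY, hZ.eq_F', hZ'.eq_F', hZ.wave.eq_XY, hZ'.wave.eq_XY]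
      with Y b3 b4 e1 e2 d1 d2
    filter_upwards [hb.dX, hb'.dX, e1, e2, d1, d2] with X b1 b2 e1 e2 d1 d2 hm
    refine ⟨_, d1.sub d2, ?_⟩
    rw [e1 hm, e2 hm]
    refine (hlip _ _ _ _ _ _ (hb.U X Y hm) (hb'.U X Y hm) (b1 Y hm) (b2 Y hm) (b3 X hm)
      (b4 X hm)).trans ?_
    gcongr
    exact norm_le_pi_norm (Z X Y - Z' X Y) 2
  · intro X
    filter_upwards [hZ.wave.hasDerivAt_Y, hZ'.wave.hasDerivAt_Y] with Y h1 h2 _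
    exact ⟨_, (h1 X).sub (h2 X), le_rfl⟩

end existence

/-! ### Global solutions -/

section global

variable {c : ℝ → ℝ} {κ : ℝ} {β α : ℝ → ℝ} {V W ζ ω : ℝ → Vec5} {C : ℝ} {Z Z' : ℝ → ℝ → Vec5}

theorem lipschitzOnWith_congr {A E : Type*} [PseudoEMetricSpace A] [PseudoEMetricSpace E]
    {f g : A → E} {s : Set A} {L : ℝ≥0} (h : LipschitzOnWith L f s) (he : ∀ x ∈ s, g x = f x) :
    LipschitzOnWith L g s := fun x hx y hy => by
  rw [he x hx, he y hy]; exact h hx hy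

/-- A global solution of the system that satisfies the algebraic relations. -/
structure IsGlobal (c : ℝ → ℝ) (Z : ℝ → ℝ → Vec5) : Prop where
  wave : IsWave (waveF c) Z
  rel : RelOn c 1 Z univ

theorem IsGlobal.solvesOn (h : IsGlobal c Z) (Ω : Set (ℝ × ℝ)) : SolvesOn c (waveF c) Z Ω :=
  ⟨h.wave, .of_forall fun _ => .of_forall fun _ _ => rfl,
    .of_forall fun _ => .of_forall fun _ _ => rfl⟩

theorem IsGlobal.relOn (h : IsGlobal c Z) (Ω : Set (ℝ × ℝ)) : RelOn c 1 Z Ω :=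
  ⟨h.rel.dX.mono fun _ h Y _ => h Y trivial, h.rel.dY.mono fun _ h X _ => h X trivial⟩

theorem mem_strip_of_abs_le {X Y L : ℝ} (h : |Y - X| ≤ L) :
    ∃ σ : ℝ, σ ^ 2 = 1 ∧ (X, Y) ∈ strip β σ L := by
  obtain ⟨σ, hσ, hm⟩ := exists_side β X Y
  refine ⟨σ, hσ, hm, ?_⟩
  simp only
  rcases mul_self_eq_one_iff.1 ((sq σ).symm.trans hσ) with rfl | rfl <;>
    linarith [abs_le.1 h]

theorem mem_strip_one_or_neg_one {X Y L : ℝ} (h : |Y - X| ≤ L) :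
    (X, Y) ∈ strip β 1 L ∨ (X, Y) ∈ strip β (-1) L := by
  obtain ⟨σ, hσ, hm⟩ := mem_strip_of_abs_le (β := β) h
  rcases mul_self_eq_one_iff.1 ((sq σ).symm.trans hσ) with rfl | rfl
  exacts [.inl hm, .inr hm]

/-- Each point lies in a strip, and solutions with the same data agree on strips. -/
theorem IsData.global_unique (hd : IsData β α V W ζ ω C) (hs : IsSpeed c κ)
    (ha : Attains c β α V W ζ ω Z) (ha' : Attains c β α V W ζ ω Z') (hZ : IsGlobal c Z)
    (hZ' : IsGlobal c Z') : Z = Z' := by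
  ext1 X; ext1 Y
  obtain ⟨σ, hσ, hm⟩ := mem_strip_of_abs_le (β := β) (le_refl |Y - X|)
  exact hd.eq_on_strip hs (abs_nonneg _) ha ha' hσ (hZ.solvesOn _) (hZ'.solvesOn _) (hZ.relOn _)
    (hZ'.relOn _) hm

/-- A field that coincides near each point with a member of a sequence of solutions is a
solution. -/
theorem isGlobal_of_local {F : ℕ → Vec5 → Vec5 → Vec5 → Vec5} {Zn : ℕ → ℝ → ℝ → Vec5}
    (hw : ∀ n, IsWave (F n) (Zn n)) (heq : ∀ (n : ℕ) (X Y : ℝ), |Y - X| < n → Z X Y = Zn n X Y)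
    (hs : ∀ n : ℕ, SolvesOn c (F n) (Zn n) {p | |p.2 - p.1| ≤ n})
    (hr : ∀ n : ℕ, RelOn c 1 (Zn n) {p | |p.2 - p.1| ≤ n}) : IsGlobal c Z := by
  have evX : ∀ (n : ℕ) (X Y : ℝ), |Y - X| < n → (fun ξ => Z ξ Y) =ᶠ[𝓝 X] fun ξ => Zn n ξ Y := by
    intro n X Y h
    have : ∀ᶠ ξ in 𝓝 X, |Y - ξ| < n :=
      (by fun_prop : Continuous fun ξ => |Y - ξ|).continuousAt.eventually_lt_const h
    exact this.mono fun ξ hξ => heq n ξ Y hξ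
  have evY : ∀ (n : ℕ) (X Y : ℝ), |Y - X| < n → (fun η => Z X η) =ᶠ[𝓝 Y] fun η => Zn n X η := by
    intro n X Y h
    have : ∀ᶠ η in 𝓝 Y, |η - X| < n :=
      (by fun_prop : Continuous fun η => |η - X|).continuousAt.eventually_lt_const h
    exact this.mono fun η hη => heq n X η hη
  have eX : ∀ (n : ℕ) (X Y : ℝ), |Y - X| < n → dX Z X Y = dX (Zn n) X Y := fun n X Y h =>
    (evX n X Y h).deriv_eq
  have eY : ∀ (n : ℕ) (X Y : ℝ), |Y - X| < n → dY Z X Y = dY (Zn n) X Y := fun n X Y h =>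
    (evY n X Y h).deriv_eq
  have evXY : ∀ (n : ℕ) (X Y : ℝ), |Y - X| < n → dX Z X =ᶠ[𝓝 Y] dX (Zn n) X := by
    intro n X Y h
    have : ∀ᶠ η in 𝓝 Y, |η - X| < n :=
      (by fun_prop : Continuous fun η => |η - X|).continuousAt.eventually_lt_const h
    exact this.mono fun η hη => eX n X η hη
  have evYX : ∀ (n : ℕ) (X Y : ℝ), |Y - X| < n →
      (fun ξ => dY Z ξ Y) =ᶠ[𝓝 X] fun ξ => dY (Zn n) ξ Y := by
    intro n X Y h
    have : ∀ᶠ ξ in 𝓝 X, |Y - ξ| < n :=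
      (by fun_prop : Continuous fun ξ => |Y - ξ|).continuousAt.eventually_lt_const h
    exact this.mono fun ξ hξ => eY n ξ Y hξ
  have hR : ∀ R : ℝ, ∃ n : ℕ, ∀ X ∈ Icc (-R) R, ∀ Y ∈ Icc (-R) R, |Y - X| < n := by
    intro R
    obtain ⟨n, hn⟩ := exists_nat_gt (R + R)
    exact ⟨n, fun X hX Y hY => (abs_sub _ _).trans_lt
      ((add_le_add (abs_le.2 hY) (abs_le.2 hX)).trans_lt hn)⟩
  refine ⟨⟨fun R => ?_, ?_, ?_, fun R => ?_, fun R => ?_, ?_, ?_⟩, ?_, ?_⟩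
  · obtain ⟨n, hn⟩ := hR R
    obtain ⟨L, hL⟩ := (hw n).lip R
    exact ⟨L, lipschitzOnWith_congr hL fun p hp => heq n _ _ (hn _ hp.1 _ hp.2)⟩
  · filter_upwards [ae_all_iff.2 fun n => (hw n).diff_X] with X h Y
    obtain ⟨n, hn⟩ := exists_nat_gt |Y - X|
    exact (h n Y).congr_of_eventuallyEq (evX n X Y hn)
  · filter_upwards [ae_all_iff.2 fun n => (hw n).diff_Y] with Y h X
    obtain ⟨n, hn⟩ := exists_nat_gt |Y - X|
    exact (h n X).congr_of_eventuallyEq (evY n X Y hn)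
  · obtain ⟨n, hn⟩ := hR R
    obtain ⟨L, hL⟩ := (hw n).dX_lip R
    exact ⟨L, hL.mono fun X h hX => lipschitzOnWith_congr (h hX) fun Y hY =>
      eX n X Y (hn X hX Y hY)⟩
  · obtain ⟨n, hn⟩ := hR R
    obtain ⟨L, hL⟩ := (hw n).dY_lip R
    exact ⟨L, hL.mono fun Y h hY => lipschitzOnWith_congr (h hY) fun X hX =>
      eY n X Y (hn X hX Y hY)⟩
  · filter_upwards [ae_all_iff.2 fun n => (hw n).eq_YX, ae_all_iff.2 fun n => (hs n).eq_F]
      with X h1 h2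
    filter_upwards [ae_all_iff.2 h1, ae_all_iff.2 h2] with Y h1 h2
    obtain ⟨n, hn⟩ := exists_nat_gt |Y - X|
    rw [waveF, heq n X Y hn, eX n X Y hn, eY n X Y hn, ← h2 n hn.le]
    exact (h1 n).congr_of_eventuallyEq (evXY n X Y hn)
  · filter_upwards [ae_all_iff.2 fun n => (hw n).eq_XY, ae_all_iff.2 fun n => (hs n).eq_F']
      with Y h1 h2
    filter_upwards [ae_all_iff.2 h1, ae_all_iff.2 h2] with X h1 h2
    obtain ⟨n, hn⟩ := exists_nat_gt |Y - X|
    rw [waveF, heq n X Y hn, eX n X Y hn, eY n X Y hn, ← h2 n hn.le]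
    exact (h1 n).congr_of_eventuallyEq (evYX n X Y hn)
  · filter_upwards [ae_all_iff.2 fun n => (hr n).dX] with X h Y _
    obtain ⟨n, hn⟩ := exists_nat_gt |Y - X|
    rw [heq n X Y hn, eX n X Y hn]
    exact h n Y hn.le
  · filter_upwards [ae_all_iff.2 fun n => (hr n).dY] with Y h X _
    obtain ⟨n, hn⟩ := exists_nat_gt |Y - X|
    rw [heq n X Y hn, eY n X Y hn]
    exact h n X hn.le

/-- The solutions on the strips `|Y - X| ≤ n` agree where they are both defined, and form a global
solution. -/
theorem IsData.exists_global (hd : IsData β α V W ζ ω C) (hs : IsSpeed c κ)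
    (hV : ∀ᵐ X, Rel c 1 (ζ X 2) (V X)) (hW : ∀ᵐ Y, Rel c (-1) (ω Y 2) (W Y)) :
    ∃ Z, Attains c β α V W ζ ω Z ∧ IsGlobal c Z := by
  choose F Zn ha hsol using fun n : ℕ =>
    hd.exists_solution_strip hs hV hW (L := (n : ℝ)) n.cast_nonneg
  have hC := hd.nonneg
  have h1 : ((1 : ℝ)) ^ 2 = 1 := by norm_num
  have h2 : ((-1 : ℝ)) ^ 2 = 1 := by norm_num
  have heq : ∀ n m : ℕ, n ≤ m → ∀ X Y : ℝ, |Y - X| ≤ n → Zn n X Y = Zn m X Y := by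
    intro n m hnm X Y h
    obtain ⟨σ, hσ, hm⟩ := mem_strip_of_abs_le (β := β) h
    have hsub : strip β σ n ⊆ strip β σ m := fun p hp => ⟨hp.1, hp.2.trans (by exact_mod_cast hnm)⟩
    obtain ⟨⟨w, e, e'⟩, r⟩ := hsol m σ hσ
    refine hd.eq_on_strip hs n.cast_nonneg (ha n) (ha m) hσ (hsol n σ hσ).1
      (F' := F m) ⟨w, ?_, ?_⟩ (hsol n σ hσ).2 ⟨?_, ?_⟩ hm
    · exact e.mono fun X h => h.mono fun Y h hm => h (hsub hm)
    · exact e'.mono fun X h => h.mono fun Y h hm => h (hsub hm)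
    · exact r.dX.mono fun X h Y hm => h Y (hsub hm)
    · exact r.dY.mono fun X h Y hm => h Y (hsub hm)
  let Z : ℝ → ℝ → Vec5 := fun X Y => Zn ⌈|Y - X|⌉₊ X Y
  have hZ : ∀ (n : ℕ) (X Y : ℝ), |Y - X| ≤ n → Z X Y = Zn n X Y := fun n X Y h =>
    heq _ n (Nat.ceil_le.2 h) X Y (Nat.le_ceil _)
  -- the whole curve lies in the interior of one of these strips
  obtain ⟨N, hN⟩ := exists_nat_gt C
  have near_β : ∀ X, |β X - X| < N := fun X => (hd.near_β X).trans_lt hN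
  have near_α : ∀ Y, |Y - α Y| < N := fun Y => by
    rw [abs_sub_comm]; exact (hd.near_α Y).trans_lt hN
  refine ⟨Z, ⟨fun X => ?_, fun Y => ?_, ?_, ?_, hV, hW⟩, isGlobal_of_local (F := F) (Zn := Zn)
    (fun n => (hsol n 1 h1).1.wave) (fun n X Y h => hZ n X Y h.le) (fun n => ?_) fun n => ?_⟩
  · rw [hZ N X _ (near_β X).le, (ha N).eq_ζ]
  · rw [hZ N _ Y (near_α Y).le, (ha N).eq_ω]
  · filter_upwards [(ha N).eq_V] with X h
    rw [← h]
    refine Filter.EventuallyEq.deriv_eq ?_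
    have : ∀ᶠ ξ in 𝓝 X, |β X - ξ| < N :=
      (by fun_prop : Continuous fun ξ => |β X - ξ|).continuousAt.eventually_lt_const (near_β X)
    exact this.mono fun ξ hξ => hZ N ξ _ hξ.le
  · filter_upwards [(ha N).eq_W] with Y h
    rw [← h]
    refine Filter.EventuallyEq.deriv_eq ?_
    have : ∀ᶠ η in 𝓝 Y, |η - α Y| < N :=
      (by fun_prop : Continuous fun η => |η - α Y|).continuousAt.eventually_lt_const (near_α Y)
    exact this.mono fun η hη => hZ N _ η hη.le
  · refine ⟨(hsol n 1 h1).1.wave, ?_, ?_⟩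
    · filter_upwards [(hsol n 1 h1).1.eq_F, (hsol n (-1) h2).1.eq_F] with X e1 e2
      filter_upwards [e1, e2] with Y e1 e2 hm
      exact (mem_strip_one_or_neg_one hm).elim e1 e2
    · filter_upwards [(hsol n 1 h1).1.eq_F', (hsol n (-1) h2).1.eq_F'] with Y e1 e2
      filter_upwards [e1, e2] with X e1 e2 hm
      exact (mem_strip_one_or_neg_one hm).elim e1 e2
  · refine ⟨?_, ?_⟩
    · filter_upwards [(hsol n 1 h1).2.dX, (hsol n (-1) h2).2.dX] with X e1 e2 Y hm
      exact (mem_strip_one_or_neg_one hm).elim (e1 Y) (e2 Y)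
    · filter_upwards [(hsol n 1 h1).2.dY, (hsol n (-1) h2).2.dY] with Y e1 e2 X hm
      exact (mem_strip_one_or_neg_one hm).elim (e1 X) (e2 X)

/-! ### Comparison with the local definition -/

theorem exists_Icc_mem (X Y : ℝ) :
    ∃ n : ℕ, X ∈ Icc (-(n + 1 : ℝ)) (n + 1) ∧ Y ∈ Icc (-(n + 1 : ℝ)) (n + 1) := by
  obtain ⟨n, hn⟩ := exists_nat_ge (max |X| |Y|)
  exact ⟨n, abs_le.1 ((le_max_left _ _).trans (hn.trans (by linarith))),
    abs_le.1 ((le_max_right _ _).trans (hn.trans (by linarith)))⟩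

theorem Icc_subset_nat (R : ℝ) : ∃ n : ℕ, Icc (-R) R ⊆ Icc (-(n + 1 : ℝ)) (n + 1) := by
  obtain ⟨n, hn⟩ := exists_nat_ge R
  exact ⟨n, Icc_subset_Icc (by linarith) (by linarith)⟩

/-- The definition of `ℋ` by rectangles gives the statements that hold for almost every `X` and
all `Y` at once: take countably many squares. -/
theorem isGlobal_of_memHOn
    (h : ∀ Xl Xr Yl Yr : ℝ, Xl < Xr → Yl < Yr → MemHOn c Z Xl Xr Yl Yr) : IsGlobal c Z := by
  have hn : ∀ n : ℕ, MemHOn c Z (-(n + 1)) (n + 1) (-(n + 1)) (n + 1) := fun n =>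
    h _ _ _ _ (by linarith [n.cast_nonneg (α := ℝ)]) (by linarith [n.cast_nonneg (α := ℝ)])
  refine ⟨⟨fun R => ?_, ?_, ?_, fun R => ?_, fun R => ?_, ?_, ?_⟩, ?_, ?_⟩
  · obtain ⟨n, hR⟩ := Icc_subset_nat R
    obtain ⟨L, hL⟩ := (hn n).sol.lipschitz
    exact ⟨L, hL.mono (prod_mono hR hR)⟩
  · choose L hL using fun n => (hn n).sol.dX_reg
    filter_upwards [ae_all_iff.2 hL] with X h Y
    obtain ⟨n, hX, hY⟩ := exists_Icc_mem X Y
    exact (h n hX).1 Y hY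
  · choose L hL using fun n => (hn n).sol.dY_reg
    filter_upwards [ae_all_iff.2 hL] with Y h X
    obtain ⟨n, hX, hY⟩ := exists_Icc_mem X Y
    exact (h n hY).1 X hX
  · obtain ⟨n, hR⟩ := Icc_subset_nat R
    obtain ⟨L, hL⟩ := (hn n).sol.dX_reg
    exact ⟨L, hL.mono fun X h hX => (h (hR hX)).2.mono hR⟩
  · obtain ⟨n, hR⟩ := Icc_subset_nat R
    obtain ⟨L, hL⟩ := (hn n).sol.dY_reg
    exact ⟨L, hL.mono fun X h hX => (h (hR hX)).2.mono hR⟩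
  · filter_upwards [ae_all_iff.2 fun n => (hn n).sol.eq_YX] with X h
    filter_upwards [ae_all_iff.2 fun n => eventually_imp_distrib_left.2 (h n)] with Y h
    obtain ⟨n, hX, hY⟩ := exists_Icc_mem X Y
    exact h n hX hY
  · filter_upwards [ae_all_iff.2 fun n => (hn n).sol.eq_XY] with Y h
    filter_upwards [ae_all_iff.2 fun n => eventually_imp_distrib_left.2 (h n)] with X h
    obtain ⟨n, hX, hY⟩ := exists_Icc_mem X Y
    exact h n hY hX
  · filter_upwards [ae_all_iff.2 fun n => (hn n).rel_X] with X h Y _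
    obtain ⟨n, hX, hY⟩ := exists_Icc_mem X Y
    obtain ⟨h1, h2, h3, h4, h5, h6⟩ := h n hX Y hY
    exact ⟨by rw [h1]; ring, by rw [h2]; ring, h3, h4, h5, h6⟩
  · filter_upwards [ae_all_iff.2 fun n => (hn n).rel_Y] with Y h X _
    obtain ⟨n, hX, hY⟩ := exists_Icc_mem X Y
    obtain ⟨h1, h2, h3, h4, h5, h6⟩ := h n hY X hX
    exact ⟨by rw [h1]; ring, by rw [h2]; ring, h3, h4, h5, h6⟩

theorem IsGlobal.memHOn (h : IsGlobal c Z) (Xl Xr Yl Yr : ℝ) : MemHOn c Z Xl Xr Yl Yr := by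
  obtain ⟨R, hX, hY⟩ : ∃ R : ℝ, Icc Xl Xr ⊆ Icc (-R) R ∧ Icc Yl Yr ⊆ Icc (-R) R := by
    refine ⟨max (max |Xl| |Xr|) (max |Yl| |Yr|), Icc_subset_Icc ?_ ?_, Icc_subset_Icc ?_ ?_⟩
    · exact (neg_le_neg ((le_max_left _ _).trans (le_max_left _ _))).trans (neg_abs_le _)
    · exact (le_abs_self _).trans ((le_max_right _ _).trans (le_max_left _ _))
    · exact (neg_le_neg ((le_max_left _ _).trans (le_max_right _ _))).trans (neg_abs_le _)
    · exact (le_abs_self _).trans ((le_max_right _ _).trans (le_max_right _ _))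
  refine ⟨⟨?_, ?_, ?_, ?_, ?_⟩, ?_, ?_⟩
  · obtain ⟨L, hL⟩ := h.wave.lip R
    exact ⟨L, hL.mono (prod_mono hX hY)⟩
  · obtain ⟨L, hL⟩ := h.wave.dX_lip R
    refine ⟨L, ?_⟩
    filter_upwards [hL, h.wave.diff_X] with X h1 h2 hm
    exact ⟨fun Y _ => h2 Y, (h1 (hX hm)).mono hY⟩
  · obtain ⟨L, hL⟩ := h.wave.dY_lip R
    refine ⟨L, ?_⟩
    filter_upwards [hL, h.wave.diff_Y] with Y h1 h2 hm
    exact ⟨fun X _ => h2 X, (h1 (hY hm)).mono hX⟩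
  · exact h.wave.eq_YX.mono fun X h _ => h.mono fun Y h _ => h
  · exact h.wave.eq_XY.mono fun X h _ => h.mono fun Y h _ => h
  · filter_upwards [h.rel.dX] with X h _ Y _
    have r := h Y trivial
    exact ⟨by rw [r.tx]; ring, by rw [r.KJ]; ring, r.energy, r.x_nonneg, r.J_nonneg, r.pos⟩
  · filter_upwards [h.rel.dY] with Y h _ X _
    have r := h X trivial
    exact ⟨by rw [r.tx]; ring, by rw [r.KJ]; ring, r.energy, r.x_nonneg, r.J_nonneg, r.pos⟩

end global

/-! ### Data on curves as data for the Goursat problem -/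

section curveData

variable {c : ℝ → ℝ} {κ : ℝ} {Θ : CurveData}

namespace CurveData

/-- The curve of `Θ` as a graph over the `X`-axis. -/
abbrev β (Θ : CurveData) : ℝ → ℝ := curveBeta Θ.X Θ.Y

/-- The curve of `Θ` as a graph over the `Y`-axis. -/
abbrev α (Θ : CurveData) : ℝ → ℝ := curveAlpha Θ.X Θ.Y

/-- The value of `Z` at the point of the curve with abscissa `X`. -/
abbrev ζ (Θ : CurveData) : ℝ → Vec5 := fun X => Θ.Z (leftInv Θ.X X)

/-- The value of `Z` at the point of the curve with ordinate `Y`. -/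
abbrev ω (Θ : CurveData) : ℝ → Vec5 := fun Y => Θ.Z (rightInv Θ.Y Y)

end CurveData

theorem aeeq_measurable (V : ℝ →ₘ[volume] (Fin 5 → ℝ)) : Measurable V :=
  V.stronglyMeasurable.measurable

theorem measurable_clampVec (M : ℝ) : Measurable (clampVec M) :=
  measurable_pi_lambda _ fun i => ((clamp_lip M).continuous.measurable).comp (measurable_pi_apply i)

theorem ae_abs_le_of_memLp_top {f : ℝ → ℝ} (h : MemLp f ∞ volume) : ∃ M, ∀ᵐ x, |f x| ≤ M := by
  refine ⟨(eLpNorm f ∞ volume).toReal, ?_⟩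
  filter_upwards [ae_le_eLpNormEssSup (f := f) (μ := volume)] with x hx
  rw [← eLpNorm_exponent_top] at hx
  have := ENNReal.toReal_mono h.eLpNorm_ne_top hx
  simpa using this

theorem ae_norm_le_of_memLp_top {V : ℝ → Vec5}
    (h : ∀ i, MemLp (fun X => (V X - halfX) i) ∞ volume) : ∃ M, ∀ᵐ X, ‖V X‖ ≤ M := by
  choose M hM using fun i => ae_abs_le_of_memLp_top (h i)
  refine ⟨∑ i, |M i| + ‖halfX‖, ?_⟩
  filter_upwards [ae_all_iff.2 hM] with X hX
  have h1 : ‖V X - halfX‖ ≤ ∑ i, |M i| := by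
    rw [pi_norm_le_iff_of_nonneg (by positivity)]
    exact fun i => ((hX i).trans (le_abs_self _)).trans
      (Finset.single_le_sum (f := fun i => |M i|) (fun j _ => abs_nonneg _) (Finset.mem_univ i))
  calc ‖V X‖ = ‖(V X - halfX) + halfX‖ := by rw [sub_add_cancel]
    _ ≤ _ := (norm_add_le _ _).trans (by gcongr)

theorem MemG.paramX (h : MemG c Θ) : IsParam Θ.X := h.curve.isParam

theorem MemG.paramY (h : MemG c Θ) : IsParam Θ.Y := (isCurve_comm h.curve).isParam

theorem LipschitzWith.ae_hasDerivAt_vec {Z : ℝ → Vec5} {L : ℝ≥0} (hZ : LipschitzWith L Z) :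
    ∀ᵐ s, HasDerivAt Z (deriv Z s) s :=
  hZ.ae_differentiableAt.mono fun _ h => h.hasDerivAt

/-- The derivative of `𝒵` in coordinates, for any representatives of `𝒱` and `𝒲`: a change on a null
set is only seen where `𝒳` or `𝒴` has derivative zero. -/
theorem MemG.compat_ae {V W : ℝ → Vec5} (h : MemG c Θ) (hV : ∀ᵐ X, V X = Θ.V X)
    (hW : ∀ᵐ Y, W Y = Θ.W Y) :
    ∀ᵐ s, ∀ i, HasDerivAt (fun s => Θ.Z s i)
      (deriv Θ.X s * V (Θ.X s) i + deriv Θ.Y s * W (Θ.Y s) i) s := by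
  obtain ⟨L, hL⟩ := h.Z_lipschitz
  filter_upwards [h.compat, LipschitzWith.ae_hasDerivAt_vec hL, h.paramX.ae_comp hV,
    h.paramY.ae_comp hW] with s h1 h2 h3 h4 i
  have h5 := hasDerivAt_pi.1 h2 i
  rw [h1, Pi.add_apply, Pi.smul_apply, Pi.smul_apply, smul_eq_mul, smul_eq_mul] at h5
  convert! h5 using 2
  · by_cases h6 : deriv Θ.X s = 0
    · rw [h6, zero_mul, zero_mul]
    · rw [h3 h6]
  · by_cases h6 : deriv Θ.Y s = 0
    · rw [h6, zero_mul, zero_mul]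
    · rw [h4 h6]

theorem MemG.ae_bdd (h : MemG c Θ) : ∃ M, (∀ᵐ X, ‖Θ.V X‖ ≤ M) ∧ ∀ᵐ Y, ‖Θ.W Y‖ ≤ M := by
  obtain ⟨M1, h1⟩ := ae_norm_le_of_memLp_top h.V_bdd
  obtain ⟨M2, h2⟩ := ae_norm_le_of_memLp_top h.W_bdd
  exact ⟨max M1 M2, h1.mono fun _ h => h.trans (le_max_left _ _),
    h2.mono fun _ h => h.trans (le_max_right _ _)⟩

theorem MemG.exists_near (h : MemG c Θ) :
    ∃ M, 0 ≤ M ∧ ∀ s, |Θ.X s - s| ≤ M ∧ |Θ.Y s - s| ≤ M := by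
  obtain ⟨M1, h1⟩ := h.paramX.near
  obtain ⟨M2, h2⟩ := h.paramY.near
  exact ⟨max M1 M2, ((abs_nonneg _).trans (h1 0)).trans (le_max_left _ _),
    fun s => ⟨(h1 s).trans (le_max_left _ _), (h2 s).trans (le_max_right _ _)⟩⟩

/-- Elements of `𝒢` give data for the Goursat problem, after a change of `𝒱` and `𝒲` on a null
set. -/
theorem MemG.exists_isData (h : MemG c Θ) : ∃ V W C, IsData Θ.β Θ.α V W Θ.ζ Θ.ω C ∧
    (∀ᵐ X, V X = Θ.V X) ∧ ∀ᵐ Y, W Y = Θ.W Y := by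
  obtain ⟨M, hV, hW⟩ := h.ae_bdd
  obtain ⟨N, hN, hn⟩ := h.exists_near
  obtain ⟨L, hL⟩ := h.Z_lipschitz
  obtain ⟨B, hB⟩ := h.Z_bdd
  have hX := h.paramX
  have hY := h.paramY
  -- one constant for all the bounds in `IsData`
  set C : ℝ := |M| + 2 * N + |B| + L * (1 + 2 * N) with hC
  have hMC : |M| ≤ C := by
    have : (0 : ℝ) ≤ L := L.coe_nonneg
    rw [hC]; linarith [abs_nonneg B, mul_nonneg this (by linarith : (0 : ℝ) ≤ 1 + 2 * N)]
  have hBC : |B| ≤ C := by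
    have : (0 : ℝ) ≤ L := L.coe_nonneg
    rw [hC]; linarith [abs_nonneg M, mul_nonneg this (by linarith : (0 : ℝ) ≤ 1 + 2 * N)]
  have hNC : N + N ≤ C := by
    have : (0 : ℝ) ≤ L := L.coe_nonneg
    rw [hC]; linarith [abs_nonneg M, abs_nonneg B,
      mul_nonneg this (by linarith : (0 : ℝ) ≤ 1 + 2 * N)]
  have hLC : L * (1 + 2 * N) ≤ C := by
    rw [hC]; linarith [abs_nonneg M, abs_nonneg B]
  have hC0 : 0 ≤ C := (abs_nonneg _).trans hMC
  have hVe : ∀ᵐ X, clampVec C (Θ.V X) = Θ.V X :=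
    hV.mono fun X hX => clampVec_eq (hX.trans ((le_abs_self _).trans hMC))
  have hWe : ∀ᵐ X, clampVec C (Θ.W X) = Θ.W X :=
    hW.mono fun X hX => clampVec_eq (hX.trans ((le_abs_self _).trans hMC))
  have hXY : ∀ s, |Θ.Y s - Θ.X s| ≤ C := fun s => by
    rw [show Θ.Y s - Θ.X s = (Θ.Y s - s) - (Θ.X s - s) by ring]
    exact (abs_sub _ _).trans ((add_le_add (hn s).2 (hn s).1).trans hNC)
  have hU : ∀ s, |Θ.Z s 2| ≤ C := fun s => by
    have := hB s 2
    simp only [Pi.sub_apply, Matrix.cons_val, sub_zero] at this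
    exact this.trans ((le_abs_self _).trans hBC)
  -- clamping makes the almost everywhere bounds of `𝒱` and `𝒲` hold everywhere
  refine ⟨fun X => clampVec C (Θ.V X), fun Y => clampVec C (Θ.W Y), C,
    ⟨fun x y => curve_galois hX hY x y, fun x => ?_, fun y => ?_,
    (measurable_clampVec C).comp (aeeq_measurable _), (measurable_clampVec C).comp
    (aeeq_measurable _), hL.continuous.measurable.comp hX.leftInv_mono.measurable,
    fun _ => norm_clampVec_le hC0 _, fun _ => norm_clampVec_le hC0 _, fun x y => ?_,
    fun _ => hU _, fun _ => hU _, fun x y => ?_⟩, hVe, hWe⟩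
  · have := hXY (leftInv Θ.X x)
    rwa [hX.apply_leftInv] at this
  · have := hXY (rightInv Θ.Y y)
    rwa [hY.apply_rightInv, abs_sub_comm] at this
  · have mV : Measurable fun X => clampVec C (Θ.V X) :=
      (measurable_clampVec C).comp (aeeq_measurable _)
    have mW : Measurable fun X => clampVec C (Θ.W X) :=
      (measurable_clampVec C).comp (aeeq_measurable _)
    have bV := locBdd_of_le fun X => norm_clampVec_le hC0 (Θ.V X)
    have bW := locBdd_of_le fun X => norm_clampVec_le hC0 (Θ.W X)
    have key := h.compat_ae hVe hWe
    have hloc : ∀ {g : ℝ → Vec5} (i : Fin 5), LocallyIntegrable g →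
        LocallyIntegrable fun x => g x i := fun {g} i hg => by
      rw [locallyIntegrable_iff] at hg ⊢
      exact fun k hk => Integrable.eval (hg k hk) i
    ext i
    have := curve_integral hX hY (hL.locallyLipschitz.coord i)
      (hloc i (bV.locallyIntegrable mV)) (hloc i (bW.locallyIntegrable mW))
      (key.mono fun s hs => (hs i).deriv) (leftInv Θ.X x) (rightInv Θ.Y y)
    rw [hX.apply_leftInv, hY.apply_rightInv] at this
    rw [Pi.sub_apply, this, Pi.add_apply]
    congr 1
    · exact (ContinuousLinearMap.proj (R := ℝ) (φ := fun _ : Fin 5 => ℝ)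
        i).intervalIntegral_comp_comm
        (bV.intervalIntegrable mV _ _)
    · exact (ContinuousLinearMap.proj (R := ℝ) (φ := fun _ : Fin 5 => ℝ)
        i).intervalIntegral_comp_comm
        (bW.intervalIntegrable mW _ _)
  · rw [← dist_eq_norm]
    refine (hL.dist_le_mul _ _).trans ?_
    have h1 := hn (rightInv Θ.Y y)
    have h2 := hn (leftInv Θ.X x)
    rw [hY.apply_rightInv] at h1
    rw [hX.apply_leftInv] at h2
    have h3 : dist (rightInv Θ.Y y) (leftInv Θ.X x) ≤ |y - x| + 2 * N := by
      rw [Real.dist_eq]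
      have a1 := abs_le.1 h1.2
      have a2 := abs_le.1 h2.1
      have a3 := abs_le.1 (le_refl |y - x|)
      exact abs_le.2 ⟨by linarith, by linarith⟩
    have hL0 : (0 : ℝ) ≤ L := L.coe_nonneg
    calc L * dist (rightInv Θ.Y y) (leftInv Θ.X x) ≤ L * (|y - x| + 2 * N) := by gcongr
      _ ≤ L * (1 + 2 * N) * (1 + |y - x|) := by
        nlinarith [mul_nonneg hL0 hN, mul_nonneg (mul_nonneg hL0 hN) (abs_nonneg (y - x)),
          abs_nonneg (y - x)]
      _ ≤ _ := by gcongr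

theorem MemG.rel_V' (h : MemG c Θ) : ∀ᵐ X, Rel c 1 (Θ.ζ X 2) (Θ.V X) := by
  obtain ⟨δ, hδ, hV⟩ := h.V_inv
  filter_upwards [h.rel_V, h.V_nonneg, hV] with X h1 h2 h3
  obtain ⟨r1, r2, r3⟩ := h1 _ (h.paramX.apply_leftInv X)
  exact ⟨by rw [r2, one_mul], by rw [r3, one_mul], r1, h2.1, h2.2, hδ.trans_le h3⟩

theorem MemG.rel_W' (h : MemG c Θ) : ∀ᵐ Y, Rel c (-1) (Θ.ω Y 2) (Θ.W Y) := by
  obtain ⟨δ, hδ, hV⟩ := h.W_inv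
  filter_upwards [h.rel_W, h.W_nonneg, hV] with X h1 h2 h3
  obtain ⟨r1, r2, r3⟩ := h1 _ (h.paramY.apply_rightInv X)
  exact ⟨by rw [r2]; ring, by rw [r3]; ring, r1, h2.1, h2.2, hδ.trans_le h3⟩

theorem IsBullet.attains {V W : ℝ → Vec5} {Z : ℝ → ℝ → Vec5} (hb : IsBullet Z Θ) (h : MemG c Θ)
    (hV : ∀ᵐ X, V X = Θ.V X) (hW : ∀ᵐ Y, W Y = Θ.W Y) :
    Attains c Θ.β Θ.α V W Θ.ζ Θ.ω Z where
  eq_ζ X := by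
    rw [CurveData.ζ, hb.eq_Z (leftInv Θ.X X), h.paramX.apply_leftInv]
    rfl
  eq_ω Y := by
    rw [CurveData.ω, hb.eq_Z (rightInv Θ.Y Y), h.paramY.apply_rightInv]
    rfl
  eq_V := by
    filter_upwards [hb.eq_V, hV] with X h1 h2
    rw [h2, h1 _ (h.paramX.apply_leftInv X)]; rfl
  eq_W := by
    filter_upwards [hb.eq_W, hW] with Y h1 h2
    rw [h2, h1 _ (h.paramY.apply_rightInv Y)]; rfl
  rel_V := by filter_upwards [h.rel_V', hV] with X h1 h2; rwa [h2]
  rel_W := by filter_upwards [h.rel_W', hW] with X h1 h2; rwa [h2]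

/-- The parameters that are found from the abscissa or from the ordinate of their point are
dense. -/
theorem dense_eq_leftInv_or {X Y : ℝ → ℝ} (hX : IsParam X) (hXY : ∀ s, X s + Y s = 2 * s)
    (hY : IsParam Y) : Dense {s | s = leftInv X (X s) ∨ s = rightInv Y (Y s)} := by
  intro s
  by_cases hs : s = leftInv X (X s)
  · exact subset_closure (.inl hs)
  have h1 : leftInv X (X s) < s := lt_of_le_of_ne (hX.le_iff_leftInv_le.1 le_rfl) (Ne.symm hs)
  have h2 : Ioo (leftInv X (X s)) s ⊆ {s | s = leftInv X (X s) ∨ s = rightInv Y (Y s)} := by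
    intro r hr
    right
    refine le_antisymm (hY.le_iff_le_rightInv.1 le_rfl) ?_
    by_contra! h3
    obtain ⟨q, hq1, hq2⟩ := exists_between (lt_min h3 hr.2)
    have e1 : X q = X s := le_antisymm (hX.mono (hq2.le.trans (min_le_right _ _)))
      (hX.le_iff_leftInv_le.2 (hr.1.le.trans hq1.le))
    have e2 : X r = X s := le_antisymm (hX.mono hr.2.le) (hX.le_iff_leftInv_le.2 hr.1.le)
    have e3 : Y q ≤ Y r := hY.le_iff_le_rightInv.2 (hq2.le.trans (min_le_left _ _))
    linarith [hXY q, hXY r]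
  refine closure_mono h2 ?_
  rw [closure_Ioo h1.ne]
  exact ⟨h1.le, le_rfl⟩

theorem IsWave.continuous {F : Vec5 → Vec5 → Vec5 → Vec5} {Z : ℝ → ℝ → Vec5} (h : IsWave F Z) :
    Continuous fun p : ℝ × ℝ => Z p.1 p.2 := by
  rw [continuous_iff_continuousAt]
  rintro ⟨X, Y⟩
  obtain ⟨L, hL⟩ := h.lip (max |X| |Y| + 1)
  refine hL.continuousOn.continuousAt (prod_mem_nhds (Icc_mem_nhds ?_ ?_) (Icc_mem_nhds ?_ ?_))
  · have := neg_abs_le X; have := le_max_left |X| |Y|; linarith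
  · have := le_abs_self X; have := le_max_left |X| |Y|; linarith
  · have := neg_abs_le Y; have := le_max_right |X| |Y|; linarith
  · have := le_abs_self Y; have := le_max_right |X| |Y|; linarith

/-- The values on the curve are attained at the points found from their abscissa or from their
ordinate; these are dense. -/
theorem Attains.isBullet {V W : ℝ → Vec5} {Z : ℝ → ℝ → Vec5} {F : Vec5 → Vec5 → Vec5 → Vec5}
    (ha : Attains c Θ.β Θ.α V W Θ.ζ Θ.ω Z) (hZ : IsWave F Z) (h : MemG c Θ)
    (hV : ∀ᵐ X, V X = Θ.V X) (hW : ∀ᵐ Y, W Y = Θ.W Y) : IsBullet Z Θ where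
  eq_Z := by
    obtain ⟨L, hL⟩ := h.Z_lipschitz
    refine congrFun (Continuous.ext_on (dense_eq_leftInv_or h.paramX (isCurve_add h.curve) h.paramY)
      hL.continuous (hZ.continuous.comp (h.paramX.continuous.prodMk h.paramY.continuous)) ?_)
    rintro s (hs | hs)
    · have := ha.eq_ζ (Θ.X s)
      simp only [CurveData.β, curveBeta, CurveData.ζ, ← hs] at this
      exact this.symm
    · have := ha.eq_ω (Θ.Y s)
      simp only [CurveData.α, curveAlpha, CurveData.ω, ← hs] at this
      exact this.symm
  eq_V := by
    filter_upwards [ha.eq_V, hV, h.paramX.ae_unique] with X h1 h2 h3 s hs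
    rw [← h2, ← h1, CurveData.β, curveBeta, h3 s (leftInv Θ.X X) hs (h.paramX.apply_leftInv X)]
  eq_W := by
    filter_upwards [ha.eq_W, hW, h.paramY.ae_unique] with Y h1 h2 h3 s hs
    rw [← h2, ← h1, CurveData.α, curveAlpha, h3 s (rightInv Θ.Y Y) hs (h.paramY.apply_rightInv Y)]

/-- The initial value problem with data on a curve has a unique global solution. -/
theorem MemG.existsUnique_solution (hs : IsSpeed c κ) (h : MemG c Θ) :
    ∃ Z ∈ setH c, IsBullet Z Θ ∧ ∀ Z' ∈ setH c, IsBullet Z' Θ → Z' = Z := by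
  obtain ⟨V, W, C, hd, hV, hW⟩ := h.exists_isData
  have rV : ∀ᵐ X, Rel c 1 (Θ.ζ X 2) (V X) := by
    filter_upwards [h.rel_V', hV] with X h1 h2; rwa [h2]
  have rW : ∀ᵐ X, Rel c (-1) (Θ.ω X 2) (W X) := by
    filter_upwards [h.rel_W', hW] with X h1 h2; rwa [h2]
  obtain ⟨Z, ha, hZ⟩ := hd.exists_global hs rV rW
  have hb := ha.isBullet hZ.wave h hV hW
  refine ⟨Z, ⟨fun _ _ _ _ _ _ => hZ.memHOn _ _ _ _, Θ, hb, h⟩, hb, fun Z' hZ' hb' => ?_⟩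
  exact hd.global_unique hs (hb'.attains h hV hW) ha (isGlobal_of_memHOn hZ'.1) hZ

end curveData

/-! ### The leftmost zero curve -/

section leftmost

/-- The leftmost zero of `g` on the antidiagonal `X + Y = 2 s`. -/
def leftCurve (g : ℝ → ℝ → ℝ) (s : ℝ) : ℝ := sSup {X | ∀ X' < X, g X' (2 * s - X') < 0}

/-- A continuous function that increases in `X`, decreases in `Y`, and is negative far above and
positive far below the diagonal. -/
structure IsLevel (g : ℝ → ℝ → ℝ) (L : ℝ) : Prop where
  cont : Continuous fun p : ℝ × ℝ => g p.1 p.2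
  mono : ∀ Y, Monotone fun X => g X Y
  anti : ∀ X, Antitone (g X)
  pos : ∀ X Y, L ≤ X - Y → 0 < g X Y
  neg : ∀ X Y, L ≤ Y - X → g X Y < 0

variable {g : ℝ → ℝ → ℝ} {L : ℝ}

theorem leftCurve_eq {s x : ℝ} (h0 : 0 ≤ g x (2 * s - x)) (h : ∀ x' < x, g x' (2 * s - x') < 0) :
    leftCurve g s = x := by
  refine le_antisymm (csSup_le ⟨x, h⟩ fun y hy => ?_) (le_csSup ⟨x, fun y hy => ?_⟩ h) <;>
  · by_contra! hlt
    exact absurd (hy x hlt) (not_lt.2 h0)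

namespace IsLevel

theorem bddAbove (h : IsLevel g L) (s : ℝ) :
    s + L / 2 ∈ upperBounds {X | ∀ X' < X, g X' (2 * s - X') < 0} := by
  intro y hy
  by_contra! hlt
  exact absurd (hy _ hlt) (not_lt.2 (h.pos _ _ (by linarith)).le)

theorem mem (h : IsLevel g L) (s : ℝ) :
    s - L / 2 ∈ {X | ∀ X' < X, g X' (2 * s - X') < 0} :=
  fun _ hX' => h.neg _ _ (by linarith)

theorem abs_sub_le (h : IsLevel g L) (s : ℝ) : |leftCurve g s - s| ≤ L / 2 := by
  have h1 := le_csSup ⟨_, h.bddAbove s⟩ (h.mem s)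
  have h2 := csSup_le ⟨_, h.mem s⟩ (h.bddAbove s)
  rw [leftCurve]
  exact abs_le.2 ⟨by linarith, by linarith⟩

theorem neg_of_lt (h : IsLevel g L) {s x : ℝ} (hx : x < leftCurve g s) :
    g x (2 * s - x) < 0 := by
  obtain ⟨y, hy, hxy⟩ := exists_lt_of_lt_csSup ⟨_, h.mem s⟩ hx
  exact hy x hxy

theorem nonneg_of_gt (h : IsLevel g L) {s x : ℝ} (hx : leftCurve g s < x) :
    0 ≤ g x (2 * s - x) := by
  by_contra! hlt
  refine absurd (le_csSup ⟨_, h.bddAbove s⟩ (a := x) fun y hy => ?_) (not_le.2 hx)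
  exact ((h.mono _ hy.le).trans (h.anti _ (by linarith))).trans_lt hlt

theorem eq_zero (h : IsLevel g L) (s : ℝ) :
    g (leftCurve g s) (2 * s - leftCurve g s) = 0 := by
  have hc : Continuous fun x => g x (2 * s - x) := h.cont.comp (by fun_prop : Continuous
    fun x : ℝ => (x, 2 * s - x))
  refine le_antisymm ?_ ?_
  · exact le_of_tendsto (hc.continuousWithinAt (s := Iio (leftCurve g s)))
      (eventually_nhdsWithin_of_forall fun x hx => (h.neg_of_lt hx).le)
  · exact ge_of_tendsto (hc.continuousWithinAt (s := Ioi (leftCurve g s)))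
      (eventually_nhdsWithin_of_forall fun x hx => h.nonneg_of_gt hx)

theorem isCurve (h : IsLevel g L) :
    IsCurve (leftCurve g) fun s => 2 * s - leftCurve g s := by
  refine isCurve_of_monotone (fun s r hsr => ?_) (fun s r hsr => ?_) (fun s => by ring)
    ⟨_, h.abs_sub_le⟩
  · refine csSup_le_csSup ⟨_, h.bddAbove r⟩ ⟨_, h.mem s⟩ fun x hx y hy => ?_
    exact (h.anti y (by linarith)).trans_lt (hx y hy)
  · have : leftCurve g r ≤ leftCurve g s + 2 * (r - s) := by
      refine csSup_le ⟨_, h.mem r⟩ fun x hx => ?_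
      suffices x - 2 * (r - s) ≤ leftCurve g s by linarith
      refine le_csSup ⟨_, h.bddAbove s⟩ fun y hy => ?_
      have h1 := hx (y + 2 * (r - s)) (by linarith)
      rw [show 2 * r - (y + 2 * (r - s)) = 2 * s - y by ring] at h1
      exact (h.mono _ (by linarith : y ≤ y + 2 * (r - s))).trans_lt h1
    linarith

end IsLevel

end leftmost

/-! ### Monotonicity of time and space along characteristics -/

section monotone

variable {c : ℝ → ℝ} {κ : ℝ} {Z : ℝ → ℝ → Vec5}

theorem Rel.t_bounds {τ u : ℝ} {v : Vec5} (h : Rel c τ u v) (hs : IsSpeed c κ) (hτ : τ ^ 2 = 1) :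
    0 ≤ τ * v 0 ∧ |v 0| ≤ κ * v 1 ∧ |v 1| ≤ κ * (τ * v 0) := by
  have hc := hs.pos u
  have h1 := h.tx
  have h2 := h.x_nonneg
  have h3 : v 1 = c u * (τ * v 0) := by rw [h1]; ring
  have h4 : 0 ≤ τ * v 0 := by
    rw [h3] at h2
    exact nonneg_of_mul_nonneg_right h2 hc
  refine ⟨h4, abs_le_of_speed_mul hs hτ h2 h1, ?_⟩
  rw [abs_of_nonneg h2, h3]
  exact mul_le_mul_of_nonneg_right (hs.bounds u).2 h4

namespace IsGlobal

theorem ae_Y (h : IsGlobal c Z) :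
    ∀ᵐ Y, ∀ X, (∀ i, HasDerivAt (fun η => Z X η i) (dY Z X Y i) Y) ∧
      Rel c (-1) (Z X Y 2) (dY Z X Y) := by
  filter_upwards [h.wave.hasDerivAt_Y, h.rel.dY] with Y h1 h2 X
  exact ⟨hasDerivAt_pi.1 (h1 X), h2 X trivial⟩

theorem ae_X (h : IsGlobal c Z) :
    ∀ᵐ X, ∀ Y, (∀ i, HasDerivAt (fun ξ => Z ξ Y i) (dX Z X Y i) X) ∧
      Rel c 1 (Z X Y 2) (dX Z X Y) := by
  filter_upwards [h.wave.hasDerivAt_X, h.rel.dX] with X h1 h2 Y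
  exact ⟨hasDerivAt_pi.1 (h1 Y), h2 Y trivial⟩

theorem mono_Y (h : IsGlobal c Z) (X : ℝ) {i : Fin 5} (hi : i = 1 ∨ i = 3) :
    Monotone fun Y => Z X Y i := fun a b hab => by
  refine le_of_ae_deriv_nonneg ((h.wave.lip_Y X).coord i) hab ?_
  filter_upwards [h.ae_Y] with Y hY _
  rw [((hY X).1 i).deriv]
  rcases hi with rfl | rfl
  exacts [(hY X).2.x_nonneg, (hY X).2.J_nonneg]

theorem mono_X (h : IsGlobal c Z) (Y : ℝ) {i : Fin 5} (hi : i = 1 ∨ i = 3) :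
    Monotone fun X => Z X Y i := fun a b hab => by
  refine le_of_ae_deriv_nonneg ((h.wave.lip_X Y).coord i) hab ?_
  filter_upwards [h.ae_X] with X hX _
  rw [((hX Y).1 i).deriv]
  rcases hi with rfl | rfl
  exacts [(hX Y).2.x_nonneg, (hX Y).2.J_nonneg]

theorem time_mono (h : IsGlobal c Z) (hs : IsSpeed c κ) (Y : ℝ) :
    Monotone fun X => Z X Y 0 := fun a b hab => by
  refine le_of_ae_deriv_nonneg ((h.wave.lip_X Y).coord 0) hab ?_
  filter_upwards [h.ae_X] with X hX _
  rw [((hX Y).1 0).deriv]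
  have := ((hX Y).2.t_bounds hs (by norm_num)).1
  linarith

theorem time_anti (h : IsGlobal c Z) (hs : IsSpeed c κ) (X : ℝ) :
    Antitone fun Y => Z X Y 0 := fun a b hab => by
  have := le_of_ae_deriv_nonneg (((h.wave.lip_Y X).coord 0).const_mul (-1)) hab (by
    filter_upwards [h.ae_Y] with Y hY _
    rw [deriv_const_mul_field, ((hY X).1 0).deriv]
    exact ((hY X).2.t_bounds hs (by norm_num)).1)
  simp only at this ⊢
  linarith

theorem space_le_time_Y (h : IsGlobal c Z) (hs : IsSpeed c κ) (X a b : ℝ) :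
    |Z X b 1 - Z X a 1| ≤ κ * |Z X b 0 - Z X a 0| := by
  have := abs_sub_le_of_ae_deriv (a := a) (b := b) ((h.wave.lip_Y X).coord 1)
    (((h.wave.lip_Y X).coord 0).const_mul (-κ)) (by
    filter_upwards [h.ae_Y] with Y hY _
    rw [deriv_const_mul_field, ((hY X).1 0).deriv, ((hY X).1 1).deriv]
    exact (((hY X).2.t_bounds hs (by norm_num)).2.2).trans_eq (by ring))
  rwa [← mul_sub, abs_mul, abs_neg, abs_of_pos hs.pos_bound] at this

theorem space_le_time_X (h : IsGlobal c Z) (hs : IsSpeed c κ) (Y a b : ℝ) :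
    |Z b Y 1 - Z a Y 1| ≤ κ * |Z b Y 0 - Z a Y 0| := by
  have := abs_sub_le_of_ae_deriv (a := a) (b := b) ((h.wave.lip_X Y).coord 1)
    (((h.wave.lip_X Y).coord 0).const_mul κ) (by
    filter_upwards [h.ae_X] with X hX _
    rw [deriv_const_mul_field, ((hX Y).1 0).deriv, ((hX Y).1 1).deriv]
    exact (((hX Y).2.t_bounds hs (by norm_num)).2.2).trans_eq (by ring))
  rwa [← mul_sub, abs_mul, abs_of_pos hs.pos_bound] at this

theorem time_le_space_Y (h : IsGlobal c Z) (hs : IsSpeed c κ) (X a b : ℝ) :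
    |Z X b 0 - Z X a 0| ≤ κ * |Z X b 1 - Z X a 1| := by
  have := abs_sub_le_of_ae_deriv (a := a) (b := b) ((h.wave.lip_Y X).coord 0)
    (((h.wave.lip_Y X).coord 1).const_mul κ) (by
    filter_upwards [h.ae_Y] with Y hY _
    rw [deriv_const_mul_field, ((hY X).1 0).deriv, ((hY X).1 1).deriv]
    exact ((hY X).2.t_bounds hs (by norm_num)).2.1)
  rwa [← mul_sub, abs_mul, abs_of_pos hs.pos_bound] at this

end IsGlobal

end monotone

/-! ### Estimates for data on curves -/

section half

variable {c : ℝ → ℝ} {κ : ℝ} {V : ℝ → Vec5}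

/-- The conditions in the definition of `𝒢` that involve only `𝒱` or only `𝒲`, without the algebraic
relations. -/
structure IsHalf (V : ℝ → Vec5) : Prop where
  bdd : ∀ i, MemLp (fun X => (V X - halfX) i) ∞ volume
  inv : ∃ δ > 0, ∀ᵐ X, δ ≤ V X 1 + V X 3
  sq : ∀ i, i ≠ 0 → MemLp (fun X => (V X - halfX) i) 2 volume
  nonneg : ∀ᵐ X, 0 ≤ V X 1 ∧ 0 ≤ V X 3

theorem sub_halfX_of_ne {i : Fin 5} (hi : i ≠ 1) (v : Vec5) : (v - halfX) i = v i := by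
  fin_cases i <;> simp_all [halfX]

theorem sub_halfX_one (v : Vec5) : (v - halfX) 1 = v 1 - 1 / 2 := by simp [halfX]

theorem MemG.halfV {Θ : CurveData} (h : MemG c Θ) : IsHalf Θ.V :=
  ⟨h.V_bdd, h.V_inv, h.V_sq, h.V_nonneg⟩

theorem MemG.halfW {Θ : CurveData} (h : MemG c Θ) : IsHalf Θ.W :=
  ⟨h.W_bdd, h.W_inv, h.W_sq, h.W_nonneg⟩

theorem IsHalf.memLp_J (h : IsHalf V) : MemLp (fun X => V X 3) 2 volume := by
  have := h.sq 3 (by decide)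
  simpa only [sub_halfX_of_ne (i := 3) (by decide)] using this

theorem IsHalf.memLp_U (h : IsHalf V) : MemLp (fun X => V X 2) 2 volume := by
  have := h.sq 2 (by decide)
  simpa only [sub_halfX_of_ne (i := 2) (by decide)] using this

theorem IsHalf.memLp_K (h : IsHalf V) : MemLp (fun X => V X 4) 2 volume := by
  have := h.sq 4 (by decide)
  simpa only [sub_halfX_of_ne (i := 4) (by decide)] using this

theorem IsHalf.memLp_x (h : IsHalf V) : MemLp (fun X => V X 1 - 1 / 2) 2 volume := by
  have := h.sq 1 (by decide)
  simpa only [sub_halfX_one] using this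

theorem IsHalf.aestronglyMeasurable (h : IsHalf V) (i : Fin 5) :
    AEStronglyMeasurable (fun X => V X i) volume := by
  have := (h.bdd i).aestronglyMeasurable.add_const (halfX i)
  simpa using this

theorem IsHalf.exists_bound (h : IsHalf V) : ∃ M, 0 ≤ M ∧ ∀ᵐ X, ‖V X‖ ≤ M := by
  obtain ⟨M, hM⟩ := ae_norm_le_of_memLp_top h.bdd
  exact ⟨|M|, abs_nonneg M, hM.mono fun X hX => hX.trans (le_abs_self M)⟩

theorem le_of_norm_le {v : Vec5} {M : ℝ} (h : ‖v‖ ≤ M) (i : Fin 5) : v i ≤ M :=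
  (le_abs_self _).trans ((norm_le_pi_norm v i).trans h)

/-- The energy density is integrable: where `V₂` is not small, it is controlled by `V₃²`, and
elsewhere by `(V₂ - 1/2)²`. -/
theorem IsHalf.integrable_J (h : IsHalf V) (hs : IsSpeed c κ) {u : ℝ → ℝ}
    (he : ∀ᵐ X, 2 * V X 3 * V X 1 = (c (u X) * V X 2) ^ 2) : Integrable fun X => V X 3 := by
  obtain ⟨M, hM0, hM⟩ := h.exists_bound
  refine Integrable.mono' ((h.memLp_U.integrable_sq.const_mul (2 * κ ^ 2)).add
    (h.memLp_x.integrable_sq.const_mul (16 * M))) (h.aestronglyMeasurable 3) ?_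
  filter_upwards [he, h.nonneg, hM] with X h1 h2 h3
  rw [Real.norm_eq_abs, abs_of_nonneg h2.2]
  have h4 : V X 3 ≤ M := le_of_norm_le h3 3
  have h5 : (c (u X) * V X 2) ^ 2 ≤ κ ^ 2 * V X 2 ^ 2 := by
    rw [mul_pow]
    exact mul_le_mul_of_nonneg_right (pow_le_pow_left₀ (hs.pos _).le (hs.bounds _).2 2)
      (sq_nonneg _)
  simp only [Pi.add_apply]
  rcases le_or_gt (1 / 4) (V X 1) with h6 | h6
  · have h7 : V X 3 * (1 / 4) ≤ V X 3 * V X 1 := mul_le_mul_of_nonneg_left h6 h2.2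
    nlinarith [mul_nonneg hM0 (sq_nonneg (V X 1 - 1 / 2))]
  · have h7 : 1 / 16 ≤ (V X 1 - 1 / 2) ^ 2 := by nlinarith
    have h8 := mul_le_mul_of_nonneg_left h7 hM0
    have h9 : 0 ≤ κ ^ 2 * V X 2 ^ 2 := by positivity
    linarith

/-- The increments over intervals of fixed length of a bounded monotone function are integrable. -/
theorem integrable_increment {g : ℝ → ℝ} (hm : Monotone g) {M : ℝ} (hM : ∀ s, |g s| ≤ M) {R : ℝ}
    (hR : 0 ≤ R) : Integrable fun s => g (s + R) - g (s - R) := by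
  have hi : ∀ a b, IntervalIntegrable g volume a b := fun a b => hm.intervalIntegrable
  have hi1 : ∀ a b, IntervalIntegrable (fun s => g (s + R)) volume a b := fun a b =>
    Monotone.intervalIntegrable fun s r h => hm (by linarith)
  have hi2 : ∀ a b, IntervalIntegrable (fun s => g (s - R)) volume a b := fun a b =>
    Monotone.intervalIntegrable fun s r h => hm (by linarith)
  -- the integral over `[-n, n]` telescopes into integrals over two intervals of length `2 R`
  refine integrable_of_intervalIntegral_norm_bounded (ι := ℕ) (l := atTop)
    (M * (2 * R) + M * (2 * R))
    (a := fun n => -(n : ℝ)) (b := fun n => n) (fun n => ?_)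
    (tendsto_neg_atTop_atBot.comp tendsto_natCast_atTop_atTop) tendsto_natCast_atTop_atTop
    (.of_forall fun n => ?_)
  · have := ((hi1 (-(n : ℝ)) n).sub (hi2 (-(n : ℝ)) n)).1
    exact this
  · have e1 : ∀ s, ‖g (s + R) - g (s - R)‖ = g (s + R) - g (s - R) := fun s => by
      rw [Real.norm_eq_abs, abs_of_nonneg (sub_nonneg.2 (hm (by linarith)))]
    simp only [e1]
    rw [intervalIntegral.integral_sub (hi1 _ _) (hi2 _ _), intervalIntegral.integral_comp_add_right,
      intervalIntegral.integral_comp_sub_right]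
    have e2 : (∫ x in -(n : ℝ) + R..n + R, g x) - ∫ x in -(n : ℝ) - R..n - R, g x =
        (∫ x in (n : ℝ) - R..n + R, g x) - ∫ x in -(n : ℝ) - R..-n + R, g x := by
      have e0 : ∀ a b, ∫ x in a..b, g x = (∫ x in 0..b, g x) - ∫ x in 0..a, g x := fun a b =>
        (intervalIntegral.integral_interval_sub_left (hi _ _) (hi _ _)).symm
      rw [e0 (-n + R) (n + R), e0 (-n - R) (n - R), e0 (n - R) (n + R), e0 (-n - R) (-n + R)]
      ring
    have e3 : ∀ a b, |∫ x in a..b, g x| ≤ M * |b - a| := fun a b =>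
      (intervalIntegral.norm_integral_le_of_norm_le_const (f := g) fun x _ => hM x :
        ‖∫ x in a..b, g x‖ ≤ M * |b - a|)
    rw [e2]
    refine (le_abs_self _).trans ((abs_sub _ _).trans (add_le_add ((e3 _ _).trans_eq ?_)
      ((e3 _ _).trans_eq ?_))) <;>
    · congr 1
      rw [abs_of_nonneg (by linarith)]; ring

theorem memLp_two_of_sq_le {f G : ℝ → ℝ} (hf : AEStronglyMeasurable f volume) (hG : Integrable G)
    (h : ∀ᵐ x, f x ^ 2 ≤ G x) : MemLp f 2 volume := by
  rw [memLp_two_iff_integrable_sq hf]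
  exact hG.mono' (hf.pow 2) (h.mono fun x hx => by
    rwa [Real.norm_eq_abs, abs_of_nonneg (sq_nonneg _)])

end half

namespace MemG

variable {c : ℝ → ℝ} {κ : ℝ} {Θ : CurveData}

/-- The derivatives of `𝒵`, with the algebraic relations at those points where they are needed. -/
theorem ae_deriv (h : MemG c Θ) : ∀ᵐ s,
    (∀ i, HasDerivAt (fun s => Θ.Z s i)
      (deriv Θ.X s * Θ.V (Θ.X s) i + deriv Θ.Y s * Θ.W (Θ.Y s) i) s) ∧
    (deriv Θ.X s ≠ 0 → Rel c 1 (Θ.Z s 2) (Θ.V (Θ.X s))) ∧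
    (deriv Θ.Y s ≠ 0 → Rel c (-1) (Θ.Z s 2) (Θ.W (Θ.Y s))) := by
  obtain ⟨δ, hδ, hV⟩ := h.V_inv
  obtain ⟨ε, hε, hW⟩ := h.W_inv
  filter_upwards [h.compat_ae (.of_forall fun _ => rfl) (.of_forall fun _ => rfl),
    h.paramX.ae_comp h.rel_V, h.paramX.ae_comp h.V_nonneg, h.paramX.ae_comp hV,
    h.paramY.ae_comp h.rel_W, h.paramY.ae_comp h.W_nonneg, h.paramY.ae_comp hW]
    with s h1 h2 h3 h4 h5 h6 h7
  refine ⟨h1, fun hX => ?_, fun hY => ?_⟩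
  · obtain ⟨r1, r2, r3⟩ := h2 hX s rfl
    exact ⟨by rw [r2, one_mul], by rw [r3, one_mul], r1, (h3 hX).1, (h3 hX).2,
      hδ.trans_le (h4 hX)⟩
  · obtain ⟨r1, r2, r3⟩ := h5 hY s rfl
    exact ⟨by rw [r2]; ring, by rw [r3]; ring, r1, (h6 hY).1, (h6 hY).2, hε.trans_le (h7 hY)⟩

/-- The `x`- and the `J`-parts of the two terms of the derivative of `𝒵` are nonnegative. -/
theorem ae_terms_nonneg (h : MemG c Θ) {i : Fin 5} (hi : i = 1 ∨ i = 3) :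
    ∀ᵐ s, 0 ≤ deriv Θ.X s * Θ.V (Θ.X s) i ∧ 0 ≤ deriv Θ.Y s * Θ.W (Θ.Y s) i := by
  filter_upwards [h.ae_deriv] with s ⟨_, h2, h3⟩
  have hX := h.paramX.deriv_nonneg s
  have hY := h.paramY.deriv_nonneg s
  constructor
  · by_cases h0 : deriv Θ.X s = 0
    · rw [h0, zero_mul]
    · rcases hi with rfl | rfl
      exacts [mul_nonneg hX (h2 h0).x_nonneg, mul_nonneg hX (h2 h0).J_nonneg]
  · by_cases h0 : deriv Θ.Y s = 0
    · rw [h0, zero_mul]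
    · rcases hi with rfl | rfl
      exacts [mul_nonneg hY (h3 h0).x_nonneg, mul_nonneg hY (h3 h0).J_nonneg]

theorem lip_coord (h : MemG c Θ) (i : Fin 5) : LocallyLipschitz fun s => Θ.Z s i := by
  obtain ⟨L, hL⟩ := h.Z_lipschitz
  exact hL.locallyLipschitz.coord i

theorem mono_Z (h : MemG c Θ) {i : Fin 5} (hi : i = 1 ∨ i = 3) : Monotone fun s => Θ.Z s i := by
  intro a b hab
  refine le_of_ae_deriv_nonneg (h.lip_coord i) hab ?_
  filter_upwards [h.ae_deriv, h.ae_terms_nonneg hi] with s h1 h2 _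
  rw [(h1.1 i).deriv]
  exact add_nonneg h2.1 h2.2

theorem exists_bound_Z (h : MemG c Θ) : ∃ M, 0 ≤ M ∧ ∀ s, |Θ.Z s 0| ≤ M ∧ |Θ.Z s 1 - s| ≤ M ∧
    |Θ.Z s 2| ≤ M ∧ |Θ.Z s 3| ≤ M ∧ |Θ.Z s 4| ≤ M := by
  obtain ⟨M, hM⟩ := h.Z_bdd
  have h0 := fun s => hM s 0
  have h1 := fun s => hM s 1
  have h2 := fun s => hM s 2
  have h3 := fun s => hM s 3
  have h4 := fun s => hM s 4
  simp only [Pi.sub_apply, Matrix.cons_val, sub_zero] at h0 h1 h2 h3 h4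
  exact ⟨M, (abs_nonneg _).trans (h0 0), fun s => ⟨h0 s, h1 s, h2 s, h3 s, h4 s⟩⟩

theorem abs_U_term_le {τ u a : ℝ} {v : Vec5} (hs : IsSpeed c κ)
    (h : a ≠ 0 → Rel c τ u v) : |a * v 2| ≤ 2 * κ * √((a * v 3) * (a * v 1)) := by
  have hκ := hs.pos_bound
  by_cases h0 : a = 0
  · rw [h0, zero_mul, abs_zero]; positivity
  · have h1 := (h h0).U_sq_le hs
    have h2 := mul_nonneg (h h0).J_nonneg (h h0).x_nonneg
    rw [← Real.sqrt_sq (by positivity : 0 ≤ 2 * κ), ← Real.sqrt_mul (sq_nonneg _)]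
    refine Real.abs_le_sqrt ?_
    have h3 : a ^ 2 * v 2 ^ 2 ≤ a ^ 2 * (2 * κ ^ 2 * (v 3 * v 1)) :=
      mul_le_mul_of_nonneg_left h1 (sq_nonneg a)
    nlinarith [mul_nonneg (mul_nonneg (sq_nonneg κ) (sq_nonneg a)) h2]

/-- The increments of `U` on the curve are controlled by those of `J` and `x`. In particular, `U` is
constant where `x` is. -/
theorem U_sub_le (h : MemG c Θ) (hs : IsSpeed c κ) (a b : ℝ) :
    |Θ.Z b 2 - Θ.Z a 2| ≤ 4 * κ * √(|Θ.Z b 3 - Θ.Z a 3| * |Θ.Z b 1 - Θ.Z a 1|) := by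
  have hκ := hs.pos_bound
  have := abs_sub_le_sqrt_of_ae_deriv (a := a) (b := b) (C := 4 * κ) (D := 0) (h.lip_coord 2)
    (h.lip_coord 3) (h.lip_coord 1) (by positivity) (by
    filter_upwards [h.ae_deriv, h.ae_terms_nonneg (.inl rfl), h.ae_terms_nonneg (.inr rfl)]
      with s ⟨h1, h2, h3⟩ ⟨p1, p2⟩ ⟨p3, p4⟩ _
    rw [(h1 1).deriv, (h1 2).deriv, (h1 3).deriv, zero_mul, add_zero]
    refine ⟨(abs_add_le _ _).trans ?_, add_nonneg p3 p4, add_nonneg p1 p2⟩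
    have e1 := abs_U_term_le hs h2
    have e2 := abs_U_term_le hs h3
    have e3 : √((deriv Θ.X s * Θ.V (Θ.X s) 3) * (deriv Θ.X s * Θ.V (Θ.X s) 1)) ≤
        √((deriv Θ.X s * Θ.V (Θ.X s) 3 + deriv Θ.Y s * Θ.W (Θ.Y s) 3) *
          (deriv Θ.X s * Θ.V (Θ.X s) 1 + deriv Θ.Y s * Θ.W (Θ.Y s) 1)) :=
      Real.sqrt_le_sqrt (mul_le_mul (by linarith) (by linarith) p1 (by linarith))
    have e4 : √((deriv Θ.Y s * Θ.W (Θ.Y s) 3) * (deriv Θ.Y s * Θ.W (Θ.Y s) 1)) ≤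
        √((deriv Θ.X s * Θ.V (Θ.X s) 3 + deriv Θ.Y s * Θ.W (Θ.Y s) 3) *
          (deriv Θ.X s * Θ.V (Θ.X s) 1 + deriv Θ.Y s * Θ.W (Θ.Y s) 1)) :=
      Real.sqrt_le_sqrt (mul_le_mul (by linarith) (by linarith) p2 (by linarith))
    have e5 := mul_le_mul_of_nonneg_left e3 (by positivity : 0 ≤ 2 * κ)
    have e6 := mul_le_mul_of_nonneg_left e4 (by positivity : 0 ≤ 2 * κ)
    linarith)
  rwa [abs_zero, zero_mul, add_zero] at this

theorem integrable_V_J (h : MemG c Θ) (hs : IsSpeed c κ) : Integrable fun X => Θ.V X 3 :=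
  h.halfV.integrable_J hs (u := fun X => Θ.ζ X 2) (h.rel_V'.mono fun _ h => h.energy)

theorem integrable_W_J (h : MemG c Θ) (hs : IsSpeed c κ) : Integrable fun Y => Θ.W Y 3 :=
  h.halfW.integrable_J hs (u := fun X => Θ.ω X 2) (h.rel_W'.mono fun _ h => h.energy)

/-- The increment of `𝒵₄` over `[s - R, s + R]`. -/
def incJ (Θ : CurveData) (R s : ℝ) : ℝ := Θ.Z (s + R) 3 - Θ.Z (s - R) 3

theorem integrable_incJ (h : MemG c Θ) {R : ℝ} (hR : 0 ≤ R) : Integrable (incJ Θ R) := by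
  obtain ⟨M, _, hM⟩ := h.exists_bound_Z
  exact integrable_increment (h.mono_Z (i := 3) (.inr rfl)) (fun s => (hM s).2.2.2.1) hR

theorem incJ_nonneg (h : MemG c Θ) {R : ℝ} (hR : 0 ≤ R) (s : ℝ) : 0 ≤ incJ Θ R s :=
  sub_nonneg.2 (h.mono_Z (i := 3) (.inr rfl) (by linarith))

theorem abs_J_sub_le_incJ (h : MemG c Θ) {R s a b : ℝ} (ha : |a - s| ≤ R) (hb : |b - s| ≤ R) :
    |Θ.Z b 3 - Θ.Z a 3| ≤ incJ Θ R s := by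
  have hm := h.mono_Z (i := 3) (.inr rfl)
  have ha := abs_le.1 ha
  have hb := abs_le.1 hb
  have h1 : Θ.Z a 3 ≤ Θ.Z (s + R) 3 := hm (by linarith)
  have h2 : Θ.Z (s - R) 3 ≤ Θ.Z a 3 := hm (by linarith)
  have h3 : Θ.Z b 3 ≤ Θ.Z (s + R) 3 := hm (by linarith)
  have h4 : Θ.Z (s - R) 3 ≤ Θ.Z b 3 := hm (by linarith)
  rw [incJ]
  exact abs_le.2 ⟨by linarith, by linarith⟩

end MemG

/-! ### Comparison of a solution with its data on another curve -/

section compare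

variable {c : ℝ → ℝ} {κ k : ℝ}

/-- What is needed of the comparison of `Z_X` at the two ends of a characteristic, with a constant
`A` and in terms of the increment `j` of `J`. -/
structure Comparable (A j : ℝ) (v w : Vec5) : Prop where
  upper : w 1 + w 3 ≤ A
  lower : v 1 + v 3 ≤ A * (w 1 + w 3)
  J_le : w 3 ≤ A * (v 3 + j)
  x_sub : (w 1 - v 1) ^ 2 ≤ A * (v 3 + j)

/-- The values of `Z_X` at the two ends of a characteristic are comparable, with a constant that
depends only on bounds for the increment of `x + J` and for `x_X + J_X` at one end. -/
theorem IsChar.exists_comparable (hs : IsSpeed c κ) (hk : 0 ≤ k) {H B : ℝ} (hH : 0 ≤ H)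
    (hB : 0 ≤ B) : ∃ A, 0 ≤ A ∧ ∀ (τ : ℝ) (P Q z : ℝ → Vec5) (a b : ℝ), IsChar c τ k P Q z a b →
      Monotone (fun η => z η 1) → Monotone (fun η => z η 3) →
      |IsChar.mass z b - IsChar.mass z a| ≤ H → P a 1 + P a 3 ≤ B →
      Rel c τ (z a 2) (P a) → Rel c τ (z b 2) (P b) →
      Comparable A |z b 3 - z a 3| (P a) (P b) := by
  have hκ := hs.pos_bound
  -- `B'` bounds `x_X + J_X` along the characteristic, `A₃` is the constant for `J_X`, and `A₁` that
  -- for the square of the variation of `x_X`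
  set E := Real.exp (2 * κ ^ 2 * k * H) with hE
  have hE1 : 1 ≤ E := Real.one_le_exp (by positivity)
  set B' := B * E with hB'
  have hB'0 : 0 ≤ B' := by positivity
  set a₁ := κ ^ 2 * k * B' with ha₁
  have ha₁0 : 0 ≤ a₁ := by positivity
  set A₃ := (1 + a₁) * E with hA₃
  have hA₃0 : 0 ≤ A₃ := by positivity
  set A₁ := 8 * (κ ^ 2 * k * B') ^ 2 * H + 8 * (κ ^ 2 * k) ^ 2 * (A₃ * B') * H ^ 2 with hA₁
  have hA₁0 : 0 ≤ A₁ := by positivity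
  refine ⟨B' + E + A₃ + A₁, by positivity, ?_⟩
  intro τ P Q z a b h m1 m3 hm hPa ra rb
  set j := |z b 3 - z a 3| with hj
  have hj0 : 0 ≤ j := abs_nonneg _
  have hsub : ∀ {f : ℝ → ℝ}, Monotone f → ∀ η ∈ uIcc a b, |f η - f a| ≤ |f b - f a| := by
    intro f hf η hη
    rcases le_total a b with hab | hab
    · rw [uIcc_of_le hab] at hη
      rw [abs_of_nonneg (sub_nonneg.2 (hf hη.1)), abs_of_nonneg (sub_nonneg.2 (hf hab))]
      exact sub_le_sub_right (hf hη.2) _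
    · rw [uIcc_of_ge hab] at hη
      rw [abs_of_nonpos (sub_nonpos.2 (hf hη.2)), abs_of_nonpos (sub_nonpos.2 (hf hab))]
      exact neg_le_neg (sub_le_sub_right (hf hη.1) _)
  have hmass : ∀ η ∈ uIcc a b, |mass z η - mass z a| ≤ H := fun η hη =>
    (hsub (f := mass z) (m1.add m3) η hη).trans hm
  have hP : ∀ η ∈ uIcc a b, P η 1 + P η 3 ≤ B' := fun η hη => by
    refine ((h.mono hη).pos_part_le hs).trans (mul_le_mul hPa (Real.exp_le_exp.2 ?_)
      (Real.exp_pos _).le hB)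
    exact mul_le_mul_of_nonneg_left (hmass η hη) (by positivity)
  have hJ : ∀ η ∈ uIcc a b, P η 3 ≤ A₃ * (P a 3 + j) := fun η hη => by
    have h1 := (h.mono hη).J_part_le hs hk (B := B') fun t ht =>
      hP t (uIcc_subset_uIcc_left hη ht)
    rw [abs_of_nonneg hB'0] at h1
    have h2 := hsub (f := fun η => z η 3) m3 η hη
    have h3 : Real.exp (κ ^ 2 * k * |mass z η - mass z a|) ≤ E := by
      refine Real.exp_le_exp.2 ?_
      calc κ ^ 2 * k * |mass z η - mass z a| ≤ κ ^ 2 * k * H :=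
            mul_le_mul_of_nonneg_left (hmass η hη) (by positivity)
        _ ≤ 2 * κ ^ 2 * k * H := by
            have : 0 ≤ κ ^ 2 * k * H := by positivity
            linarith
    have h4 : P a 3 + a₁ * |z η 3 - z a 3| ≤ (1 + a₁) * (P a 3 + j) := by
      have := mul_le_mul_of_nonneg_left h2 ha₁0
      have := mul_nonneg ha₁0 ra.J_nonneg
      linarith
    refine h1.trans ((mul_le_mul h4 h3 (Real.exp_pos _).le
      (mul_nonneg (by positivity) (add_nonneg ra.J_nonneg hj0))).trans_eq ?_)
    rw [hA₃]; ring
  have hj' : 0 ≤ P a 3 + j := add_nonneg ra.J_nonneg hj0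
  refine ⟨?_, ?_, ?_, ?_⟩
  · exact (hP b right_mem_uIcc).trans (by linarith)
  -- the lower bound is the upper bound on the reversed characteristic
  · have h1 := h.symm.pos_part_le hs
    rw [abs_sub_comm] at h1
    refine h1.trans ?_
    rw [mul_comm]
    refine mul_le_mul_of_nonneg_right ?_ rb.pos.le
    exact (Real.exp_le_exp.2 (mul_le_mul_of_nonneg_left hm (by positivity))).trans (by linarith)
  · exact (hJ b right_mem_uIcc).trans (mul_le_mul_of_nonneg_right (by linarith) hj')
  · have h1 := h.x_part_sub_le hs hk hP hJ
    rw [abs_of_nonneg hB'0, abs_of_nonneg (mul_nonneg hA₃0 hj')] at h1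
    have h2 : √(j * |mass z b - mass z a|) ≤ √(j * H) :=
      Real.sqrt_le_sqrt (mul_le_mul_of_nonneg_left hm hj0)
    have h3 : |P b 1 - P a 1| ≤ 2 * κ ^ 2 * k * B' * √(j * H) +
        2 * κ ^ 2 * k * √(A₃ * (P a 3 + j) * B') * H :=
      h1.trans (add_le_add (mul_le_mul_of_nonneg_left h2 (by positivity))
        (mul_le_mul_of_nonneg_left hm (by positivity)))
    have s1 := Real.sq_sqrt (by positivity : 0 ≤ j * H)
    have s2 := Real.sq_sqrt (mul_nonneg (mul_nonneg hA₃0 hj') hB'0)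
    rw [← sq_abs]
    calc |P b 1 - P a 1| ^ 2 ≤ (2 * κ ^ 2 * k * B' * √(j * H) +
          2 * κ ^ 2 * k * √(A₃ * (P a 3 + j) * B') * H) ^ 2 :=
          pow_le_pow_left₀ (abs_nonneg _) h3 2
      _ ≤ 2 * (2 * κ ^ 2 * k * B' * √(j * H)) ^ 2 +
          2 * (2 * κ ^ 2 * k * √(A₃ * (P a 3 + j) * B') * H) ^ 2 := by
          nlinarith [sq_nonneg (2 * κ ^ 2 * k * B' * √(j * H) -
            2 * κ ^ 2 * k * √(A₃ * (P a 3 + j) * B') * H)]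
      _ = 8 * (κ ^ 2 * k * B') ^ 2 * H * j +
          8 * (κ ^ 2 * k) ^ 2 * (A₃ * B') * H ^ 2 * (P a 3 + j) := by
          rw [mul_pow _ (√(j * H)), s1, mul_pow _ H, mul_pow _ (√(A₃ * (P a 3 + j) * B')), s2]
          ring
      _ ≤ A₁ * (P a 3 + j) := by
          have : 0 ≤ 8 * (κ ^ 2 * k * B') ^ 2 * H * P a 3 :=
            mul_nonneg (by positivity) ra.J_nonneg
          rw [hA₁]; linarith
      _ ≤ _ := mul_le_mul_of_nonneg_right (by linarith) hj'

/-- Comparable data satisfy the conditions in the definition of `𝒢`. -/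
theorem IsHalf.of_comparable (hs : IsSpeed c κ) {τ A : ℝ} (hτ : τ ^ 2 = 1) (hA : 0 ≤ A)
    {V W : ℝ → Vec5} {G u : ℝ → ℝ}
    (hV : IsHalf V) (hJ : Integrable fun X => V X 3) (hG : Integrable G)
    (hW : ∀ i, AEStronglyMeasurable (fun X => W X i) volume)
    (hr : ∀ᵐ X, Rel c τ (u X) (W X)) (hc : ∀ᵐ X, Comparable A (G X) (V X) (W X)) : IsHalf W := by
  have hκ := hs.pos_bound
  have hA' : Integrable fun X => A * (V X 3 + G X) := (hJ.add hG).const_mul A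
  have hn : ∀ᵐ X, ‖W X‖ ≤ κ * A := by
    filter_upwards [hr, hc] with X h1 h2
    exact (h1.norm_le hs hτ).trans (mul_le_mul_of_nonneg_left h2.upper hκ.le)
  have hWm : ∀ i, AEStronglyMeasurable (fun X => (W X - halfX) i) volume := fun i =>
    (hW i).sub aestronglyMeasurable_const
  have h3 : MemLp (fun X => W X 3) 2 volume := by
    refine memLp_two_of_sq_le (hW 3) (hA'.const_mul A) ?_
    filter_upwards [hr, hc] with X h1 h2
    have h4 : W X 3 ≤ A := by linarith [h2.upper, h1.x_nonneg]
    rw [pow_two]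
    exact mul_le_mul h4 h2.J_le h1.J_nonneg hA
  refine ⟨fun i => ?_, ?_, fun i hi => ?_, hr.mono fun X h => ⟨h.x_nonneg, h.J_nonneg⟩⟩
  · refine memLp_top_of_bound (hWm i) (κ * A + ‖halfX‖) ?_
    filter_upwards [hn] with X h
    exact (norm_le_pi_norm (W X - halfX) i).trans ((norm_sub_le _ _).trans (by gcongr))
  · obtain ⟨δ, hδ, h⟩ := hV.inv
    refine ⟨δ / (A + 1), by positivity, ?_⟩
    filter_upwards [h, hr, hc] with X h1 h2 h4
    rw [div_le_iff₀ (by positivity)]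
    have := h4.lower
    nlinarith [h2.pos]
  · have h1 : i = 1 ∨ i = 2 ∨ i = 3 ∨ i = 4 := by revert hi; revert i; decide
    rcases h1 with rfl | rfl | rfl | rfl
    · have hm := hV.memLp_x
      have h5 : MemLp (fun X => W X 1 - V X 1) 2 volume := by
        refine memLp_two_of_sq_le ((hW 1).sub (hV.aestronglyMeasurable 1)) hA' ?_
        filter_upwards [hc] with X h using h.x_sub
      refine (h5.add hm).ae_eq (.of_forall fun X => ?_)
      simp only [Pi.add_apply, sub_halfX_one]
      ring
    · simp only [sub_halfX_of_ne (i := 2) (by decide)]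
      refine memLp_two_of_sq_le (hW 2) (hA'.const_mul (2 * κ ^ 2 * A)) ?_
      filter_upwards [hr, hc] with X h1 h2
      have h4 : W X 1 ≤ A := by linarith [h2.upper, h1.J_nonneg]
      refine (h1.U_sq_le hs).trans ?_
      have h5 : W X 3 * W X 1 ≤ A * (V X 3 + G X) * A :=
        mul_le_mul h2.J_le h4 h1.x_nonneg (h1.J_nonneg.trans h2.J_le)
      calc 2 * κ ^ 2 * (W X 3 * W X 1) ≤ 2 * κ ^ 2 * (A * (V X 3 + G X) * A) := by gcongr
        _ = _ := by ring
    · simpa only [sub_halfX_of_ne (i := 3) (by decide)] using h3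
    · simp only [sub_halfX_of_ne (i := 4) (by decide)]
      refine (h3.const_mul κ).mono' (hW 4) ?_
      filter_upwards [hr] with X h
      exact abs_le_of_speed_mul hs hτ h.J_nonneg h.KJ

end compare

/-! ### Restriction of a field to a curve -/

section chainRule

variable {F : Vec5 → Vec5 → Vec5 → Vec5} {Z : ℝ → ℝ → Vec5}

theorem hasDerivAt_zero_of_le_sq {E : Type*} [NormedAddCommGroup E] [NormedSpace ℝ E] {m : ℝ → E}
    {s K : ℝ} (hs : m s = 0) (h : ∀ᶠ r in 𝓝 s, ‖m r‖ ≤ K * (r - s) ^ 2) : HasDerivAt m 0 s := by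
  rw [hasDerivAt_iff_isLittleO]
  simp only [hs, sub_zero, smul_zero]
  refine (Asymptotics.IsBigO.of_bound K (h.mono fun r hr => hr.trans_eq ?_)).trans_isLittleO
    (Asymptotics.isLittleO_pow_sub_sub s one_lt_two)
  rw [norm_pow, norm_norm, Real.norm_eq_abs, sq_abs]

theorem _root_.LocallyLipschitz.hasDerivAt_comp_zero {E : Type*} [NormedAddCommGroup E]
    [NormedSpace ℝ E] {f : ℝ → E} (hf : LocallyLipschitz f) {X : ℝ → ℝ} {s : ℝ}
    (hX : HasDerivAt X 0 s) : HasDerivAt (fun r => f (X r)) 0 s := by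
  obtain ⟨K, U, hU, hK⟩ := hf (X s)
  rw [hasDerivAt_iff_isLittleO] at hX ⊢
  simp only [smul_zero, sub_zero] at hX ⊢
  refine (Asymptotics.IsBigO.of_bound (K : ℝ) ?_).trans_isLittleO hX
  have hc : ContinuousAt X s := by
    have : HasDerivAt X 0 s := by rw [hasDerivAt_iff_isLittleO]; simpa using hX
    exact this.continuousAt
  filter_upwards [hc.preimage_mem_nhds hU] with r hr
  have := hK.dist_le_mul (X r) hr (X s) (mem_of_mem_nhds hU)
  rwa [dist_eq_norm, dist_eq_norm] at this

/-- A Lipschitz function composed with a monotone parametrization. -/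
theorem IsParam.ae_hasDerivAt_comp {X : ℝ → ℝ} (hX : IsParam X) {f : ℝ → ℝ}
    (hf : LocallyLipschitz f) :
    ∀ᵐ s, HasDerivAt (fun s => f (X s)) (deriv X s * deriv f (X s)) s := by
  filter_upwards [hX.ae_differentiableAt, hX.ae_comp hf.ae_differentiableAt] with s h1 h2
  by_cases h0 : deriv X s = 0
  · rw [h0, zero_mul]
    exact hf.hasDerivAt_comp_zero (by rw [← h0]; exact h1.hasDerivAt)
  · rw [mul_comm]
    exact (h2 h0).hasDerivAt.comp s h1.hasDerivAt

namespace IsWave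

theorem mixed_difference_le (hZ : IsWave F Z) (R : ℝ) : ∃ L, 0 ≤ L ∧ ∀ X ∈ Icc (-R) R,
    ∀ X' ∈ Icc (-R) R, ∀ Y ∈ Icc (-R) R, ∀ Y' ∈ Icc (-R) R,
    ‖(Z X' Y' - Z X' Y) - (Z X Y' - Z X Y)‖ ≤ L * |Y' - Y| * |X' - X| := by
  obtain ⟨L, hL⟩ := hZ.dX_lip R
  refine ⟨L, L.coe_nonneg, fun X hX X' hX' Y hY Y' hY' => ?_⟩
  refine norm_sub_le_of_ae_deriv_const (f := fun ξ => Z ξ Y' - Z ξ Y) (a := X) (b := X')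
    (mul_nonneg L.coe_nonneg (abs_nonneg _)) ((hZ.lip_X Y').sub (hZ.lip_X Y)) ?_
  filter_upwards [hL, hZ.hasDerivAt_X] with ξ h1 h2 hξ
  refine ⟨_, (h2 Y').sub (h2 Y), ?_⟩
  rw [← dist_eq_norm, ← Real.dist_eq]
  exact (h1 (uIcc_subset_Icc hX hX' (uIoo_subset_uIcc_self hξ))).dist_le_mul Y' hY' Y hY

theorem ae_hasDerivAt_comp_X (hZ : IsWave F Z) {X : ℝ → ℝ} (hX : IsParam X) :
    ∀ᵐ s, ∀ Y, HasDerivAt (fun r => Z (X r) Y) (deriv X s • dX Z (X s) Y) s := by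
  filter_upwards [hX.ae_differentiableAt, hX.ae_comp hZ.hasDerivAt_X] with s h1 h2 Y
  by_cases h0 : deriv X s = 0
  · rw [h0, zero_smul]
    exact (hZ.lip_X Y).hasDerivAt_comp_zero (by rw [← h0]; exact h1.hasDerivAt)
  · exact (h2 h0 Y).scomp s h1.hasDerivAt

/-- The chain rule along a curve: the second mixed difference is quadratically small. -/
theorem ae_hasDerivAt_curve (hZ : IsWave F Z) {X Y : ℝ → ℝ} (hX : IsParam X) (hY : IsParam Y) :
    ∀ᵐ s, HasDerivAt (fun r => Z (X r) (Y r))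
      (deriv X s • dX Z (X s) (Y s) + deriv Y s • dY Z (X s) (Y s)) s := by
  filter_upwards [hZ.ae_hasDerivAt_comp_X hX, hZ.swap.ae_hasDerivAt_comp_X hY] with s h1 h2
  have h2 : HasDerivAt (fun r => Z (X s) (Y r)) (deriv Y s • dY Z (X s) (Y s)) s := h2 (X s)
  obtain ⟨L, hL, hm⟩ := hZ.mixed_difference_le (max |X s| |Y s| + 2)
  have hmem : ∀ {f : ℝ → ℝ}, IsParam f → |f s| ≤ max |X s| |Y s| → ∀ r, |r - s| ≤ 1 →
      f r ∈ Icc (-(max |X s| |Y s| + 2)) (max |X s| |Y s| + 2) := by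
    intro f hf hb r hr
    have h3 := hf.lip.dist_le_mul r s
    rw [Real.dist_eq, Real.dist_eq, NNReal.coe_ofNat] at h3
    have h4 := abs_sub_abs_le_abs_sub (f r) (f s)
    exact abs_le.1 (by linarith)
  have h3 : HasDerivAt (fun r => (Z (X r) (Y r) - Z (X r) (Y s)) - (Z (X s) (Y r) - Z (X s) (Y s)))
      0 s := by
    refine hasDerivAt_zero_of_le_sq (K := L * 2 * 2) (by simp) ?_
    filter_upwards [Metric.closedBall_mem_nhds s one_pos] with r hr
    have hr' : |r - s| ≤ 1 := by simpa [Real.dist_eq] using hr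
    have h0 : |s - s| ≤ 1 := by simp
    refine (hm (X s) (hmem hX (le_max_left _ _) s h0) (X r) (hmem hX (le_max_left _ _) r hr')
      (Y s) (hmem hY (le_max_right _ _) s h0) (Y r) (hmem hY (le_max_right _ _) r hr')).trans ?_
    have h3 := hX.lip.dist_le_mul r s
    have h4 := hY.lip.dist_le_mul r s
    rw [Real.dist_eq, Real.dist_eq, NNReal.coe_ofNat] at h3 h4
    calc L * |Y r - Y s| * |X r - X s| ≤ L * (2 * |r - s|) * (2 * |r - s|) := by gcongr
      _ = L * 2 * 2 * |r - s| ^ 2 := by ring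
      _ = _ := by rw [sq_abs]
  have h4 := ((h1 (Y s)).add h2).add h3
  rw [add_zero] at h4
  have h5 := h4.sub_const (Z (X s) (Y s))
  convert! h5 using 1
  ext1 r
  simp only [Pi.add_apply]
  abel

theorem locallyLipschitz_curve (hZ : IsWave F Z) {X Y : ℝ → ℝ} (hX : IsParam X)
    (hY : IsParam Y) : LocallyLipschitz fun s => Z (X s) (Y s) := by
  obtain ⟨M1, h1⟩ := hX.near
  obtain ⟨M2, h2⟩ := hY.near
  refine locallyLipschitz_of_Icc fun R => ?_
  obtain ⟨L, hL⟩ := hZ.lip (R + max M1 M2)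
  refine ⟨L * max 2 2, hL.comp (f := fun s => (X s, Y s)) (hX.lip.prodMk hY.lip).lipschitzOnWith
    fun s hs => ?_⟩
  have h3 := abs_le.1 ((h1 s).trans (le_max_left M1 M2))
  have h4 := abs_le.1 ((h2 s).trans (le_max_right M1 M2))
  exact ⟨⟨by linarith [hs.1, h3.1], by linarith [hs.2, h3.2]⟩,
    ⟨by linarith [hs.1, h4.1], by linarith [hs.2, h4.2]⟩⟩

theorem aestronglyMeasurable_dX (hZ : IsWave F Z) {b : ℝ → ℝ} (hb : Measurable b) :
    AEStronglyMeasurable (fun X => dX Z X (b X)) volume := by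
  refine aestronglyMeasurable_of_tendsto_ae atTop
    (f := fun (n : ℕ) X => ((n : ℝ) + 1) • (Z (X + 1 / ((n : ℝ) + 1)) (b X) - Z X (b X)))
    (fun n => ?_) ?_
  · have h1 : Measurable fun X => Z (X + 1 / ((n : ℝ) + 1)) (b X) :=
      hZ.continuous.measurable.comp ((measurable_id.add_const _).prodMk hb)
    have h2 : Measurable fun X => Z X (b X) :=
      hZ.continuous.measurable.comp (measurable_id.prodMk hb)
    exact ((h1.sub h2).const_smul ((n : ℝ) + 1)).aestronglyMeasurable
  · filter_upwards [hZ.hasDerivAt_X] with X h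
    have h1 := (h (b X)).tendsto_slope_zero
    have h2 : Tendsto (fun n : ℕ => 1 / ((n : ℝ) + 1)) atTop (𝓝[≠] 0) :=
      tendsto_nhdsWithin_iff.2 ⟨tendsto_one_div_add_atTop_nhds_zero_nat,
        .of_forall fun n => (one_div_pos.2 n.cast_add_one_pos).ne'⟩
    have h3 := h1.comp h2
    simpa [Function.comp_def] using h3

end IsWave

end chainRule

/-! ### Estimates near the diagonal -/

section diagonal

variable {c : ℝ → ℝ} {κ : ℝ} {Z : ℝ → ℝ → Vec5} {β α : ℝ → ℝ} {V W ζ ω : ℝ → Vec5} {C : ℝ}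

theorem IsGlobal.exists_bddOn (hg : IsGlobal c Z) (hs : IsSpeed c κ) (hd : IsData β α V W ζ ω C)
    (ha : Attains c β α V W ζ ω Z) {L : ℝ} (hL : 0 ≤ L) :
    ∃ M, 0 ≤ M ∧ BddOn Z {p | |p.2 - p.1| ≤ L} M := by
  obtain ⟨M, hM, h⟩ := hd.exists_bound hs hL
  have h1 := h 1 L _ Z (by norm_num) le_rfl ha (hg.solvesOn _) (hg.relOn _)
  have h2 := h (-1) L _ Z (by norm_num) le_rfl ha (hg.solvesOn _) (hg.relOn _)
  refine ⟨M, hd.nonneg.trans hM, fun X Y hm =>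
    (mem_strip_one_or_neg_one hm).elim (h1.U X Y) (h2.U X Y), ?_, ?_⟩
  · filter_upwards [h1.dX, h2.dX] with X e1 e2 Y hm using (mem_strip_one_or_neg_one hm).elim (e1 Y)
      (e2 Y)
  · filter_upwards [h1.dY, h2.dY] with Y e1 e2 X hm using (mem_strip_one_or_neg_one hm).elim (e1 X)
      (e2 X)

theorem IsGlobal.exists_norm_sub_le (hg : IsGlobal c Z) (hs : IsSpeed c κ)
    (hd : IsData β α V W ζ ω C) (ha : Attains c β α V W ζ ω Z) {L : ℝ} (hL : 0 ≤ L) :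
    ∃ D, 0 ≤ D ∧ ∀ X Y, |Y - X| ≤ L → ‖Z X Y - Z X (β X)‖ ≤ D := by
  have hC := hd.nonneg
  obtain ⟨M, hM, hb⟩ := hg.exists_bddOn hs hd ha (by positivity : 0 ≤ L + C)
  refine ⟨M * (L + C), by positivity, fun X Y h => ?_⟩
  refine (norm_sub_le_of_ae_deriv_const (K := M) (a := β X) (b := Y) hM (hg.wave.lip_Y X)
    ?_).trans (mul_le_mul_of_nonneg_left ?_ hM)
  · filter_upwards [hg.wave.hasDerivAt_Y, hb.dY] with η h1 h2 hη
    refine ⟨_, h1 X, h2 X ?_⟩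
    have h3 := uIoo_subset_uIcc_self hη
    have h4 := abs_le.1 h
    have h5 := abs_le.1 (hd.near_β X)
    have h6 : η ∈ Icc (X - (L + C)) (X + (L + C)) :=
      uIcc_subset_Icc ⟨by linarith, by linarith⟩ ⟨by linarith, by linarith⟩ h3
    exact abs_le.2 ⟨by linarith [h6.1], by linarith [h6.2]⟩
  · rw [show Y - β X = (Y - X) - (β X - X) by ring]
    exact (abs_sub _ _).trans (add_le_add h (hd.near_β X))

/-- On strips, `Z_X` is comparable to its value on the curve. -/
theorem ae_comparable {F : Vec5 → Vec5 → Vec5 → Vec5} {σ τ H U₀ k B A : ℝ} {Ω : Set (ℝ × ℝ)}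
    (hs : IsSpeed c κ) (hσ : σ ^ 2 = 1) (hΩ : IsDom β α σ Ω) (hZ : SolvesOn c F Z Ω)
    (hr : RelOn c τ Z univ) (hc : CurveBdd β α Z Ω U₀ H)
    (hk : ∀ u, |u| ≤ U₀ + κ * (2 * H) → |deriv c u| ≤ k)
    (hB : ∀ᵐ X, dX Z X (β X) 1 + dX Z X (β X) 3 ≤ B)
    (hA : ∀ (τ : ℝ) (P Q z : ℝ → Vec5) (a b : ℝ), IsChar c τ k P Q z a b →
      Monotone (fun η => z η 1) → Monotone (fun η => z η 3) →
      |IsChar.mass z b - IsChar.mass z a| ≤ 2 * H → P a 1 + P a 3 ≤ B →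
      Rel c τ (z a 2) (P a) → Rel c τ (z b 2) (P b) →
      Comparable A |z b 3 - z a 3| (P a) (P b)) :
    ∀ᵐ X, ∀ Y, (X, Y) ∈ Ω →
      Comparable A |Z X Y 3 - Z X (β X) 3| (dX Z X (β X)) (dX Z X Y) := by
  have hr' : RelOn c τ Z Ω := ⟨hr.dX.mono fun _ h Y _ => h Y trivial,
    hr.dY.mono fun _ h X _ => h X trivial⟩
  have hmono : ∀ X, Monotone (fun η => Z X η 1) ∧ Monotone fun η => Z X η 3 := by
    intro X
    constructor <;> intro a b hab
    · refine le_of_ae_deriv_nonneg ((hZ.wave.lip_Y X).coord 1) hab ?_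
      filter_upwards [hZ.wave.hasDerivAt_Y, hr.dY] with η h1 h2 _
      rw [(hasDerivAt_pi.1 (h1 X) 1).deriv]
      exact (h2 X trivial).x_nonneg
    · refine le_of_ae_deriv_nonneg ((hZ.wave.lip_Y X).coord 3) hab ?_
      filter_upwards [hZ.wave.hasDerivAt_Y, hr.dY] with η h1 h2 _
      rw [(hasDerivAt_pi.1 (h1 X) 3).deriv]
      exact (h2 X trivial).J_nonneg
  filter_upwards [ae_isChar hs hσ hΩ hZ hr' hc hk, hr.dX, hB] with X h1 h2 h3 Y hm
  exact hA τ _ _ _ _ _ (h1 Y hm) (hmono X).1 (hmono X).2 (mass_inc_le hσ hΩ hZ.wave hr' hc hm) h3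
    (h2 _ trivial) (h2 _ trivial)

theorem Comparable.mono {A j j' : ℝ} {v w : Vec5} (h : Comparable A j v w) (hA : 0 ≤ A)
    (hj : j ≤ j') : Comparable A j' v w :=
  ⟨h.upper, h.lower, h.J_le.trans (mul_le_mul_of_nonneg_left (by linarith) hA),
    h.x_sub.trans (mul_le_mul_of_nonneg_left (by linarith) hA)⟩

/-- Near the diagonal, `Z_X` and `Z_Y` are comparable to their values on the curve. The increment of
`J` along a characteristic is at most that between the two points of the curve that see its end. -/
theorem IsGlobal.exists_ae_comparable (hg : IsGlobal c Z) (hs : IsSpeed c κ)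
    (hd : IsData β α V W ζ ω C) (ha : Attains c β α V W ζ ω Z) {L : ℝ} (hL : 0 ≤ L) :
    ∃ A, 0 ≤ A ∧
      (∀ᵐ X, ∀ Y, |Y - X| ≤ L → Comparable A |ω Y 3 - ζ X 3| (V X) (dX Z X Y)) ∧
      ∀ᵐ Y, ∀ X, |Y - X| ≤ L → Comparable A |ω Y 3 - ζ X 3| (W Y) (dY Z X Y) := by
  have hC := hd.nonneg
  set H := C * (1 + (L + C)) with hH
  have hH0 : 0 ≤ H := by positivity
  obtain ⟨k, hk0, hk⟩ := hs.deriv_bdd (C + κ * (2 * H))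
  obtain ⟨A, hA0, hA⟩ := IsChar.exists_comparable hs hk0 (H := 2 * H) (B := C + C) (by positivity)
    (by positivity)
  have hsum : ∀ {v : Vec5}, ‖v‖ ≤ C → v 1 + v 3 ≤ C + C := fun {v} hv =>
    add_le_add (le_of_norm_le hv 1) (le_of_norm_le hv 3)
  have key : ∀ σ : ℝ, σ ^ 2 = 1 →
      (∀ᵐ X, ∀ Y, (X, Y) ∈ strip β σ L → Comparable A |ω Y 3 - ζ X 3| (V X) (dX Z X Y)) ∧
      ∀ᵐ Y, ∀ X, (X, Y) ∈ strip β σ L → Comparable A |ω Y 3 - ζ X 3| (W Y) (dY Z X Y) := by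
    intro σ hσ
    have hΩ := hd.isDom_strip σ L
    have hc := hd.curveBdd ha hσ hL (Ω := strip β σ L) subset_rfl
    constructor
    · filter_upwards [ae_comparable hs hσ hΩ (hg.solvesOn _) hg.rel hc hk
        (by filter_upwards [ha.eq_V] with X h; rw [h]; exact hsum (hd.V_bdd X)) hA, ha.eq_V]
        with X h1 h2 Y hm
      have h3 := increment_Y_le hσ hg.wave hΩ (hg.relOn _) hm (i := 3) (.inr rfl)
      rw [ha.eq_ω, ha.eq_ζ] at h3
      have h4 := h1 Y hm
      rw [h2, ha.eq_ζ] at h4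
      exact h4.mono hA0 h3
    · filter_upwards [ae_comparable hs (by simpa using hσ) hΩ.swap (hg.solvesOn _).swap
        hg.rel.swap hc.swap hk
        (by filter_upwards [ha.eq_W] with Y h
            rw [show dX (fun X Y => Z Y X) Y (α Y) = W Y from h]; exact hsum (hd.W_bdd Y)) hA,
        ha.eq_W] with Y h1 h2 X hm
      have h3 := increment_Y_le (by simpa using hσ) hg.wave.swap hΩ.swap (hg.relOn _).swap
        (X := Y) (Y := X) hm (i := 3) (.inr rfl)
      simp only [ha.eq_ω, ha.eq_ζ] at h3
      rw [abs_sub_comm (ζ X 3)] at h3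
      have h4 := h1 X hm
      rw [show dX (fun X Y => Z Y X) Y (α Y) = W Y from h2, ha.eq_ω] at h4
      exact h4.mono hA0 h3
  obtain ⟨p1, p2⟩ := key 1 (by norm_num)
  obtain ⟨q1, q2⟩ := key (-1) (by norm_num)
  refine ⟨A, hA0, ?_, ?_⟩
  · filter_upwards [p1, q1] with X h1 h2 Y hm using (mem_strip_one_or_neg_one hm).elim (h1 Y) (h2 Y)
  · filter_upwards [p2, q2] with Y h1 h2 X hm using (mem_strip_one_or_neg_one hm).elim (h1 X) (h2 X)

/-- The increment of `U` along a vertical segment is controlled by that of `J`. -/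
theorem IsGlobal.U_sub_le (hg : IsGlobal c Z) (hs : IsSpeed c κ) (X a b : ℝ) :
    |Z X b 2 - Z X a 2| ≤ 2 * κ * √(|Z X b 3 - Z X a 3| * |Z X b 1 - Z X a 1|) := by
  have hκ := hs.pos_bound
  have := abs_sub_le_sqrt_of_ae_deriv (a := a) (b := b) (C := 2 * κ) (D := 0)
    ((hg.wave.lip_Y X).coord 2) ((hg.wave.lip_Y X).coord 3) ((hg.wave.lip_Y X).coord 1)
    (by positivity) (by
    filter_upwards [hg.ae_Y] with Y hY _
    obtain ⟨h1, h2⟩ := hY X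
    rw [(h1 1).deriv, (h1 2).deriv, (h1 3).deriv, zero_mul, add_zero]
    refine ⟨?_, h2.J_nonneg, h2.x_nonneg⟩
    have := MemG.abs_U_term_le hs (a := 1) fun _ => h2
    simpa using this)
  rwa [abs_zero, zero_mul, add_zero] at this

end diagonal

/-! ### Restriction of a global solution to a curve -/

section restriction

variable {c : ℝ → ℝ} {κ : ℝ} {Z : ℝ → ℝ → Vec5} {Θ : CurveData} {X Y : ℝ → ℝ}

theorem IsParam.abs_leftInv_sub_le {X : ℝ → ℝ} (hX : IsParam X) {M : ℝ}
    (h : ∀ s, |X s - s| ≤ M) (x : ℝ) : |leftInv X x - x| ≤ M := by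
  have := h (leftInv X x)
  rwa [hX.apply_leftInv, abs_sub_comm] at this

theorem IsParam.abs_rightInv_sub_le {X : ℝ → ℝ} (hX : IsParam X) {M : ℝ}
    (h : ∀ s, |X s - s| ≤ M) (x : ℝ) : |rightInv X x - x| ≤ M := by
  have := h (rightInv X x)
  rwa [hX.apply_rightInv, abs_sub_comm] at this

theorem IsBullet.eq_ζ (hb : IsBullet Z Θ) (h : MemG c Θ) (X : ℝ) : Z X (Θ.β X) = Θ.ζ X := by
  rw [CurveData.ζ, hb.eq_Z (leftInv Θ.X X), h.paramX.apply_leftInv]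
  rfl

theorem IsBullet.eq_ω (hb : IsBullet Z Θ) (h : MemG c Θ) (Y : ℝ) : Z (Θ.α Y) Y = Θ.ω Y := by
  rw [CurveData.ω, hb.eq_Z (rightInv Θ.Y Y), h.paramY.apply_rightInv]
  rfl

/-- Moving from the curve along a vertical segment and then along a horizontal one back to the
curve, `J` changes monotonically. -/
theorem IsGlobal.abs_J_sub_le (hg : IsGlobal c Z) (hb : IsBullet Z Θ) (h : MemG c Θ) (X Y : ℝ) :
    |Z X Y 3 - Θ.ζ X 3| ≤ |Θ.ω Y 3 - Θ.ζ X 3| := by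
  rw [← hb.eq_ζ h, ← hb.eq_ω h]
  have hgc := curve_galois h.paramX h.paramY X Y
  rcases le_or_gt (Θ.β X) Y with h1 | h1
  · have h2 := hg.mono_Y X (i := 3) (.inr rfl) h1
    have h3 := hg.mono_X Y (i := 3) (.inr rfl) (hgc.1 h1)
    simp only at h2 h3
    rw [abs_of_nonneg (by linarith), abs_of_nonneg (by linarith)]
    linarith
  · have h2 := hg.mono_Y X (i := 3) (.inr rfl) h1.le
    have h3 := hg.mono_X Y (i := 3) (.inr rfl) (not_le.1 fun h5 => h1.not_ge (hgc.2 h5)).le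
    simp only at h2 h3
    rw [abs_of_nonpos (by linarith), abs_of_nonpos (by linarith)]
    linarith

/-- The restriction of a global solution to a curve exists as a set of data; that it belongs to
`𝒢` is `IsBullet.memG`. -/
theorem exists_isBullet (hg : IsGlobal c Z) (hc : IsCurve X Y) :
    ∃ Ψ : CurveData, Ψ.X = X ∧ Ψ.Y = Y ∧ IsBullet Z Ψ := by
  have hX := hc.isParam
  have hY := (isCurve_comm hc).isParam
  have m1 : AEStronglyMeasurable (fun x => dX Z x (curveBeta X Y x)) volume :=
    hg.wave.aestronglyMeasurable_dX (hY.continuous.measurable.comp hX.leftInv_mono.measurable)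
  have m2 : AEStronglyMeasurable (fun y => dY Z (curveAlpha X Y y) y) volume :=
    hg.wave.swap.aestronglyMeasurable_dX
      (hX.continuous.measurable.comp hY.rightInv_mono.measurable)
  refine ⟨⟨X, Y, fun s => Z (X s) (Y s), AEEqFun.mk _ m1, AEEqFun.mk _ m2⟩, rfl, rfl,
    fun _ => rfl, ?_, ?_⟩
  · filter_upwards [AEEqFun.coeFn_mk _ m1, hX.ae_unique] with x h1 h2 s hs
    rw [h1, curveBeta, h2 s (leftInv X x) hs (hX.apply_leftInv x)]
  · filter_upwards [AEEqFun.coeFn_mk _ m2, hY.ae_unique] with y h1 h2 s hs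
    rw [h1, curveAlpha, h2 s (rightInv Y y) hs (hY.apply_rightInv y)]

theorem IsBullet.ext {Ψ : CurveData} (h1 : IsBullet Z Θ) (h2 : IsBullet Z Ψ) (hX : Ψ.X = Θ.X)
    (hY : Ψ.Y = Θ.Y) (hc : IsCurve Θ.X Θ.Y) : Ψ = Θ := by
  refine CurveData.ext hX hY (funext fun s => ?_) (AEEqFun.ext ?_) (AEEqFun.ext ?_)
  · rw [h1.eq_Z, h2.eq_Z, hX, hY]
  · filter_upwards [h1.eq_V, h2.eq_V] with x e1 e2
    have := hc.isParam.apply_leftInv x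
    rw [e1 _ this, e2 _ (by rwa [hX]), hY]
  · filter_upwards [h1.eq_W, h2.eq_W] with y e1 e2
    have := (isCurve_comm hc).isParam.apply_rightInv y
    rw [e1 _ this, e2 _ (by rwa [hY]), hX]

/-- The halves of the restriction of a global solution to a second curve inherit the bounds of the
halves on the first one. -/
theorem IsBullet.halves (hs : IsSpeed c κ) (h : MemG c Θ) (hg : IsGlobal c Z)
    (hb : IsBullet Z Θ) {Ψ : CurveData} (hb' : IsBullet Z Ψ) (hc : IsCurve Ψ.X Ψ.Y) :
    IsHalf Ψ.V ∧ IsHalf Ψ.W := by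
  have hX := hc.isParam
  have hY := (isCurve_comm hc).isParam
  obtain ⟨M, hM, hn⟩ := h.exists_near
  obtain ⟨N1, hN1⟩ := hX.near
  obtain ⟨N2, hN2⟩ := hY.near
  have hN0 : 0 ≤ N1 + N2 := add_nonneg ((abs_nonneg _).trans (hN1 0)) ((abs_nonneg _).trans (hN2 0))
  obtain ⟨V, W, C, hd, hV, hW⟩ := h.exists_isData
  have ha := hb.attains h hV hW
  obtain ⟨A, hA, c1, c2⟩ := hg.exists_ae_comparable hs hd ha hN0
  set R := M + (N1 + N2) with hR
  have hG := h.integrable_incJ (R := R) (by positivity)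
  have hL := h.paramX.abs_leftInv_sub_le fun s => (hn s).1
  have hr := h.paramY.abs_rightInv_sub_le fun s => (hn s).2
  have hd' : ∀ s, |Ψ.Y s - Ψ.X s| ≤ N1 + N2 := fun s => by
    have e1 := abs_le.1 (hN1 s)
    have e2 := abs_le.1 (hN2 s)
    exact abs_le.2 ⟨by linarith, by linarith⟩
  constructor
  · refine IsHalf.of_comparable hs (τ := 1) (by norm_num) hA h.halfV (h.integrable_V_J hs) hG
      (u := fun x => Z x (Ψ.Y (leftInv Ψ.X x)) 2)
      (fun i => (measurable_pi_iff.1 (aeeq_measurable Ψ.V) i).aestronglyMeasurable) ?_ ?_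
    · filter_upwards [hg.rel.dX, hb'.eq_V] with x h1 h2
      rw [h2 _ (hX.apply_leftInv x)]
      exact h1 _ trivial
    · filter_upwards [c1, hb'.eq_V, hV] with x h1 h2 h3
      rw [h2 _ (hX.apply_leftInv x), ← h3]
      have e0 := hd' (leftInv Ψ.X x)
      rw [hX.apply_leftInv] at e0
      refine (h1 _ e0).mono hA (h.abs_J_sub_le_incJ ?_ ?_)
      · exact (hL x).trans (by linarith)
      · have e1 := abs_le.1 (hr (Ψ.Y (leftInv Ψ.X x)))
        have e2 := abs_le.1 e0
        exact abs_le.2 ⟨by linarith, by linarith⟩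
  · refine IsHalf.of_comparable hs (τ := -1) (by norm_num) hA h.halfW (h.integrable_W_J hs) hG
      (u := fun y => Z (Ψ.X (leftInv Ψ.Y y)) y 2)
      (fun i => (measurable_pi_iff.1 (aeeq_measurable Ψ.W) i).aestronglyMeasurable) ?_ ?_
    · filter_upwards [hg.rel.dY, hb'.eq_W] with y h1 h2
      rw [h2 _ (hY.apply_leftInv y)]
      exact h1 _ trivial
    · filter_upwards [c2, hb'.eq_W, hW] with y h1 h2 h3
      rw [h2 _ (hY.apply_leftInv y), ← h3]
      have e0 := hd' (leftInv Ψ.Y y)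
      rw [hY.apply_leftInv] at e0
      refine (h1 _ e0).mono hA (h.abs_J_sub_le_incJ ?_ ?_)
      · have e1 := abs_le.1 (hL (Ψ.X (leftInv Ψ.Y y)))
        have e2 := abs_le.1 e0
        exact abs_le.2 ⟨by linarith, by linarith⟩
      · exact (hr y).trans (by linarith)

/-- Distances between the values on two curves. The increments of `J` are integrable in `s` and the
squares of those of `U` are bounded by them, so that `U` remains square integrable. -/
theorem IsBullet.exists_compare_Z (hs : IsSpeed c κ) (h : MemG c Θ) (hg : IsGlobal c Z)
    (hb : IsBullet Z Θ) {Ψ : CurveData} (hb' : IsBullet Z Ψ) (hc : IsCurve Ψ.X Ψ.Y) :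
    ∃ D R, 0 ≤ D ∧ 0 ≤ R ∧ ∀ s, ‖Ψ.Z s - Θ.Z s‖ ≤ D ∧
      |Ψ.Z s 3 - Θ.Z s 3| ≤ 2 * MemG.incJ Θ R s ∧
      Ψ.Z s 2 ^ 2 ≤ 3 * Θ.Z s 2 ^ 2 + D * MemG.incJ Θ R s := by
  have hκ := hs.pos_bound
  obtain ⟨M, hM, hn⟩ := h.exists_near
  obtain ⟨N1, hN1⟩ := hc.isParam.near
  obtain ⟨N2, hN2⟩ := (isCurve_comm hc).isParam.near
  have hN10 := (abs_nonneg _).trans (hN1 0)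
  have hN20 := (abs_nonneg _).trans (hN2 0)
  obtain ⟨V, W, C, hd, hV, hW⟩ := h.exists_isData
  have ha := hb.attains h hV hW
  obtain ⟨D, hD, hDn⟩ := hg.exists_norm_sub_le hs hd ha (add_nonneg hN10 hN20)
  obtain ⟨L, hL⟩ := h.Z_lipschitz
  set D' := D + L * (M + N1) with hD'
  have hD'0 : 0 ≤ D' := by positivity
  set R := M + N1 + N2 with hR
  -- `60 = 3 (4 + 16)`, with `4` and `16` from the two estimates for the increments of `U`
  refine ⟨D' + 60 * κ ^ 2 * D', R, by positivity, by positivity, fun s => ?_⟩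
  have e1 := abs_le.1 (hN1 s)
  have e2 := abs_le.1 (hN2 s)
  have hl : |leftInv Θ.X (Ψ.X s) - s| ≤ M + N1 := by
    have := abs_le.1 (h.paramX.abs_leftInv_sub_le (fun s => (hn s).1) (Ψ.X s))
    exact abs_le.2 ⟨by linarith, by linarith⟩
  have hr : |rightInv Θ.Y (Ψ.Y s) - s| ≤ M + N2 := by
    have := abs_le.1 (h.paramY.abs_rightInv_sub_le (fun s => (hn s).2) (Ψ.Y s))
    exact abs_le.2 ⟨by linarith, by linarith⟩
  -- from `Ψ.Z s` to `Θ.ζ (Ψ.X s)` along a vertical segment, then to `Θ.Z s` along the curve of `Θ`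
  have n1 : ‖Ψ.Z s - Θ.ζ (Ψ.X s)‖ ≤ D := by
    rw [hb'.eq_Z, ← hb.eq_ζ h]
    exact hDn _ _ (abs_le.2 ⟨by linarith, by linarith⟩)
  have n2 : ‖Θ.ζ (Ψ.X s) - Θ.Z s‖ ≤ L * (M + N1) := by
    rw [← dist_eq_norm]
    refine (hL.dist_le_mul _ _).trans (mul_le_mul_of_nonneg_left ?_ L.coe_nonneg)
    rwa [Real.dist_eq]
  have hI := h.incJ_nonneg (R := R) (by positivity) s
  have j1 : |Ψ.Z s 3 - Θ.ζ (Ψ.X s) 3| ≤ MemG.incJ Θ R s := by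
    rw [hb'.eq_Z]
    exact (hg.abs_J_sub_le hb h _ _).trans (h.abs_J_sub_le_incJ (hl.trans (by linarith))
      (hr.trans (by linarith)))
  have j2 : |Θ.ζ (Ψ.X s) 3 - Θ.Z s 3| ≤ MemG.incJ Θ R s :=
    h.abs_J_sub_le_incJ (by rw [sub_self, abs_zero]; positivity) (hl.trans (by linarith))
  have u1 : (Ψ.Z s 2 - Θ.ζ (Ψ.X s) 2) ^ 2 ≤ 4 * κ ^ 2 * (MemG.incJ Θ R s * D') := by
    have a1 := hg.U_sub_le hs (Ψ.X s) (Θ.β (Ψ.X s)) (Ψ.Y s)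
    rw [hb.eq_ζ h, ← hb'.eq_Z] at a1
    have a2 := (norm_le_pi_norm (Ψ.Z s - Θ.ζ (Ψ.X s)) 1).trans n1
    have a3 : |Ψ.Z s 3 - Θ.ζ (Ψ.X s) 3| * |Ψ.Z s 1 - Θ.ζ (Ψ.X s) 1| ≤ MemG.incJ Θ R s * D' :=
      mul_le_mul j1 (a2.trans (by rw [hD']; linarith [mul_nonneg L.coe_nonneg (add_nonneg hM
        hN10)]))
        (abs_nonneg _) hI
    have a4 := pow_le_pow_left₀ (abs_nonneg _) a1 2
    rw [sq_abs, mul_pow, Real.sq_sqrt (by positivity)] at a4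
    nlinarith [mul_le_mul_of_nonneg_left a3 (sq_nonneg κ)]
  have u2 : (Θ.ζ (Ψ.X s) 2 - Θ.Z s 2) ^ 2 ≤ 16 * κ ^ 2 * (MemG.incJ Θ R s * D') := by
    have a1 := h.U_sub_le hs s (leftInv Θ.X (Ψ.X s))
    have a2 := (norm_le_pi_norm (Θ.ζ (Ψ.X s) - Θ.Z s) 1).trans n2
    have a3 : |Θ.ζ (Ψ.X s) 3 - Θ.Z s 3| * |Θ.ζ (Ψ.X s) 1 - Θ.Z s 1| ≤ MemG.incJ Θ R s * D' :=
      mul_le_mul j2 (a2.trans (by rw [hD']; linarith)) (abs_nonneg _) hI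
    have a4 := pow_le_pow_left₀ (abs_nonneg _) a1 2
    rw [sq_abs, mul_pow, Real.sq_sqrt (by positivity)] at a4
    nlinarith [mul_le_mul_of_nonneg_left a3 (sq_nonneg κ)]
  refine ⟨?_, ?_, ?_⟩
  · calc ‖Ψ.Z s - Θ.Z s‖ ≤ ‖Ψ.Z s - Θ.ζ (Ψ.X s)‖ + ‖Θ.ζ (Ψ.X s) - Θ.Z s‖ :=
          norm_sub_le_norm_sub_add_norm_sub _ _ _
      _ ≤ D' := add_le_add n1 n2
      _ ≤ _ := by linarith [show 0 ≤ 60 * κ ^ 2 * D' by positivity]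
  · exact (abs_sub_le _ (Θ.ζ (Ψ.X s) 3) _).trans (by linarith)
  · have a1 : 0 ≤ D' * MemG.incJ Θ R s := mul_nonneg hD'0 hI
    have a2 : ∀ a b z : ℝ, z ^ 2 ≤ 3 * a ^ 2 + 3 * (z - b) ^ 2 + 3 * (b - a) ^ 2 := fun a b z => by
      nlinarith [sq_nonneg (a - (z - b)), sq_nonneg (a - (b - a)), sq_nonneg ((z - b) - (b - a))]
    have a3 := a2 (Θ.Z s 2) (Θ.ζ (Ψ.X s) 2) (Ψ.Z s 2)
    nlinarith

/-- The restriction of a global solution to any curve belongs to `𝒢`. -/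
theorem IsBullet.memG (hs : IsSpeed c κ) (h : MemG c Θ) (hg : IsGlobal c Z)
    (hb : IsBullet Z Θ) {Ψ : CurveData} (hb' : IsBullet Z Ψ) (hc : IsCurve Ψ.X Ψ.Y) :
    MemG c Ψ := by
  have hX := hc.isParam
  have hY := (isCurve_comm hc).isParam
  obtain ⟨hV, hW⟩ := hb.halves hs h hg hb' hc
  obtain ⟨D, R, hD, hR, hZ⟩ := hb.exists_compare_Z hs h hg hb' hc
  have hZe : Ψ.Z = fun s => Z (Ψ.X s) (Ψ.Y s) := funext hb'.eq_Z
  have hder : ∀ᵐ s, HasDerivAt Ψ.Z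
      (deriv Ψ.X s • Ψ.V (Ψ.X s) + deriv Ψ.Y s • Ψ.W (Ψ.Y s)) s := by
    filter_upwards [hg.wave.ae_hasDerivAt_curve hX hY, hX.ae_comp hb'.eq_V, hY.ae_comp hb'.eq_W]
      with s h1 h2 h3
    rw [hZe]
    convert! h1 using 2
    · by_cases h0 : deriv Ψ.X s = 0
      · rw [h0, zero_smul, zero_smul]
      · rw [h2 h0 s rfl]
    · by_cases h0 : deriv Ψ.Y s = 0
      · rw [h0, zero_smul, zero_smul]
      · rw [h3 h0 s rfl]
  have hJ0 : Tendsto (MemG.incJ Θ R) atBot (𝓝 0) := by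
    have h1 := h.J_lim.comp (tendsto_atBot_add_const_right atBot R tendsto_id)
    have h2 := h.J_lim.comp (tendsto_atBot_add_const_right atBot (-R) tendsto_id)
    have := h1.sub h2
    rw [sub_zero] at this
    exact this
  refine ⟨hc, ?_, ?_, hV.bdd, hW.bdd, hV.inv, hW.inv, ?_, hV.sq, hW.sq, hV.nonneg, hW.nonneg,
    hder.mono fun s hs => hs.deriv, ?_, ?_, ?_⟩
  · obtain ⟨M1, hM1, h1⟩ := hV.exists_bound
    obtain ⟨M2, hM2, h2⟩ := hW.exists_bound
    refine ⟨⟨2 * M1 + 2 * M2, by positivity⟩, LipschitzWith.of_dist_le_mul fun a b => ?_⟩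
    rw [dist_comm, dist_eq_norm, dist_comm, Real.dist_eq]
    refine norm_sub_le_of_ae_deriv_const (f := Ψ.Z) (NNReal.coe_nonneg _) ?_ ?_
    · rw [hZe]
      exact hg.wave.locallyLipschitz_curve hX hY
    · filter_upwards [hder, hX.ae_comp h1, hY.ae_comp h2] with s d1 d2 d3 _
      have hb : ∀ {f : ℝ → ℝ} {v : Vec5} {M : ℝ}, IsParam f → 0 ≤ M → (deriv f s ≠ 0 → ‖v‖ ≤ M) →
          ‖deriv f s • v‖ ≤ 2 * M := by
        intro f v M hf hM hv
        rw [norm_smul, Real.norm_eq_abs, abs_of_nonneg (hf.deriv_nonneg s)]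
        by_cases h0 : deriv f s = 0
        · rw [h0, zero_mul]; positivity
        · exact mul_le_mul (hf.deriv_le s) (hv h0) (norm_nonneg _) (by norm_num)
      exact ⟨_, d1, (norm_add_le _ _).trans (add_le_add (hb hX hM1 d2) (hb hY hM2 d3))⟩
  · obtain ⟨M, hM⟩ := h.Z_bdd
    refine ⟨D + M, fun s i => ?_⟩
    have e1 := (norm_le_pi_norm (Ψ.Z s - Θ.Z s) i).trans (hZ s).1
    rw [show (Ψ.Z s - ![0, s, 0, 0, 0]) i = (Ψ.Z s - Θ.Z s) i + (Θ.Z s - ![0, s, 0, 0, 0]) i by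
      simp only [Pi.sub_apply]; ring]
    exact (abs_add_le _ _).trans (add_le_add e1 (hM s i))
  · refine memLp_two_of_sq_le (G := fun s => 3 * Θ.Z s 2 ^ 2 + D * MemG.incJ Θ R s) ?_
      ((h.U_sq.integrable_sq.const_mul 3).add ((h.integrable_incJ hR).const_mul D))
      (.of_forall fun s => (hZ s).2.2)
    rw [hZe]
    exact ((continuous_apply 2).comp (hg.wave.continuous.comp
      (hX.continuous.prodMk hY.continuous))).aestronglyMeasurable
  · filter_upwards [hb'.eq_V, hg.rel.dX] with x h1 h2 s hs
    have h3 := h2 (Ψ.Y s) trivial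
    rw [h1 s hs, hb'.eq_Z, hs]
    exact ⟨h3.energy, by rw [h3.tx, one_mul], by rw [h3.KJ, one_mul]⟩
  · filter_upwards [hb'.eq_W, hg.rel.dY] with x h1 h2 s hs
    have h3 := h2 (Ψ.X s) trivial
    rw [h1 s hs, hb'.eq_Z, hs]
    exact ⟨h3.energy, by rw [h3.tx]; ring, by rw [h3.KJ]; ring⟩
  · have h1 : Tendsto (fun s => Ψ.Z s 3 - Θ.Z s 3) atBot (𝓝 0) :=
      squeeze_zero_norm (fun s => (hZ s).2.1) (by simpa using hJ0.const_mul 2)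
    simpa using h1.add h.J_lim

/-- The time is a level function. If it were bounded at a point far below the diagonal, then `x`,
whose increments are at most `κ` times those of `t`, could not increase by the distance between the
two points of the curve that see this point. -/
theorem IsGlobal.exists_isLevel (hs : IsSpeed c κ) (h : MemG c Θ) (hg : IsGlobal c Z)
    (hb : IsBullet Z Θ) : ∃ L, IsLevel (fun X Y => Z X Y 0) L := by
  have hκ := hs.pos_bound
  obtain ⟨M, hM, hn⟩ := h.exists_near
  obtain ⟨N, hN, hz⟩ := h.exists_bound_Z
  have key : ∀ X Y, |Θ.ζ X 0| ≤ N ∧ |Θ.ω Y 0| ≤ N ∧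
      |Θ.ζ X 1 - X| ≤ N + M ∧ |Θ.ω Y 1 - Y| ≤ N + M ∧ |Θ.β X - X| ≤ 2 * M ∧
      |Θ.α Y - Y| ≤ 2 * M := by
    intro X Y
    have hl := h.paramX.abs_leftInv_sub_le (fun s => (hn s).1) X
    have hr := h.paramY.abs_rightInv_sub_le (fun s => (hn s).2) Y
    have e1 := abs_le.1 hl
    have e2 := abs_le.1 hr
    have e3 := abs_le.1 (hz (leftInv Θ.X X)).2.1
    have e4 := abs_le.1 (hz (rightInv Θ.Y Y)).2.1
    have e5 := abs_le.1 (hn (leftInv Θ.X X)).2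
    have e6 := abs_le.1 (hn (rightInv Θ.Y Y)).1
    refine ⟨(hz _).1, (hz _).1, abs_le.2 ⟨?_, ?_⟩, abs_le.2 ⟨?_, ?_⟩, abs_le.2 ⟨?_, ?_⟩,
      abs_le.2 ⟨?_, ?_⟩⟩ <;> simp only [CurveData.ζ, CurveData.ω, curveBeta, curveAlpha] <;>
        linarith
  -- `2 κ N` is for the two increments of `t`, `2 N + 2 M` for the distance of `x` from the identity
  -- on the curve
  refine ⟨2 * κ * N + 2 * N + 2 * M + 1, (continuous_apply 0).comp hg.wave.continuous,
    hg.time_mono hs, hg.time_anti hs, fun X Y hL => ?_, fun X Y hL => ?_⟩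
  all_goals
    obtain ⟨k1, k2, k3, k4, k5, k6⟩ := key X Y
    have hκN : 0 ≤ 2 * κ * N := by positivity
    have k1 := abs_le.1 k1
    have k2 := abs_le.1 k2
    have k3 := abs_le.1 k3
    have k4 := abs_le.1 k4
    have k5 := abs_le.1 k5
    have k6 := abs_le.1 k6
    have p1 := abs_le.1 (hg.space_le_time_Y hs X (Θ.β X) Y)
    have p2 := abs_le.1 (hg.space_le_time_X hs Y (Θ.α Y) X)
    rw [hb.eq_ζ h] at p1
    rw [hb.eq_ω h] at p2
  · have t1 := hg.time_anti hs X (by linarith : Y ≤ Θ.β X)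
    have t2 := hg.time_mono hs Y (by linarith : Θ.α Y ≤ X)
    simp only [hb.eq_ζ h, hb.eq_ω h] at t1 t2
    rw [abs_of_nonneg (by linarith)] at p1 p2
    by_contra! h0
    have q1 : κ * (Z X Y 0 - Θ.ζ X 0) ≤ κ * N := by gcongr; linarith
    have q2 : κ * (Z X Y 0 - Θ.ω Y 0) ≤ κ * N := by gcongr; linarith
    linarith [p1.1, p2.2]
  · have t1 := hg.time_anti hs X (by linarith : Θ.β X ≤ Y)
    have t2 := hg.time_mono hs Y (by linarith : X ≤ Θ.α Y)
    simp only [hb.eq_ζ h, hb.eq_ω h] at t1 t2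
    rw [abs_of_nonpos (by linarith)] at p1 p2
    by_contra! h0
    have q1 : κ * -(Z X Y 0 - Θ.ζ X 0) ≤ κ * N := by gcongr; linarith
    have q2 : κ * -(Z X Y 0 - Θ.ω Y 0) ≤ κ * N := by gcongr; linarith
    linarith [p1.2, p2.1]

theorem IsE.level {L : ℝ} (hE : IsE Z Θ) (hl : IsLevel (fun X Y => Z X Y 0) L) :
    IsCurve Θ.X Θ.Y ∧ (∀ s, Θ.Z s 0 = 0) ∧
      ∀ s, ∀ x < Θ.X s, Z x (2 * s - x) 0 < 0 := by
  have hX : Θ.X = leftCurve fun X Y => Z X Y 0 := funext hE.eq_X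
  have hY : Θ.Y = fun s => 2 * s - leftCurve (fun X Y => Z X Y 0) s := by
    rw [← hX]; exact funext hE.eq_Y
  refine ⟨?_, fun s => ?_, fun s x hx => ?_⟩
  · rw [hX, hY]; exact hl.isCurve
  · rw [hE.bullet.eq_Z, hX, hY]; exact hl.eq_zero s
  · rw [hX] at hx; exact hl.neg_of_lt hx

/-- The restriction to the leftmost curve of time zero. -/
theorem existsUnique_isE (hs : IsSpeed c κ) (hZ : Z ∈ setH c) :
    ∃ Ψ ∈ setG0 c, IsE Z Ψ ∧ ∀ Ψ', IsE Z Ψ' → Ψ' = Ψ := by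
  obtain ⟨hZ, Θ, hb, h⟩ := hZ
  have hg := isGlobal_of_memHOn hZ
  obtain ⟨L, hl⟩ := hg.exists_isLevel hs h hb
  obtain ⟨Ψ, hX, hY, hb'⟩ := exists_isBullet hg hl.isCurve
  have hE : IsE Z Ψ := ⟨fun s => by rw [hX]; rfl, fun s => by rw [hX, hY], hb'⟩
  have hl1 := hE.level hl
  refine ⟨Ψ, ⟨hb.memG hs h hg hb' hl1.1, hl1.2.1⟩, hE, fun Ψ' hE' => ?_⟩
  have hX' : Ψ'.X = Ψ.X := funext fun s => by rw [hE'.eq_X, hE.eq_X]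
  exact hb'.ext hE'.bullet hX' (funext fun s => by rw [hE'.eq_Y, hE.eq_Y, hX']) hl1.1

end restriction

/-! ### Functions of class `H¹` -/

section sobolev

variable {f : ℝ → ℝ}

theorem MemH1.continuous (h : MemH1 f) : Continuous f := by
  refine continuous_iff_continuousAt.2 fun x => ?_
  refine (h.1 (x - 1) (x + 1)).continuousOn.continuousAt ?_
  rw [uIcc_of_le (by linarith)]
  exact Icc_mem_nhds (by linarith) (by linarith)

theorem MemH1.integral_deriv (h : MemH1 f) (a b : ℝ) : ∫ x in a..b, deriv f x = f b - f a :=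
  (h.1 a b).integral_deriv_eq_sub

theorem locallyIntegrable_of_memLp_two (h : MemLp f 2 volume) : LocallyIntegrable f :=
  h.locallyIntegrable (by norm_num)

/-- The average of an `L²` function over an interval of length one. -/
theorem integral_abs_le_of_memLp_two (h : MemLp f 2 volume) (x : ℝ) :
    ∫ y in x..(x + 1), |f y| ≤ 1 + ∫ y, f y ^ 2 := by
  have hi := h.integrable_sq
  have h1 : IntervalIntegrable (fun y => |f y|) volume x (x + 1) :=
    (((locallyIntegrable_of_memLp_two h).integrableOn_isCompact
      isCompact_uIcc).intervalIntegrable).abs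
  calc ∫ y in x..(x + 1), |f y| ≤ ∫ y in x..(x + 1), (1 + f y ^ 2) := by
        refine intervalIntegral.integral_mono_on (by linarith) h1
          (intervalIntegrable_const.add hi.intervalIntegrable) fun y _ => ?_
        nlinarith [sq_abs (f y), sq_nonneg (|f y| - 1)]
    _ = 1 + ∫ y in x..(x + 1), f y ^ 2 := by
        rw [intervalIntegral.integral_add intervalIntegrable_const hi.intervalIntegrable]
        simp
    _ ≤ _ := by
        rw [intervalIntegral.integral_of_le (by linarith)]
        exact add_le_add le_rfl (setIntegral_le_integral hi (.of_forall fun y => sq_nonneg _))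

/-- A function of class `H¹` is bounded: it differs from its averages over intervals of length one
by the integral of its derivative. -/
theorem MemH1.exists_bound (h : MemH1 f) : ∃ M, ∀ x, |f x| ≤ M := by
  set C := 1 + ∫ y, deriv f y ^ 2 with hC
  refine ⟨(1 + ∫ y, f y ^ 2) + C, fun x => ?_⟩
  have hd : ∀ y, IntervalIntegrable (fun z => |deriv f z|) volume x y := fun y =>
    (((locallyIntegrable_of_memLp_two h.2.2).integrableOn_isCompact
      isCompact_uIcc).intervalIntegrable).abs
  have h1 : ∀ y ∈ Icc x (x + 1), |f x| ≤ |f y| + C := fun y hy => by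
    have e1 : |f y - f x| ≤ ∫ z in x..y, |deriv f z| := by
      rw [← h.integral_deriv]
      exact intervalIntegral.abs_integral_le_integral_abs hy.1
    have e2 : ∫ z in x..y, |deriv f z| ≤ ∫ z in x..(x + 1), |deriv f z| :=
      intervalIntegral.integral_mono_interval le_rfl hy.1 hy.2 (.of_forall fun _ => abs_nonneg _)
        (hd _)
    have e3 := integral_abs_le_of_memLp_two h.2.2 x
    have e4 := abs_sub_abs_le_abs_sub (f x) (f y)
    rw [abs_sub_comm] at e4
    linarith
  have hi : IntervalIntegrable (fun z => |f z|) volume x (x + 1) :=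
    h.continuous.abs.intervalIntegrable _ _
  have h2 := intervalIntegral.integral_mono_on (by linarith) intervalIntegrable_const
    (hi.add intervalIntegrable_const) h1
  rw [intervalIntegral.integral_add hi intervalIntegrable_const] at h2
  simp only [intervalIntegral.integral_const, add_sub_cancel_left, one_smul] at h2
  linarith [integral_abs_le_of_memLp_two h.2.1 x]

end sobolev

/-! ### The data on the initial curve -/

section initialCurve

variable {c : ℝ → ℝ} {κ σ : ℝ} {p : LagHalf} {ψ : LagData} {Θ : CurveData}

theorem MemW1Inf.locallyLipschitz {f : ℝ → ℝ} (h : MemW1Inf f) : LocallyLipschitz f := by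
  obtain ⟨L, hL⟩ := h.1
  exact hL.locallyLipschitz

theorem lipschitz_of_memW1Inf_sub {f : ℝ → ℝ} (h : MemW1Inf fun X => f X - X) :
    ∃ L : ℝ≥0, LipschitzWith L f := by
  obtain ⟨L, hL⟩ := h.1
  refine ⟨L + 1, ?_⟩
  simpa using hL.add LipschitzWith.id

theorem exists_lipschitzWith_pi {f : ℝ → Vec5}
    (h : ∀ i, ∃ L : ℝ≥0, LipschitzWith L fun s => f s i) :
    ∃ L : ℝ≥0, LipschitzWith L f := by
  choose L hL using h
  refine ⟨∑ i, L i, LipschitzWith.of_dist_le_mul fun a b => ?_⟩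
  rw [dist_pi_le_iff (by positivity)]
  intro i
  refine ((hL i).dist_le_mul a b).trans (mul_le_mul_of_nonneg_right ?_ dist_nonneg)
  exact_mod_cast Finset.single_le_sum (f := L) (fun j _ => zero_le) (Finset.mem_univ i)

/-- The vector of the `X`-derivatives (`σ = 1`) or of the `Y`-derivatives (`σ = -1`) on the initial
curve. -/
def halfVec (c : ℝ → ℝ) (σ : ℝ) (p : LagHalf) (X : ℝ) : Vec5 :=
  ![σ * (1 / (2 * c (p.U X))) * deriv p.x X, 1 / 2 * deriv p.x X, p.V X, deriv p.J X, deriv p.K X]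

/-- The inverse of an element of the group is Lipschitz, so its derivative is bounded from below. -/
theorem MemGroup.exists_le_deriv {f : ℝ → ℝ} (h : MemGroup f) :
    ∃ δ > 0, ∀ x d, HasDerivAt f d x → δ ≤ |d| := by
  obtain ⟨⟨g, h1, -, -, h2⟩, -⟩ := h
  obtain ⟨L, hL⟩ := lipschitz_of_memW1Inf_sub h2
  refine ⟨1 / (L + 1), by positivity, fun x d hd => ?_⟩
  have h3 := (hasDerivAt_iff_tendsto_slope.1 hd).abs
  refine ge_of_tendsto h3 (eventually_nhdsWithin_of_forall fun y hy => ?_)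
  have h4 := hL.dist_le_mul (f y) (f x)
  rw [h1, h1, Real.dist_eq, Real.dist_eq] at h4
  have h5 : 0 < |y - x| := abs_pos.2 (sub_ne_zero.2 hy)
  rw [slope_def_field, abs_div, le_div_iff₀ h5, div_mul_eq_mul_div, one_mul,
    div_le_iff₀ (by positivity)]
  linarith [abs_nonneg (f y - f x)]

theorem IsHalf.congr {V W : ℝ → Vec5} (h : IsHalf V) (he : ∀ᵐ X, V X = W X) : IsHalf W := by
  obtain ⟨δ, hδ, hd⟩ := h.inv
  refine ⟨fun i => (h.bdd i).ae_eq (he.mono fun X hX => by rw [hX]), ⟨δ, hδ, ?_⟩,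
    fun i hi => (h.sq i hi).ae_eq (he.mono fun X hX => by rw [hX]), ?_⟩
  · filter_upwards [hd, he] with X h1 h2
    rwa [← h2]
  · filter_upwards [h.nonneg, he] with X h1 h2
    rwa [← h2]

namespace LagHalf.Admissible

theorem lip_x (h : p.Admissible c σ) : LocallyLipschitz p.x := by
  obtain ⟨L, hL⟩ := lipschitz_of_memW1Inf_sub h.x_reg
  exact hL.locallyLipschitz

theorem mono_x (h : p.Admissible c σ) : Monotone p.x := fun _ _ hab =>
  le_of_ae_deriv_nonneg h.lip_x hab (h.nonneg.mono fun _ hx _ => hx.1)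

theorem exists_le (h : p.Admissible c σ) : ∃ δ > 0, ∀ᵐ X, δ ≤ deriv p.x X + deriv p.J X := by
  obtain ⟨δ, hδ, hd⟩ := h.group.exists_le_deriv
  refine ⟨δ, hδ, ?_⟩
  filter_upwards [h.nonneg, h.lip_x.ae_differentiableAt,
    h.J_reg.locallyLipschitz.ae_differentiableAt]
    with X h1 h2 h3
  have := hd X _ (h2.hasDerivAt.add h3.hasDerivAt)
  rwa [abs_of_nonneg (add_nonneg h1.1 h1.2)] at this

theorem measurable_halfVec (hs : IsSpeed c κ) (h : p.Admissible c σ) (i : Fin 5) :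
    Measurable fun X => halfVec c σ p X i := by
  have hU : Measurable fun X => c (p.U X) := (hs.contDiff.continuous.comp
    h.U_reg.continuous).measurable
  have hV : Measurable p.V := p.V.stronglyMeasurable.measurable
  fin_cases i
  · exact ((measurable_const.div (hU.const_mul 2)).const_mul σ).mul (measurable_deriv p.x)
  · exact (measurable_deriv p.x).const_mul _
  · exact hV
  · exact measurable_deriv p.J
  · exact measurable_deriv p.K

theorem rel_halfVec (hs : IsSpeed c κ) (hσ : σ ^ 2 = 1) (h : p.Admissible c σ) :
    ∀ᵐ X, Rel c σ (p.U X) (halfVec c σ p X) := by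
  obtain ⟨δ, hδ, hd⟩ := h.exists_le
  filter_upwards [h.rel_JK, h.rel_xJV, h.nonneg, hd] with X h1 h2 h3 h4
  have hc := hs.pos (p.U X)
  refine ⟨?_, h1, ?_, ?_, h3.2, ?_⟩ <;> simp only [halfVec, Matrix.cons_val]
  · field_simp
    linear_combination (-deriv p.x X) * hσ
  · linear_combination h2
  · linarith [h3.1]
  · linarith [h3.1, h3.2]

/-- One half of the Lagrangian data gives one half of data on a curve. -/
theorem isHalf (hs : IsSpeed c κ) (h : p.Admissible c σ) : IsHalf (halfVec c σ p) := by
  obtain ⟨δ, hδ, hd⟩ := h.exists_le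
  have hκ := hs.pos_bound
  have hx : ∀ X, (halfVec c σ p X - halfX) 1 = 1 / 2 * (deriv p.x X - 1) := fun X => by
    simp only [sub_halfX_one, halfVec, Matrix.cons_val]; ring
  have hm := fun i => (measurable_halfVec hs h i).aestronglyMeasurable (μ := volume)
  have hg : ∀ {q : ℝ≥0∞} {i : Fin 5} {f : ℝ → ℝ}, i ≠ 1 → (∀ X, halfVec c σ p X i = f X) →
      MemLp f q volume → MemLp (fun X => (halfVec c σ p X - halfX) i) q volume :=
    fun hi he hf => hf.ae_eq (.of_forall fun X => ((sub_halfX_of_ne hi _).trans (he X)).symm)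
  refine ⟨fun i => ?_, ⟨δ / 2, by positivity, ?_⟩, fun i hi => ?_, ?_⟩
  · fin_cases i
    · obtain ⟨M, hM⟩ := ae_abs_le_of_memLp_top h.dx_bdd
      simp only [Fin.zero_eta, sub_halfX_of_ne (i := 0) (by decide)]
      refine memLp_top_of_bound (hm 0) (|σ| * κ * (|M| + 1)) ?_
      filter_upwards [hM] with X hX
      have h1 : |deriv p.x X| ≤ |M| + 1 := by
        have := abs_sub_abs_le_abs_sub (deriv p.x X) 1
        rw [abs_one] at this
        linarith [le_abs_self M]
      have h2 : |1 / (2 * c (p.U X))| ≤ κ := by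
        have hc := hs.pos (p.U X)
        rw [abs_of_pos (by positivity)]
        have := hs.inv_le (p.U X)
        calc 1 / (2 * c (p.U X)) = (c (p.U X))⁻¹ / 2 := by field_simp
          _ ≤ _ := by linarith [inv_pos.2 hc]
      simp only [halfVec, Matrix.cons_val, Real.norm_eq_abs, abs_mul]
      gcongr
    · exact (h.dx_bdd.const_mul (1 / 2)).ae_eq (.of_forall fun X => (hx X).symm)
    · exact hg (i := 2) (by decide) (fun _ => rfl) h.V_bdd
    · exact hg (i := 3) (by decide) (fun _ => rfl) h.dJ_bdd
    · exact hg (i := 4) (by decide) (fun _ => rfl) h.dK_bdd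
  · filter_upwards [hd, h.nonneg] with X h1 h2
    simp only [halfVec, Matrix.cons_val]
    linarith [h2.1, h2.2]
  · fin_cases i
    · exact absurd rfl hi
    · exact (h.dx_sq.const_mul (1 / 2)).ae_eq (.of_forall fun X => (hx X).symm)
    · exact hg (i := 2) (by decide) (fun _ => rfl) h.V_sq
    · exact hg (i := 3) (by decide) (fun _ => rfl) h.dJ_sq
    · exact hg (i := 4) (by decide) (fun _ => rfl) h.dK_sq
  · filter_upwards [h.nonneg] with X h1
    simp only [halfVec, Matrix.cons_val]
    exact ⟨by linarith [h1.1], h1.2⟩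

end LagHalf.Admissible

/-- On a curve where `x₁ = x₂`, the function `U` is Lipschitz, although `U₁` and `U₂` need not be:
its derivative is expressed by the bounded functions `V₁` and `V₂`. -/
theorem setF_deriv_U (hψ : ψ ∈ setF c) {X Y : ℝ → ℝ} (hc : IsCurve X Y)
    (hx : ∀ s, ψ.fst.x (X s) = ψ.snd.x (Y s)) :
    (∃ L : ℝ≥0, LipschitzWith L fun s => ψ.fst.U (X s)) ∧
    ∀ᵐ s, HasDerivAt (fun s => ψ.fst.U (X s))
      (deriv X s * ψ.fst.V (X s) + deriv Y s * ψ.snd.V (Y s)) s := by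
  obtain ⟨h1, h2, h3⟩ := hψ
  obtain ⟨-, h4⟩ := h3 X Y hc hx
  have hX := hc.isParam
  have hY := (isCurve_comm hc).isParam
  obtain ⟨M1, hM1⟩ := ae_abs_le_of_memLp_top h1.V_bdd
  obtain ⟨M2, hM2⟩ := ae_abs_le_of_memLp_top h2.V_bdd
  set w : ℝ → ℝ := fun s => deriv X s * ψ.fst.V (X s) + deriv Y s * ψ.snd.V (Y s) with hw
  have hwm : Measurable w := by
    have m1 : Measurable ψ.fst.V := ψ.fst.V.stronglyMeasurable.measurable
    have m2 : Measurable ψ.snd.V := ψ.snd.V.stronglyMeasurable.measurable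
    exact ((measurable_deriv X).mul (m1.comp hX.continuous.measurable)).add
      ((measurable_deriv Y).mul (m2.comp hY.continuous.measurable))
  have hwb : ∀ᵐ s, ‖w s‖ ≤ 2 * |M1| + 2 * |M2| := by
    have key : ∀ {f V : ℝ → ℝ} {M s : ℝ}, IsParam f → (deriv f s ≠ 0 → |V (f s)| ≤ M) →
        |deriv f s * V (f s)| ≤ 2 * |M| := by
      intro f V M s hf hV
      rw [abs_mul, abs_of_nonneg (hf.deriv_nonneg s)]
      by_cases h0 : deriv f s = 0
      · rw [h0, zero_mul]; positivity
      · exact mul_le_mul (hf.deriv_le s) ((hV h0).trans (le_abs_self M)) (abs_nonneg _)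
          (by norm_num)
    filter_upwards [hX.ae_comp hM1, hY.ae_comp hM2] with s e1 e2
    exact (abs_add_le _ _).trans (add_le_add (key hX e1) (key hY e2))
  have hwi : LocallyIntegrable w := by
    rw [locallyIntegrable_iff]
    exact fun k hk => Measure.integrableOn_of_bounded hk.measure_ne_top
      hwm.aestronglyMeasurable (ae_restrict_of_ae hwb)
  have hint : ∀ a b, ψ.fst.U (X b) - ψ.fst.U (X a) = ∫ s in a..b, w s := fun a b => by
    rw [← h1.U_reg.integral_deriv, hX.intervalIntegral_comp]
    refine intervalIntegral.integral_congr_ae (h4.mono fun s hs _ => ?_)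
    rw [smul_eq_mul, mul_comm, hs.1, hs.2, hw]
    ring
  refine ⟨⟨⟨2 * |M1| + 2 * |M2|, by positivity⟩, LipschitzWith.of_dist_le_mul fun a b => ?_⟩, ?_⟩
  · rw [Real.dist_eq, hint, Real.dist_eq, ← Real.norm_eq_abs]
    exact intervalIntegral.norm_integral_le_of_norm_le_const_ae (hwb.mono fun s hs _ => hs)
  · filter_upwards [LocallyIntegrable.ae_hasDerivAt_integral hwi] with s hs
    have := (hs 0).const_add (ψ.fst.U (X 0))
    convert! this using 1
    funext r
    rw [← hint]
    ring

theorem LagHalf.Admissible.exists_near (h : p.Admissible c σ) : ∃ M, ∀ X, |p.x X - X| ≤ M :=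
  h.x_reg.2

/-- The zeros of `x₁(X) - x₂(Y)` contain a curve: this is a level function. -/
theorem setF_isLevel (hψ : ψ ∈ setF c) :
    ∃ L, IsLevel (fun X Y => ψ.fst.x X - ψ.snd.x Y) L := by
  obtain ⟨h1, h2, -⟩ := hψ
  obtain ⟨M1, hM1⟩ := h1.exists_near
  obtain ⟨M2, hM2⟩ := h2.exists_near
  refine ⟨M1 + M2 + 1, ?_, fun Y a b hab => sub_le_sub_right (h1.mono_x hab) _,
    fun X a b hab => sub_le_sub_left (h2.mono_x hab) _, fun X Y hL => ?_, fun X Y hL => ?_⟩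
  · exact (h1.lip_x.continuous.comp continuous_fst).sub (h2.lip_x.continuous.comp continuous_snd)
  all_goals
    have e1 := abs_le.1 (hM1 X)
    have e2 := abs_le.1 (hM2 Y)
    linarith

/-- The elements of `ℱ` give data in `𝒢` on every curve where `x₁ = x₂`. -/
theorem IsC.memG (hs : IsSpeed c κ) (hψ : ψ ∈ setF c) (hC : IsC c ψ Θ) (hc : IsCurve Θ.X Θ.Y) :
    MemG c Θ := by
  have hx : ∀ s, ψ.fst.x (Θ.X s) = ψ.snd.x (Θ.Y s) := fun s => by
    rw [← (hC.eq_x s).1, (hC.eq_x s).2]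
  obtain ⟨⟨L, hL⟩, hdU⟩ := setF_deriv_U hψ hc hx
  obtain ⟨h1, h2, -⟩ := hψ
  have hX := hc.isParam
  have hY := (isCurve_comm hc).isParam
  have eV : ∀ᵐ X, halfVec c 1 ψ.fst X = Θ.V X := by
    filter_upwards [hC.eq_V] with X h
    rw [h, halfVec, one_mul]
  have eW : ∀ᵐ Y, halfVec c (-1) ψ.snd Y = Θ.W Y := by
    filter_upwards [hC.eq_W] with X h
    rw [h, halfVec, neg_one_mul]
  have hV : IsHalf Θ.V := (h1.isHalf hs).congr eV
  have hW : IsHalf Θ.W := (h2.isHalf hs).congr eW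
  have rV := h1.rel_halfVec hs (by norm_num)
  have rW := h2.rel_halfVec hs (by norm_num)
  have zx : (fun s => Θ.Z s 1) = fun s => ψ.fst.x (Θ.X s) := funext fun s => (hC.eq_x s).1
  have zx' : (fun s => Θ.Z s 1) = fun s => ψ.snd.x (Θ.Y s) := funext fun s => (hC.eq_x s).2
  have zU : (fun s => Θ.Z s 2) = fun s => ψ.fst.U (Θ.X s) := funext fun s => (hC.eq_U s).1
  obtain ⟨N, hN⟩ := hX.near
  have hlip : ∀ i, ∃ L : ℝ≥0, LipschitzWith L fun s => Θ.Z s i := by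
    have hcomp : ∀ {f X : ℝ → ℝ}, (∃ L : ℝ≥0, LipschitzWith L f) → IsParam X →
        ∃ L : ℝ≥0, LipschitzWith L fun s => f (X s) := fun ⟨L, hL⟩ hX => ⟨_, hL.comp hX.lip⟩
    have hadd : ∀ {f g : ℝ → ℝ}, (∃ L : ℝ≥0, LipschitzWith L f) → (∃ L : ℝ≥0, LipschitzWith L g) →
        ∃ L : ℝ≥0, LipschitzWith L fun s => f s + g s := fun ⟨L, hL⟩ ⟨M, hM⟩ => ⟨_, hL.add hM⟩
    intro i
    fin_cases i
    · exact ⟨0, by simpa only [hC.eq_t, Fin.zero_eta] using LipschitzWith.const (0 : ℝ)⟩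
    · simp only [Fin.mk_one, zx]
      exact hcomp (lipschitz_of_memW1Inf_sub h1.x_reg) hX
    · simp only [Fin.reduceFinMk, zU]
      exact ⟨L, hL⟩
    · simp only [Fin.reduceFinMk, hC.eq_J]
      exact hadd (hcomp h1.J_reg.1 hX) (hcomp h2.J_reg.1 hY)
    · simp only [Fin.reduceFinMk, hC.eq_K]
      exact hadd (hcomp h1.K_reg.1 hX) (hcomp h2.K_reg.1 hY)
  refine ⟨hc, exists_lipschitzWith_pi hlip, ?_, hV.bdd, hW.bdd, hV.inv, hW.inv, ?_, hV.sq, hW.sq,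
    hV.nonneg, hW.nonneg, ?_, ?_, ?_, ?_⟩
  · obtain ⟨M1, hM1⟩ := h1.exists_near
    obtain ⟨M2, hM2⟩ := h1.U_reg.exists_bound
    obtain ⟨M3, hM3⟩ := h1.J_reg.2
    obtain ⟨M4, hM4⟩ := h2.J_reg.2
    obtain ⟨M5, hM5⟩ := h1.K_reg.2
    obtain ⟨M6, hM6⟩ := h2.K_reg.2
    have n0 := (abs_nonneg _).trans (hN 0)
    have n1 := (abs_nonneg _).trans (hM1 0)
    have n2 := (abs_nonneg _).trans (hM2 0)
    have n3 := (abs_nonneg _).trans (hM3 0)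
    have n4 := (abs_nonneg _).trans (hM4 0)
    have n5 := (abs_nonneg _).trans (hM5 0)
    have n6 := (abs_nonneg _).trans (hM6 0)
    refine ⟨N + M1 + M2 + (M3 + M4) + (M5 + M6), fun s i => ?_⟩
    fin_cases i <;> simp only [Fin.zero_eta, Fin.mk_one, Fin.reduceFinMk, Pi.sub_apply,
      Matrix.cons_val, sub_zero, hC.eq_t, (hC.eq_x s).1, (hC.eq_U s).1, hC.eq_J, hC.eq_K]
    · rw [abs_zero]; positivity
    · have := abs_add_le (ψ.fst.x (Θ.X s) - Θ.X s) (Θ.X s - s)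
      rw [sub_add_sub_cancel] at this
      linarith [hM1 (Θ.X s), hN s]
    · linarith [hM2 (Θ.X s)]
    · linarith [abs_add_le (ψ.fst.J (Θ.X s)) (ψ.snd.J (Θ.Y s)), hM3 (Θ.X s), hM4 (Θ.Y s)]
    · linarith [abs_add_le (ψ.fst.K (Θ.X s)) (ψ.snd.K (Θ.Y s)), hM5 (Θ.X s), hM6 (Θ.Y s)]
  · have i1 := (hX.integrable_comp_iff fun x => ψ.fst.U x ^ 2).1 h1.U_reg.2.1.integrable_sq
    have i2 := (hY.integrable_comp_iff fun x => ψ.snd.U x ^ 2).1 h2.U_reg.2.1.integrable_sq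
    refine memLp_two_of_sq_le ?_ (i1.add i2) ?_
    · exact (h1.U_reg.continuous.comp hX.continuous).aestronglyMeasurable.congr
        (.of_forall fun s => (congrFun zU s).symm)
    · filter_upwards [hX.ae_differentiableAt, hY.ae_differentiableAt] with s d1 d2
      -- `U² = (𝒳' + 𝒴') U² / 2`, and each of the two terms is integrable by a change of variables
      have h3 : deriv Θ.X s + deriv Θ.Y s = 2 := by
        have h4 := d1.hasDerivAt.add d2.hasDerivAt
        have h5 : Θ.X + Θ.Y = fun s => 2 * s := funext fun s => isCurve_add hc s
        rw [h5] at h4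
        have h6 := (hasDerivAt_id s).const_mul (2 : ℝ)
        rw [mul_one] at h6
        exact h4.unique h6
      simp only [Pi.add_apply, smul_eq_mul]
      rw [← (hC.eq_U s).1, ← (hC.eq_U s).2, ← add_mul, h3]
      linarith [sq_nonneg (Θ.Z s 2)]
  · filter_upwards [hdU, hX.ae_hasDerivAt_comp h1.lip_x, hY.ae_hasDerivAt_comp h2.lip_x,
      hX.ae_hasDerivAt_comp h1.J_reg.locallyLipschitz,
      hY.ae_hasDerivAt_comp h2.J_reg.locallyLipschitz,
      hX.ae_hasDerivAt_comp h1.K_reg.locallyLipschitz,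
      hY.ae_hasDerivAt_comp h2.K_reg.locallyLipschitz, hX.ae_comp eV, hY.ae_comp eW]
      with s dU dx1 dx2 dJ1 dJ2 dK1 dK2 hv hw
    have e1 : deriv Θ.X s • Θ.V (Θ.X s) = deriv Θ.X s • halfVec c 1 ψ.fst (Θ.X s) := by
      by_cases h0 : deriv Θ.X s = 0
      · rw [h0, zero_smul, zero_smul]
      · rw [hv h0]
    have e2 : deriv Θ.Y s • Θ.W (Θ.Y s) = deriv Θ.Y s • halfVec c (-1) ψ.snd (Θ.Y s) := by
      by_cases h0 : deriv Θ.Y s = 0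
      · rw [h0, zero_smul, zero_smul]
      · rw [hw h0]
    rw [e1, e2]
    -- as `x₁ = x₂` on the curve, the two terms of the derivative of `x` are equal; hence those of
    -- the derivative of `t` cancel
    have e3 : deriv Θ.X s * deriv ψ.fst.x (Θ.X s) = deriv Θ.Y s * deriv ψ.snd.x (Θ.Y s) := by
      rw [← zx] at dx1
      rw [← zx'] at dx2
      exact dx1.unique dx2
    refine HasDerivAt.deriv (hasDerivAt_pi.2 fun i => ?_)
    fin_cases i <;> simp only [Fin.zero_eta, Fin.mk_one, Fin.reduceFinMk, Pi.add_apply,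
      Pi.smul_apply, smul_eq_mul, halfVec, Matrix.cons_val]
    · simp only [hC.eq_t]
      have : deriv Θ.X s * (1 * (1 / (2 * c (ψ.fst.U (Θ.X s)))) * deriv ψ.fst.x (Θ.X s)) +
          deriv Θ.Y s * (-1 * (1 / (2 * c (ψ.snd.U (Θ.Y s)))) * deriv ψ.snd.x (Θ.Y s)) = 0 := by
        rw [← (hC.eq_U s).1, ← (hC.eq_U s).2]
        linear_combination (1 / (2 * c (Θ.Z s 2))) * e3
      rw [this]
      exact hasDerivAt_const s 0
    · rw [zx]
      convert! dx1 using 1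
      linear_combination (-1 / 2) * e3
    · rw [zU]; exact dU
    · simp only [hC.eq_J]; exact dJ1.add dJ2
    · simp only [hC.eq_K]; exact dK1.add dK2
  · filter_upwards [rV, eV] with x r e s hs
    rw [← e, (hC.eq_U s).1, hs]
    exact ⟨r.energy, by rw [r.tx, one_mul], by rw [r.KJ, one_mul]⟩
  · filter_upwards [rW, eW] with x r e s hs
    rw [← e, (hC.eq_U s).2, hs]
    exact ⟨r.energy, by rw [r.tx]; ring, by rw [r.KJ]; ring⟩
  · simp only [hC.eq_J]
    simpa using (h1.J_lim.comp hX.tendsto_atBot).add (h2.J_lim.comp hY.tendsto_atBot)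

theorem IsC.curve_eq (hC : IsC c ψ Θ) :
    Θ.X = leftCurve (fun X Y => ψ.fst.x X - ψ.snd.x Y) ∧
      Θ.Y = fun s => 2 * s - leftCurve (fun X Y => ψ.fst.x X - ψ.snd.x Y) s := by
  have hX : Θ.X = leftCurve (fun X Y => ψ.fst.x X - ψ.snd.x Y) := funext fun s => by
    rw [hC.eq_X, leftCurve]
    simp only [sub_neg]
  exact ⟨hX, funext fun s => by rw [hC.eq_Y, hX]⟩

/-- The data on the leftmost curve where `x₁ = x₂`. -/
theorem existsUnique_isC (hs : IsSpeed c κ) (hψ : ψ ∈ setF c) :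
    ∃ Θ ∈ setG0 c, IsC c ψ Θ ∧ ∀ Θ', IsC c ψ Θ' → Θ' = Θ := by
  obtain ⟨L, hl⟩ := setF_isLevel hψ
  have hx := fun s => sub_eq_zero.1 (hl.eq_zero s)
  have hU := (hψ.2.2 _ _ hl.isCurve hx).1
  have h1 := hψ.1
  have h2 := hψ.2.1
  have m1 : AEStronglyMeasurable (halfVec c 1 ψ.fst) volume :=
    (measurable_pi_iff.2 (h1.measurable_halfVec hs)).aestronglyMeasurable
  have m2 : AEStronglyMeasurable (halfVec c (-1) ψ.snd) volume :=
    (measurable_pi_iff.2 (h2.measurable_halfVec hs)).aestronglyMeasurable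
  set X := leftCurve (fun X Y => ψ.fst.x X - ψ.snd.x Y) with hX
  let Θ : CurveData := ⟨X, fun s => 2 * s - X s, fun s => ![0, ψ.fst.x (X s), ψ.fst.U (X s),
    ψ.fst.J (X s) + ψ.snd.J (2 * s - X s), ψ.fst.K (X s) + ψ.snd.K (2 * s - X s)],
    AEEqFun.mk _ m1, AEEqFun.mk _ m2⟩
  have hC : IsC c ψ Θ := by
    refine ⟨fun s => ?_, fun s => rfl, fun s => rfl, fun s => ⟨rfl, hx s⟩, fun s => ⟨rfl, hU s⟩,
      fun s => rfl, fun s => rfl, ?_, ?_⟩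
    · simp only [Θ, hX, leftCurve, sub_neg]
    · filter_upwards [AEEqFun.coeFn_mk _ m1] with x h
      rw [h, halfVec, one_mul]
    · filter_upwards [AEEqFun.coeFn_mk _ m2] with x h
      rw [h, halfVec, neg_one_mul]
  refine ⟨Θ, ⟨hC.memG hs hψ hl.isCurve, hC.eq_t⟩, hC, fun Θ' hC' => ?_⟩
  have eX : Θ'.X = Θ.X := by rw [hC'.curve_eq.1, hC.curve_eq.1]
  have eY : Θ'.Y = Θ.Y := by rw [hC'.curve_eq.2, hC.curve_eq.2]
  refine CurveData.ext eX eY (funext fun s => funext fun i => ?_) (AEEqFun.ext ?_) (AEEqFun.ext ?_)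
  · fin_cases i <;> simp only [Fin.zero_eta, Fin.mk_one, Fin.reduceFinMk]
    · rw [hC.eq_t, hC'.eq_t]
    · rw [(hC.eq_x s).1, (hC'.eq_x s).1, eX]
    · rw [(hC.eq_U s).1, (hC'.eq_U s).1, eX]
    · rw [hC.eq_J, hC'.eq_J, eX, eY]
    · rw [hC.eq_K, hC'.eq_K, eX, eY]
  · filter_upwards [hC.eq_V, hC'.eq_V] with x e1 e2
    rw [e1, e2]
  · filter_upwards [hC.eq_W, hC'.eq_W] with x e1 e2
    rw [e1, e2]

end initialCurve

/-! ### Primitives -/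

section primitive

variable {f u g : ℝ → ℝ}

theorem integral_Iic_sub (hg : Integrable g) (a b : ℝ) :
    (∫ y in Iic b, g y) - ∫ y in Iic a, g y = ∫ y in a..b, g y :=
  intervalIntegral.integral_Iic_sub_Iic hg.integrableOn hg.integrableOn

theorem ae_hasDerivAt_of_integral (hu : LocallyIntegrable u)
    (h : ∀ a b, f b - f a = ∫ y in a..b, u y) : ∀ᵐ x, HasDerivAt f (u x) x := by
  filter_upwards [LocallyIntegrable.ae_hasDerivAt_integral hu] with x hx
  have := (hx 0).const_add (f 0)
  convert! this using 1
  funext y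
  rw [← h]; ring

theorem lipschitz_of_integral {M : ℝ} (hM : ∀ᵐ x, |u x| ≤ M)
    (h : ∀ a b, f b - f a = ∫ y in a..b, u y) : ∃ L : ℝ≥0, LipschitzWith L f := by
  refine ⟨⟨|M|, abs_nonneg M⟩, LipschitzWith.of_dist_le_mul fun a b => ?_⟩
  rw [Real.dist_eq, h, Real.dist_eq, ← Real.norm_eq_abs]
  exact intervalIntegral.norm_integral_le_of_norm_le_const_ae
    (hM.mono fun s hs _ => hs.trans (le_abs_self M))

theorem memW1Inf_primitive (hg : Integrable g) {M : ℝ} (hM : ∀ᵐ x, |g x| ≤ M) :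
    MemW1Inf fun x => ∫ y in Iic x, g y := by
  refine ⟨lipschitz_of_integral hM (integral_Iic_sub hg), ∫ y, ‖g y‖, fun x => ?_⟩
  exact (norm_integral_le_integral_norm _).trans
    (setIntegral_le_integral hg.norm (.of_forall fun _ => norm_nonneg _))

theorem memH1_of_integral (hf : MemLp f 2 volume) (hu : MemLp u 2 volume)
    (h : ∀ a b, f b - f a = ∫ y in a..b, u y) : MemH1 f := by
  have hl := locallyIntegrable_of_memLp_two hu
  refine ⟨fun a b => ?_, hf, hu.ae_eq ?_⟩
  · have h1 := IntervalIntegrable.absolutelyContinuousOnInterval_intervalIntegral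
      (hl.integrableOn_isCompact isCompact_uIcc).intervalIntegrable (a := a) (b := b)
      (c := a) (by simp)
    have h2 : AbsolutelyContinuousOnInterval (fun _ : ℝ => f a) a b :=
      (LipschitzWith.const (f a)).lipschitzOnWith.absolutelyContinuousOnInterval
    convert! h2.add h1 using 1
    funext y
    rw [Pi.add_apply, ← h]; ring
  · filter_upwards [ae_hasDerivAt_of_integral hl h] with x hx
    exact hx.deriv.symm

/-- The chain rule for a function of class `H¹` and a monotone parametrization. -/
theorem MemH1.ae_hasDerivAt_comp (h : MemH1 f) {X : ℝ → ℝ} (hX : IsParam X) :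
    ∀ᵐ s, HasDerivAt (fun s => f (X s)) (deriv X s * deriv f (X s)) s := by
  have hl := locallyIntegrable_of_memLp_two h.2.2
  refine ae_hasDerivAt_of_integral ?_ fun a b => ?_
  · rw [locallyIntegrable_iff]
    intro k hk
    obtain ⟨r, hr⟩ := hk.isBounded.subset_closedBall 0
    rw [Real.closedBall_eq_Icc] at hr
    refine IntegrableOn.mono_set ?_ hr
    have := hX.intervalIntegrable_comp hl (0 - |r|) (0 + |r|)
    rw [intervalIntegrable_iff_integrableOn_Icc_of_le (by linarith [abs_nonneg r])] at this
    exact this.mono_set (Icc_subset_Icc (by linarith [le_abs_self r]) (by linarith [le_abs_self r]))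
  · rw [← h.integral_deriv, hX.intervalIntegral_comp]
    rfl

/-- A function with a bounded derivative that is bounded from below by a positive number, close to
the identity, is an element of the group. -/
theorem memGroup_of_integral {f u : ℝ → ℝ} (hu : LocallyIntegrable u)
    (h : ∀ a b, f b - f a = ∫ y in a..b, u y) {M : ℝ} (hM : ∀ᵐ x, |u x - 1| ≤ M)
    {δ : ℝ} (hδ : 0 < δ) (hd : ∀ᵐ x, δ ≤ u x) {N : ℝ} (hN : ∀ x, |f x - x| ≤ N)
    (h2 : MemLp (fun x => u x - 1) 2 volume) : MemGroup f := by
  have hi : ∀ a b, IntervalIntegrable u volume a b := fun a b =>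
    (hu.integrableOn_isCompact isCompact_uIcc).intervalIntegrable
  have hlow : ∀ a b, a ≤ b → δ * (b - a) ≤ f b - f a := fun a b hab => by
    rw [h]
    have := intervalIntegral.integral_mono_ae hab intervalIntegrable_const (hi a b) hd
    simp only [intervalIntegral.integral_const, smul_eq_mul] at this
    linarith
  have hsub : ∀ a b, (f b - b) - (f a - a) = ∫ y in a..b, (u y - 1) := fun a b => by
    rw [intervalIntegral.integral_sub (hi a b) intervalIntegrable_const, ← h]
    simp only [intervalIntegral.integral_const, smul_eq_mul]
    ring
  have hl1 : LocallyIntegrable fun x => u x - 1 := hu.sub (locallyIntegrable_const 1)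
  obtain ⟨L, hL⟩ := lipschitz_of_integral hM hsub
  have hfL : ∃ L : ℝ≥0, LipschitzWith L f := lipschitz_of_memW1Inf_sub ⟨⟨L, hL⟩, N, hN⟩
  obtain ⟨L', hL'⟩ := hfL
  have hanti : ∀ a b, |b - a| ≤ 1 / δ * |f b - f a| := fun a b => by
    rw [one_div, ← div_eq_inv_mul, le_div_iff₀ hδ]
    rcases le_total a b with hab | hab
    · rw [abs_of_nonneg (by linarith)]
      linarith [hlow a b hab, le_abs_self (f b - f a)]
    · rw [abs_of_nonpos (by linarith)]
      linarith [hlow b a hab, neg_abs_le (f b - f a)]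
  have hinj : Function.Injective f := fun a b hab => by
    have := hanti a b
    rw [hab, sub_self, abs_zero, mul_zero] at this
    exact (sub_eq_zero.1 (abs_nonpos_iff.1 this)).symm
  have hsurj : Function.Surjective f := by
    refine hL'.continuous.surjective ?_ ?_
    · refine tendsto_atTop_mono (f := fun x => x - N) (fun x => ?_)
        (tendsto_atTop_add_const_right _ _ tendsto_id)
      linarith [(abs_le.1 (hN x)).1]
    · refine tendsto_atBot_mono (fun x => ?_)
        (tendsto_atBot_add_const_right _ N tendsto_id)
      have := (abs_le.1 (hN x)).2
      change f x ≤ x + N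
      linarith
  obtain ⟨g, hg1, hg2⟩ := Function.bijective_iff_has_inverse.1 ⟨hinj, hsurj⟩
  refine ⟨⟨g, hg1, hg2, ⟨⟨L, hL⟩, N, hN⟩, ⟨⟨⟨1 / δ, by positivity⟩ + 1, ?_⟩, N, fun x => ?_⟩⟩, ?_⟩
  · refine LipschitzWith.sub (LipschitzWith.of_dist_le_mul fun a b => ?_) LipschitzWith.id
    have := hanti (g b) (g a)
    rwa [hg2, hg2, ← Real.dist_eq, ← Real.dist_eq] at this
  · have := hN (g x)
    rwa [hg2, abs_sub_comm] at this
  · refine h2.ae_eq ?_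
    filter_upwards [ae_hasDerivAt_of_integral hl1 hsub] with x hx
    exact hx.deriv.symm

end primitive

/-! ### Lagrangian data from data at time zero -/

section lagrangian

variable {c : ℝ → ℝ} {κ σ : ℝ} {X : ℝ → ℝ} {z : ℝ → Vec5} {V : ℝ →ₘ[volume] (Fin 5 → ℝ)}

/-- What is used of one half of the data at time zero to invert the parametrization `X`. Both `x`
and `U` are constant where `X` is, and the derivative of `U` is square integrable with respect to
the variable `X`. -/
structure IsTimeZero (c : ℝ → ℝ) (σ : ℝ) (X : ℝ → ℝ) (z : ℝ → Vec5)
    (V : ℝ →ₘ[volume] (Fin 5 → ℝ)) : Prop where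
  param : IsParam X
  half : IsHalf V
  rel : ∀ᵐ x, Rel c σ (z (leftInv X x) 2) (V x)
  lip_x : LocallyLipschitz fun s => z s 1
  lip_U : LocallyLipschitz fun s => z s 2
  near : ∃ M, ∀ s, |z s 1 - s| ≤ M
  dx : ∀ᵐ s, HasDerivAt (fun s => z s 1) (deriv X s * (2 * V (X s) 1)) s
  U_const : ∀ s r, z s 1 = z r 1 → z s 2 = z r 2
  U_sq : MemLp (fun s => z s 2) 2 volume
  energy : ∃ G : ℝ → ℝ, Integrable G ∧ ∀ᵐ s, deriv (fun s => z s 2) s ^ 2 ≤ deriv X s * G s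

/-- One half of the Lagrangian data of data at time zero. -/
def lagHalf (X : ℝ → ℝ) (z : ℝ → Vec5) (V : ℝ →ₘ[volume] (Fin 5 → ℝ)) : LagHalf where
  x x := z (leftInv X x) 1
  U x := z (leftInv X x) 2
  V := AEEqFun.comp (fun v : Fin 5 → ℝ => v 2) (continuous_apply 2) V
  J x := ∫ y in Iic x, V y 3
  K x := ∫ y in Iic x, V y 4

namespace IsTimeZero

theorem coe_V : ∀ᵐ x, (lagHalf X z V).V x = V x 2 :=
  AEEqFun.coeFn_comp (fun v : Fin 5 → ℝ => v 2) (continuous_apply 2) V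

theorem locallyIntegrable (h : IsTimeZero c σ X z V) (i : Fin 5) :
    LocallyIntegrable fun x => V x i := by
  obtain ⟨M, -, hM⟩ := h.half.exists_bound
  rw [locallyIntegrable_iff]
  exact fun k hk => Measure.integrableOn_of_bounded hk.measure_ne_top
    (h.half.aestronglyMeasurable i)
    (ae_restrict_of_ae (hM.mono fun x hx => (norm_le_pi_norm _ i).trans hx))

theorem x_sub (h : IsTimeZero c σ X z V) (s r : ℝ) :
    z r 1 - z s 1 = ∫ y in X s..X r, 2 * V y 1 := by
  rw [h.param.intervalIntegral_comp,
    ← (h.lip_x.absolutelyContinuousOnInterval s r).integral_deriv_eq_sub]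
  exact intervalIntegral.integral_congr_ae (h.dx.mono fun s hs _ => hs.deriv)

theorem x_eq (h : IsTimeZero c σ X z V) (s : ℝ) : (lagHalf X z V).x (X s) = z s 1 := by
  have := h.x_sub s (leftInv X (X s))
  rw [h.param.apply_leftInv, intervalIntegral.integral_same] at this
  exact sub_eq_zero.1 this

theorem U_eq (h : IsTimeZero c σ X z V) (s : ℝ) : (lagHalf X z V).U (X s) = z s 2 :=
  h.U_const _ _ (h.x_eq s)

theorem lag_x_sub (h : IsTimeZero c σ X z V) (a b : ℝ) :
    (lagHalf X z V).x b - (lagHalf X z V).x a = ∫ y in a..b, 2 * V y 1 := by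
  have := h.x_sub (leftInv X a) (leftInv X b)
  rwa [h.param.apply_leftInv, h.param.apply_leftInv] at this

theorem ae_deriv_x (h : IsTimeZero c σ X z V) :
    ∀ᵐ x, HasDerivAt (lagHalf X z V).x (2 * V x 1) x :=
  ae_hasDerivAt_of_integral ((h.locallyIntegrable 1).smul (2 : ℝ)) h.lag_x_sub

theorem integrable_J (h : IsTimeZero c σ X z V) (hs : IsSpeed c κ) : Integrable fun x => V x 3 :=
  h.half.integrable_J hs (h.rel.mono fun _ h => h.energy)

theorem integrable_K (h : IsTimeZero c σ X z V) (hs : IsSpeed c κ) (hσ : σ ^ 2 = 1) :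
    Integrable fun x => V x 4 := by
  refine ((h.integrable_J hs).const_mul κ).mono' (h.half.aestronglyMeasurable 4) ?_
  filter_upwards [h.rel] with x hx
  exact abs_le_of_speed_mul hs hσ hx.J_nonneg hx.KJ

/-- The function `U` of the variable `X` is of class `H¹`. Its derivative is the quotient of the
derivatives of `U` and of `X` with respect to the parameter; where the latter vanishes, so does the
former. -/
theorem U_reg (h : IsTimeZero c σ X z V) : MemH1 (lagHalf X z V).U := by
  obtain ⟨G, hG, hle⟩ := h.energy
  have hX := h.param
  set u : ℝ → ℝ := fun x => deriv (fun s => z s 2) (leftInv X x) / deriv X (leftInv X x) with hu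
  have hinv : ∀ᵐ s, deriv X s ≠ 0 → leftInv X (X s) = s := by
    filter_upwards [hX.ae_differentiableAt] with s hs h0
    exact hX.eq_of_deriv_pos hs.hasDerivAt (lt_of_le_of_ne (hX.deriv_nonneg s) (Ne.symm h0))
      (hX.apply_leftInv _)
  have hum : Measurable u := ((measurable_deriv _).comp hX.leftInv_mono.measurable).div
    ((measurable_deriv _).comp hX.leftInv_mono.measurable)
  have hUm : Measurable (lagHalf X z V).U :=
    h.lip_U.continuous.measurable.comp hX.leftInv_mono.measurable
  refine memH1_of_integral (u := u) ?_ ?_ fun a b => ?_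
  · rw [memLp_two_iff_integrable_sq hUm.aestronglyMeasurable, hX.integrable_comp_iff]
    refine (h.U_sq.integrable_sq.const_mul 2).mono' ?_ (.of_forall fun s => ?_)
    · exact ((measurable_deriv X).mul
        ((hUm.comp hX.continuous.measurable).pow_const 2)).aestronglyMeasurable
    · rw [h.U_eq, smul_eq_mul, Real.norm_eq_abs,
        abs_of_nonneg (mul_nonneg (hX.deriv_nonneg s) (sq_nonneg _))]
      exact mul_le_mul_of_nonneg_right (hX.deriv_le s) (sq_nonneg _)
  · rw [memLp_two_iff_integrable_sq hum.aestronglyMeasurable, hX.integrable_comp_iff]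
    refine hG.norm.mono' ?_ ?_
    · exact ((measurable_deriv X).mul
        ((hum.comp hX.continuous.measurable).pow_const 2)).aestronglyMeasurable
    · filter_upwards [hinv, hle] with s h1 h2
      rw [smul_eq_mul, Real.norm_eq_abs,
        abs_of_nonneg (mul_nonneg (hX.deriv_nonneg s) (sq_nonneg _))]
      by_cases h0 : deriv X s = 0
      · rw [h0, zero_mul]; positivity
      · have hpos : 0 < deriv X s := lt_of_le_of_ne (hX.deriv_nonneg s) (Ne.symm h0)
        refine le_trans ?_ (le_abs_self _)
        rw [hu]
        simp only [h1 h0]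
        rw [div_pow, mul_div_assoc', div_le_iff₀ (by positivity)]
        nlinarith
  · have h1 : (lagHalf X z V).U b - (lagHalf X z V).U a =
        ∫ s in (leftInv X a)..(leftInv X b), deriv (fun s => z s 2) s :=
      (h.lip_U.absolutelyContinuousOnInterval _ _).integral_deriv_eq_sub.symm
    have h2 := hX.intervalIntegral_comp u (leftInv X a) (leftInv X b)
    rw [hX.apply_leftInv, hX.apply_leftInv] at h2
    rw [h1, h2]
    refine intervalIntegral.integral_congr_ae ?_
    filter_upwards [hinv, hle] with s e1 e2 _
    rw [smul_eq_mul]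
    by_cases h0 : deriv X s = 0
    · rw [h0, zero_mul] at e2
      rw [h0, zero_mul]
      exact pow_eq_zero_iff (two_ne_zero) |>.1 (le_antisymm e2 (sq_nonneg _))
    · rw [hu]
      simp only [e1 h0]
      field_simp

theorem ae_deriv_J (h : IsTimeZero c σ X z V) (hs : IsSpeed c κ) :
    ∀ᵐ x, HasDerivAt (lagHalf X z V).J (V x 3) x :=
  ae_hasDerivAt_of_integral (h.integrable_J hs).locallyIntegrable
    (integral_Iic_sub (h.integrable_J hs))

theorem ae_deriv_K (h : IsTimeZero c σ X z V) (hs : IsSpeed c κ) (hσ : σ ^ 2 = 1) :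
    ∀ᵐ x, HasDerivAt (lagHalf X z V).K (V x 4) x :=
  ae_hasDerivAt_of_integral (h.integrable_K hs hσ).locallyIntegrable
    (integral_Iic_sub (h.integrable_K hs hσ))

theorem halfVec_eq (h : IsTimeZero c σ X z V) (hs : IsSpeed c κ) (hσ : σ ^ 2 = 1) :
    ∀ᵐ x, halfVec c σ (lagHalf X z V) x = V x := by
  filter_upwards [h.ae_deriv_x, h.ae_deriv_J hs, h.ae_deriv_K hs hσ, h.rel,
    coe_V (z := z) (V := V) (X := X)] with x h1 h2 h3 h4 h5
  have hc := hs.pos (z (leftInv X x) 2)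
  ext i
  fin_cases i <;> simp only [halfVec, Fin.zero_eta, Fin.mk_one, Fin.reduceFinMk, Matrix.cons_val,
    h1.deriv, h2.deriv, h3.deriv, h5]
  · rw [h4.tx]
    change σ * (1 / (2 * c (z (leftInv X x) 2))) * _ = _
    field_simp
    rw [hσ, one_mul]
  · ring

/-- The Lagrangian data satisfy the conditions that involve one half only. -/
theorem admissible (h : IsTimeZero c σ X z V) (hs : IsSpeed c κ) (hσ : σ ^ 2 = 1) :
    (lagHalf X z V).Admissible c σ := by
  have hX := h.param
  obtain ⟨B, hB0, hB⟩ := h.half.exists_bound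
  have hBi : ∀ i, ∀ᵐ x, |V x i| ≤ B := fun i => hB.mono fun x hx => (norm_le_pi_norm _ i).trans hx
  have hJi := h.integrable_J hs
  have hKi := h.integrable_K hs hσ
  have dx := h.ae_deriv_x
  have dJ := h.ae_deriv_J hs
  have dK := h.ae_deriv_K hs hσ
  have ex : (fun x => 2 * (V x - halfX) 1) =ᵐ[volume] fun x => deriv (lagHalf X z V).x x - 1 := by
    filter_upwards [dx] with x hx
    rw [hx.deriv, sub_halfX_one]; ring
  have eJ : (fun x => V x 3) =ᵐ[volume] deriv (lagHalf X z V).J := dJ.mono fun x hx => hx.deriv.symm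
  have eK : (fun x => V x 4) =ᵐ[volume] deriv (lagHalf X z V).K := dK.mono fun x hx => hx.deriv.symm
  have eV : (fun x => V x 2) =ᵐ[volume] (lagHalf X z V).V := (coe_V (z := z)).mono fun x hx =>
    hx.symm
  have htop : ∀ i : Fin 5, i ≠ 1 → MemLp (fun x => V x i) ∞ volume := fun i hi =>
    (h.half.bdd i).ae_eq (.of_forall fun x => sub_halfX_of_ne hi _)
  obtain ⟨N1, hN1⟩ := h.near
  obtain ⟨N2, hN2⟩ := hX.near
  have hxn : ∀ x, |(lagHalf X z V).x x - x| ≤ N1 + N2 := fun x => by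
    have e1 := hN1 (leftInv X x)
    have e2 := hX.abs_leftInv_sub_le hN2 x
    have := abs_add_le (z (leftInv X x) 1 - leftInv X x) (leftInv X x - x)
    rw [sub_add_sub_cancel] at this
    exact this.trans (add_le_add e1 e2)
  have hxsub : ∀ a b, ((lagHalf X z V).x b - b) - ((lagHalf X z V).x a - a) =
      ∫ y in a..b, (2 * V y 1 - 1) := fun a b => by
    rw [intervalIntegral.integral_sub _ intervalIntegrable_const, ← h.lag_x_sub]
    · simp only [intervalIntegral.integral_const, smul_eq_mul]; ring
    · exact (((h.locallyIntegrable 1).integrableOn_isCompact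
        isCompact_uIcc).intervalIntegrable).const_mul 2
  have hJW := memW1Inf_primitive hJi (hBi 3)
  obtain ⟨δ, hδ, hd⟩ := h.half.inv
  refine
    { x_reg := ⟨lipschitz_of_integral (u := fun y => 2 * V y 1 - 1) (M := 2 * B + 1) ?_ hxsub,
        _, hxn⟩
      J_reg := hJW
      K_reg := memW1Inf_primitive hKi (hBi 4)
      dx_sq := ((h.half.sq 1 (by decide)).const_mul 2).ae_eq ex
      dx_bdd := ((h.half.bdd 1).const_mul 2).ae_eq ex
      dJ_sq := h.half.memLp_J.ae_eq eJ
      dJ_bdd := (htop 3 (by decide)).ae_eq eJ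
      dK_sq := h.half.memLp_K.ae_eq eK
      dK_bdd := (htop 4 (by decide)).ae_eq eK
      U_reg := h.U_reg
      V_sq := h.half.memLp_U.ae_eq eV
      V_bdd := (htop 2 (by decide)).ae_eq eV
      nonneg := ?_
      rel_JK := ?_
      rel_xJV := ?_
      group := ?_
      J_lim := tendsto_integral_Iic_zero tendsto_id }
  · filter_upwards [hBi 1] with x hx
    have := abs_le.1 hx
    exact abs_le.2 ⟨by linarith, by linarith⟩
  · filter_upwards [dx, dJ, h.half.nonneg] with x h1 h2 h3
    rw [h1.deriv, h2.deriv]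
    exact ⟨by linarith [h3.1], h3.2⟩
  · filter_upwards [dJ, dK, h.rel] with x h1 h2 h3
    rw [h1.deriv, h2.deriv]
    exact h3.KJ
  · filter_upwards [dx, dJ, h.rel, coe_V (z := z) (V := V) (X := X)] with x h1 h2 h3 h4
    rw [h1.deriv, h2.deriv, h4]
    have := h3.energy
    change _ = (c (z (leftInv X x) 2) * V x 2) ^ 2
    linarith
  · obtain ⟨N3, hN3⟩ := hJW.2
    refine memGroup_of_integral (u := fun y => 2 * V y 1 + V y 3) (M := 2 * B + B + 1) (δ := δ)
      (N := N1 + N2 + N3) (((h.locallyIntegrable 1).smul (2 : ℝ)).add (h.locallyIntegrable 3))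
      (fun a b => ?_) ?_ hδ ?_ (fun x => ?_) ?_
    · rw [intervalIntegral.integral_add, ← h.lag_x_sub, ← integral_Iic_sub hJi]
      · simp only [lagHalf]; ring
      · exact (((h.locallyIntegrable 1).integrableOn_isCompact
          isCompact_uIcc).intervalIntegrable).const_mul 2
      · exact hJi.intervalIntegrable
    · filter_upwards [hBi 1, hBi 3] with x h1 h2
      have h1 := abs_le.1 h1
      have h2 := abs_le.1 h2
      exact abs_le.2 ⟨by linarith, by linarith⟩
    · filter_upwards [hd, h.half.nonneg] with x h1 h2
      linarith [h2.1]
    · have e1 := abs_le.1 (hxn x)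
      have e2 := abs_le.1 (hN3 x)
      simp only [lagHalf] at e1 e2 ⊢
      exact abs_le.2 ⟨by linarith, by linarith⟩
    · refine (((h.half.sq 1 (by decide)).const_mul 2).add h.half.memLp_J).ae_eq
        (.of_forall fun x => ?_)
      simp only [Pi.add_apply, sub_halfX_one]
      ring

theorem isIntegralTo (hX : IsParam X) {g : ℝ → ℝ} (hg : Integrable g) (s : ℝ) :
    IsIntegralTo (fun r => g (X r) * deriv X r) s (∫ y in Iic (X s), g y) := by
  simp only [mul_comm (g _)]
  refine ⟨((hX.integrable_comp_iff g).1 hg).integrableOn, ?_⟩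
  rw [← hX.image_Iic, hX.integral_image measurableSet_Iic]
  rfl

/-- The generic values of the parameter at which the derivatives of `x` and `U` are known. -/
theorem ae_generic (h : IsTimeZero c σ X z V) (hs : IsSpeed c κ) {p : ℝ → Prop}
    (hp : ∀ᵐ s, deriv X s ≠ 0 → p s) : ∀ᵐ x, deriv (lagHalf X z V).x x = 2 * V x 1 ∧
      (V x 1 = 0 → V x 2 = 0) ∧ ∃ s, X s = x ∧ leftInv X x = s ∧ 0 < deriv X s ∧
        HasDerivAt (fun s => z s 1) (deriv X s * (2 * V x 1)) s ∧
        HasDerivAt (fun s => z s 2) (deriv X s * deriv (lagHalf X z V).U x) s ∧ p s := by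
  have hX := h.param
  have hU : (fun s => (lagHalf X z V).U (X s)) = fun s => z s 2 := funext h.U_eq
  filter_upwards [h.ae_deriv_x, h.rel, hX.ae_of_ae (h.dx.mono fun _ h _ => h),
    hX.ae_of_ae ((h.U_reg.ae_hasDerivAt_comp hX).mono fun _ h _ => h), hX.ae_of_ae hp]
    with x h1 h2 h3 h4 h5
  have hx := hX.apply_leftInv x
  refine ⟨h1.deriv, fun h0 => ?_, leftInv X x, hx, rfl, (h3 _ hx).2.2, ?_, ?_, (h5 _ hx).1⟩
  · have h6 := h2.energy
    rw [h0, mul_zero] at h6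
    exact (mul_eq_zero.1 (pow_eq_zero_iff (two_ne_zero) |>.1 h6.symm)).resolve_left (hs.pos _).ne'
  · have := (h3 _ hx).1
    rwa [hx] at this
  · have := (h4 _ hx).1
    rwa [hx, hU] at this

end IsTimeZero

variable {Θ : CurveData}

/-- On a curve of time zero the two terms of the derivative of `x` are equal. -/
theorem MemG.ae_time_zero (h : MemG c Θ) (h0 : ∀ s, Θ.Z s 0 = 0) :
    ∀ᵐ s, deriv Θ.X s * Θ.V (Θ.X s) 1 = deriv Θ.Y s * Θ.W (Θ.Y s) 1 := by
  filter_upwards [h.ae_deriv] with s ⟨h1, h2, h3⟩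
  have h4 := h1 0
  simp only [h0] at h4
  have h5 := h4.unique (hasDerivAt_const s 0)
  have h6 : deriv Θ.X s * Θ.V (Θ.X s) 1 = c (Θ.Z s 2) * (deriv Θ.X s * Θ.V (Θ.X s) 0) := by
    by_cases hX : deriv Θ.X s = 0
    · rw [hX]; ring
    · rw [(h2 hX).tx]; ring
  have h7 : deriv Θ.Y s * Θ.W (Θ.Y s) 1 = -c (Θ.Z s 2) * (deriv Θ.Y s * Θ.W (Θ.Y s) 0) := by
    by_cases hY : deriv Θ.Y s = 0
    · rw [hY]; ring
    · rw [(h3 hY).tx]; ring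
  rw [h6, h7]
  linear_combination c (Θ.Z s 2) * h5

/-- If the two terms of the derivative of `x` are equal, each of them bounds the derivative of
`U`. -/
theorem sq_add_le_of_rel (hs : IsSpeed c κ) {τ u a b M : ℝ} {v w : Vec5} (ha : 0 ≤ a)
    (hb : 0 ≤ b) (hv : a ≠ 0 → ‖v‖ ≤ M) (hw : b ≠ 0 → Rel c τ u w)
    (he : a * v 1 = b * w 1) :
    (a * v 2 + b * w 2) ^ 2 ≤ a * (2 * (a * v 2 ^ 2) + 4 * κ ^ 2 * M * (b * w 3)) := by
  have h1 : (b * w 2) ^ 2 ≤ 2 * κ ^ 2 * (b * w 3) * (a * M) := by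
    by_cases h0 : b = 0
    · rw [h0]; simp
    · have h2 := mul_le_mul_of_nonneg_left ((hw h0).U_sq_le hs) (sq_nonneg b)
      have h3 : a * v 1 ≤ a * M := by
        by_cases h0 : a = 0
        · rw [h0, zero_mul, zero_mul]
        · exact mul_le_mul_of_nonneg_left (le_of_norm_le (hv h0) 1) ha
      have h4 : 0 ≤ 2 * κ ^ 2 * (b * w 3) := by
        have := (hw h0).J_nonneg
        positivity
      have h5 := mul_le_mul_of_nonneg_left h3 h4
      rw [he] at h5
      nlinarith
  nlinarith [sq_nonneg (a * v 2 - b * w 2)]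

/-- Data at time zero can be inverted on each side: as the two terms of the derivative of `x` are
equal, either of them determines `x`. -/
theorem MemG.isTimeZero (hs : IsSpeed c κ) (h : MemG c Θ) (h0 : ∀ s, Θ.Z s 0 = 0) :
    IsTimeZero c 1 Θ.X Θ.Z Θ.V ∧ IsTimeZero c (-1) Θ.Y Θ.Z Θ.W := by
  obtain ⟨M, -, hM⟩ := h.exists_bound_Z
  obtain ⟨B1, -, hV⟩ := h.halfV.exists_bound
  obtain ⟨B2, -, hW⟩ := h.halfW.exists_bound
  have hX := h.paramX
  have hY := h.paramY
  have hU : ∀ s r, Θ.Z s 1 = Θ.Z r 1 → Θ.Z s 2 = Θ.Z r 2 := fun s r hsr => by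
    have := h.U_sub_le hs r s
    rw [hsr, sub_self, abs_zero, mul_zero, Real.sqrt_zero, mul_zero] at this
    exact sub_eq_zero.1 (abs_nonpos_iff.1 this)
  have i1 : Integrable fun s => deriv Θ.X s * Θ.V (Θ.X s) 2 ^ 2 :=
    (hX.integrable_comp_iff fun x => Θ.V x 2 ^ 2).1 h.halfV.memLp_U.integrable_sq
  have i2 : Integrable fun s => deriv Θ.Y s * Θ.W (Θ.Y s) 2 ^ 2 :=
    (hY.integrable_comp_iff fun x => Θ.W x 2 ^ 2).1 h.halfW.memLp_U.integrable_sq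
  have i3 : Integrable fun s => deriv Θ.X s * Θ.V (Θ.X s) 3 :=
    (hX.integrable_comp_iff fun x => Θ.V x 3).1 (h.integrable_V_J hs)
  have i4 : Integrable fun s => deriv Θ.Y s * Θ.W (Θ.Y s) 3 :=
    (hY.integrable_comp_iff fun x => Θ.W x 3).1 (h.integrable_W_J hs)
  constructor
  · refine ⟨hX, h.halfV, h.rel_V', h.lip_coord 1, h.lip_coord 2, ⟨M, fun s => (hM s).2.1⟩, ?_, hU,
      h.U_sq, _, (i1.const_mul 2).add (i4.const_mul (4 * κ ^ 2 * B1)), ?_⟩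
    · filter_upwards [h.ae_deriv, h.ae_time_zero h0] with s h1 h2
      convert! h1.1 1 using 1
      linear_combination h2
    · filter_upwards [h.ae_deriv, h.ae_time_zero h0, hX.ae_comp hV] with s h1 h2 h3
      rw [(h1.1 2).deriv]
      exact sq_add_le_of_rel hs (hX.deriv_nonneg s) (hY.deriv_nonneg s) h3 h1.2.2 h2
  · refine ⟨hY, h.halfW, ?_, h.lip_coord 1, h.lip_coord 2, ⟨M, fun s => (hM s).2.1⟩, ?_, hU,
      h.U_sq, _, (i2.const_mul 2).add (i3.const_mul (4 * κ ^ 2 * B2)), ?_⟩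
    · filter_upwards [h.rel_W', hY.ae_unique] with y h1 h2
      rwa [h2 _ _ (hY.apply_rightInv y) (hY.apply_leftInv y)]
    · filter_upwards [h.ae_deriv, h.ae_time_zero h0] with s h1 h2
      convert! h1.1 1 using 1
      linear_combination -h2
    · filter_upwards [h.ae_deriv, h.ae_time_zero h0, hY.ae_comp hW] with s h1 h2 h3
      rw [(h1.1 2).deriv, add_comm]
      exact sq_add_le_of_rel hs (hY.deriv_nonneg s) (hX.deriv_nonneg s) h3 h1.2.1 h2.symm

/-- The Lagrangian data of data at time zero. -/
def lagData (Θ : CurveData) : LagData := ⟨lagHalf Θ.X Θ.Z Θ.V, lagHalf Θ.Y Θ.Z Θ.W⟩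

/-- On an arbitrary curve where `x₁ = x₂`, the derivative of `U` is expressed by `V₁` and `V₂`.
Where the derivative of `x` along the curve does not vanish, almost every point lies on the curve
of `Θ`, and the relation is the one that holds there; elsewhere all terms vanish. -/
theorem MemG.lagData_compat (hs : IsSpeed c κ) (h : MemG c Θ) (h0 : ∀ s, Θ.Z s 0 = 0)
    {X Y : ℝ → ℝ} (hc : IsCurve X Y)
    (hx : ∀ s, (lagData Θ).fst.x (X s) = (lagData Θ).snd.x (Y s)) :
    (∀ s, (lagData Θ).fst.U (X s) = (lagData Θ).snd.U (Y s)) ∧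
    ∀ᵐ s, deriv (lagData Θ).fst.U (X s) * deriv X s = deriv (lagData Θ).snd.U (Y s) * deriv Y s ∧
      deriv (lagData Θ).snd.U (Y s) * deriv Y s =
        (lagData Θ).fst.V (X s) * deriv X s + (lagData Θ).snd.V (Y s) * deriv Y s := by
  obtain ⟨h1, h2⟩ := h.isTimeZero hs h0
  have hX := hc.isParam
  have hY := (isCurve_comm hc).isParam
  have hU : ∀ s, (lagData Θ).fst.U (X s) = (lagData Θ).snd.U (Y s) := fun s => h1.U_const _ _ (hx s)
  have hU' : (fun s => (lagData Θ).fst.U (X s)) = fun s => (lagData Θ).snd.U (Y s) := funext hU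
  have hx' : (fun s => (lagData Θ).fst.x (X s)) = fun s => (lagData Θ).snd.x (Y s) := funext hx
  refine ⟨hU, ?_⟩
  have a1 := h1.admissible hs (by norm_num)
  have a2 := h2.admissible hs (by norm_num)
  -- the relations on the curve of `Θ`, carried to almost every value of the variable `X`
  have g1 := h1.ae_generic hs (p := fun s => HasDerivAt (fun s => Θ.Z s 2)
    (deriv Θ.X s * Θ.V (Θ.X s) 2 + deriv Θ.Y s * Θ.W (Θ.Y s) 2) s ∧
    deriv Θ.X s * Θ.V (Θ.X s) 1 = deriv Θ.Y s * Θ.W (Θ.Y s) 1 ∧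
    (deriv Θ.Y s ≠ 0 → Rel c (-1) (Θ.Z s 2) (Θ.W (Θ.Y s))))
    (by filter_upwards [h.ae_deriv, h.ae_time_zero h0] with s e1 e2 _ using ⟨e1.1 2, e2, e1.2.2⟩)
  have g2 := h2.ae_generic hs (p := fun _ => True) (.of_forall fun _ _ => trivial)
  filter_upwards [hX.ae_hasDerivAt_comp a1.lip_x, hY.ae_hasDerivAt_comp a2.lip_x,
    a1.U_reg.ae_hasDerivAt_comp hX, a2.U_reg.ae_hasDerivAt_comp hY, hX.ae_comp g1, hY.ae_comp g2,
    hX.ae_comp (IsTimeZero.coe_V (X := Θ.X) (z := Θ.Z) (V := Θ.V)),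
    hY.ae_comp (IsTimeZero.coe_V (X := Θ.Y) (z := Θ.Z) (V := Θ.W))]
    with s dx1 dx2 dU1 dU2 e1 e2 v1 v2
  have fx : deriv X s * deriv (lagData Θ).fst.x (X s) = deriv Y s * deriv (lagData Θ).snd.x (Y s) :=
    dx1.unique (hx' ▸ dx2)
  have fU : deriv X s * deriv (lagData Θ).fst.U (X s) = deriv Y s * deriv (lagData Θ).snd.U (Y s) :=
    dU1.unique (hU' ▸ dU2)
  refine ⟨by linarith, ?_⟩
  have w1 : (lagData Θ).fst.V (X s) * deriv X s = deriv X s * Θ.V (X s) 2 := by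
    by_cases h0 : deriv X s = 0
    · rw [h0, zero_mul, mul_zero]
    · rw [mul_comm]; exact congrArg _ (v1 h0)
  have w2 : (lagData Θ).snd.V (Y s) * deriv Y s = deriv Y s * Θ.W (Y s) 2 := by
    by_cases h0 : deriv Y s = 0
    · rw [h0, zero_mul, mul_zero]
    · rw [mul_comm]; exact congrArg _ (v2 h0)
  rw [w1, w2, mul_comm, ← fU]
  by_cases hE : deriv X s * deriv (lagData Θ).fst.x (X s) = 0
  -- no motion of `x`: the energy relations make all terms vanish
  · have z1 : deriv X s * deriv (lagData Θ).fst.U (X s) = 0 ∧ deriv X s * Θ.V (X s) 2 = 0 := by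
      by_cases hd : deriv X s = 0
      · rw [hd, zero_mul, zero_mul]; exact ⟨rfl, rfl⟩
      · obtain ⟨q1, q2, r, hr, -, hpos, -, q3, q4, q5, q6⟩ := e1 hd
        have hV1 : Θ.V (X s) 1 = 0 := by
          have : deriv (lagData Θ).fst.x (X s) = 0 := (mul_eq_zero.1 hE).resolve_left hd
          rw [lagData] at this
          linarith
        have hV2 := q2 hV1
        rw [hr, hV1, mul_zero] at q5
        have hW2 : deriv Θ.Y r * Θ.W (Θ.Y r) 2 = 0 := by
          by_cases hd' : deriv Θ.Y r = 0
          · rw [hd', zero_mul]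
          · have hW1 := (mul_eq_zero.1 q5.symm).resolve_left hd'
            have h6 := (q6 hd').U_sq_le hs
            rw [hW1, mul_zero, mul_zero] at h6
            rw [pow_eq_zero_iff two_ne_zero |>.1 (le_antisymm h6 (sq_nonneg _)), mul_zero]
        have h7 := q3.unique q4
        rw [hr, hV2, hW2, mul_zero, add_zero] at h7
        have h8 := (mul_eq_zero.1 h7).resolve_left hpos.ne'
        exact ⟨by rw [show deriv (lagData Θ).fst.U (X s) = 0 from h8, mul_zero],
          by rw [hV2, mul_zero]⟩
    have z2 : deriv Y s * Θ.W (Y s) 2 = 0 := by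
      by_cases hd : deriv Y s = 0
      · rw [hd, zero_mul]
      · obtain ⟨q1, q2, -⟩ := e2 hd
        rw [fx] at hE
        have : deriv (lagData Θ).snd.x (Y s) = 0 := (mul_eq_zero.1 hE).resolve_left hd
        rw [lagData] at this
        rw [q2 (by linarith), mul_zero]
    rw [z1.1, z1.2, z2, add_zero]
  · have hdX : deriv X s ≠ 0 := left_ne_zero_of_mul hE
    have hE' := hE
    rw [fx] at hE'
    have hdY : deriv Y s ≠ 0 := left_ne_zero_of_mul hE'
    obtain ⟨q1, -, r, hr, -, hpos, q2, q3, q4, q5, -⟩ := e1 hdX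
    obtain ⟨p1, -, -⟩ := e2 hdY
    have fx2 : deriv X s * (2 * Θ.V (X s) 1) = deriv Y s * (2 * Θ.W (Y s) 1) := by
      rw [← q1, ← p1]; exact fx
    have hV1 : 2 * Θ.V (X s) 1 ≠ 0 := by
      rw [← q1]; exact right_ne_zero_of_mul hE
    have hW1 : 2 * Θ.W (Y s) 1 ≠ 0 := by
      rw [← p1]; exact right_ne_zero_of_mul hE'
    -- the point `(X s, Y s)` lies on the curve of `Θ`
    have hmono := h.mono_Z (i := 1) (.inl rfl)
    have hrY : leftInv Θ.Y (Y s) = r := by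
      refine hmono.eq_of_hasDerivAt_pos q2 ?_ ?_
      · refine lt_of_le_of_ne ?_ (mul_ne_zero hpos.ne' hV1).symm
        rw [← q2.deriv]
        exact hmono.deriv_nonneg
      · have := hx s
        rw [← hr] at this
        exact (this.symm.trans (h1.x_eq r))
    have hYr : Θ.Y r = Y s := by rw [← hrY, h.paramY.apply_leftInv]
    rw [hr, hYr] at q4 q5
    have h7 := q3.unique q4
    -- the two curves have parallel tangents at this point
    have h8 : deriv X s * deriv Θ.Y r = deriv Y s * deriv Θ.X r := by
      refine mul_right_cancel₀ hW1 ?_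
      linear_combination (-2 * deriv X s) * q5 + deriv Θ.X r * fx2
    refine mul_left_cancel₀ hpos.ne' ?_
    change deriv Θ.X r * (deriv X s * deriv (lagHalf Θ.X Θ.Z Θ.V).U (X s)) = _
    linear_combination deriv X s * h7 + Θ.W (Y s) 2 * h8

/-- The Lagrangian data are admissible and are the only ones with the prescribed values on the
curve, because `𝒳` and `𝒴` are surjective. -/
theorem isD_lagData (hs : IsSpeed c κ) (hΘ : Θ ∈ setG0 c) :
    lagData Θ ∈ setF c ∧ IsD Θ (lagData Θ) ∧ ∀ ψ', IsD Θ ψ' → ψ' = lagData Θ := by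
  obtain ⟨h, h0⟩ := hΘ
  obtain ⟨h1, h2⟩ := h.isTimeZero hs h0
  have hX := h.paramX
  have hY := h.paramY
  have hD : IsD Θ (lagData Θ) := by
    refine ⟨fun s => ⟨h1.x_eq s, h2.x_eq s⟩, fun s => ⟨h1.U_eq s, h2.U_eq s⟩,
      IsTimeZero.isIntegralTo hX (h1.integrable_J hs),
      IsTimeZero.isIntegralTo hY (h2.integrable_J hs),
      IsTimeZero.isIntegralTo hX (h1.integrable_K hs (by norm_num)),
      IsTimeZero.isIntegralTo hY (h2.integrable_K hs (by norm_num)), ?_⟩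
    filter_upwards [IsTimeZero.coe_V (X := Θ.X) (z := Θ.Z) (V := Θ.V),
      IsTimeZero.coe_V (X := Θ.Y) (z := Θ.Z) (V := Θ.W)] with x e1 e2 using ⟨e1, e2⟩
  refine ⟨⟨h1.admissible hs (by norm_num), h2.admissible hs (by norm_num),
    fun X Y hc hx => h.lagData_compat hs h0 hc hx⟩, hD, fun ψ' hD' => ?_⟩
  have eX : ∀ {f g : ℝ → ℝ}, (∀ s, f (Θ.X s) = g (Θ.X s)) → f = g := fun {f g} he =>
    funext fun x => by rw [← hX.apply_leftInv x]; exact he _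
  have eY : ∀ {f g : ℝ → ℝ}, (∀ s, f (Θ.Y s) = g (Θ.Y s)) → f = g := fun {f g} he =>
    funext fun x => by rw [← hY.apply_leftInv x]; exact he _
  refine LagData.ext (LagHalf.ext ?_ ?_ (AEEqFun.ext ?_) ?_ ?_)
    (LagHalf.ext ?_ ?_ (AEEqFun.ext ?_) ?_ ?_)
  · exact eX fun s => by rw [(hD.eq_x s).1, (hD'.eq_x s).1]
  · exact eX fun s => by rw [(hD.eq_U s).1, (hD'.eq_U s).1]
  · filter_upwards [hD.eq_V, hD'.eq_V] with x e1 e2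
    rw [e1.1, e2.1]
  · exact eX fun s => by rw [(hD.eq_J₁ s).2, (hD'.eq_J₁ s).2]
  · exact eX fun s => by rw [(hD.eq_K₁ s).2, (hD'.eq_K₁ s).2]
  · exact eY fun s => by rw [(hD.eq_x s).2, (hD'.eq_x s).2]
  · exact eY fun s => by rw [(hD.eq_U s).2, (hD'.eq_U s).2]
  · filter_upwards [hD.eq_V, hD'.eq_V] with x e1 e2
    rw [e1.2, e2.2]
  · exact eY fun s => by rw [(hD.eq_J₂ s).2, (hD'.eq_J₂ s).2]
  · exact eY fun s => by rw [(hD.eq_K₂ s).2, (hD'.eq_K₂ s).2]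

end lagrangian

/-! ### Shifts of the time and of the potential -/

section shift

variable {c : ℝ → ℝ} {κ : ℝ} {Z : ℝ → ℝ → Vec5} {Θ : CurveData} {ψ : LagData}

/-- The vector that shifts the time by `T` and the potential `K` by `k`. -/
def shiftVec (T k : ℝ) : Vec5 := ![T, 0, 0, 0, k]

/-- The shift of a function of `(X, Y)`. -/
def shift (T k : ℝ) (Z : ℝ → ℝ → Vec5) : ℝ → ℝ → Vec5 := fun X Y => Z X Y - shiftVec T k

/-- The shift of data on a curve. -/
def CurveData.shift (T k : ℝ) (Θ : CurveData) : CurveData :=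
  { Θ with Z := fun s => Θ.Z s - shiftVec T k }

theorem sub_shiftVec (T k : ℝ) (v : Vec5) : (v - shiftVec T k) 0 = v 0 - T ∧
    (v - shiftVec T k) 1 = v 1 ∧ (v - shiftVec T k) 2 = v 2 ∧ (v - shiftVec T k) 3 = v 3 ∧
    (v - shiftVec T k) 4 = v 4 - k := by
  simp [shiftVec]

theorem timeShift_eq (T : ℝ) (Z : ℝ → ℝ → Vec5) : timeShift T Z = shift T 0 Z := rfl

theorem shift_shift (T k T' k' : ℝ) (Z : ℝ → ℝ → Vec5) :
    shift T k (shift T' k' Z) = shift (T + T') (k + k') Z := by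
  funext X Y
  have : shiftVec T' k' + shiftVec T k = shiftVec (T + T') (k + k') := by
    ext i
    fin_cases i <;> simp [shiftVec, add_comm]
  rw [shift, shift, shift, sub_sub, this]

theorem dX_shift (T k : ℝ) (Z : ℝ → ℝ → Vec5) : dX (shift T k Z) = dX Z := by
  funext X Y
  exact deriv_sub_const _

theorem dY_shift (T k : ℝ) (Z : ℝ → ℝ → Vec5) : dY (shift T k Z) = dY Z := by
  funext X Y
  exact deriv_sub_const _

theorem shift_U (T k : ℝ) (Z : ℝ → ℝ → Vec5) (X Y : ℝ) : shift T k Z X Y 2 = Z X Y 2 :=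
  (sub_shiftVec T k _).2.2.1

theorem waveF_shift (T k : ℝ) (Z : ℝ → ℝ → Vec5) (X Y : ℝ) (v w : Vec5) :
    waveF c (shift T k Z X Y) v w = waveF c (Z X Y) v w := by
  rw [waveF, shift_U, waveF]

theorem IsGlobal.shift (h : IsGlobal c Z) (T k : ℝ) : IsGlobal c (shift T k Z) where
  wave :=
    { lip := fun R => by
        obtain ⟨L, hL⟩ := h.wave.lip R
        have := hL.sub (LipschitzWith.const (shiftVec T k)).lipschitzOnWith
        rw [add_zero] at this
        exact ⟨L, this⟩
      diff_X := h.wave.diff_X.mono fun X hX Y => (hX Y).sub_const _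
      diff_Y := h.wave.diff_Y.mono fun Y hY X => (hY X).sub_const _
      dX_lip := by rw [dX_shift]; exact h.wave.dX_lip
      dY_lip := by rw [dY_shift]; exact h.wave.dY_lip
      eq_YX := by simp only [dX_shift, dY_shift, waveF_shift]; exact h.wave.eq_YX
      eq_XY := by simp only [dX_shift, dY_shift, waveF_shift]; exact h.wave.eq_XY }
  rel := ⟨by simp only [dX_shift, shift_U]; exact h.rel.dX,
    by simp only [dY_shift, shift_U]; exact h.rel.dY⟩

theorem IsBullet.shift (h : IsBullet Z Θ) (T k : ℝ) : IsBullet (shift T k Z) (Θ.shift T k) where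
  eq_Z s := congrArg (· - shiftVec T k) (h.eq_Z s)
  eq_V := by rw [dX_shift]; exact h.eq_V
  eq_W := by rw [dY_shift]; exact h.eq_W

theorem MemG.shift (h : MemG c Θ) (T k : ℝ) : MemG c (Θ.shift T k) := by
  have e2 : ∀ s, (Θ.shift T k).Z s 2 = Θ.Z s 2 := fun s => (sub_shiftVec T k _).2.2.1
  have e3 : ∀ s, (Θ.shift T k).Z s 3 = Θ.Z s 3 := fun s => (sub_shiftVec T k _).2.2.2.1
  refine ⟨h.curve, ?_, ?_, h.V_bdd, h.W_bdd, h.V_inv, h.W_inv, ?_, h.V_sq, h.W_sq, h.V_nonneg,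
    h.W_nonneg, ?_, ?_, ?_, ?_⟩
  · obtain ⟨L, hL⟩ := h.Z_lipschitz
    have := hL.sub (LipschitzWith.const (shiftVec T k))
    rw [add_zero] at this
    exact ⟨L, this⟩
  · obtain ⟨M, hM⟩ := h.Z_bdd
    refine ⟨M + ‖shiftVec T k‖, fun s i => ?_⟩
    have h1 : ((Θ.shift T k).Z s - ![0, s, 0, 0, 0]) i =
        (Θ.Z s - ![0, s, 0, 0, 0]) i - shiftVec T k i := by
      simp only [CurveData.shift, Pi.sub_apply]; ring
    rw [h1]
    exact (abs_sub _ _).trans (add_le_add (hM s i) (norm_le_pi_norm (shiftVec T k) i))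
  · simp only [e2]; exact h.U_sq
  · refine h.compat.mono fun s hs => ?_
    exact (deriv_sub_const _).trans hs
  · simp only [e2]; exact h.rel_V
  · simp only [e2]; exact h.rel_W
  · simp only [e3]; exact h.J_lim

theorem shift_mem_setH (hZ : Z ∈ setH c) (T k : ℝ) : shift T k Z ∈ setH c := by
  obtain ⟨h1, Θ, hb, h⟩ := hZ
  exact ⟨fun _ _ _ _ _ _ => ((isGlobal_of_memHOn h1).shift T k).memHOn _ _ _ _, Θ.shift T k,
    hb.shift T k, h.shift T k⟩

theorem shift_mem_setG0 (hΘ : Θ ∈ setG0 c) (k : ℝ) : Θ.shift 0 k ∈ setG0 c :=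
  ⟨hΘ.1.shift 0 k, fun s => by
    rw [show (Θ.shift 0 k).Z s 0 = Θ.Z s 0 - 0 from (sub_shiftVec 0 k _).1, hΘ.2, sub_zero]⟩

theorem IsE.shift (h : IsE Z Θ) (k : ℝ) : IsE (shift 0 k Z) (Θ.shift 0 k) where
  eq_X s := by
    have : ∀ X Y, NVW.shift 0 k Z X Y 0 = Z X Y 0 := fun X Y =>
      (sub_shiftVec 0 k _).1.trans (sub_zero _)
    simp only [this]
    exact h.eq_X s
  eq_Y := h.eq_Y
  bullet := h.bullet.shift 0 k

theorem IsD.shift (h : IsD Θ ψ) (k : ℝ) : IsD (Θ.shift 0 k) ψ := by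
  have e1 : ∀ s, (Θ.shift 0 k).Z s 1 = Θ.Z s 1 := fun s => (sub_shiftVec 0 k _).2.1
  have e2 : ∀ s, (Θ.shift 0 k).Z s 2 = Θ.Z s 2 := fun s => (sub_shiftVec 0 k _).2.2.1
  exact ⟨fun s => by rw [e1]; exact h.eq_x s, fun s => by rw [e2]; exact h.eq_U s, h.eq_J₁, h.eq_J₂,
    h.eq_K₁, h.eq_K₂, h.eq_V⟩

end shift

/-! ### The composition of the maps -/

section composition

variable {c : ℝ → ℝ} {κ : ℝ} {Z : ℝ → ℝ → Vec5} {Θ : CurveData} {ψ : LagData}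

/-- A function with an integrable derivative that tends to zero at `-∞`. -/
theorem eq_primitive {f g : ℝ → ℝ} (hg : Integrable g) (h : ∀ a b, f b - f a = ∫ y in a..b, g y)
    (h0 : Tendsto f atBot (𝓝 0)) (x : ℝ) : f x = ∫ y in Iic x, g y := by
  have h1 : Tendsto (fun a => f a - ∫ y in Iic a, g y) atBot (𝓝 (0 - 0)) :=
    h0.sub (tendsto_integral_Iic_zero tendsto_id)
  have h2 : ∀ a, f a - ∫ y in Iic a, g y = f x - ∫ y in Iic x, g y := fun a => by
    have e1 := h a x
    rw [← integral_Iic_sub hg] at e1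
    linarith
  simp only [h2] at h1
  have h3 := tendsto_nhds_unique h1 tendsto_const_nhds
  linarith

/-- The potentials `J` and `K` on the curve are the sums of the two energies up to a constant. -/
theorem MemG.exists_eq_add (h : MemG c Θ) {i : Fin 5} (hV : Integrable fun x => Θ.V x i)
    (hW : Integrable fun y => Θ.W y i) : ∃ k, Tendsto (fun s => Θ.Z s i) atBot (𝓝 k) ∧
      ∀ s, Θ.Z s i - k = (∫ x in Iic (Θ.X s), Θ.V x i) + ∫ y in Iic (Θ.Y s), Θ.W y i := by
  have h1 := fun a b => curve_integral h.paramX h.paramY (h.lip_coord i) hV.locallyIntegrable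
    hW.locallyIntegrable (h.ae_deriv.mono fun s hs => (hs.1 i).deriv) a b
  simp only [← integral_Iic_sub hV, ← integral_Iic_sub hW] at h1
  set P : ℝ → ℝ := fun s => (∫ x in Iic (Θ.X s), Θ.V x i) + ∫ y in Iic (Θ.Y s), Θ.W y i with hP
  have h2 : Tendsto P atBot (𝓝 0) := by
    simpa using (tendsto_integral_Iic_zero (f := fun x => Θ.V x i) (μ := volume)
      h.paramX.tendsto_atBot).add (tendsto_integral_Iic_zero (f := fun x => Θ.W x i) (μ := volume)
      h.paramY.tendsto_atBot)
  have h3 : ∀ s, Θ.Z s i = P s + (Θ.Z 0 i - P 0) := fun s => by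
    have := h1 0 s
    simp only [hP]
    linarith
  refine ⟨Θ.Z 0 i - P 0, ?_, fun s => by rw [h3 s]; ring⟩
  rw [show (fun s => Θ.Z s i) = fun s => P s + (Θ.Z 0 i - P 0) from funext h3]
  simpa using h2.add_const (Θ.Z 0 i - P 0)

/-- Points to the left of the curve, and their projections to the curve along the axes. -/
theorem MemG.project (h : MemG c Θ) {s x : ℝ} (hx : x < Θ.X s) :
    Θ.β x ≤ 2 * s - x ∧ x ≤ Θ.α (2 * s - x) ∧ Θ.ζ x 1 ≤ Θ.Z s 1 ∧
      Θ.Z s 1 ≤ Θ.ω (2 * s - x) 1 := by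
  have hXY := isCurve_add h.curve s
  have hl : leftInv Θ.X x ≤ s := h.paramX.le_iff_leftInv_le.1 hx.le
  have hb : Θ.β x ≤ 2 * s - x := (h.paramY.mono hl).trans (by linarith)
  refine ⟨hb, (curve_galois h.paramX h.paramY _ _).1 hb, h.mono_Z (.inl rfl) hl,
    h.mono_Z (.inl rfl) (h.paramY.le_iff_le_rightInv.1 (by linarith))⟩

/-- The leftmost curve of time zero is the leftmost curve where `x₁ = x₂`: if these values agreed at
a point to the left of the curve, `x` and thus `t` would be constant on a segment from this point
to the curve. -/
theorem IsE.isC_lagData (hs : IsSpeed c κ) (hZ : Z ∈ setH c) (hE : IsE Z Θ) (hΘ : Θ ∈ setG0 c) :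
    ∃ k, IsC c (lagData Θ) (Θ.shift 0 k) := by
  obtain ⟨hH, Θ₀, hb₀, h₀⟩ := hZ
  have hg := isGlobal_of_memHOn hH
  obtain ⟨L, hl⟩ := hg.exists_isLevel hs h₀ hb₀
  obtain ⟨-, ht, hneg⟩ := hE.level hl
  have h := hΘ.1
  obtain ⟨t1, t2⟩ := h.isTimeZero hs hΘ.2
  have hσ : (-1 : ℝ) ^ 2 = 1 := by norm_num
  have hD := (isD_lagData hs hΘ).2.1
  obtain ⟨j, hj, hJ⟩ := h.exists_eq_add (i := 3) (t1.integrable_J hs) (t2.integrable_J hs)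
  obtain ⟨k, -, hK⟩ := h.exists_eq_add (i := 4) (t1.integrable_K hs (by norm_num))
    (t2.integrable_K hs hσ)
  have hj0 : j = 0 := tendsto_nhds_unique hj h.J_lim
  refine ⟨k, ?_⟩
  have e := fun s => sub_shiftVec 0 k (Θ.Z s)
  refine ⟨fun s => ?_, hE.eq_Y, fun s => ?_, fun s => ?_, fun s => ?_, fun s => ?_, fun s => ?_,
    ?_, ?_⟩
  · have hX : leftCurve (fun X Y => (lagData Θ).fst.x X - (lagData Θ).snd.x Y) s = Θ.X s := by
      refine leftCurve_eq ?_ fun x hx => ?_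
      · rw [← hE.eq_Y, (hD.eq_x s).1, (hD.eq_x s).2, sub_self]
      · have hp := h.project hx
        have e1 : (lagData Θ).fst.x x = Θ.ζ x 1 := rfl
        have e2 : (lagData Θ).snd.x (2 * s - x) = Θ.ω (2 * s - x) 1 := by
          have := (hD.eq_x (rightInv Θ.Y (2 * s - x))).2
          rwa [h.paramY.apply_rightInv] at this
        by_contra! hcon
        rw [e1, e2] at hcon
        have h1 := hg.mono_Y x (i := 1) (.inl rfl) hp.1
        have h2 := hg.mono_X (2 * s - x) (i := 1) (.inl rfl) hp.2.1
        simp only [hE.bullet.eq_ζ h, hE.bullet.eq_ω h] at h1 h2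
        have h3 := hg.time_le_space_Y hs x (Θ.β x) (2 * s - x)
        rw [hE.bullet.eq_ζ h, show Z x (2 * s - x) 1 - Θ.ζ x 1 = 0 by linarith [hp.2.2], abs_zero,
          mul_zero] at h3
        have h4 := sub_eq_zero.1 (abs_nonpos_iff.1 h3)
        have h5 : Θ.ζ x 0 = 0 := ht _
        linarith [hneg s x hx]
    rw [show (Θ.shift 0 k).X s = Θ.X s from rfl, ← hX, leftCurve]
    simp only [sub_neg]
  · exact (e s).1.trans (by rw [ht, sub_zero])
  · exact ⟨(e s).2.1.trans (hD.eq_x s).1.symm, (e s).2.1.trans (hD.eq_x s).2.symm⟩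
  · exact ⟨(e s).2.2.1.trans (hD.eq_U s).1.symm, (e s).2.2.1.trans (hD.eq_U s).2.symm⟩
  · refine (e s).2.2.2.1.trans ?_
    have := hJ s
    rwa [hj0, sub_zero] at this
  · exact (e s).2.2.2.2.trans (hK s)
  · filter_upwards [t1.halfVec_eq hs (by norm_num)] with x hx
    rw [halfVec, one_mul] at hx
    exact hx.symm
  · filter_upwards [t2.halfVec_eq hs hσ] with x hx
    rw [halfVec, neg_one_mul] at hx
    exact hx.symm

/-- The solution with the data `𝐂(ψ)` at time zero attains the time zero first on the curve of
these data: otherwise `t` and thus `x` would be constant on the segments from a point to the left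
of the curve to the curve. -/
theorem IsC.isE (hs : IsSpeed c κ) (hψ : ψ ∈ setF c) (hC : IsC c ψ Θ) (h : MemG c Θ)
    (hZ : Z ∈ setH c) (hb : IsBullet Z Θ) : IsE Z Θ := by
  have hg := isGlobal_of_memHOn hZ.1
  obtain ⟨L, hl⟩ := setF_isLevel hψ
  refine ⟨fun s => ?_, hC.eq_Y, hb⟩
  refine (leftCurve_eq (g := fun X Y => Z X Y 0) ?_ fun x hx => ?_).symm
  · rw [← hC.eq_Y, ← hb.eq_Z, hC.eq_t]
  · have hp := h.project hx
    rw [hC.curve_eq.1] at hx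
    have hlt := hl.neg_of_lt hx
    have e1 : ψ.fst.x x = Θ.ζ x 1 := by
      have := (hC.eq_x (leftInv Θ.X x)).1
      rw [h.paramX.apply_leftInv] at this
      exact this.symm
    have e2 : ψ.snd.x (2 * s - x) = Θ.ω (2 * s - x) 1 := by
      have := (hC.eq_x (rightInv Θ.Y (2 * s - x))).2
      rw [h.paramY.apply_rightInv] at this
      exact this.symm
    rw [e1, e2] at hlt
    by_contra! hcon
    have h1 := hg.time_anti hs x hp.1
    have h2 := hg.time_mono hs (2 * s - x) hp.2.1
    have z1 : Θ.ζ x 0 = 0 := hC.eq_t _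
    have z2 : Θ.ω (2 * s - x) 0 = 0 := hC.eq_t _
    simp only [hb.eq_ζ h, hb.eq_ω h, z1, z2] at h1 h2
    have h0 : Z x (2 * s - x) 0 = 0 := le_antisymm h1 hcon
    have h3 := hg.space_le_time_Y hs x (Θ.β x) (2 * s - x)
    have h4 := hg.space_le_time_X hs (2 * s - x) (Θ.α (2 * s - x)) x
    rw [hb.eq_ζ h, h0, z1, sub_zero, abs_zero, mul_zero] at h3
    rw [hb.eq_ω h, h0, z2, sub_zero, abs_zero, mul_zero] at h4
    have h5 := sub_eq_zero.1 (abs_nonpos_iff.1 h3)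
    have h6 := sub_eq_zero.1 (abs_nonpos_iff.1 h4)
    linarith

/-- The map `𝐃` is a left inverse of `𝐂` on normalized data. -/
theorem IsC.isD (hs : IsSpeed c κ) (hψ : ψ ∈ setF c) (hC : IsC c ψ Θ) (h : MemG c Θ)
    (hK1 : Tendsto ψ.fst.K atBot (𝓝 0)) (hK2 : Tendsto ψ.snd.K atBot (𝓝 0)) : IsD Θ ψ := by
  obtain ⟨t1, t2⟩ := h.isTimeZero hs hC.eq_t
  have hσ : (-1 : ℝ) ^ 2 = 1 := by norm_num
  have key : ∀ {X f g : ℝ → ℝ}, IsParam X → MemW1Inf f → Tendsto f atBot (𝓝 0) → Integrable g →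
      (∀ᵐ x, g x = deriv f x) → ∀ s, IsIntegralTo (fun r => g (X r) * deriv X r) s (f (X s)) := by
    intro X f g hX hf h0 hg he s
    rw [eq_primitive hg (fun a b => ?_) h0]
    · exact IsTimeZero.isIntegralTo hX hg s
    · rw [← (hf.locallyLipschitz.absolutelyContinuousOnInterval a b).integral_deriv_eq_sub]
      exact intervalIntegral.integral_congr_ae (he.mono fun x hx _ => hx.symm)
  have eV : ∀ i, ∀ᵐ x, Θ.V x i = _ := fun i => hC.eq_V.mono fun x hx => congrFun hx i
  have eW : ∀ i, ∀ᵐ x, Θ.W x i = _ := fun i => hC.eq_W.mono fun x hx => congrFun hx i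
  refine ⟨fun s => ⟨(hC.eq_x s).1.symm, (hC.eq_x s).2.symm⟩,
    fun s => ⟨(hC.eq_U s).1.symm, (hC.eq_U s).2.symm⟩,
    key h.paramX hψ.1.J_reg hψ.1.J_lim (t1.integrable_J hs) (eV 3),
    key h.paramY hψ.2.1.J_reg hψ.2.1.J_lim (t2.integrable_J hs) (eW 3),
    key h.paramX hψ.1.K_reg hK1 (t1.integrable_K hs (by norm_num)) (eV 4),
    key h.paramY hψ.2.1.K_reg hK2 (t2.integrable_K hs hσ) (eW 4), ?_⟩
  filter_upwards [eV 2, eW 2] with x e1 e2 using ⟨e1.symm, e2.symm⟩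

end composition

/-! ### The semigroup -/

section semigroup

variable {c : ℝ → ℝ} {κ : ℝ} {C : setF c → setG0 c} {S : setG c → setH c}
  {t : ℝ → setH c → setH c} {E : setH c → setG0 c} {D : setG0 c → setF c}

/-- Going from data at time zero to Lagrangian data and back shifts the potential `K` only. The maps
after `𝐂` respect this shift, and the time shifts add up. -/
theorem flow_add (hs : IsSpeed c κ) (hC : ∀ ψ Θ, C ψ = Θ ↔ IsC c ψ.1 Θ.1)
    (hS : ∀ Θ Z, S Θ = Z ↔ IsBullet Z.1 Θ.1) (ht : ∀ T Z, (t T Z).1 = timeShift T Z.1)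
    (hE : ∀ Z Θ, E Z = Θ ↔ IsE Z.1 Θ.1) (hD : ∀ Θ ψ, D Θ = ψ ↔ IsD Θ.1 ψ.1) (T T' : ℝ)
    (Z : setH c) :
    D (E (t T (S (inclusion (setG0_subset_setG c) (C (D (E (t T' Z)))))))) =
      D (E (t (T + T') Z)) := by
  have hE1 := (hE (t T' Z) _).1 rfl
  have hE2 := (hE (t (T + T') Z) _).1 rfl
  obtain ⟨k, hk⟩ := hE1.isC_lagData hs (t T' Z).2 (E (t T' Z)).2
  rw [← (isD_lagData hs (E (t T' Z)).2).2.2 _ ((hD _ _).1 rfl)] at hk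
  have e1 : C (D (E (t T' Z))) = ⟨_, shift_mem_setG0 (E (t T' Z)).2 k⟩ := (hC _ _).2 hk
  have e2 : S (inclusion (setG0_subset_setG c) (C (D (E (t T' Z))))) =
      ⟨_, shift_mem_setH (t T' Z).2 0 k⟩ := by
    rw [hS, e1]
    exact hE1.bullet.shift 0 k
  have e3 : t T (S (inclusion (setG0_subset_setG c) (C (D (E (t T' Z)))))) =
      ⟨_, shift_mem_setH (t (T + T') Z).2 0 k⟩ := by
    refine Subtype.ext ?_
    rw [ht, e2]
    change timeShift T (shift 0 k (t T' Z).1) = shift 0 k (t (T + T') Z).1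
    rw [ht, ht]
    simp only [timeShift_eq, shift_shift]
    congr 1 <;> ring
  have e4 : E (t T (S (inclusion (setG0_subset_setG c) (C (D (E (t T' Z))))))) =
      ⟨_, shift_mem_setG0 (E (t (T + T') Z)).2 k⟩ := by
    rw [hE, e3]
    exact hE2.shift k
  rw [e4, hD]
  exact ((hD (E (t (T + T') Z)) _).1 rfl).shift k

/-- Both `𝐄 ∘ 𝐒` and `𝐃` undo what was done: the curve of `𝐂(ψ)` is the leftmost one of time zero,
and normalized data are recovered from their derivatives. -/
theorem flow_zero (hs : IsSpeed c κ) (hC : ∀ ψ Θ, C ψ = Θ ↔ IsC c ψ.1 Θ.1)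
    (hS : ∀ Θ Z, S Θ = Z ↔ IsBullet Z.1 Θ.1) (ht : ∀ T Z, (t T Z).1 = timeShift T Z.1)
    (hE : ∀ Z Θ, E Z = Θ ↔ IsE Z.1 Θ.1) (hD : ∀ Θ ψ, D Θ = ψ ↔ IsD Θ.1 ψ.1) {ψ : setF c}
    (hK1 : Tendsto ψ.1.fst.K atBot (𝓝 0)) (hK2 : Tendsto ψ.1.snd.K atBot (𝓝 0)) :
    D (E (t 0 (S (inclusion (setG0_subset_setG c) (C ψ))))) = ψ := by
  have h1 := (hC ψ _).1 rfl
  have h2 := (hS (inclusion (setG0_subset_setG c) (C ψ)) _).1 rfl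
  set Z := S (inclusion (setG0_subset_setG c) (C ψ))
  have e1 : t 0 Z = Z := by
    refine Subtype.ext ?_
    rw [ht]
    funext X Y i
    fin_cases i <;> simp [timeShift]
  rw [e1, (hE Z (C ψ)).2 (h1.isE hs ψ.2 (C ψ).2.1 Z.2 h2), hD]
  exact h1.isD hs ψ.2 (C ψ).2.1 hK1 hK2

end semigroup

end NVW

end

theorem mainTheorem5 (c : ℝ → ℝ) (κ : ℝ) (hκ : 0 < κ)
    (hc : ContDiff ℝ 1 c) (hc' : LocallyLipschitz (deriv c))
    (hcκ : ∀ u, κ⁻¹ ≤ c u ∧ c u ≤ κ) :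
    ∃ (C : NVW.setF c → NVW.setG0 c) (S : NVW.setG c → NVW.setH c)
      (t : ℝ → NVW.setH c → NVW.setH c) (E : NVW.setH c → NVW.setG0 c)
      (D : NVW.setG0 c → NVW.setF c),
      (∀ ψ Θ, C ψ = Θ ↔ NVW.IsC c ψ.1 Θ.1) ∧
      (∀ Θ Z, S Θ = Z ↔ NVW.IsBullet Z.1 Θ.1) ∧
      (∀ T Z, (t T Z).1 = NVW.timeShift T Z.1) ∧
      (∀ Z Θ, E Z = Θ ↔ NVW.IsE Z.1 Θ.1) ∧
      (∀ Θ ψ, D Θ = ψ ↔ NVW.IsD Θ.1 ψ.1) ∧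
      ∀ ST : ℝ → NVW.setF c → NVW.setF c,
        (∀ T, ST T = D ∘ E ∘ t T ∘ S ∘ Set.inclusion (NVW.setG0_subset_setG c) ∘ C) →
        (∀ T T' : ℝ, 0 ≤ T → 0 ≤ T' → ST T ∘ ST T' = ST (T + T')) ∧
        (∀ ψ : NVW.setF c, Tendsto ψ.1.fst.K atBot (𝓝 0) → Tendsto ψ.1.snd.K atBot (𝓝 0) →
          ST 0 ψ = ψ) := by
  have hs : NVW.IsSpeed c κ := ⟨hκ, hc, hc', hcκ⟩
  have hC := fun ψ : NVW.setF c => NVW.existsUnique_isC hs ψ.2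
  have hS := fun Θ : NVW.setG c => NVW.MemG.existsUnique_solution hs Θ.2
  have hE := fun Z : NVW.setH c => NVW.existsUnique_isE hs Z.2
  have hD := fun Θ : NVW.setG0 c => NVW.isD_lagData hs Θ.2
  choose C hCm hC1 hC2 using hC
  choose S hSm hS1 hS2 using hS
  choose E hEm hE1 hE2 using hE
  have cC : ∀ (ψ : NVW.setF c) (Θ : NVW.setG0 c), (⟨C ψ, hCm ψ⟩ : NVW.setG0 c) = Θ ↔
      NVW.IsC c ψ.1 Θ.1 := fun ψ Θ =>
    ⟨fun h => h ▸ hC1 ψ, fun h => Subtype.ext (hC2 ψ _ h).symm⟩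
  have cS : ∀ (Θ : NVW.setG c) (Z : NVW.setH c), (⟨S Θ, hSm Θ⟩ : NVW.setH c) = Z ↔
      NVW.IsBullet Z.1 Θ.1 := fun Θ Z =>
    ⟨fun h => h ▸ hS1 Θ, fun h => Subtype.ext (hS2 Θ _ Z.2 h).symm⟩
  have cE : ∀ (Z : NVW.setH c) (Θ : NVW.setG0 c), (⟨E Z, hEm Z⟩ : NVW.setG0 c) = Θ ↔
      NVW.IsE Z.1 Θ.1 := fun Z Θ =>
    ⟨fun h => h ▸ hE1 Z, fun h => Subtype.ext (hE2 Z _ h).symm⟩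
  have cD : ∀ (Θ : NVW.setG0 c) (ψ : NVW.setF c),
      (⟨NVW.lagData Θ.1, (hD Θ).1⟩ : NVW.setF c) = ψ ↔ NVW.IsD Θ.1 ψ.1 := fun Θ ψ =>
    ⟨fun h => h ▸ (hD Θ).2.1, fun h => Subtype.ext ((hD Θ).2.2 _ h).symm⟩
  have ht : ∀ (T : ℝ) (Z : NVW.setH c), ∃ Z' : NVW.setH c, Z'.1 = NVW.timeShift T Z.1 := fun T Z =>
    ⟨⟨_, NVW.shift_mem_setH Z.2 T 0⟩, rfl⟩
  choose t ht using ht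
  refine ⟨fun ψ => ⟨C ψ, hCm ψ⟩, fun Θ => ⟨S Θ, hSm Θ⟩, t, fun Z => ⟨E Z, hEm Z⟩,
    fun Θ => ⟨NVW.lagData Θ.1, (hD Θ).1⟩, cC, cS, ht, cE, cD,
    fun ST hST => ⟨fun T T' _ _ => funext fun ψ => ?_, fun ψ hK1 hK2 => ?_⟩⟩
  · rw [Function.comp_apply, hST, hST, hST]
    exact NVW.flow_add hs cC cS ht cE cD T T' _
  · rw [hST]
    exact NVW.flow_zero hs cC cS ht cE cD hK1 hK2
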